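/- Let $V_7$ be a seven-dimensional complex vector space and let $\Omega\in\wedge^3V_7^*$ be a general three-form, i.e. one that in a suitable basis of $V_7^*$ is written $$\Omega=v_0\wedge v_\alpha\wedge v_{-\alpha}+v_0\wedge v_\beta\wedge v_{-\beta}+v_0\wedge v_\gamma\wedge v_{-\gamma}+v_\alpha\wedge v_\beta\wedge v_\gamma+v_{-\alpha}\wedge v_{-\beta}\wedge v_{-\gamma}.$$ Let $CG\subset G(4,V_7)$ be the Cayley Grassmannian, that is, the zero locus of the section of $\wedge^3T^*$ defined by $\Omega$ ($T$ the tautological bundle): the scheme of four-dimensional subspaces on which $\Omega$ vanishes. Let $G_2^{ad}\subset G(2,V_7)$ be the scheme of planes $V_2$ with $\Omega(V_2,V_2,V_7)=0$ (the adjoint variety of $G_2$). Let $V_7=V_6\oplus V_1$ with $V_1=\mathbb{C}e$ a line, and put $\omega=\Omega|_{V_6}\in\wedge^3V_6^*$ and $\alpha=\Omega(e,\cdot,\cdot)|_{V_6}\in\wedge^2V_6^*$. If $e$ is general (outside the zero set of some nonzero polynomial on $V_7$), then $\alpha$ is nondegenerate for every choice of the complement $V_6$. Assume from now on that $\alpha$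 is nondegenerate. Let * $Z_3=LG_\alpha(3,6)\cap H_\omega\subset G(3,V_6)$ be the scheme of three-dimensional subspaces $U_3\subset V_6$ on which $\alpha$ and $\omega$ vanish (a hyperplane section of the Lagrangian Grassmannian $LG_\alpha(3,6)$), mapped to $CG$ by $U_3\mapsto U_3\oplus V_1$; * $Y_4\subset G(4,V_6)$ be the scheme of four-dimensional subspaces $U_4\subset V_6$ that contain $U_2:=U_4^{\perp_\alpha}$ and satisfy $\omega(U_2,U_2,U_4)=0$. Then: 1. The map $Z_3\to CG$ is a closed immersion with dense open complement, and the projection along $V_1$ defines a morphism $\pi_4\colon CG\setminus Z_3\to G(4,V_6)$, $V_4\mapsto (V_4+V_1)\cap V_6$, which is a birational map $CG\dashrightarrow G(4,V_6)$. 2. There are a scheme $\widetilde{CG}$ over $\mathbb{C}$ and morphisms $p\colon\widetilde{CG}\to CG$ and $q\colon\widetilde{CG}\to G(4,V_6)$ such that $p$ is the blow-up of $CG$ along $Z_3$, $q=\pi_4\circ p$ on $p^{-1}(CG\setminus Z_3)$, and $q$ is the blow-up of $G(4,V_6)$ along $Y_4$. 3. $Y_4\cong G_2^{ad}$, by the isomorphism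 sending a plane $V_2\subset V_7$ to the $\alpha$-orthogonal of its projection to $V_6$ along $V_1$. -/

import Mathlib

open CategoryTheory AlgebraicGeometry TensorProduct

noncomputable section

namespace CayleyGrassmannian

/-! ### Blow-ups of schemes -/

/-- The closed subscheme cut out by the ideal sheaf `I` is an effective Cartier divisor: locally
`I` is generated by one nonzerodivisor. -/
def IsEffectiveCartier {X : Scheme.{0}} (I : X.IdealSheafData) : Prop :=
  ∀ x : X, ∃ U : X.affineOpens, x ∈ U.1 ∧
    ∃ f ∈ nonZeroDivisors Γ(X, U.1), I.ideal U = Ideal.span {f}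

/-- `p : B ⟶ X` is the blow-up of `X` along the closed subscheme `i : Z ⟶ X`: the scheme-theoretic
inverse image of `Z` in `B` is an effective Cartier divisor, and `p` is universal among all
morphisms to `X` with this property. -/
structure IsBlowup {B X Z : Scheme.{0}} (p : B ⟶ X) (i : Z ⟶ X) : Prop where
  isClosedImmersion : IsClosedImmersion i
  isEffectiveCartier : IsEffectiveCartier (i.ker.comap p)
  existsUnique_lift : ∀ (T : Scheme.{0}) (g : T ⟶ X),
    IsEffectiveCartier (i.ker.comap g) → ∃! h : T ⟶ B, h ≫ p = g

/-! ### Schemes of subspaces, by their functors of points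

`Module.Grassmannian A (A ⊗[ℂ] W) k` is the set of `A`-submodules `N` of `A ⊗ W` whose quotient is
projective of rank `k`; for `W` of dimension `n` these are the families over `Spec A` of
`(n - k)`-dimensional subspaces of `W`. -/

variable {W : Type} [AddCommGroup W] [Module ℂ W]

/-- A condition on families of subspaces of `W` of codimension `k`, over all `ℂ`-algebras. -/
abbrev Condition (W : Type) [AddCommGroup W] [Module ℂ W] (k : ℕ) : Type 1 :=
  ∀ A : CommAlgCat.{0} ℂ, Set (Module.Grassmannian A (A ⊗[ℂ] W) k)

/-- The affine scheme `Spec A` over `Spec ℂ`. -/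
abbrev specOver (A : CommAlgCat.{0} ℂ) : Over (Spec (.of ℂ)) :=
  (algSpec (.of ℂ)).obj (.op A)

/-- The morphism `Spec B ⟶ Spec A` over `Spec ℂ` induced by `A ⟶ B`. -/
abbrev specOverMap {A B : CommAlgCat.{0} ℂ} (f : A ⟶ B) : specOver B ⟶ specOver A :=
  (algSpec (.of ℂ)).map f.op

/-- The `ℂ`-scheme `X` is the moduli scheme of the subspaces of `W` of codimension `k` satisfying
`P`: its `A`-points are, naturally in the `ℂ`-algebra `A`, the families over `Spec A` of such
subspaces. This determines `X` up to a unique isomorphism. -/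
structure Represents {k : ℕ} (X : Over (Spec (.of ℂ))) (P : Condition W k) where
  /-- The identification of the `A`-points of `X`. -/
  points (A : CommAlgCat.{0} ℂ) : (specOver A ⟶ X) ≃ P A
  natural {A B : CommAlgCat.{0} ℂ} (f : A ⟶ B) (x : specOver A ⟶ X) :
    (points B (specOverMap f ≫ x)).1 = Module.Grassmannian.map f.hom (points A x).1

/-- The submodule of `A ⊗ W` corresponding to an `A`-point of `X`. -/
def Represents.sub {k : ℕ} {X : Over (Spec (.of ℂ))} {P : Condition W k} (r : Represents X P)
    {A : CommAlgCat.{0} ℂ} (x : specOver A ⟶ X) : Submodule A (A ⊗[ℂ] W) :=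
  (r.points A x).1.toSubmodule

/-! ### Three-forms -/

/-- A three-form as a trilinear map. -/
def trilinear (Ω : W [⋀^Fin 3]→ₗ[ℂ] ℂ) : W →ₗ[ℂ] W →ₗ[ℂ] W →ₗ[ℂ] ℂ where
  toFun x := LinearMap.mk₂ ℂ (fun y z => Ω ![x, y, z])
    (fun y y' z => by
      simpa using ((Ω.curryLeft x).map_vecCons_add ![z] y y'))
    (fun c y z => by
      simpa using ((Ω.curryLeft x).map_vecCons_smul ![z] c y))
    (fun y z z' => by
      simpa using (((Ω.curryLeft x).curryLeft y).map_vecCons_add ![] z z'))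
    (fun c y z => by
      simpa using (((Ω.curryLeft x).curryLeft y).map_vecCons_smul ![] c z))
  map_add' x x' := by
    ext y z
    exact Ω.map_vecCons_add ![y, z] x x'
  map_smul' c x := by
    ext y z
    exact Ω.map_vecCons_smul ![y, z] c x

/-- The `A`-trilinear extension to `A ⊗ W` of a trilinear form on `W`. -/
def extend (A : Type) [CommRing A] [Algebra ℂ A] (T : W →ₗ[ℂ] W →ₗ[ℂ] W →ₗ[ℂ] ℂ) :
    A ⊗[ℂ] W →ₗ[A] A ⊗[ℂ] W →ₗ[A] A ⊗[ℂ] W →ₗ[A] A :=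
  LinearMap.liftBaseChange A
    { toFun := fun x => LinearMap.liftBaseChange A
        { toFun := fun y => LinearMap.liftBaseChange A ((Algebra.linearMap ℂ A).comp (T x y))
          map_add' := fun y y' => by ext; simp
          map_smul' := fun c y => by ext; simp [Algebra.smul_def] }
      map_add' := fun x x' => by ext; simp
      map_smul' := fun c x => by ext; simp [Algebra.smul_def] }

theorem extend_tmul (A : Type) [CommRing A] [Algebra ℂ A] (T : W →ₗ[ℂ] W →ₗ[ℂ] W →ₗ[ℂ] ℂ)
    (a b c : A) (x y z : W) :
    extend A T (a ⊗ₜ x) (b ⊗ₜ y) (c ⊗ₜ z) = a * b * c * algebraMap ℂ A (T x y z) := by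
  simp [extend, mul_assoc]

/-- The three-form `f ∧ g ∧ h`, evaluated on three vectors. -/
def wedge₃ (f g h : Module.Dual ℂ W) (x y z : W) : ℂ :=
  Matrix.det !![f x, f y, f z; g x, g y, g z; h x, h y, h z]

/-- `Ω` is a general three-form in seven variables: in a suitable basis of the (seven-dimensional)
space, whose dual basis is written `v₀, v_α, v_β, v_γ, v_-α, v_-β, v_-γ` (indices `0, …, 6`), it is
`v₀ v_α v_-α + v₀ v_β v_-β + v₀ v_γ v_-γ + v_α v_β v_γ + v_-α v_-β v_-γ`. -/
def IsGeneralThreeForm (Ω : W [⋀^Fin 3]→ₗ[ℂ] ℂ) : Prop :=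
  ∃ b : Module.Basis (Fin 7) ℂ W, ∀ x y z : W, Ω ![x, y, z] =
    wedge₃ (b.coord 0) (b.coord 1) (b.coord 4) x y z +
    wedge₃ (b.coord 0) (b.coord 2) (b.coord 5) x y z +
    wedge₃ (b.coord 0) (b.coord 3) (b.coord 6) x y z +
    wedge₃ (b.coord 1) (b.coord 2) (b.coord 3) x y z +
    wedge₃ (b.coord 4) (b.coord 5) (b.coord 6) x y z

/-- The restriction `ω` of `Ω` to the subspace `V₆`. -/
def omega (Ω : W [⋀^Fin 3]→ₗ[ℂ] ℂ) (V₆ : Submodule ℂ W) : V₆ [⋀^Fin 3]→ₗ[ℂ] ℂ :=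
  Ω.compLinearMap V₆.subtype

/-- The two-form `α = Ω(e, ·, ·)` on the subspace `V₆`. -/
def alpha (Ω : W [⋀^Fin 3]→ₗ[ℂ] ℂ) (e : W) (V₆ : Submodule ℂ W) : LinearMap.BilinForm ℂ V₆ :=
  (trilinear Ω e).compl₁₂ V₆.subtype V₆.subtype

/-! ### The varieties -/

/-- The full Grassmannian of subspaces of `W` of codimension `k`. -/
def grassmannian (W : Type) [AddCommGroup W] [Module ℂ W] (k : ℕ) : Condition W k :=
  fun _ => Set.univ

/-- Subspaces on which the three-form `Ω` vanishes identically. On subspaces of dimension three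
this is the section by the hyperplane `H_Ω` in the Plücker embedding. -/
def vanishing (k : ℕ) (Ω : W [⋀^Fin 3]→ₗ[ℂ] ℂ) : Condition W k :=
  fun A => {N | ∀ x ∈ N.toSubmodule, ∀ y ∈ N.toSubmodule, ∀ z ∈ N.toSubmodule,
    extend A (trilinear Ω) x y z = 0}

/-- The Cayley Grassmannian: the four-dimensional subspaces of the seven-dimensional space `W` on
which `Ω` vanishes. -/
def cayley (Ω : W [⋀^Fin 3]→ₗ[ℂ] ℂ) : Condition W 3 :=
  vanishing 3 Ω

/-- The adjoint variety of `G₂`: the planes `V₂` in the seven-dimensional space `W` such that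
`Ω(V₂, V₂, W) = 0`. -/
def adjointVariety (Ω : W [⋀^Fin 3]→ₗ[ℂ] ℂ) : Condition W 5 :=
  fun A => {N | ∀ x ∈ N.toSubmodule, ∀ y ∈ N.toSubmodule, ∀ z : A ⊗[ℂ] W,
    extend A (trilinear Ω) x y z = 0}

/-- The Lagrangian Grassmannian of a two-form on a six-dimensional space `W`. -/
def lagrangian (a : LinearMap.BilinForm ℂ W) : Condition W 3 :=
  fun A => {N | ∀ x ∈ N.toSubmodule, ∀ y ∈ N.toSubmodule, a.baseChange A x y = 0}

/-- The variety `Z₃ = LG_a(3, 6) ∩ H_w` in `G(3, W)`, for a six-dimensional space `W`. -/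
def varietyZ₃ (a : LinearMap.BilinForm ℂ W) (w : W [⋀^Fin 3]→ₗ[ℂ] ℂ) : Condition W 3 :=
  fun A => lagrangian a A ∩ vanishing 3 w A

/-- The variety `Y₄` in `G(4, W)`, for a six-dimensional space `W`: the four-dimensional subspaces
`U₄` that contain their `a`-orthogonal `U₂ = U₄^⊥` and satisfy `w(U₂, U₂, U₄) = 0`. -/
def varietyY₄ (a : LinearMap.BilinForm ℂ W) (w : W [⋀^Fin 3]→ₗ[ℂ] ℂ) : Condition W 2 :=
  fun A => {N | (a.baseChange A).orthogonal N.toSubmodule ≤ N.toSubmodule ∧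
    ∀ x ∈ (a.baseChange A).orthogonal N.toSubmodule,
    ∀ y ∈ (a.baseChange A).orthogonal N.toSubmodule, ∀ z ∈ N.toSubmodule,
      extend A (trilinear w) x y z = 0}

end CayleyGrassmannian

end

/-! Both blow-ups have the same total space: the incidence scheme `B` of pairs (V₄, U₄) with V₄ in
CG, U₄ in G(4, V₆) and V₄ ⊂ U₄ ⊕ V₁, with its two projections `p` and `q`.

Locally `B` is explicit. A four-dimensional subspace of a six-dimensional symplectic space is not
isotropic, so over a local ring U₄ has a basis x₀, …, x₃ with α(x₀, x₁) = 1 and x₂, x₃ orthogonal to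
x₀, x₁ (`exists_adapted`). The subspace V₄ is the kernel of a functional L on U₄ ⊕ ℂe, and if Ω
vanishes on V₄ then L ∧ Ω = 0. Two of these equations express L(x₂) and L(x₃) through L(e). The
others say that s = (ω(x₀, x₂, x₃), ω(x₁, x₂, x₃), α(x₂, x₃)) is a multiple c·l of the unimodular
vector l = (L(x₀), L(x₁), L(e)) (`exists_parameters`; the converse is `Adapted.Ω_eq_zero`). Now s =
0 are the equations of Y₄ (`Adapted.mem_iff`), and V₄ contains e iff l₂ = 0. Hence c cuts out the
preimage of Y₄ in `B`, and l₂ cuts out the preimage of Z₃.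

The universal property of a blow-up need only be tested on local rings (`isBlowup_of_local`,
`isBlowup_of_points`). For `q`: if the entries of s generate (c) with c a nonzerodivisor, then s =
c·l with l unimodular and unique up to a unit, so there is exactly one V₄. For `p`: V₄ is the kernel
of a surjection g onto A³, and the vector g(e) cuts out Z₃; if its entries generate (c), then g(e) =
c·l and U₄ has to be the preimage of the line A·l.

It remains that c and l₂ are nonzerodivisors in the local rings of `B`. In a noetherian local
ℚ-algebra a nonunit with a unit derivative is a nonzerodivisor
(`mem_nonZeroDivisors_of_derivation`), and derivations come from deformations of points of `B` over
the dual numbers. Enough deformations exist because the derivative of s is surjective at points of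
Y₄: a linear dependence would produce a three-dimensional space on which all contractions Ω(v, v',
·) vanish (`Adapted.eq_zero_of_derivParam`), and the general form admits none
(`finrank_le_two_of_stdForm`).

The complement of the two exceptional divisors is dense in `B` and open in both CG and G(4, V₆). Its
images are dense because `p` and `q` are surjective: over a field every vector is a multiple of a
unimodular one. This gives birationality. For the adjoint variety, U₄ in Y₄ has U₄^⊥ = ⟨x₂, x₃⟩, the
functional ω(x₂, x₃, ·) is α(w, ·) with w in U₄^⊥, and w prescribes the unique lift of ⟨x₂, x₃⟩ to a
plane killed by Ω (`existsUnique_isAdjoint`).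

All schemes are handled through points over ℂ-algebras. The Grassmannian is glued from charts as the
representing scheme of a Zariski sheaf. A condition on points that holds exactly over the quotients
of a quotient ring defines a closed subscheme (`exists_closed`); this yields CG, Z₃, Y₄, the adjoint
variety and `B`. -/

noncomputable section

namespace CayleyGrassmannian

section

/-! ### Families of submodules over the stalks of a scheme -/

section Push

variable {n k : ℕ} {R S T : Type*} [CommRing R] [CommRing S] [CommRing T]

/-- The submodule of `S ^ n` generated by the image of a submodule of `R ^ n`. -/
def push (φ : R →+* S) (N : Submodule R (Fin n → R)) : Submodule S (Fin n → S) :=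
  Submodule.span S ((fun v => φ ∘ v) '' N)

theorem mem_push (φ : R →+* S) {N : Submodule R (Fin n → R)} {v : Fin n → R} (hv : v ∈ N) :
    φ ∘ v ∈ push φ N :=
  Submodule.subset_span ⟨v, hv, rfl⟩

theorem push_le_iff (φ : R →+* S) {N : Submodule R (Fin n → R)} {N' : Submodule S (Fin n → S)} :
    push φ N ≤ N' ↔ ∀ v ∈ N, φ ∘ v ∈ N' := by
  rw [push, Submodule.span_le, Set.image_subset_iff]; rfl

theorem push_id (N : Submodule R (Fin n → R)) : push (RingHom.id R) N = N := by
  refine le_antisymm ((push_le_iff _).2 fun v hv => hv) fun v hv => mem_push (RingHom.id R) hv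

theorem push_push (φ : R →+* S) (ψ : S →+* T) (N : Submodule R (Fin n → R)) :
    push ψ (push φ N) = push (ψ.comp φ) N := by
  refine le_antisymm ((push_le_iff _).2 fun v hv => ?_)
    ((push_le_iff _).2 fun v hv => mem_push ψ (mem_push φ hv))
  induction hv using Submodule.span_induction with
  | mem x hx =>
    obtain ⟨w, hw, rfl⟩ := hx
    exact mem_push (ψ.comp φ) hw
  | zero =>
    convert! (push (ψ.comp φ) N).zero_mem using 1
    ext; simp
  | add x y _ _ hx hy =>
    convert! (push (ψ.comp φ) N).add_mem hx hy using 1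
    ext; simp
  | smul a x _ hx =>
    convert! (push (ψ.comp φ) N).smul_mem (ψ a) hx using 1
    ext; simp

theorem map_mulVec_comp (φ : R →+* S) (M : Matrix (Fin k) (Fin n) R) (v : Fin n → R) :
    (M.map φ).mulVec (φ ∘ v) = φ ∘ (M.mulVec v) := by
  ext i; simp [Matrix.mulVec, dotProduct]

/-- The matrix `1 - P * M` is a projector onto the kernel of `M`, so its columns generate the
kernel, and they still do so after any change of rings. Splitness is what makes kernels commute with
base change here. -/
theorem push_ker (φ : R →+* S) {M : Matrix (Fin k) (Fin n) R} {P : Matrix (Fin n) (Fin k) R}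
    (h : M * P = 1) :
    push φ (LinearMap.ker M.mulVecLin) = LinearMap.ker (M.map φ).mulVecLin := by
  refine le_antisymm ((push_le_iff _).2 fun v hv => ?_) fun v hv => ?_
  · rw [LinearMap.mem_ker, Matrix.mulVecLin_apply] at hv ⊢
    rw [map_mulVec_comp, hv]; ext; simp
  · rw [LinearMap.mem_ker, Matrix.mulVecLin_apply] at hv
    have key : v = ∑ j, v j • (φ ∘ ((1 - P * M).col j)) := by
      have h1 : v = (1 - P.map φ * M.map φ).mulVec v := by
        rw [Matrix.sub_mulVec, Matrix.one_mulVec, ← Matrix.mulVec_mulVec, hv, Matrix.mulVec_zero,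
          sub_zero]
      conv_lhs => rw [h1]
      have h2 : (1 - P.map φ * M.map φ) = (1 - P * M).map φ := by
        rw [Matrix.map_sub _ (map_sub φ), Matrix.map_mul, Matrix.map_one _ (map_zero φ) (map_one φ)]
      rw [h2]
      ext i
      simp [Matrix.mulVec, dotProduct, mul_comm]
    rw [key]
    refine Submodule.sum_mem _ fun j _ => Submodule.smul_mem _ _ (mem_push φ ?_)
    rw [LinearMap.mem_ker, Matrix.mulVecLin_apply]
    have : M * (1 - P * M) = 0 := by
      rw [Matrix.mul_sub, ← Matrix.mul_assoc, h]; simp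
    have h3 := congrArg (fun X => Matrix.col X j) this
    ext i
    have := congrFun h3 i
    simpa [Matrix.mul_apply, Matrix.mulVec, dotProduct] using this

end Push

/-- Restriction of a matrix to a choice of columns. -/
abbrev cols {n k : ℕ} {R : Type*} (σ : Fin k → Fin n) (M : Matrix (Fin k) (Fin n) R) :
    Matrix (Fin k) (Fin k) R := M.submatrix id σ

/-- The family of submodules is locally on `T` the kernel of a split surjective matrix. -/
def IsLocKer {n : ℕ} (k : ℕ) (T : Scheme.{0})
    (N : ∀ x : T, Submodule (T.presheaf.stalk x) (Fin n → T.presheaf.stalk x)) : Prop :=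
  ∀ x : T, ∃ U : T.Opens, x ∈ U ∧ ∃ (M : Matrix (Fin k) (Fin n) Γ(T, U))
    (P : Matrix (Fin n) (Fin k) Γ(T, U)), M * P = 1 ∧
    ∀ (y : T) (hy : y ∈ U), N y = LinearMap.ker (M.map (T.presheaf.germ U y hy).hom).mulVecLin

/-- Families of subspaces of codimension `k` in `n`-space over a scheme. -/
@[ext] structure Fam (n k : ℕ) (T : Scheme.{0}) : Type where
  /-- The submodule at a stalk. -/
  at' : ∀ x : T, Submodule (T.presheaf.stalk x) (Fin n → T.presheaf.stalk x)
  isLocKer : IsLocKer k T at'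

variable {n k : ℕ}

/-- Pullback of families. -/
def Fam.pull {T T' : Scheme.{0}} (f : T' ⟶ T) (N : Fam n k T) : Fam n k T' := by
  -- Recording the submodules on stalks makes pullback strictly functorial and gluing a pointwise
  -- choice.
  refine ⟨fun x => push (f.stalkMap x).hom (N.at' (f x)), fun x => ?_⟩
  obtain ⟨U, hx, M, P, hMP, h⟩ := N.isLocKer (f x)
  refine ⟨f ⁻¹ᵁ U, hx, M.map (f.app U).hom, P.map (f.app U).hom, ?_, fun y hy => ?_⟩
  · rw [← Matrix.map_mul, hMP, Matrix.map_one _ (map_zero _) (map_one _)]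
  · dsimp only
    rw [h (f y) hy, push_ker (P := P.map (T.presheaf.germ U (f y) hy).hom)]
    · congr 2
      rw [Matrix.map_map, Matrix.map_map]
      congr 1
      have := Scheme.Hom.germ_stalkMap f U y hy
      exact congrArg (fun g => (g.hom : _ → _)) this
    · rw [← Matrix.map_mul, hMP, Matrix.map_one _ (map_zero _) (map_one _)]

theorem Fam.pull_val {T T' : Scheme.{0}} (f : T' ⟶ T) (N : Fam n k T) (x : T') :
    (N.pull f).at' x = push (f.stalkMap x).hom (N.at' (f x)) := rfl

theorem Fam.pull_id {T : Scheme.{0}} (N : Fam n k T) : N.pull (𝟙 T) = N := by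
  refine Fam.ext (funext fun x => ?_)
  change push (Scheme.Hom.stalkMap (𝟙 _) x).hom (N.at' x) = N.at' x
  rw [Scheme.Hom.stalkMap_id]
  exact push_id _

theorem Fam.pull_comp {T T' T'' : Scheme.{0}} (f : T'' ⟶ T') (g : T' ⟶ T) (N : Fam n k T) :
    N.pull (f ≫ g) = (N.pull g).pull f := by
  refine Fam.ext (funext fun x => ?_)
  change push (Scheme.Hom.stalkMap (f ≫ g) x).hom (N.at' _) =
    push (Scheme.Hom.stalkMap f x).hom (push (Scheme.Hom.stalkMap g _).hom (N.at' _))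
  rw [Scheme.Hom.stalkMap_comp, push_push]
  rfl

/-- The functor of families of subspaces. -/
def famFunctor (n k : ℕ) : Scheme.{0}ᵒᵖ ⥤ Type where
  obj T := Fam n k T.unop
  map f := ↾(Fam.pull f.unop)
  map_id T := ConcreteCategory.hom_ext _ _ fun N => Fam.pull_id N
  map_comp f g := ConcreteCategory.hom_ext _ _ fun N => Fam.pull_comp g.unop f.unop N

end

/-! ### Gluing of families: the functor of families is a Zariski sheaf -/

section

variable {n k : ℕ}

theorem push_injective_of_isIso {R S : CommRingCat} (φ : R ⟶ S) [IsIso φ] :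
    Function.Injective (push (n := n) φ.hom) := by
  refine Function.LeftInverse.injective (g := push (inv φ).hom) fun N => ?_
  rw [push_push, ← CommRingCat.hom_comp, IsIso.hom_inv_id]
  exact push_id N

theorem push_inv_push {R S : CommRingCat} (φ : R ⟶ S) [IsIso φ]
    (N : Submodule S (Fin n → S)) : push φ.hom (push (inv φ).hom N) = N := by
  rw [push_push, ← CommRingCat.hom_comp, IsIso.inv_hom_id]
  exact push_id N

/-- The map on stalks of a morphism at a point with a prescribed image. -/
def germMap {U T : Scheme.{0}} (f : U ⟶ T) {y : U} {x : T} (h : f y = x) :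
    T.presheaf.stalk x ⟶ U.presheaf.stalk y :=
  T.presheaf.stalkSpecializes (specializes_of_eq h) ≫ f.stalkMap y

theorem germMap_rfl {U T : Scheme.{0}} (f : U ⟶ T) (y : U) :
    germMap f (rfl : f y = f y) = f.stalkMap y := by
  simp [germMap]

instance {U T : Scheme.{0}} (f : U ⟶ T) [IsOpenImmersion f] {y : U} {x : T} (h : f y = x) :
    IsIso (germMap f h) := by
  subst h; rw [germMap_rfl]; infer_instance

theorem germMap_comp {V U T : Scheme.{0}} (g : V ⟶ U) (f : U ⟶ T) {z : V} {x : T}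
    (h : f (g z) = x) :
    germMap (g ≫ f) (by simpa using h) = germMap f h ≫ g.stalkMap z := by
  subst h
  rw [germMap_rfl]
  exact (germMap_rfl (g ≫ f) z).trans (Scheme.Hom.stalkMap_comp g f z)

theorem germMap_congr {U T : Scheme.{0}} {f f' : U ⟶ T} (e : f = f') {y : U} {x : T}
    (h : f y = x) (h' : f' y = x) : germMap f h = germMap f' h' := by
  subst e; rfl

/-- Preimages of `x` in two members of the cover come from one point of their fibre product. There
the two families agree, and `push` along the isomorphisms of stalks is injective. -/
theorem Fam.compat_at {T : Scheme.{0}} (𝓤 : T.OpenCover) (N : ∀ i, Fam n k (𝓤.X i))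
    (hN : ∀ i j, (N i).pull (Limits.pullback.fst (𝓤.f i) (𝓤.f j)) =
      (N j).pull (Limits.pullback.snd (𝓤.f i) (𝓤.f j)))
    {i j : 𝓤.I₀} {x : T} {y : 𝓤.X i} {v : 𝓤.X j} (hy : 𝓤.f i y = x) (hv : 𝓤.f j v = x)
    (a : Submodule (T.presheaf.stalk x) (Fin n → T.presheaf.stalk x))
    (ha : push (germMap (𝓤.f i) hy).hom a = (N i).at' y) :
    push (germMap (𝓤.f j) hv).hom a = (N j).at' v := by
  obtain ⟨z, rfl, rfl⟩ := Scheme.Pullback.exists_preimage_pullback (f := 𝓤.f i) (g := 𝓤.f j)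
    y v (hy.trans hv.symm)
  have h := congrArg (fun F => Fam.at' F z) (hN i j)
  simp only [Fam.pull_val] at h
  apply push_injective_of_isIso ((Limits.pullback.snd (𝓤.f i) (𝓤.f j)).stalkMap z)
  rw [← h, ← ha, push_push, push_push, ← CommRingCat.hom_comp, ← CommRingCat.hom_comp,
    ← germMap_comp, ← germMap_comp, germMap_congr Limits.pullback.condition]

theorem Fam.exists_glue {T : Scheme.{0}} (𝓤 : T.OpenCover) (N : ∀ i, Fam n k (𝓤.X i))
    (hN : ∀ i j, (N i).pull (Limits.pullback.fst (𝓤.f i) (𝓤.f j)) =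
      (N j).pull (Limits.pullback.snd (𝓤.f i) (𝓤.f j))) :
    ∃ N' : Fam n k T, ∀ i, N'.pull (𝓤.f i) = N i := by
  choose ix y hy using fun x : T => 𝓤.exists_eq x
  -- The value at `x` is transported from an arbitrarily chosen member of the cover; `Fam.compat_at`
  -- makes the choice immaterial.
  let a : ∀ x : T, Submodule (T.presheaf.stalk x) (Fin n → T.presheaf.stalk x) :=
    fun x => push (inv (germMap (𝓤.f (ix x)) (hy x))).hom ((N (ix x)).at' (y x))
  have key : ∀ i (v : 𝓤.X i), push ((𝓤.f i).stalkMap v).hom (a (𝓤.f i v)) = (N i).at' v := by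
    intro i v
    rw [← germMap_rfl]
    exact Fam.compat_at 𝓤 N hN (hy (𝓤.f i v)) rfl _ (push_inv_push _ _)
  refine ⟨⟨a, fun x => ?_⟩, fun i => Fam.ext (funext fun v => key i v)⟩
  obtain ⟨V, hV, M, P, hMP, h⟩ := (N (ix x)).isLocKer (y x)
  let f := 𝓤.f (ix x)
  let r : Γ(𝓤.X (ix x), V) ⟶ Γ(T, f ''ᵁ V) := (f.appIso V).inv
  refine ⟨f ''ᵁ V, ⟨y x, hV, hy x⟩, M.map r.hom, P.map r.hom, ?_, ?_⟩
  · rw [← Matrix.map_mul, hMP, Matrix.map_one _ (map_zero _) (map_one _)]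
  · intro w hw
    obtain ⟨v, hv, (e : f v = w)⟩ := id hw
    subst e
    apply push_injective_of_isIso (f.stalkMap v)
    rw [key, h v hv, push_ker (P := (P.map r.hom).map (T.presheaf.germ (f ''ᵁ V) (f v) hw).hom)]
    · congr 2
      rw [Matrix.map_map, Matrix.map_map]
      congr 1
      have : r ≫ T.presheaf.germ (f ''ᵁ V) (f v) hw ≫ f.stalkMap v =
          (𝓤.X (ix x)).presheaf.germ V v hv := by
        rw [Scheme.Hom.germ_stalkMap f (f ''ᵁ V) v hw]
        simp only [r, Scheme.Hom.appIso_inv_app_assoc]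
        exact TopCat.Presheaf.germ_res _ _ _ _
      exact congrArg (fun g => (g.hom : _ → _)) this.symm
    · rw [← Matrix.map_mul, ← Matrix.map_mul, hMP, Matrix.map_one _ (map_zero _) (map_one _),
        Matrix.map_one _ (map_zero _) (map_one _)]

theorem Fam.hom_ext {T : Scheme.{0}} (𝓤 : T.OpenCover) {N N' : Fam n k T}
    (h : ∀ i, N.pull (𝓤.f i) = N'.pull (𝓤.f i)) : N = N' := by
  refine Fam.ext (funext fun x => ?_)
  obtain ⟨i, y, rfl⟩ := 𝓤.exists_eq x
  exact push_injective_of_isIso ((𝓤.f i).stalkMap y) (congrArg (fun F => Fam.at' F y) (h i))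

theorem isSheaf_famFunctor : Presheaf.IsSheaf Scheme.zariskiTopology.{0} (famFunctor n k) := by
  rw [isSheaf_iff_isSheaf_of_type, Precoverage.isSheaf_toGrothendieck_iff_of_isStableUnderBaseChange]
  rintro Y S hS x hx
  obtain ⟨(𝓤 : Scheme.OpenCover Y), rfl⟩ := Scheme.exists_cover_of_mem_pretopology hS
  obtain ⟨N, hN⟩ := Fam.exists_glue 𝓤 (fun i => x (𝓤.f i) (.mk i))
    (fun i j => hx _ _ _ _ Limits.pullback.condition)
  refine ⟨N, ?_, fun N' hN' => Fam.hom_ext 𝓤 fun i => ?_⟩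
  · rintro Z e ⟨j⟩
    exact hN j
  · exact (hN' _ (.mk i)).trans (hN i).symm

end

/-! ### Affine charts: matrices normalized on a choice of columns -/

section

variable {n k : ℕ}

section Charts

/-- The inclusion of the coordinate subspace spanned by the coordinates in `σ`. -/
def selMat (σ : Fin k → Fin n) (R : Type*) [CommRing R] : Matrix (Fin n) (Fin k) R :=
  (1 : Matrix (Fin n) (Fin n) R).submatrix id σ

theorem mul_selMat {R : Type*} [CommRing R] (σ : Fin k → Fin n) (M : Matrix (Fin k) (Fin n) R) :
    M * selMat σ R = cols σ M := by
  ext i j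
  simp [selMat, Matrix.mul_apply, Matrix.one_apply]

/-- Matrices normalized on the columns `σ` are determined by their kernel. -/
theorem eq_of_ker_le {R : Type*} [CommRing R] {σ : Fin k → Fin n} {M M' : Matrix (Fin k) (Fin n) R}
    (h : cols σ M = 1) (h' : cols σ M' = 1)
    (hk : LinearMap.ker M.mulVecLin ≤ LinearMap.ker M'.mulVecLin) : M = M' := by
  have h1 : M' * (1 - selMat σ R * M) = 0 := by
    have h2 : M * (1 - selMat σ R * M) = 0 := by
      rw [Matrix.mul_sub, ← Matrix.mul_assoc, mul_selMat, h]; simp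
    ext i j
    have : (1 - selMat σ R * M).col j ∈ LinearMap.ker M.mulVecLin := by
      rw [LinearMap.mem_ker]
      ext i
      have := congrFun (congrFun h2 i) j
      simpa [Matrix.mul_apply, Matrix.mulVec, dotProduct] using this
    have := congrFun (LinearMap.mem_ker.1 (hk this)) i
    simpa [Matrix.mul_apply, Matrix.mulVec, dotProduct] using this
  rw [Matrix.mul_sub, ← Matrix.mul_assoc, mul_selMat, h', Matrix.mul_one, Matrix.one_mul] at h1
  exact (sub_eq_zero.1 h1).symm

/-- The family given by the kernel of a matrix of global functions. -/
def kerFam {T : Scheme.{0}} (M : Matrix (Fin k) (Fin n) Γ(T, ⊤)) {P : Matrix (Fin n) (Fin k) Γ(T, ⊤)}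
    (h : M * P = 1) : Fam n k T where
  at' x := LinearMap.ker (M.map (T.presheaf.germ ⊤ x trivial).hom).mulVecLin
  isLocKer _ := ⟨⊤, trivial, M, P, h, fun _ _ => rfl⟩

theorem mul_selMat_of_cols {R : Type*} [CommRing R] {σ : Fin k → Fin n}
    {M : Matrix (Fin k) (Fin n) R} (h : cols σ M = 1) : M * selMat σ R = 1 := by
  rw [mul_selMat, h]

theorem cols_map {R S : Type*} [CommRing R] [CommRing S] (φ : R →+* S) {σ : Fin k → Fin n}
    {M : Matrix (Fin k) (Fin n) R} (h : cols σ M = 1) : cols σ (M.map φ) = 1 := by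
  rw [cols, Matrix.submatrix_map, ← cols, h, Matrix.map_one _ (map_zero _) (map_one _)]

theorem kerFam_pull {T T' : Scheme.{0}} (f : T' ⟶ T) (M : Matrix (Fin k) (Fin n) Γ(T, ⊤))
    {P : Matrix (Fin n) (Fin k) Γ(T, ⊤)} (h : M * P = 1)
    {P' : Matrix (Fin n) (Fin k) Γ(T', ⊤)} (h' : M.map f.appTop.hom * P' = 1) :
    (kerFam M h).pull f = kerFam (M.map f.appTop.hom) h' := by
  refine Fam.ext (funext fun x => ?_)
  rw [Fam.pull_val]
  change push _ (LinearMap.ker _) = LinearMap.ker _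
  rw [push_ker (P := P.map (T.presheaf.germ ⊤ (f x) trivial).hom)]
  · congr 2
    rw [Matrix.map_map, Matrix.map_map]
    congr 1
    exact congrArg (fun g => (g.hom : _ → _)) (Scheme.Hom.germ_stalkMap f ⊤ x trivial)
  · rw [← Matrix.map_mul, h, Matrix.map_one _ (map_zero _) (map_one _)]

/-- The ring of the chart of matrices normalized on the columns `σ`. -/
abbrev ChartRing (σ : Fin k → Fin n) : Type :=
  MvPolynomial (Fin k × Fin n) ℤ ⧸ Ideal.span (Set.range fun p : Fin k × Fin k =>
    (MvPolynomial.X (p.1, σ p.2) - if p.1 = p.2 then 1 else 0 : MvPolynomial (Fin k × Fin n) ℤ))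

/-- The universal normalized matrix. -/
def chartMat (σ : Fin k → Fin n) : Matrix (Fin k) (Fin n) (ChartRing σ) :=
  fun i j => Ideal.Quotient.mk _ (MvPolynomial.X (i, j))

theorem cols_chartMat (σ : Fin k → Fin n) : cols σ (chartMat σ) = 1 := by
  ext i j
  change Ideal.Quotient.mk _ (MvPolynomial.X (i, σ j)) = _
  have : Ideal.Quotient.mk (Ideal.span (Set.range fun p : Fin k × Fin k =>
    (MvPolynomial.X (p.1, σ p.2) - if p.1 = p.2 then 1 else 0 : MvPolynomial (Fin k × Fin n) ℤ)))
    (MvPolynomial.X (i, σ j)) = Ideal.Quotient.mk _ (if i = j then 1 else 0) :=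
    Ideal.Quotient.eq.2 (Ideal.subset_span ⟨(i, j), rfl⟩)
  rw [this, Matrix.one_apply]
  split_ifs <;> simp

/-- The map from the chart ring classifying a normalized matrix. -/
def chartLift {R : Type*} [CommRing R] {σ : Fin k → Fin n} {M : Matrix (Fin k) (Fin n) R}
    (h : cols σ M = 1) : ChartRing σ →+* R :=
  Ideal.Quotient.lift _ (MvPolynomial.eval₂Hom (Int.castRingHom R) fun p => M p.1 p.2) (by
    intro a ha
    have : Ideal.span (Set.range fun p : Fin k × Fin k => (MvPolynomial.X (p.1, σ p.2) -
        if p.1 = p.2 then 1 else 0 : MvPolynomial (Fin k × Fin n) ℤ)) ≤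
        RingHom.ker (MvPolynomial.eval₂Hom (Int.castRingHom R) fun p => M p.1 p.2) := by
      rw [Ideal.span_le]
      rintro _ ⟨⟨i, j⟩, rfl⟩
      have := congrFun (congrFun h i) j
      simp only [Matrix.submatrix_apply, id, Matrix.one_apply] at this
      simp only [SetLike.mem_coe, RingHom.mem_ker, map_sub, MvPolynomial.eval₂Hom_X', this]
      split_ifs <;> simp
    exact this ha)

theorem chartLift_chartMat {R : Type*} [CommRing R] {σ : Fin k → Fin n}
    {M : Matrix (Fin k) (Fin n) R} (h : cols σ M = 1) : (chartMat σ).map (chartLift h) = M := by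
  ext i j
  exact MvPolynomial.eval₂Hom_X' (Int.castRingHom R) (fun p : Fin k × Fin n => M p.1 p.2) (i, j)

theorem chartRing_hom_ext {R : Type*} [CommRing R] {σ : Fin k → Fin n} {φ ψ : ChartRing σ →+* R}
    (h : (chartMat σ).map φ = (chartMat σ).map ψ) : φ = ψ := by
  refine Ideal.Quotient.ringHom_ext (MvPolynomial.ringHom_ext (fun r => ?_) fun p => ?_)
  · simp
  · exact congrFun (congrFun h p.1) p.2

/-- The chart of the Grassmannian. -/
abbrev chart (σ : Fin k → Fin n) : Scheme.{0} := Spec (.of (ChartRing σ))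

/-- The universal matrix as a matrix of functions on the chart. -/
def chartMatΓ (σ : Fin k → Fin n) : Matrix (Fin k) (Fin n) Γ(chart σ, ⊤) :=
  (chartMat σ).map (Scheme.ΓSpecIso (.of (ChartRing σ))).inv.hom

theorem cols_chartMatΓ (σ : Fin k → Fin n) : cols σ (chartMatΓ σ) = 1 :=
  cols_map _ (cols_chartMat σ)

/-- The morphism to the chart classifying a normalized matrix. -/
def toChart {T : Scheme.{0}} {σ : Fin k → Fin n} {M : Matrix (Fin k) (Fin n) Γ(T, ⊤)}
    (h : cols σ M = 1) : T ⟶ chart σ :=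
  T.toSpecΓ ≫ Spec.map (CommRingCat.ofHom (chartLift h))

theorem toChart_mat {T : Scheme.{0}} {σ : Fin k → Fin n} {M : Matrix (Fin k) (Fin n) Γ(T, ⊤)}
    (h : cols σ M = 1) : (chartMatΓ σ).map (toChart h).appTop.hom = M := by
  conv_rhs => rw [← chartLift_chartMat h]
  rw [chartMatΓ, Matrix.map_map]
  congr 1
  have : (Scheme.ΓSpecIso (.of (ChartRing σ))).inv ≫ (toChart h).appTop =
      CommRingCat.ofHom (chartLift h) := by
    simp [toChart]
  exact congrArg (fun g => (g.hom : _ → _)) this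

theorem chart_hom_ext {T : Scheme.{0}} {σ : Fin k → Fin n} {f g : T ⟶ chart σ}
    (h : (chartMatΓ σ).map f.appTop.hom = (chartMatΓ σ).map g.appTop.hom) : f = g := by
  refine ext_of_isAffine ?_
  rw [← cancel_epi (Scheme.ΓSpecIso (.of (ChartRing σ))).inv]
  ext1
  apply chartRing_hom_ext
  rw [chartMatΓ, Matrix.map_map, Matrix.map_map] at h
  exact h

/-- The universal family on a chart, as a morphism of presheaves. -/
def chartMap (σ : Fin k → Fin n) : yoneda.obj (chart σ) ⟶ famFunctor n k :=
  yonedaEquiv.symm (kerFam (chartMatΓ σ) (mul_selMat_of_cols (cols_chartMatΓ σ)))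

theorem chartMap_app {T : Scheme.{0}} (σ : Fin k → Fin n) (f : T ⟶ chart σ) :
    (chartMap σ).app (.op T) f = kerFam ((chartMatΓ σ).map f.appTop.hom)
      (mul_selMat_of_cols (cols_map _ (cols_chartMatΓ σ))) :=
  kerFam_pull f (chartMatΓ σ) (mul_selMat_of_cols (cols_chartMatΓ σ)) _

end Charts

end

/-! ### Normalized matrices of a family: uniqueness, gluing, local existence -/

section

variable {n k : ℕ}

/-- On the open set `V` the family is the kernel of a matrix normalized on the columns `σ`. -/
structure IsChartOn {T : Scheme.{0}} (N : Fam n k T) (σ : Fin k → Fin n) (V : T.Opens)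
    (M : Matrix (Fin k) (Fin n) Γ(T, V)) : Prop where
  cols_eq : cols σ M = 1
  at_eq : ∀ (y : T) (hy : y ∈ V),
    N.at' y = LinearMap.ker (M.map (T.presheaf.germ V y hy).hom).mulVecLin

theorem IsChartOn.res {T : Scheme.{0}} {N : Fam n k T} {σ : Fin k → Fin n} {V W : T.Opens}
    {M : Matrix (Fin k) (Fin n) Γ(T, V)} (h : IsChartOn N σ V M) (i : W ⟶ V) :
    IsChartOn N σ W (M.map (T.presheaf.map i.op).hom) := by
  refine ⟨cols_map _ h.1, fun y hy => ?_⟩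
  rw [h.2 y (i.le hy), Matrix.map_map]
  congr 3
  exact congrArg (fun g => (g.hom : _ → _)) (TopCat.Presheaf.germ_res T.presheaf i y hy).symm

theorem IsChartOn.unique {T : Scheme.{0}} {N : Fam n k T} {σ : Fin k → Fin n} {V : T.Opens}
    {M M' : Matrix (Fin k) (Fin n) Γ(T, V)} (h : IsChartOn N σ V M) (h' : IsChartOn N σ V M') :
    M = M' := by
  ext i j
  refine TopCat.Presheaf.section_ext T.sheaf V _ _ fun y hy => ?_
  have := eq_of_ker_le (cols_map (T.presheaf.germ V y hy).hom h.1)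
    (cols_map (T.presheaf.germ V y hy).hom h'.1) (by rw [← h.2 y hy, ← h'.2 y hy])
  exact congrFun (congrFun this i) j

/-- Normalized matrices glue. -/
theorem IsChartOn.glue {T : Scheme.{0}} {N : Fam n k T} {σ : Fin k → Fin n} (U : T.Opens)
    (h : ∀ x ∈ U, ∃ V : T.Opens, x ∈ V ∧ V ≤ U ∧ ∃ M, IsChartOn N σ V M) :
    ∃ M, IsChartOn N σ U M := by
  choose V hxV hVU M hM using fun x : U => h x.1 x.2
  have hcov : U ≤ iSup V := fun x hx => TopologicalSpace.Opens.mem_iSup.2 ⟨⟨x, hx⟩, hxV _⟩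
  have hcomp : ∀ i j, TopCat.Presheaf.IsCompatible T.sheaf.1 V (fun x => M x i j) := by
    intro i j x y
    have := ((hM x).res (TopologicalSpace.Opens.infLELeft (V x) (V y))).unique
      ((hM y).res (TopologicalSpace.Opens.infLERight (V x) (V y)))
    exact congrFun (congrFun this i) j
  choose s hs _ using fun i j => T.sheaf.existsUnique_gluing' V U (fun x => homOfLE (hVU x)) hcov
    (fun x => M x i j) (hcomp i j)
  have hres : ∀ x : U, (Matrix.of s : Matrix (Fin k) (Fin n) Γ(T, U)).map
      (T.presheaf.map (homOfLE (hVU x)).op).hom = M x := fun x => by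
    ext i j
    exact hs i j x
  refine ⟨Matrix.of s, ?_, fun y hy => ?_⟩
  · ext i j
    refine TopCat.Sheaf.eq_of_locally_eq' T.sheaf V U (fun x => homOfLE (hVU x)) hcov _ _
      fun x => ?_
    have h1 := congrFun (congrFun (hres x) i) (σ j)
    have h2 := congrFun (congrFun (hM x).1 i) j
    simp only [Matrix.submatrix_apply, id] at h2
    refine h1.trans (h2.trans ?_)
    simp only [Matrix.one_apply]
    split_ifs
    · exact (map_one (T.presheaf.map (homOfLE (hVU x)).op).hom).symm
    · exact (map_zero (T.presheaf.map (homOfLE (hVU x)).op).hom).symm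
  · rw [(hM ⟨y, hy⟩).2 y (hxV _), ← hres, Matrix.map_map]
    congr 3
    exact congrArg (fun g => (g.hom : _ → _)) (TopCat.Presheaf.germ_res T.presheaf
      (homOfLE (hVU ⟨y, hy⟩)) y (hxV _))

/-- If some columns of a local matrix are invertible at `x`, the family is in a chart near `x`. -/
theorem exists_isChartOn {T : Scheme.{0}} {N : Fam n k T} {σ : Fin k → Fin n} {U : T.Opens} {x : T}
    (hx : x ∈ U) {M : Matrix (Fin k) (Fin n) Γ(T, U)}
    (h : ∀ (y : T) (hy : y ∈ U),
      N.at' y = LinearMap.ker (M.map (T.presheaf.germ U y hy).hom).mulVecLin)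
    (hu : IsUnit (T.presheaf.germ U x hx (cols σ M).det)) :
    ∃ V : T.Opens, x ∈ V ∧ ∃ M', IsChartOn N σ V M' := by
  let d := (cols σ M).det
  let i : T.basicOpen d ⟶ U := homOfLE (T.basicOpen_le d)
  let r := (T.presheaf.map i.op).hom
  have hd : IsUnit (cols σ (M.map r)).det := by
    have : (cols σ (M.map r)).det = r d := by
      rw [RingHom.map_det]; rfl
    rw [this]
    exact RingedSpace.isUnit_res_basicOpen _ d
  refine ⟨T.basicOpen d, (T.mem_basicOpen d x hx).2 hu, (cols σ (M.map r))⁻¹ * M.map r, ?_,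
    fun y hy => ?_⟩
  · have : cols σ ((cols σ (M.map r))⁻¹ * M.map r) = (cols σ (M.map r))⁻¹ * cols σ (M.map r) := by
      ext; simp [Matrix.mul_apply]
    rw [this, Matrix.nonsing_inv_mul _ hd]
  · rw [h y (i.le hy)]
    have hM : M.map (T.presheaf.germ U y (i.le hy)).hom =
        (M.map r).map (T.presheaf.germ _ y hy).hom := by
      rw [Matrix.map_map]
      congr 1
      exact congrArg (fun g => (g.hom : _ → _)) (TopCat.Presheaf.germ_res T.presheaf i y hy).symm
    rw [hM, Matrix.map_mul]
    set G := (T.presheaf.germ (T.basicOpen d) y hy).hom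
    have hinv : (cols σ (M.map r)).map G * ((cols σ (M.map r))⁻¹).map G = 1 := by
      rw [← Matrix.map_mul, Matrix.mul_nonsing_inv _ hd, Matrix.map_one _ (map_zero _) (map_one _)]
    ext v
    simp only [LinearMap.mem_ker, Matrix.mulVecLin_apply, ← Matrix.mulVec_mulVec]
    refine ⟨fun h => by rw [h, Matrix.mulVec_zero], fun h => ?_⟩
    have := congrArg (((cols σ (M.map r)).map G).mulVec) h
    rwa [Matrix.mulVec_mulVec, hinv, Matrix.one_mulVec, Matrix.mulVec_zero] at this

/-- A square matrix `D` is invertible if the kernels of `M` and a normalized `M'` agree. -/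
theorem isUnit_det_of_ker_eq {R : Type*} [CommRing R] {σ : Fin k → Fin n}
    {M M' : Matrix (Fin k) (Fin n) R} {P : Matrix (Fin n) (Fin k) R} (hP : M * P = 1)
    (h' : cols σ M' = 1) (hk : LinearMap.ker M.mulVecLin = LinearMap.ker M'.mulVecLin) :
    IsUnit (cols σ M).det := by
  have h1 : M * (1 - selMat σ R * M') = 0 := by
    have h2 : M' * (1 - selMat σ R * M') = 0 := by
      rw [Matrix.mul_sub, ← Matrix.mul_assoc, mul_selMat, h']; simp
    ext i j
    have : (1 - selMat σ R * M').col j ∈ LinearMap.ker M'.mulVecLin := by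
      rw [LinearMap.mem_ker]
      ext i
      have := congrFun (congrFun h2 i) j
      simpa [Matrix.mul_apply, Matrix.mulVec, dotProduct] using this
    rw [← hk] at this
    have := congrFun (LinearMap.mem_ker.1 this) i
    simpa [Matrix.mul_apply, Matrix.mulVec, dotProduct] using this
  rw [Matrix.mul_sub, ← Matrix.mul_assoc, mul_selMat, Matrix.mul_one, sub_eq_zero] at h1
  have h2 : cols σ M * (M' * P) = 1 := by rw [← Matrix.mul_assoc, ← h1, hP]
  exact Matrix.isUnit_det_of_right_inverse h2

end

/-! ### The charts are open subfunctors -/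

section

variable {n k : ℕ}

theorem IsChartOn.pull {T T' : Scheme.{0}} {N : Fam n k T} {σ : Fin k → Fin n} {V : T.Opens}
    {M : Matrix (Fin k) (Fin n) Γ(T, V)} (h : IsChartOn N σ V M) (f : T' ⟶ T) :
    IsChartOn (N.pull f) σ (f ⁻¹ᵁ V) (M.map (f.app V).hom) := by
  refine ⟨cols_map _ h.1, fun y hy => ?_⟩
  rw [Fam.pull_val, h.2 (f y) hy,
    push_ker _ (mul_selMat_of_cols (cols_map (T.presheaf.germ V (f y) hy).hom h.1)),
    Matrix.map_map, Matrix.map_map]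
  congr 3
  exact congrArg (fun g => (g.hom : _ → _)) (Scheme.Hom.germ_stalkMap f V y hy)

theorem exists_chartMap_app {T : Scheme.{0}} {N : Fam n k T} {σ : Fin k → Fin n}
    {M : Matrix (Fin k) (Fin n) Γ(T, ⊤)} (h : IsChartOn N σ ⊤ M) :
    (chartMap σ).app (.op T) (toChart h.1) = N := by
  rw [chartMap_app]
  refine Fam.ext (funext fun x => ?_)
  rw [h.2 x trivial]
  exact congrArg (fun M' : Matrix (Fin k) (Fin n) Γ(T, ⊤) =>
    LinearMap.ker (M'.map (T.presheaf.germ ⊤ x trivial).hom).mulVecLin) (toChart_mat h.1)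

theorem chartMap_comp {T T' : Scheme.{0}} (σ : Fin k → Fin n) (f : T' ⟶ T) (m : T ⟶ chart σ) :
    (chartMap σ).app (.op T') (f ≫ m) = Fam.pull f ((chartMap σ).app (.op T) m) :=
  Fam.pull_comp f m (kerFam (chartMatΓ σ) (mul_selMat_of_cols (cols_chartMatΓ σ)))

theorem isChartOn_chartMap {T : Scheme.{0}} {σ : Fin k → Fin n} (m : T ⟶ chart σ) :
    IsChartOn ((chartMap σ).app (.op T) m) σ ⊤ ((chartMatΓ σ).map m.appTop.hom) := by
  rw [chartMap_app]
  exact ⟨cols_map _ (cols_chartMatΓ σ), fun y hy => rfl⟩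

theorem chartMap_injective {T : Scheme.{0}} {σ : Fin k → Fin n} {m m' : T ⟶ chart σ}
    (h : (chartMap σ).app (.op T) m = (chartMap σ).app (.op T) m') : m = m' :=
  chart_hom_ext ((isChartOn_chartMap m).unique (h ▸ isChartOn_chartMap m'))

/-- The open subset of `T` over which the family is in the chart `σ`. -/
def chartOpen {T : Scheme.{0}} (N : Fam n k T) (σ : Fin k → Fin n) : T.Opens :=
  sSup {V | ∃ M, IsChartOn N σ V M}

theorem exists_isChartOn_chartOpen {T : Scheme.{0}} (N : Fam n k T) (σ : Fin k → Fin n) :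
    ∃ M, IsChartOn N σ (chartOpen N σ) M := by
  refine IsChartOn.glue _ fun x hx => ?_
  obtain ⟨V, ⟨M, hM⟩, hV⟩ := TopologicalSpace.Opens.mem_sSup.1 hx
  exact ⟨V, hV, le_sSup ⟨M, hM⟩, M, hM⟩

/-- Lying in the chart `σ` near a point means that a maximal minor is a unit in the local ring
there. Stalk maps are local homomorphisms, so a minor that is a unit upstairs was already one
downstairs. -/
theorem mem_chartOpen_of_pull {T T' : Scheme.{0}} (N : Fam n k T) {σ : Fin k → Fin n}
    (f : T' ⟶ T) {V : T'.Opens} {M} (h : IsChartOn (N.pull f) σ V M) {x : T'} (hx : x ∈ V) :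
    f x ∈ chartOpen N σ := by
  obtain ⟨U, hxU, M₀, P, hMP, h₀⟩ := N.isLocKer (f x)
  suffices hu : IsUnit (T.presheaf.germ U (f x) hxU (cols σ M₀).det) by
    obtain ⟨W, hW, M', hM'⟩ := exists_isChartOn hxU h₀ hu
    exact TopologicalSpace.Opens.mem_sSup.2 ⟨W, ⟨M', hM'⟩, hW⟩
  set G := (T.presheaf.germ U (f x) hxU).hom
  have hMP' : M₀.map G * P.map G = 1 := by
    rw [← Matrix.map_mul, hMP, Matrix.map_one _ (map_zero _) (map_one _)]
  have hMP'' : (M₀.map G).map (f.stalkMap x).hom * (P.map G).map (f.stalkMap x).hom = 1 := by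
    rw [← Matrix.map_mul, hMP', Matrix.map_one _ (map_zero _) (map_one _)]
  have hk := h.2 x hx
  rw [Fam.pull_val, h₀ (f x) hxU, push_ker _ hMP'] at hk
  have hu := isUnit_det_of_ker_eq hMP'' (cols_map _ h.1) hk
  have e : (cols σ ((M₀.map G).map (f.stalkMap x).hom)).det =
      (f.stalkMap x).hom (G (cols σ M₀).det) := by
    rw [RingHom.map_det, RingHom.map_det]; rfl
  rw [e] at hu
  exact isUnit_of_map_unit (f.stalkMap x).hom _ hu

/-- The fibre product of the chart with a family over `T` is `chartOpen`. The glued normalized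
matrix gives its map to the chart; a morphism whose pulled back family lies in the chart lands in
`chartOpen` by `mem_chartOpen_of_pull`, and the matrix is unique. -/
theorem isOpenImmersion_chartMap (σ : Fin k → Fin n) :
    MorphismProperty.presheaf @IsOpenImmersion (chartMap σ) := by
  refine MorphismProperty.relative.of_exists fun T g => ?_
  set N : Fam n k T := yonedaEquiv g with hN
  have hg : ∀ (T' : Scheme.{0}) (f : T' ⟶ T), g.app (.op T') f = N.pull f := fun T' f => by
    have : g = yonedaEquiv.symm N := by rw [hN, Equiv.symm_apply_apply]
    rw [this]; rfl
  obtain ⟨M, hM⟩ := exists_isChartOn_chartOpen N σ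
  set U := chartOpen N σ
  have hU := (hM.pull U.ι).res (homOfLE (show ⊤ ≤ U.ι ⁻¹ᵁ U by simp))
  refine ⟨U, yoneda.map (toChart hU.1), U.ι, ?_, inferInstance⟩
  refine IsPullback.of_forall_isPullback_app fun T' => ?_
  rw [Limits.Types.isPullback_iff]
  have hcomm : ∀ f : T'.unop ⟶ U.toScheme, (chartMap σ).app T' (f ≫ toChart hU.1) =
      N.pull (f ≫ U.ι) := fun f => by
    rw [Fam.pull_comp]
    exact (chartMap_comp σ f (toChart hU.1)).trans
      (congrArg (Fam.pull f) (exists_chartMap_app hU))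
  refine ⟨?_, ?_, ?_⟩
  · ext f
    exact (hcomm f).trans (hg _ _).symm
  · rintro f f' ⟨-, h⟩
    exact (cancel_mono U.ι).1 h
  · intro m (f : T'.unop ⟶ T) h
    have h' : (chartMap σ).app T' m = N.pull f := h.trans (hg _ f)
    have hch := isChartOn_chartMap m
    have hrange : Set.range f ⊆ Set.range U.ι := by
      rintro _ ⟨x, rfl⟩
      rw [Scheme.Opens.range_ι]
      exact mem_chartOpen_of_pull N f (V := ⊤) (h' ▸ hch) trivial
    refine ⟨IsOpenImmersion.lift U.ι f hrange, ?_, IsOpenImmersion.lift_fac _ _ _⟩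
    apply chartMap_injective
    refine (hcomm _).trans ?_
    rw [IsOpenImmersion.lift_fac, ← h']

end

/-! ### The charts cover; the Grassmannian over the integers -/

section

variable {n k : ℕ}

/-- A weak form of the Cauchy–Binet formula by multilinear expansion: the sum runs over all maps
`σ`, not only the increasing ones. It suffices for finding an invertible minor. -/
theorem det_mul_eq_sum {R : Type*} [CommRing R] (M : Matrix (Fin k) (Fin n) R)
    (P : Matrix (Fin n) (Fin k) R) :
    (M * P).det = ∑ σ : Fin k → Fin n, (∏ j, P (σ j) j) * (cols σ M).det := by
  rw [← Matrix.det_transpose]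
  have h : (M * P).transpose = fun j => ∑ i, P i j • M.transpose i := by
    ext j l
    simp [Matrix.mul_apply, mul_comm]
  rw [h]
  refine (Matrix.detRowAlternating.toMultilinearMap.map_sum
    (fun j (i : Fin n) => P i j • M.transpose i)).trans (Finset.sum_congr rfl fun σ _ => ?_)
  refine (Matrix.detRowAlternating.toMultilinearMap.map_smul_univ (fun j => P (σ j) j)
    (fun j => M.transpose (σ j))).trans ?_
  rw [smul_eq_mul]
  congr 1
  rw [← Matrix.det_transpose (cols σ M)]
  rfl

/-- If all maximal minors were in the maximal ideal, so would be `det (M * P) = 1`. -/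
theorem exists_isUnit_det_cols {R : Type*} [CommRing R] [IsLocalRing R]
    {M : Matrix (Fin k) (Fin n) R} {P : Matrix (Fin n) (Fin k) R} (h : M * P = 1) :
    ∃ σ : Fin k → Fin n, IsUnit (cols σ M).det := by
  by_contra! hcon
  have h1 := det_mul_eq_sum M P
  rw [h, Matrix.det_one] at h1
  have : (1 : R) ∈ IsLocalRing.maximalIdeal R := by
    rw [h1]
    exact Ideal.sum_mem _ fun σ _ => Ideal.mul_mem_left _ _ (hcon σ)
  exact (IsLocalRing.mem_maximalIdeal _).1 this isUnit_one

theorem exists_mem_chartOpen {T : Scheme.{0}} (N : Fam n k T) (x : T) :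
    ∃ σ, x ∈ chartOpen N σ := by
  obtain ⟨U, hx, M, P, hMP, h⟩ := N.isLocKer x
  have hMP' : M.map (T.presheaf.germ U x hx).hom * P.map (T.presheaf.germ U x hx).hom = 1 := by
    rw [← Matrix.map_mul, hMP, Matrix.map_one _ (map_zero _) (map_one _)]
  obtain ⟨σ, hσ⟩ := exists_isUnit_det_cols hMP'
  have e : (cols σ (M.map (T.presheaf.germ U x hx).hom)).det =
      (T.presheaf.germ U x hx).hom (cols σ M).det := by
    rw [RingHom.map_det]; rfl
  rw [e] at hσ
  obtain ⟨V, hV, M', hM'⟩ := exists_isChartOn hx h hσ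
  exact ⟨σ, TopologicalSpace.Opens.mem_sSup.2 ⟨V, ⟨M', hM'⟩, hV⟩⟩

theorem chartMap_chartOpen {T : Scheme.{0}} (N : Fam n k T) (σ : Fin k → Fin n) :
    ∃ m : (chartOpen N σ).toScheme ⟶ chart σ,
      (chartMap σ).app (.op _) m = N.pull (chartOpen N σ).ι := by
  obtain ⟨M, hM⟩ := exists_isChartOn_chartOpen N σ
  have hU := (hM.pull (chartOpen N σ).ι).res
    (homOfLE (show ⊤ ≤ (chartOpen N σ).ι ⁻¹ᵁ (chartOpen N σ) by simp))
  exact ⟨_, exists_chartMap_app hU⟩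

instance isLocallySurjective_chartMap :
    Presheaf.IsLocallySurjective Scheme.zariskiTopology.{0}
      (Limits.Sigma.desc (chartMap (n := n) (k := k))) where
  imageSieve_mem {T} N := by
    let 𝓤 : T.OpenCover := T.openCoverOfIsOpenCover (chartOpen (T := T) (n := n) (k := k) N)
      (by
        rw [TopologicalSpace.IsOpenCover, eq_top_iff]
        intro x _
        obtain ⟨σ, hσ⟩ := exists_mem_chartOpen (T := T) N x
        exact TopologicalSpace.Opens.mem_iSup.2 ⟨σ, hσ⟩)
    refine GrothendieckTopology.superset_covering _ ?_ 𝓤.mem_grothendieckTopology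
    rintro V f ⟨W, a, b, ⟨σ⟩, rfl⟩
    obtain ⟨m, hm⟩ := chartMap_chartOpen (T := T) N σ
    refine Sieve.downward_closed _ ?_ a
    refine ⟨(Limits.Sigma.ι (fun σ : Fin k → Fin n => yoneda.obj (chart σ)) σ).app _ m, ?_⟩
    have := ConcreteCategory.congr_hom (NatTrans.congr_app
      (Limits.Sigma.ι_desc (chartMap (n := n) (k := k)) σ)
      (.op (chartOpen (T := T) N σ).toScheme)) m
    exact this.trans hm

/-- The Grassmannian over `ℤ`. -/
def grZ (n k : ℕ) : Scheme.{0} :=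
  (Scheme.LocalRepresentability.glueData (F := ⟨famFunctor n k, isSheaf_famFunctor⟩)
    (f := chartMap) (fun σ => isOpenImmersion_chartMap σ)).glued

/-- The Grassmannian represents families of subspaces. -/
def grZRepr (n k : ℕ) : (famFunctor n k).RepresentableBy (grZ n k) :=
  Scheme.LocalRepresentability.representableBy (F := ⟨famFunctor n k, isSheaf_famFunctor⟩)
    (f := chartMap) (fun σ => isOpenImmersion_chartMap σ)

theorem finiteType_chartRing (σ : Fin k → Fin n) : Algebra.FiniteType ℤ (ChartRing σ) :=
  Algebra.FiniteType.of_surjective (Ideal.Quotient.mkₐ ℤ _) (Ideal.Quotient.mkₐ_surjective _ _)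

/-- Checked on the charts. Finiteness is needed because the nonzerodivisor argument for the blow-ups
works with noetherian local rings. -/
theorem locallyOfFiniteType_specZ (f : grZ n k ⟶ Spec (.of ℤ)) : LocallyOfFiniteType f := by
  let 𝓤 := (Scheme.LocalRepresentability.glueData (F := ⟨famFunctor n k, isSheaf_famFunctor⟩)
    (f := chartMap) (fun σ => isOpenImmersion_chartMap σ)).openCover
  have : IsZariskiLocalAtSource @LocallyOfFiniteType.{0} := by
    apply HasRingHomProperty.instIsZariskiLocalAtSource
  refine (IsZariskiLocalAtSource.iff_of_openCover (P := @LocallyOfFiniteType.{0}) (f := f) 𝓤).2 ?_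
  intro σ
  obtain ⟨φ, hφ⟩ := Spec.map_surjective (show chart σ ⟶ Spec (.of ℤ) from
    (Scheme.LocalRepresentability.glueData (F := ⟨famFunctor n k, isSheaf_famFunctor⟩)
    (f := chartMap) (fun σ => isOpenImmersion_chartMap σ)).openCover.f σ ≫ f)
  have : LocallyOfFiniteType (Spec.map φ) := by
    rw [HasRingHomProperty.Spec_iff (P := @LocallyOfFiniteType)]
    have h := finiteType_chartRing σ
    rw [← RingHom.finiteType_algebraMap] at h
    convert! h
    exact RingHom.ext_int (R := ChartRing σ) _ _
  rw [hφ] at this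
  exact this

instance locallyOfFiniteType_grZ {S : Scheme.{0}} (f : grZ n k ⟶ S) : LocallyOfFiniteType f :=
  have := locallyOfFiniteType_specZ (f ≫ specZIsTerminal.from S)
  locallyOfFiniteType_of_comp f (specZIsTerminal.from S)

end

section

/-! ### Submodules with projective quotient are locally kernels of split matrices -/

section Algebra

variable {n k : ℕ} {R : Type} [CommRing R]

/-- The localization map on `n`-space. -/
abbrev piLoc (n : ℕ) (R S : Type) [CommRing R] [CommRing S] [Algebra R S] :
    (Fin n → R) →ₗ[R] (Fin n → S) :=
  LinearMap.pi (fun i : Fin n => (Algebra.linearMap R S) ∘ₗ LinearMap.proj i)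

theorem push_eq_localized' (S : Type) [CommRing S] [Algebra R S] (p : Submonoid R)
    [IsLocalization p S] (N : Submodule R (Fin n → R)) :
    push (algebraMap R S) N = N.localized' S p (piLoc n R S) := by
  rw [Submodule.localized'_eq_span]; rfl

/-- The quotient by the kernel of a split matrix is free. -/
def quotKerEquiv {S : Type} [CommRing S] {M : Matrix (Fin k) (Fin n) S}
    {P : Matrix (Fin n) (Fin k) S} (h : M * P = 1) {N : Submodule S (Fin n → S)}
    (hN : N = LinearMap.ker M.mulVecLin) : ((Fin n → S) ⧸ N) ≃ₗ[S] (Fin k → S) :=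
  Submodule.quotEquivOfEq _ _ hN ≪≫ₗ
  M.mulVecLin.quotKerEquivOfSurjective (fun v => ⟨P.mulVec v, by
    rw [Matrix.mulVecLin_apply, Matrix.mulVec_mulVec, h, Matrix.one_mulVec]⟩)

/-- A submodule with free quotient is the kernel of a split matrix. -/
theorem exists_matrix_of_equiv {S : Type} [CommRing S] {N : Submodule S (Fin n → S)}
    (e : ((Fin n → S) ⧸ N) ≃ₗ[S] (Fin k → S)) :
    ∃ (M : Matrix (Fin k) (Fin n) S) (P : Matrix (Fin n) (Fin k) S), M * P = 1 ∧
      N = LinearMap.ker M.mulVecLin := by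
  let g : (Fin n → S) →ₗ[S] (Fin k → S) := e.toLinearMap ∘ₗ N.mkQ
  have hg : Function.Surjective g := e.surjective.comp N.mkQ_surjective
  obtain ⟨s, hs⟩ := Module.projective_lifting_property g LinearMap.id hg
  refine ⟨LinearMap.toMatrix' g, LinearMap.toMatrix' s, ?_, ?_⟩
  · rw [← LinearMap.toMatrix'_comp, hs, LinearMap.toMatrix'_id]
  · rw [← Matrix.toLin'_apply', Matrix.toLin'_toMatrix']
    simp [g, LinearMap.ker_comp]

/-- A projective module of constant rank is free near `p`. The trivialization is asked for over
every model of the localization, so that it applies both to `Localization.Away f` and to sections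
over a basic open set. -/
theorem exists_away_equiv {Q : Type} [AddCommGroup Q] [Module R Q] [Module.Finite R Q]
    [Module.Projective R Q] (hk : ∀ p, Module.rankAtStalk (R := R) Q p = k)
    (p : Ideal R) [p.IsPrime] :
    ∃ f ∉ p, ∀ (S : Type) [CommRing S] [Algebra R S] [IsLocalization.Away f S]
      (Q' : Type) [AddCommGroup Q'] [Module R Q'] [Module S Q'] [IsScalarTower R S Q']
      (g : Q →ₗ[R] Q') [IsLocalizedModule (Submonoid.powers f) g],
      Nonempty (Q' ≃ₗ[S] (Fin k → S)) := by
  obtain ⟨f, hf, hfree⟩ := Module.Free.away_of_finite_of_flat_of_rankAtStalk_constant Q p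
    (fun m _ => by rw [hk, hk])
  refine ⟨f, hf, fun S _ _ _ Q' _ _ _ _ g _ => ?_⟩
  have hb : IsBaseChange S g := IsLocalizedModule.isBaseChange (Submonoid.powers f) S g
  have hb0 : IsBaseChange (Localization.Away f)
      (LocalizedModule.mkLinearMap (Submonoid.powers f) Q) :=
    IsLocalizedModule.isBaseChange (Submonoid.powers f) _ _
  have : Module.Free S (S ⊗[R] Q) := by
    let _ : Algebra (Localization.Away f) S :=
      (IsLocalization.lift (M := Submonoid.powers f) (g := algebraMap R S)
        (IsLocalization.map_units S)).toAlgebra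
    have : IsScalarTower R (Localization.Away f) S := IsScalarTower.of_algebraMap_eq
      (fun x => (IsLocalization.lift_eq _ x).symm)
    have : Module.Free (Localization.Away f) (Localization.Away f ⊗[R] Q) :=
      Module.Free.of_equiv hb0.equiv.symm
    exact Module.Free.of_equiv (TensorProduct.AlgebraTensorModule.cancelBaseChange R
      (Localization.Away f) S S Q)
  have : Module.Free S Q' := Module.Free.of_equiv hb.equiv
  have : Module.Finite S Q' := Module.Finite.equiv hb.equiv
  have hpR : Nontrivial R := ⟨0, 1, fun h => (Ideal.ne_top_iff_one p).1 Ideal.IsPrime.ne_top'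
    (h ▸ p.zero_mem)⟩
  -- The rank can only be read off over a nonzero ring; over the zero ring all modules are
  -- isomorphic.
  by_cases hS : Nontrivial S
  · obtain ⟨m⟩ := (inferInstance : Nonempty (PrimeSpectrum S))
    have h1 := Module.rankAtStalk_isBaseChange hb m
    rw [hk, Module.rankAtStalk_eq_finrank_of_free] at h1
    simp only [Pi.natCast_def, Nat.cast_id] at h1
    exact ⟨(Module.finBasisOfFinrankEq S Q' h1).equivFun⟩
  · have : Subsingleton S := not_nontrivial_iff_subsingleton.1 hS
    have : Subsingleton Q' := Module.subsingleton S Q'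
    have : Subsingleton (Fin k → S) := Module.subsingleton S _
    exact ⟨LinearEquiv.ofSubsingleton _ _⟩

theorem exists_away_matrix (N : Module.Grassmannian R (Fin n → R) k) (p : Ideal R) [p.IsPrime] :
    ∃ f ∉ p, ∀ (S : Type) [CommRing S] [Algebra R S] [IsLocalization.Away f S],
      ∃ (M : Matrix (Fin k) (Fin n) S) (P : Matrix (Fin n) (Fin k) S), M * P = 1 ∧
      push (algebraMap R S) N.toSubmodule = LinearMap.ker M.mulVecLin := by
  obtain ⟨f, hf, h⟩ := exists_away_equiv N.rankAtStalk_eq p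
  refine ⟨f, hf, fun S _ _ _ => ?_⟩
  rw [push_eq_localized' S (Submonoid.powers f)]
  obtain ⟨e⟩ := h S _ (N.toSubmodule.toLocalizedQuotient' S (Submonoid.powers f) (piLoc n R S))
  exact exists_matrix_of_equiv e

/-- Finite presentation and flatness of the quotient descend from a cover by localizations, and
together they give projectivity. The rank at a prime is computed after lifting the prime to one of
the localizations. -/
theorem grassmannian_of_away_matrix (N : Submodule R (Fin n → R)) (t : Set R)
    (ht : Ideal.span t = ⊤)
    (h : ∀ f ∈ t, ∃ (M : Matrix (Fin k) (Fin n) (Localization.Away f))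
      (P : Matrix (Fin n) (Fin k) (Localization.Away f)), M * P = 1 ∧
      push (algebraMap R (Localization.Away f)) N = LinearMap.ker M.mulVecLin) :
    ∃ N' : Module.Grassmannian R (Fin n → R) k, N'.toSubmodule = N := by
  let g (f : t) := N.toLocalizedQuotient' (Localization.Away f.1) (Submonoid.powers f.1)
    (piLoc n R (Localization.Away f.1))
  have e (f : t) : Nonempty (((Fin n → Localization.Away f.1) ⧸ N.localized'
      (Localization.Away f.1) (Submonoid.powers f.1) (piLoc n R (Localization.Away f.1)))
      ≃ₗ[Localization.Away f.1] (Fin k → Localization.Away f.1)) := by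
    obtain ⟨M, P, hMP, hN⟩ := h f.1 f.2
    rw [push_eq_localized' _ (Submonoid.powers f.1)] at hN
    exact ⟨quotKerEquiv hMP hN⟩
  have hfp : Module.FinitePresentation R ((Fin n → R) ⧸ N) :=
    Module.FinitePresentation.of_localizationSpan' t ht g
      (fun f => Module.FinitePresentation.of_equiv (e f).some.symm)
  have hfl : Module.Flat R ((Fin n → R) ⧸ N) := by
    refine Module.flat_of_isLocalized_span R _ t ht _ g fun f => ?_
    have : Module.Flat (Localization.Away f.1) ((Fin n → Localization.Away f.1) ⧸ N.localized'
      (Localization.Away f.1) (Submonoid.powers f.1) (piLoc n R (Localization.Away f.1))) :=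
      Module.Flat.of_linearEquiv (e f).some
    exact Module.Flat.trans R (Localization.Away f.1) _
  have hpr : Module.Projective R ((Fin n → R) ⧸ N) := Module.Flat.projective_of_finitePresentation
  refine ⟨⟨N, inferInstance, hpr, fun p => ?_⟩, rfl⟩
  obtain ⟨f, hft, hfp⟩ : ∃ f ∈ t, f ∉ p.asIdeal := by
    by_contra! hc
    exact p.2.ne_top (top_le_iff.1 (ht ▸ Ideal.span_le.2 hc))
  obtain ⟨q, rfl⟩ : p ∈ Set.range (PrimeSpectrum.comap
      (algebraMap R (Localization.Away f))) := by
    rw [PrimeSpectrum.localization_away_comap_range (Localization.Away f) f]; exact hfp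
  have hb : IsBaseChange (Localization.Away f) (g ⟨f, hft⟩) :=
    IsLocalizedModule.isBaseChange (Submonoid.powers f) _ _
  rw [← Module.rankAtStalk_isBaseChange hb, Module.rankAtStalk_eq_of_equiv (e ⟨f, hft⟩).some]
  have : Nontrivial (Localization.Away f) := ⟨0, 1, fun h => (Ideal.ne_top_iff_one q.asIdeal).1
    q.2.ne_top' (h ▸ q.asIdeal.zero_mem)⟩
  rw [Module.rankAtStalk_eq_finrank_of_free]
  simp

end Algebra

end

section

/-! ### Families over an affine scheme -/

/-- The map of quotients is a surjection between projective modules of the same rank, hence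
bijective. Thanks to this, equality of families is reduced to one inclusion throughout. -/
theorem Grassmannian.eq_of_le {R : Type*} [CommRing R] {M : Type*} [AddCommGroup M] [Module R M]
    {k : ℕ} {N N' : Module.Grassmannian R M k} (h : N.toSubmodule ≤ N'.toSubmodule) : N = N' := by
  refine Module.Grassmannian.ext (le_antisymm h ?_)
  have hb := Module.bijective_of_surjective_of_rankAtStalk_eq
    (φ := Submodule.factor h) (Submodule.factor_surjective h)
    (fun m _ => by rw [N.rankAtStalk_eq, N'.rankAtStalk_eq])
  intro x hx
  rw [← Submodule.Quotient.mk_eq_zero]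
  apply hb.1
  simpa using hx

variable {n k : ℕ}

/-- The basic open subset of `Spec R`. -/
def bOpen {R : CommRingCat.{0}} (f : R) : (Spec R).Opens := PrimeSpectrum.basicOpen f

instance {R : CommRingCat.{0}} (f : R) : IsLocalization.Away f Γ(Spec R, bOpen f) :=
  StructureSheaf.IsLocalization.to_basicOpen R f

theorem exists_mem_bOpen {R : CommRingCat.{0}} {t : Set R} (ht : Ideal.span t = ⊤) (x : Spec R) :
    ∃ f ∈ t, x ∈ bOpen f := by
  by_contra! hcon
  exact (show PrimeSpectrum R from x).2.ne_top
    (top_le_iff.1 (ht ▸ Ideal.span_le.2 fun f hf => not_not.1 (hcon f hf)))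

/-- The map from a ring to a stalk of its spectrum. -/
abbrev toSt (R : CommRingCat.{0}) (x : Spec R) : R →+* (Spec R).presheaf.stalk x :=
  ((Scheme.ΓSpecIso R).inv ≫ (Spec R).presheaf.germ ⊤ x trivial).hom

theorem germ_algebraMap {R : CommRingCat.{0}} (U : (Spec R).Opens) (x : Spec R) (hx : x ∈ U) :
    ((Spec R).presheaf.germ U x hx).hom.comp (algebraMap R Γ(Spec R, U)) = toSt R x := by
  rw [IsAffineOpen.algebraMap_Spec_obj, ← CommRingCat.hom_comp, Category.assoc, TopCat.Presheaf.germ_res]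

theorem stalkMap_toSt {R S : CommRingCat.{0}} (φ : R ⟶ S) (x : Spec S) :
    ((Spec.map φ).stalkMap x).hom.comp (toSt R (Spec.map φ x)) = (toSt S x).comp φ.hom := by
  have h : (Spec R).presheaf.germ ⊤ (Spec.map φ x) trivial ≫ (Spec.map φ).stalkMap x =
      (Spec.map φ).app ⊤ ≫ (Spec S).presheaf.germ ⊤ x trivial :=
    Scheme.Hom.germ_stalkMap (Spec.map φ) ⊤ x trivial
  have hcomp : ((Scheme.ΓSpecIso R).inv ≫ (Spec R).presheaf.germ ⊤ (Spec.map φ x) trivial) ≫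
      (Spec.map φ).stalkMap x =
      φ ≫ (Scheme.ΓSpecIso S).inv ≫ (Spec S).presheaf.germ ⊤ x trivial := by
    refine (Category.assoc _ _ _).trans ((congrArg (_ ≫ ·) h).trans ?_)
    exact (Scheme.ΓSpecIso_inv_naturality_assoc φ _).symm
  exact congrArg (fun g => g.hom) hcomp

/-- The family over `Spec R` given by a submodule with projective quotient. -/
def grFam {R : CommRingCat.{0}} (N : Module.Grassmannian R (Fin n → R) k) : Fam n k (Spec R) := by
  refine ⟨fun x => push (toSt R x) N.toSubmodule, fun x => ?_⟩
  obtain ⟨f, hf, h⟩ := @exists_away_matrix _ _ _ _ N (PrimeSpectrum.asIdeal (R := R) x)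
    (PrimeSpectrum.isPrime (R := R) x)
  obtain ⟨M, P, hMP, hM⟩ := h Γ(Spec R, bOpen f)
  refine ⟨bOpen f, hf, M, P, hMP, fun y hy => ?_⟩
  dsimp only
  rw [← germ_algebraMap _ y hy, ← push_push, hM, push_ker _ hMP]

theorem grFam_pull {R S : CommRingCat.{0}} (φ : R ⟶ S) (N : Module.Grassmannian R (Fin n → R) k)
    (N' : Module.Grassmannian S (Fin n → S) k) (h : N'.toSubmodule = push φ.hom N.toSubmodule) :
    (grFam N).pull (Spec.map φ) = grFam N' := by
  refine Fam.ext (funext fun x => ?_)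
  change push _ (push _ _) = push _ _
  rw [h, push_push, push_push, stalkMap_toSt]

theorem Fam.exists_cover {R : CommRingCat.{0}} (F : Fam n k (Spec R)) :
    ∃ t : Finset R, Ideal.span (t : Set R) = ⊤ ∧ ∀ f ∈ t,
      ∃ (M : Matrix (Fin k) (Fin n) Γ(Spec R, bOpen f))
      (P : Matrix (Fin n) (Fin k) Γ(Spec R, bOpen f)), M * P = 1 ∧
      ∀ (y : Spec R) (hy : y ∈ bOpen f),
        F.at' y = LinearMap.ker (M.map ((Spec R).presheaf.germ _ y hy).hom).mulVecLin := by
  let t : Set R := {f | ∃ (M : Matrix (Fin k) (Fin n) Γ(Spec R, bOpen f))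
      (P : Matrix (Fin n) (Fin k) Γ(Spec R, bOpen f)), M * P = 1 ∧
      ∀ (y : Spec R) (hy : y ∈ bOpen f),
        F.at' y = LinearMap.ker (M.map ((Spec R).presheaf.germ _ y hy).hom).mulVecLin}
  have ht : Ideal.span t = ⊤ := by
    by_contra hc
    obtain ⟨m, hm, hle⟩ := Ideal.exists_le_maximal _ hc
    let x : Spec R := (⟨m, hm.isPrime⟩ : PrimeSpectrum R)
    obtain ⟨U, hx, M, P, hMP, h⟩ := F.isLocKer x
    obtain ⟨f, hxf, hfU⟩ : ∃ f : R, x ∈ bOpen f ∧ bOpen f ≤ U := by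
      obtain ⟨_, ⟨_, ⟨f, rfl⟩, rfl⟩, hxf, hfU⟩ :=
        PrimeSpectrum.isBasis_basic_opens.exists_subset_of_mem_open hx U.2
      exact ⟨f, hxf, hfU⟩
    refine hxf (hle (Ideal.subset_span ?_))
    let r := (Spec R).presheaf.map (homOfLE hfU).op
    refine ⟨M.map r.hom, P.map r.hom, ?_, fun y hy => ?_⟩
    · rw [← Matrix.map_mul, hMP, Matrix.map_one _ (map_zero _) (map_one _)]
    · rw [h y (hfU hy), Matrix.map_map]
      congr 3
      exact congrArg (fun g => (g.hom : _ → _)) ((Spec R).presheaf.germ_res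
        (homOfLE hfU) y hy).symm
  obtain ⟨t', htt, ht'⟩ := (Ideal.span_eq_top_iff_finite t).1 ht
  exact ⟨t', ht', fun f hf => htt hf⟩

/-- The global submodule of a family over an affine scheme. -/
def Fam.glob {R : CommRingCat.{0}} (F : Fam n k (Spec R)) : Submodule R (Fin n → R) where
  carrier := {v | ∀ x, toSt R x ∘ v ∈ F.at' x}
  zero_mem' x := by
    convert! (F.at' x).zero_mem
    ext; simp
  add_mem' {v w} hv hw x := by
    convert! (F.at' x).add_mem (hv x) (hw x)
    ext; simp
  smul_mem' a v hv x := by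
    convert! (F.at' x).smul_mem (toSt R x a) (hv x)
    ext; simp

theorem exists_pow_mul_eq_zero_of_germ {R : CommRingCat.{0}} {f g : R}
    (c : Γ(Spec R, bOpen g))
    (h : ∀ (y : Spec R) (hy : y ∈ bOpen g), y ∈ bOpen f →
      (Spec R).presheaf.germ _ y hy c = 0) :
    ∃ r : ℕ, algebraMap R _ f ^ r * c = 0 := by
  have haff : IsAffineOpen (X := Spec R) (bOpen g) :=
    IsAffineOpen.Spec_basicOpen g
  refine exists_pow_mul_eq_zero_of_res_basicOpen_eq_zero_of_isCompact (Spec R) haff.isCompact c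
    (algebraMap R _ f) ?_
  refine TopCat.Presheaf.section_ext (Spec R).sheaf _ _ _ fun y hy => ?_
  have hyg : y ∈ bOpen g := (Spec R).basicOpen_le _ hy
  have hyf : y ∈ bOpen f := by
    have h1 := ((Spec R).mem_basicOpen _ y hyg).1 hy
    have h2 : (Spec R).presheaf.germ _ y hyg (algebraMap R Γ(Spec R, bOpen g) f)
      = toSt R y f := DFunLike.congr_fun (germ_algebraMap _ y hyg) f
    rw [h2] at h1
    have h3 : y ∈ (Spec R).basicOpen ((Scheme.ΓSpecIso R).inv f) :=
      ((Spec R).mem_basicOpen ((Scheme.ΓSpecIso R).inv f) y trivial).2 h1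
    rw [basicOpen_eq_of_affine' ] at h3
    have h4 : y ∈ bOpen ((Scheme.ΓSpecIso R).hom ((Scheme.ΓSpecIso R).inv f)) := h3
    rwa [← CommRingCat.comp_apply, Iso.inv_hom_id, CommRingCat.id_apply] at h4
  have := h y hyg hyf
  rw [← TopCat.Presheaf.germ_res_apply (Spec R).presheaf (homOfLE ((Spec R).basicOpen_le _)) y hy]
    at this
  exact this.trans (map_zero ((Spec R).presheaf.germ _ y hy).hom).symm

/-- The global submodule localizes correctly, as for quasi-coherent sheaves: a vector `w` over the
basic open set of `f` is multiplied by a power of `f` to come from `R`, and by a further power to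
satisfy the local equations on each member of the finite cover `t`. -/
theorem Fam.push_glob {R : CommRingCat.{0}} (F : Fam n k (Spec R)) (t : Finset R)
    (ht : Ideal.span (t : Set R) = ⊤)
    (M : ∀ f ∈ t, Matrix (Fin k) (Fin n) Γ(Spec R, bOpen f))
    (h : ∀ f (hf : f ∈ t) (y : Spec R) (hy : y ∈ bOpen f),
      F.at' y = LinearMap.ker ((M f hf).map ((Spec R).presheaf.germ _ y hy).hom).mulVecLin)
    (f : R) (hf : f ∈ t) :
    push (algebraMap R Γ(Spec R, bOpen f)) F.glob =
      LinearMap.ker (M f hf).mulVecLin := by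
  refine le_antisymm ((push_le_iff _).2 fun v hv => ?_) fun w hw => ?_
  · rw [LinearMap.mem_ker, Matrix.mulVecLin_apply]
    ext i
    refine TopCat.Presheaf.section_ext (Spec R).sheaf _ _ _ fun y hy => ?_
    have h1 := hv y
    rw [h f hf y hy, LinearMap.mem_ker, Matrix.mulVecLin_apply, ← germ_algebraMap _ y hy,
      RingHom.coe_comp, Function.comp_assoc, map_mulVec_comp] at h1
    exact (congrFun h1 i).trans (map_zero ((Spec R).presheaf.germ _ y hy).hom).symm
  · obtain ⟨⟨u, ⟨_, m, rfl⟩⟩, hu⟩ := IsLocalizedModule.surj (Submonoid.powers f)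
      (piLoc n R Γ(Spec R, bOpen f)) w
    dsimp only at hu
    have hc (g : R) (hg : g ∈ t) (i : Fin k) : ∃ r : ℕ,
        algebraMap R _ f ^ r * (M g hg).mulVec (algebraMap R _ ∘ u) i = 0 := by
      refine exists_pow_mul_eq_zero_of_germ _ fun y hyg hyf => ?_
      have h2 : toSt R y ∘ u ∈ F.at' y := by
        rw [h f hf y hyf, LinearMap.mem_ker, Matrix.mulVecLin_apply, ← germ_algebraMap _ y hyf,
          RingHom.coe_comp, Function.comp_assoc, map_mulVec_comp]
        have h3 : algebraMap R Γ(Spec R, bOpen f) ∘ u = f ^ m • w := hu.symm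
        rw [LinearMap.mem_ker, Matrix.mulVecLin_apply] at hw
        rw [h3, Matrix.mulVec_smul, hw, smul_zero]
        ext; simp
      rw [h g hg y hyg, LinearMap.mem_ker, Matrix.mulVecLin_apply, ← germ_algebraMap _ y hyg,
          RingHom.coe_comp, Function.comp_assoc, map_mulVec_comp] at h2
      exact congrFun h2 i
    choose! r hr using hc
    -- One exponent serving all of the finitely many equations on all of the finitely many basic
    -- open sets.
    let r₀ := t.attach.sup fun g => Finset.univ.sup (r g)
    have hN : f ^ r₀ • u ∈ F.glob := by
      intro y
      obtain ⟨g, hg, hgy⟩ := exists_mem_bOpen ht y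
      rw [h g hg y hgy, LinearMap.mem_ker, Matrix.mulVecLin_apply, ← germ_algebraMap _ y hgy,
          RingHom.coe_comp, Function.comp_assoc, map_mulVec_comp]
      have : (M g hg).mulVec (algebraMap R _ ∘ (f ^ r₀ • u)) = 0 := by
        have e1 : algebraMap R Γ(Spec R, bOpen g) ∘ (f ^ r₀ • u) =
            algebraMap R Γ(Spec R, bOpen g) f ^ r₀ • (algebraMap R _ ∘ u) := by
          ext; simp
        rw [e1, Matrix.mulVec_smul]
        ext i
        rw [Pi.smul_apply, smul_eq_mul, Pi.zero_apply]
        have hle : r g i ≤ r₀ := (Finset.le_sup (f := r g) (Finset.mem_univ i)).trans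
          (Finset.le_sup (f := fun g : t => Finset.univ.sup (r g)) (Finset.mem_attach t ⟨g, hg⟩))
        rw [← Nat.sub_add_cancel hle, pow_add, mul_assoc, hr g hg i, mul_zero]
      rw [this]; ext; simp
    have h5 := mem_push (algebraMap R Γ(Spec R, bOpen f)) hN
    have h6 : algebraMap R Γ(Spec R, bOpen f) ∘ (f ^ r₀ • u) =
        algebraMap R Γ(Spec R, bOpen f) (f ^ (r₀ + m)) • w := by
      have h3 : algebraMap R Γ(Spec R, bOpen f) ∘ u = f ^ m • w := hu.symm
      have e1 : algebraMap R Γ(Spec R, bOpen f) ∘ (f ^ r₀ • u) =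
            f ^ r₀ • (algebraMap R Γ(Spec R, bOpen f) ∘ u) := by
        ext; simp [Algebra.smul_def]
      rw [e1, h3, smul_smul, ← pow_add, algebraMap_smul]
    rw [h6] at h5
    have hun : IsUnit (algebraMap R Γ(Spec R, bOpen f) (f ^ (r₀ + m))) :=
      IsLocalization.map_units (M := Submonoid.powers f) _ ⟨_, _, rfl⟩
    exact (Submodule.smul_mem_iff_of_isUnit _ hun).1 h5

theorem Fam.exists_grassmannian {R : CommRingCat.{0}} (F : Fam n k (Spec R)) :
    ∃ N : Module.Grassmannian R (Fin n → R) k, N.toSubmodule = F.glob ∧ grFam N = F := by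
  obtain ⟨t, ht, h⟩ := F.exists_cover
  choose M P hMP hM using h
  have hp := F.push_glob t ht M hM
  obtain ⟨N, hN⟩ := grassmannian_of_away_matrix F.glob t ht (k := k) (fun f hf => by
    let e := (IsLocalization.algEquiv (Submonoid.powers f) Γ(Spec R, bOpen f)
      (Localization.Away f)).toAlgHom.toRingHom
    refine ⟨(M f hf).map e, (P f hf).map e, ?_, ?_⟩
    · rw [← Matrix.map_mul, hMP, Matrix.map_one _ (map_zero _) (map_one _)]
    · rw [← push_ker _ (hMP f hf), ← hp f hf, push_push]
      congr 1
      exact ((IsLocalization.algEquiv (Submonoid.powers f) Γ(Spec R, bOpen f)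
        (Localization.Away f)).toAlgHom.comp_algebraMap).symm)
  refine ⟨N, hN, Fam.ext (funext fun x => ?_)⟩
  change push (toSt R x) N.toSubmodule = _
  obtain ⟨g, hg, hgy⟩ := exists_mem_bOpen ht x
  rw [hN, ← germ_algebraMap _ x hgy, ← push_push, hp g hg, push_ker _ (hMP g hg), hM g hg x hgy]

/-- Families over an affine scheme are submodules with projective quotient. -/
def grFamEquiv (R : CommRingCat.{0}) : Module.Grassmannian R (Fin n → R) k ≃ Fam n k (Spec R) :=
  Equiv.ofBijective grFam ⟨fun N N' h => by
    -- Both submodules lie in the global submodule of the common family, which has the same corank,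
    -- so both are equal to it.
    obtain ⟨N₁, hN₁, -⟩ := (grFam N).exists_grassmannian
    have h1 : N = N₁ := Grassmannian.eq_of_le (by
      rw [hN₁]; exact fun v hv x => mem_push _ hv)
    have h2 : N' = N₁ := Grassmannian.eq_of_le (by
      rw [hN₁, h]; exact fun v hv x => mem_push _ hv)
    rw [h1, h2], fun F => ⟨_, F.exists_grassmannian.choose_spec.2⟩⟩

end

section

/-! ### The Grassmannian of a complex vector space -/

section BaseChange

variable {W : Type} [AddCommGroup W] [Module ℂ W] {k : ℕ}
variable {A B C : Type} [CommRing A] [Algebra ℂ A] [CommRing B] [Algebra ℂ B] [CommRing C]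
  [Algebra ℂ C]

/-- Change of scalars on vectors. -/
def bc (f : A →ₐ[ℂ] B) : A ⊗[ℂ] W →ₗ[ℂ] B ⊗[ℂ] W := LinearMap.rTensor W f.toLinearMap

@[simp] theorem bc_tmul (f : A →ₐ[ℂ] B) (a : A) (w : W) : bc f (a ⊗ₜ[ℂ] w) = f a ⊗ₜ w := rfl

theorem bc_smul (f : A →ₐ[ℂ] B) (a : A) (v : A ⊗[ℂ] W) : bc f (a • v) = f a • bc f v := by
  induction v with
  | zero => simp
  | tmul x w => simp [TensorProduct.smul_tmul']
  | add x y hx hy => rw [smul_add, map_add, hx, hy, map_add, smul_add]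

theorem bc_bc (f : A →ₐ[ℂ] B) (g : B →ₐ[ℂ] C) (v : A ⊗[ℂ] W) :
    bc g (bc f v) = bc (g.comp f) v := by
  induction v with
  | zero => simp
  | tmul x w => simp
  | add x y hx hy => simp only [map_add, hx, hy]

theorem exists_lTensor_subtype {R M : Type*} [CommRing R] [AddCommGroup M] [Module R M]
    (S : Type*) [AddCommGroup S] [Module R S] (N : Submodule R M) {y : S ⊗[R] M}
    (h : LinearMap.lTensor S N.mkQ y = 0) : ∃ z, LinearMap.lTensor S N.subtype z = y :=
  (lTensor_exact S (LinearMap.exact_subtype_mkQ N) N.mkQ_surjective y).1 h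

/-- The base change in the Grassmannian is the kernel of the map to the base changed quotient; by
right exactness of the tensor product this kernel is generated by the image of the submodule. Later
arguments use only the description by generators. -/
theorem map_toSubmodule_eq_span (f : A →ₐ[ℂ] B) (N : Module.Grassmannian A (A ⊗[ℂ] W) k) :
    (Module.Grassmannian.map f N).toSubmodule = Submodule.span B (bc f '' N.toSubmodule) := by
  let _ : Algebra A B := f.toAlgebra
  let _ : IsScalarTower ℂ A B := IsScalarTower.of_algebraMap_eq' (IsScalarTower.algebraMap_eq ℂ A B)
  rw [Module.Grassmannian.map_toSubmodule]
  have hc (b : B) (v : A ⊗[ℂ] W) :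
      TensorProduct.AlgebraTensorModule.cancelBaseChange ℂ A B B W (b ⊗ₜ v) = b • bc f v := by
    induction v with
    | zero => simp
    | tmul x w => simp [TensorProduct.smul_tmul', Algebra.smul_def, mul_comm]; rfl
    | add x y hx hy => rw [TensorProduct.tmul_add, map_add, hx, hy, map_add, smul_add]
  refine le_antisymm (fun x hx => ?_) (Submodule.span_le.2 ?_)
  · obtain ⟨y, rfl⟩ := (TensorProduct.AlgebraTensorModule.cancelBaseChange ℂ A B B W).surjective x
    have hx' : LinearMap.lTensor B N.toSubmodule.mkQ y = 0 := by
      have := LinearMap.mem_ker.1 hx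
      exact (congrArg (LinearMap.lTensor B N.toSubmodule.mkQ)
        (LinearEquiv.symm_apply_apply
          (TensorProduct.AlgebraTensorModule.cancelBaseChange ℂ A B B W) y)).symm.trans this
    obtain ⟨z, rfl⟩ := exists_lTensor_subtype B N.toSubmodule hx'
    clear hx hx'
    induction z with
    | zero => simp
    | tmul b v =>
      rw [LinearMap.lTensor_tmul, hc]
      exact Submodule.smul_mem _ _ (Submodule.subset_span ⟨_, v.2, rfl⟩)
    | add x y hx hy => rw [map_add, map_add]; exact Submodule.add_mem _ hx hy
  · rintro _ ⟨v, hv, rfl⟩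
    have h1 : bc f v = TensorProduct.AlgebraTensorModule.cancelBaseChange ℂ A B B W (1 ⊗ₜ v) := by
      rw [hc, one_smul]
    rw [SetLike.mem_coe, LinearMap.mem_ker, h1]
    simp only [Module.Grassmannian.baseChangeMkQ, LinearMap.comp_apply, LinearEquiv.coe_coe,
      LinearEquiv.symm_apply_apply, LinearMap.baseChange_tmul]
    rw [Submodule.mkQ_apply, (Submodule.Quotient.mk_eq_zero _).2 hv, TensorProduct.tmul_zero]

theorem bc_mem_map (f : A →ₐ[ℂ] B) (N : Module.Grassmannian A (A ⊗[ℂ] W) k) {v : A ⊗[ℂ] W}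
    (hv : v ∈ N.toSubmodule) : bc f v ∈ (Module.Grassmannian.map f N).toSubmodule := by
  rw [map_toSubmodule_eq_span]
  exact Submodule.subset_span ⟨v, hv, rfl⟩

end BaseChange

/-- Transport of the Grassmannian along a linear equivalence. -/
def Grassmannian.congr {A M M' : Type*} [CommRing A] [AddCommGroup M] [Module A M]
    [AddCommGroup M'] [Module A M'] {k : ℕ} (e : M ≃ₗ[A] M') :
    Module.Grassmannian A M k ≃ Module.Grassmannian A M' k where
  toFun N :=
    have q := Submodule.Quotient.equiv N.toSubmodule (N.toSubmodule.map e.toLinearMap) e rfl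
    { toSubmodule := N.toSubmodule.map e.toLinearMap
      finite_quotient := Module.Finite.equiv q
      projective_quotient := Module.Projective.of_equiv q
      rankAtStalk_eq := fun p => by
        rw [← Module.rankAtStalk_eq_of_equiv q]; exact N.rankAtStalk_eq p }
  invFun N :=
    have q := Submodule.Quotient.equiv N.toSubmodule (N.toSubmodule.map e.symm.toLinearMap)
      e.symm rfl
    { toSubmodule := N.toSubmodule.map e.symm.toLinearMap
      finite_quotient := Module.Finite.equiv q
      projective_quotient := Module.Projective.of_equiv q
      rankAtStalk_eq := fun p => by
        rw [← Module.rankAtStalk_eq_of_equiv q]; exact N.rankAtStalk_eq p }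
  left_inv N := Module.Grassmannian.ext (by
    change (N.toSubmodule.map e.toLinearMap).map e.symm.toLinearMap = _
    rw [← Submodule.map_comp]; simp)
  right_inv N := Module.Grassmannian.ext (by
    change (N.toSubmodule.map e.symm.toLinearMap).map e.toLinearMap = _
    rw [← Submodule.map_comp]; simp)

section

variable {W : Type} [AddCommGroup W] [Module ℂ W] {n k : ℕ} (b : Module.Basis (Fin n) ℂ W)

/-- Coordinates on `A ⊗ W`. -/
abbrev coords (A : Type) [CommRing A] [Algebra ℂ A] : A ⊗[ℂ] W ≃ₗ[A] (Fin n → A) :=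
  (b.baseChange A).equivFun

theorem coords_bc {A B : Type} [CommRing A] [Algebra ℂ A] [CommRing B] [Algebra ℂ B]
    (f : A →ₐ[ℂ] B) (v : A ⊗[ℂ] W) : coords b B (bc f v) = f ∘ coords b A v := by
  induction v with
  | zero => ext; simp
  | tmul x w => ext; simp [Module.Basis.baseChange, Algebra.smul_def]
  | add x y hx hy => rw [map_add, map_add, hx, hy, map_add]; ext; simp

theorem coords_map {A B : Type} [CommRing A] [Algebra ℂ A] [CommRing B] [Algebra ℂ B]
    (f : A →ₐ[ℂ] B) (N : Module.Grassmannian A (A ⊗[ℂ] W) k) :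
    (Grassmannian.congr (coords b B) (Module.Grassmannian.map f N)).toSubmodule =
      push f.toRingHom (Grassmannian.congr (coords b A) N).toSubmodule := by
  change (Module.Grassmannian.map f N).toSubmodule.map (coords b B).toLinearMap =
    push f.toRingHom (N.toSubmodule.map (coords b A).toLinearMap)
  rw [map_toSubmodule_eq_span, Submodule.map_span, push]
  congr 1
  ext v
  constructor
  · rintro ⟨_, ⟨w, hw, rfl⟩, rfl⟩
    exact ⟨_, ⟨w, hw, rfl⟩, (coords_bc b f w).symm⟩
  · rintro ⟨_, ⟨w, hw, rfl⟩, rfl⟩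
    exact ⟨_, ⟨w, hw, rfl⟩, coords_bc b f w⟩

/-- The Grassmannian over the complex numbers. -/
def grC (n k : ℕ) : Over (Spec (.of ℂ)) :=
  Over.mk (Limits.pullback.snd (Limits.terminal.from (grZ n k))
    (Limits.terminal.from (Spec (.of ℂ))))

instance : LocallyOfFiniteType (grC n k).hom := by
  dsimp [grC]; infer_instance

/-- Points of the complex Grassmannian. -/
def grCPoints (T : Over (Spec (.of ℂ))) : (T ⟶ grC n k) ≃ (T.left ⟶ grZ n k) where
  toFun x := x.left ≫ Limits.pullback.fst _ _
  invFun m := Over.homMk (Limits.pullback.lift m T.hom (Subsingleton.elim _ _))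
    (Limits.pullback.lift_snd _ _ _)
  left_inv x := by
    ext : 1
    refine Limits.pullback.hom_ext ?_ ?_
    · exact Limits.pullback.lift_fst _ _ _
    · exact (Limits.pullback.lift_snd _ _ _).trans (Over.w x).symm
  right_inv m := Limits.pullback.lift_fst _ _ _

/-- The complex Grassmannian represents families of subspaces. -/
def grCRepresents : Represents (grC n k) (grassmannian W k) where
  points A := (grCPoints (specOver A)).trans (((grZRepr n k).homEquiv
      (X := Spec (.of A))).trans ((grFamEquiv (.of A)).symm.trans
      ((Grassmannian.congr (coords b A)).symm.trans (Equiv.Set.univ _).symm)))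
  natural {A B} f x := by
    have h1 : grCPoints _ (specOverMap f ≫ x) =
      Spec.map (CommRingCat.ofHom f.hom.toRingHom) ≫ grCPoints _ x := by
      rw [grCPoints]; simp; rfl
    change (Grassmannian.congr (coords b B)).symm ((grFamEquiv (.of B)).symm ((grZRepr n k).homEquiv
      (X := Spec (.of B)) (grCPoints (specOver B) (specOverMap f ≫ x)))) =
      Module.Grassmannian.map f.hom ((Grassmannian.congr (coords b A)).symm
        ((grFamEquiv (.of A)).symm ((grZRepr n k).homEquiv
      (X := Spec (.of A)) (grCPoints (specOver A) x))))
    rw [h1]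
    have h2 := (grZRepr n k).homEquiv_comp (Spec.map (CommRingCat.ofHom f.hom.toRingHom))
      (show Spec (.of A) ⟶ grZ n k from grCPoints _ x)
    refine (Equiv.symm_apply_eq _).2 ((Equiv.symm_apply_eq _).2 (h2.trans ?_))
    generalize hF : (grZRepr n k).homEquiv
      (X := Spec (.of A)) (grCPoints (specOver A) x) = F
    obtain ⟨N, rfl⟩ := (grFamEquiv (.of A)).surjective F
    rw [Equiv.symm_apply_apply]
    refine grFam_pull _ N _ ?_
    rw [coords_map, Equiv.apply_symm_apply]
    rfl

end

end

section

/-! ### Pullbacks of ideal sheaves to affine schemes -/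

variable {X T : Scheme.{0}}

/-- The ideal of the pullback of an ideal sheaf to an affine scheme. -/
def cut (I : X.IdealSheafData) {A : CommRingCat.{0}} (x : Spec A ⟶ X) : Ideal A :=
  ((I.comap x).ideal ⟨⊤, isAffineOpen_top _⟩).comap (Scheme.ΓSpecIso A).inv.hom

theorem comap_inv_eq_map_hom {R S : CommRingCat.{0}} (e : R ≅ S) (J : Ideal R) :
    J.comap e.inv.hom = J.map e.hom.hom := by
  have := Ideal.comap_symm (I := J) e.commRingCatIsoToRingEquiv
  exact this

theorem map_hom_injective {R S : CommRingCat.{0}} (e : R ≅ S) {J J' : Ideal R}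
    (h : J.comap e.inv.hom = J'.comap e.inv.hom) : J = J' := by
  have := congrArg (Ideal.comap e.hom.hom) h
  rwa [Ideal.comap_comap, Ideal.comap_comap, ← CommRingCat.hom_comp, Iso.hom_inv_id,
    CommRingCat.hom_id, Ideal.comap_id, Ideal.comap_id] at this

theorem cut_eq_bot_iff (I : X.IdealSheafData) {A : CommRingCat.{0}} (x : Spec A ⟶ X) :
    cut I x = ⊥ ↔ I.comap x = ⊥ := by
  constructor
  · intro h
    refine Scheme.IdealSheafData.ext_of_isAffine (map_hom_injective (Scheme.ΓSpecIso A) ?_)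
    refine h.trans ?_
    rw [Scheme.IdealSheafData.ideal_bot, comap_inv_eq_map_hom]
    exact Ideal.map_bot.symm
  · intro h
    rw [cut, h, Scheme.IdealSheafData.ideal_bot, comap_inv_eq_map_hom]
    exact Ideal.map_bot

/-- Adjunction between pullback and pushforward of ideal sheaves, the pushforward of zero along
`Spec φ` being the kernel of `φ`. It characterizes the ideal `cut I x` by the points of the closed
subscheme. -/
theorem cut_comp_eq_bot_iff (I : X.IdealSheafData) {A B : CommRingCat.{0}} (x : Spec A ⟶ X)
    (φ : A ⟶ B) : cut I (Spec.map φ ≫ x) = ⊥ ↔ cut I x ≤ RingHom.ker φ.hom := by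
  rw [cut_eq_bot_iff, Scheme.IdealSheafData.comap_comp, ← le_bot_iff,
    ← Scheme.IdealSheafData.le_map_iff_comap_le, Scheme.IdealSheafData.map_bot]
  have hk : ((Spec.map φ).ker.ideal ⟨⊤, isAffineOpen_top _⟩).comap (Scheme.ΓSpecIso A).inv.hom =
      RingHom.ker φ.hom := by
    rw [Scheme.Hom.ker_apply, RingHom.comap_ker, ← CommRingCat.hom_comp]
    have h2 : (Scheme.ΓSpecIso A).inv ≫ (Spec.map φ).appTop = φ ≫ (Scheme.ΓSpecIso B).inv :=
      (Scheme.ΓSpecIso_inv_naturality φ).symm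
    refine (congrArg (fun g => RingHom.ker g.hom) h2).trans ?_
    rw [CommRingCat.hom_comp, ← RingHom.comap_ker]
    have : RingHom.ker (Scheme.ΓSpecIso B).inv.hom = ⊥ :=
      RingHom.ker_coe_equiv (Scheme.ΓSpecIso B).symm.commRingCatIsoToRingEquiv
    rw [this]; rfl
  rw [← hk, cut]
  constructor
  · intro h
    exact Ideal.comap_mono (h _)
  · intro h
    refine Scheme.IdealSheafData.le_of_isAffine ?_
    have := Ideal.comap_mono (f := (Scheme.ΓSpecIso A).hom.hom) h
    rwa [Ideal.comap_comap, Ideal.comap_comap, ← CommRingCat.hom_comp, Iso.hom_inv_id,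
      CommRingCat.hom_id, Ideal.comap_id, Ideal.comap_id] at this

theorem ideal_eq_of_le_ker_iff {A : CommRingCat.{0}} {J J' : Ideal A}
    (h : ∀ (B : CommRingCat.{0}) (φ : A ⟶ B), J ≤ RingHom.ker φ.hom ↔ J' ≤ RingHom.ker φ.hom) :
    J = J' := by
  refine le_antisymm ?_ ?_
  · have := (h (.of (A ⧸ J')) (CommRingCat.ofHom (Ideal.Quotient.mk J'))).2 (by
      simp [Ideal.mk_ker])
    simpa [Ideal.mk_ker] using this
  · have := (h (.of (A ⧸ J)) (CommRingCat.ofHom (Ideal.Quotient.mk J))).1 (by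
      simp [Ideal.mk_ker])
    simpa [Ideal.mk_ker] using this

theorem cut_map (I : X.IdealSheafData) {A B : CommRingCat.{0}} (x : Spec A ⟶ X) (φ : A ⟶ B) :
    (cut I x).map φ.hom = cut I (Spec.map φ ≫ x) := by
  refine ideal_eq_of_le_ker_iff fun C ψ => ?_
  rw [← cut_comp_eq_bot_iff, ← Category.assoc, ← Spec.map_comp, cut_comp_eq_bot_iff,
    Ideal.map_le_iff_le_comap, RingHom.comap_ker]
  rfl

theorem cut_comp (I : X.IdealSheafData) {A : CommRingCat.{0}} (x : Spec A ⟶ T) (g : T ⟶ X) :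
    cut I (x ≫ g) = cut (I.comap g) x := by
  rw [cut, cut, Scheme.IdealSheafData.comap_comp]

theorem cut_fromSpec (I : X.IdealSheafData) {U : X.Opens} (hU : IsAffineOpen U) :
    cut I hU.fromSpec = I.ideal ⟨U, hU⟩ := by
  have hV : hU.fromSpec ''ᵁ ⊤ = U := by simp
  rw [cut, Scheme.IdealSheafData.ideal_comap_of_isOpenImmersion, Ideal.comap_comap]
  rw [← I.map_ideal' (U := ⟨hU.fromSpec ''ᵁ ⊤, (isAffineOpen_top _).image_of_isOpenImmersion _⟩)
    (V := ⟨U, hU⟩) (eqToHom (congrArg Opposite.op hV.symm))]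
  -- The chain of identifications hidden in `cut` composes to an automorphism that turns out to be
  -- the identity.
  let e : Γ(X, U) ≅ Γ(X, U) := X.presheaf.mapIso (eqToIso (by rw [hV])) ≪≫
    hU.fromSpec.appIso ⊤ ≪≫ Scheme.ΓSpecIso _
  have he : e.hom = 𝟙 _ := by
    dsimp only [e, Iso.trans_hom, Functor.mapIso_hom, eqToIso.hom]
    rw [Scheme.Hom.appIso_hom, IsAffineOpen.fromSpec_app_of_le _ _ hV.ge]
    have h1 (f : Opposite.op U ⟶ Opposite.op U) : X.presheaf.map f = 𝟙 _ := by
      rw [Subsingleton.elim f (𝟙 _), X.presheaf.map_id]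
    have h2 (f : Opposite.op (⊤ : (Spec Γ(X, U)).Opens) ⟶ Opposite.op ⊤) :
        (Spec Γ(X, U)).presheaf.map f = 𝟙 _ := by
      rw [Subsingleton.elim f (𝟙 _), (Spec Γ(X, U)).presheaf.map_id]
    simp only [Category.assoc, ← Functor.map_comp_assoc]
    rw [h1, h2, Category.id_comp, Category.id_comp, Iso.inv_hom_id]
  have h1 : (I.ideal ⟨U, hU⟩).comap e.inv.hom = I.ideal ⟨U, hU⟩ := by
    rw [comap_inv_eq_map_hom, he, CommRingCat.hom_id, Ideal.map_id]
  refine Eq.trans ?_ h1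
  have h2 := comap_inv_eq_map_hom (X.presheaf.mapIso (eqToIso
    (show Opposite.op U = Opposite.op (hU.fromSpec ''ᵁ ⊤) by rw [hV]))) (I.ideal ⟨U, hU⟩)
  refine (congrArg (Ideal.comap _) h2.symm).trans ?_
  rw [Ideal.comap_comap]
  rfl

/-- A morphism factors through a closed immersion iff it pulls back its ideal sheaf to zero. -/
theorem exists_comp_eq_iff {Z : Scheme.{0}} (i : Z ⟶ X) [IsClosedImmersion i] (g : T ⟶ X) :
    (∃ h : T ⟶ Z, h ≫ i = g) ↔ i.ker.comap g = ⊥ := by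
  rw [← le_bot_iff, ← Scheme.IdealSheafData.le_map_iff_comap_le, Scheme.IdealSheafData.map_bot]
  constructor
  · rintro ⟨h, rfl⟩
    exact Scheme.Hom.le_ker_comp _ _
  · intro h
    exact ⟨IsClosedImmersion.lift i g h, IsClosedImmersion.lift_fac _ _ _⟩

theorem exists_comp_eq_iff_cut {Z : Scheme.{0}} (i : Z ⟶ X) [IsClosedImmersion i]
    {A : CommRingCat.{0}} (x : Spec A ⟶ X) :
    (∃ h : Spec A ⟶ Z, h ≫ i = x) ↔ cut i.ker x = ⊥ := by
  rw [exists_comp_eq_iff, cut_eq_bot_iff]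

end

section

/-! ### Closed subschemes defined by conditions on points -/

theorem ideal_eq_of_map_away {R : Type*} [CommRing R] {J J' : Ideal R} (s : Set R)
    (hs : Ideal.span s = ⊤) (h : ∀ r ∈ s, J.map (algebraMap R (Localization.Away r)) =
      J'.map (algebraMap R (Localization.Away r))) : J = J' := by
  refine le_antisymm ?_ ?_
  all_goals
  · refine Submodule.le_of_isLocalized_span s hs (fun r => Localization.Away r.1)
      (fun r => Algebra.linearMap R (Localization.Away r.1)) ?_
    rintro ⟨r, hr⟩
    simp only [← Submodule.restrictScalars_localized' (Localization.Away r),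
      Ideal.localized'_eq_map]
    rw [h r hr]

variable {X : Scheme.{0}}

theorem exists_factor_affine {A : CommRingCat.{0}} (x : Spec A ⟶ X) :
    ∃ s : Set A, Ideal.span s = ⊤ ∧ ∀ r ∈ s, ∃ (U : X.Opens) (hU : IsAffineOpen U)
      (ψ : Γ(X, U) ⟶ .of (Localization.Away r)),
      Spec.map (CommRingCat.ofHom (algebraMap A (Localization.Away r))) ≫ x =
        Spec.map ψ ≫ hU.fromSpec := by
  refine ⟨{r | ∃ (U : X.Opens) (hU : IsAffineOpen U)
      (ψ : Γ(X, U) ⟶ .of (Localization.Away r)),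
      Spec.map (CommRingCat.ofHom (algebraMap A (Localization.Away r))) ≫ x =
        Spec.map ψ ≫ hU.fromSpec}, ?_, fun r hr => hr⟩
  by_contra hc
  obtain ⟨m, hm, hle⟩ := Ideal.exists_le_maximal _ hc
  let y : Spec A := (⟨m, hm.isPrime⟩ : PrimeSpectrum A)
  obtain ⟨U, hU, hyU, -⟩ := exists_isAffineOpen_mem_and_subset (U := ⊤) (x := x y) trivial
  obtain ⟨r, hyr, hrU⟩ : ∃ r : A, y ∈ bOpen r ∧ bOpen r ≤ x ⁻¹ᵁ U := by
    obtain ⟨_, ⟨_, ⟨f, rfl⟩, rfl⟩, hxf, hfU⟩ :=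
      PrimeSpectrum.isBasis_basic_opens.exists_subset_of_mem_open
        (show y ∈ x ⁻¹ᵁ U from hyU) (x ⁻¹ᵁ U).2
    exact ⟨f, hxf, hfU⟩
  refine hyr (hle (Ideal.subset_span ⟨U, hU, ?_⟩))
  have hrange : Set.range (Spec.map (CommRingCat.ofHom (algebraMap A (Localization.Away r))) ≫ x) ⊆
      Set.range hU.fromSpec := by
    rw [hU.range_fromSpec]
    rintro _ ⟨z, rfl⟩
    have hz : Spec.map (CommRingCat.ofHom (algebraMap A (Localization.Away r))) z ∈ bOpen r := by
      have : PrimeSpectrum.comap (algebraMap A (Localization.Away r)) z ∈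
          (PrimeSpectrum.basicOpen r : Set (PrimeSpectrum A)) := by
        rw [← PrimeSpectrum.localization_away_comap_range (Localization.Away r) r]
        exact ⟨z, rfl⟩
      exact this
    rw [Scheme.Hom.comp_apply]
    exact hrU hz
  refine ⟨Spec.preimage (IsOpenImmersion.lift hU.fromSpec _ hrange), ?_⟩
  rw [Spec.map_preimage, IsOpenImmersion.lift_fac]

/-- The values of `J` at the affine open subsets form an ideal sheaf because `J` commutes with
localization. To compare it with `J` at an arbitrary point, localize until the point factors through
an affine open subset. -/
theorem exists_idealSheaf (J : ∀ (A : CommRingCat.{0}) (_ : Spec A ⟶ X), Ideal A)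
    (hJ : ∀ (A B : CommRingCat.{0}) (x : Spec A ⟶ X) (φ : A ⟶ B),
      (J A x).map φ.hom = J B (Spec.map φ ≫ x)) :
    ∃ I : X.IdealSheafData, ∀ (A : CommRingCat.{0}) (x : Spec A ⟶ X), cut I x = J A x := by
  let I : X.IdealSheafData :=
    { ideal := fun U => J _ (IsAffineOpen.fromSpec U.2)
      map_ideal_basicOpen := fun U f => by
        rw [hJ]
        congr 1
        exact IsAffineOpen.map_fromSpec U.2 (IsAffineOpen.basicOpen U.2 f) _ }
  refine ⟨I, fun A x => ?_⟩
  obtain ⟨s, hs, h⟩ := exists_factor_affine x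
  refine ideal_eq_of_map_away s hs fun r hr => ?_
  obtain ⟨U, hU, ψ, hψ⟩ := h r hr
  have h1 := cut_map I x (CommRingCat.ofHom (algebraMap A (Localization.Away r)))
  have h2 := hJ _ _ x (CommRingCat.ofHom (algebraMap A (Localization.Away r)))
  rw [hψ] at h1 h2
  rw [← cut_map, cut_fromSpec] at h1
  rw [← hJ] at h2
  exact h1.trans h2.symm

/-! ### Points over the complex numbers -/

variable {X : Over (Spec (.of ℂ))}

/-- The `ℂ`-algebra structure of a ring determined by a point of a scheme over `ℂ`. -/
def algOf {R : CommRingCat.{0}} (x : Spec R ⟶ X.left) : CommAlgCat.{0} ℂ :=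
  letI := (Spec.preimage (x ≫ X.hom)).hom.toAlgebra
  CommAlgCat.of ℂ R

/-- A point of a scheme over `ℂ` as a morphism over `ℂ`. -/
def overOf {R : CommRingCat.{0}} (x : Spec R ⟶ X.left) : specOver (algOf x) ⟶ X :=
  Over.homMk x (Spec.map_preimage (x ≫ X.hom)).symm

/-- A ring homomorphism as a homomorphism of algebras. -/
def algOfHom {R S : CommRingCat.{0}} (x : Spec R ⟶ X.left) (φ : R ⟶ S) :
    algOf x ⟶ algOf (Spec.map φ ≫ x) :=
  CommAlgCat.ofHom (X := algOf x) (Y := algOf (Spec.map φ ≫ x))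
    { (show algOf x →+* algOf (Spec.map φ ≫ x) from φ.hom) with
      commutes' := fun c => by
        have : Spec.preimage (x ≫ X.hom) ≫ φ = Spec.preimage ((Spec.map φ ≫ x) ≫ X.hom) := by
          apply Spec.map_injective
          rw [Spec.map_comp, Spec.map_preimage, Spec.map_preimage, Category.assoc]
        exact congrArg (fun g => g.hom c) this }

/-- The underlying morphism of a point. -/
def pt {A : CommAlgCat.{0} ℂ} (x : specOver A ⟶ X) : Spec (.of A) ⟶ X.left := x.left

/-- The identity as an algebra homomorphism. -/
def algOfId {A : CommAlgCat.{0} ℂ} (x : specOver A ⟶ X) :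
    A ⟶ algOf (pt x) :=
  CommAlgCat.ofHom (X := A) (Y := algOf (pt x))
    { (show A →+* algOf (pt x) from RingHom.id A) with
      commutes' := fun c => by
        have : CommRingCat.ofHom (algebraMap ℂ A) =
            Spec.preimage (pt x ≫ X.hom) := by
          apply Spec.map_injective
          rw [Spec.map_preimage]
          exact (Over.w x).symm
        exact congrArg (fun g => g.hom c) this }

theorem specOverMap_algOfId {A : CommAlgCat.{0} ℂ} (x : specOver A ⟶ X) :
    specOverMap (algOfId x) ≫ x = overOf (pt x) := by
  ext : 1
  have : (specOverMap (algOfId x)).left = 𝟙 _ := Spec.map_id (.of A)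
  exact (congrArg (· ≫ x.left) this).trans (Category.id_comp _)

/-- The ideal attached to a point is determined by the algebras over which the condition holds, so
these ideals are compatible with base change and come from an ideal sheaf. -/
theorem exists_closed (𝒬 : ∀ A : CommAlgCat.{0} ℂ, (specOver A ⟶ X) → Prop)
    (h : ∀ (A : CommAlgCat.{0} ℂ) (x : specOver A ⟶ X), ∃ I : Ideal A, ∀ (B : CommAlgCat.{0} ℂ) (φ : A ⟶ B),
      𝒬 B (specOverMap φ ≫ x) ↔
        I ≤ RingHom.ker φ.hom.toRingHom) :
    ∃ (Z : Over (Spec (.of ℂ))) (i : Z ⟶ X), IsClosedImmersion i.left ∧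
      ∀ A x, 𝒬 A x ↔ ∃ y : specOver A ⟶ Z, y ≫ i = x := by
  choose J hJ using h
  have hbot (A x) : 𝒬 A x ↔ J A x = ⊥ := by
    have := hJ A x A (𝟙 A)
    have e : RingHom.ker (CommAlgCat.Hom.hom (𝟙 A)).toRingHom = ⊥ :=
      (RingHom.injective_iff_ker_eq_bot _).1 fun _ _ h => h
    have e' : specOverMap (𝟙 A) ≫ x = x := by
      rw [show specOverMap (𝟙 A) = 𝟙 _ from (algSpec (.of ℂ)).map_id _, Category.id_comp]
    rwa [e, le_bot_iff, e'] at this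
  have hmap (A B : CommAlgCat.{0} ℂ) (φ : A ⟶ B) (x) :
      (J A x).map φ.hom.toRingHom = J B (specOverMap φ ≫ x) := by
    have key (C : CommAlgCat.{0} ℂ) (ψ : B ⟶ C) :
        (J A x).map φ.hom.toRingHom ≤ RingHom.ker ψ.hom.toRingHom ↔
          J B (specOverMap φ ≫ x) ≤ RingHom.ker ψ.hom.toRingHom := by
      rw [← hJ, Ideal.map_le_iff_le_comap, RingHom.comap_ker]
      have := hJ A x C (φ ≫ ψ)
      rw [show specOverMap (φ ≫ ψ) = specOverMap ψ ≫ specOverMap φ from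
        (algSpec (.of ℂ)).map_comp _ _, Category.assoc] at this
      exact this.symm
    have hq (I I' : Ideal B) (hI : ∀ (C : CommAlgCat.{0} ℂ) (ψ : B ⟶ C),
        I' ≤ RingHom.ker ψ.hom.toRingHom → I ≤ RingHom.ker ψ.hom.toRingHom) : I ≤ I' := by
      have := hI (CommAlgCat.of ℂ (B ⧸ I')) (CommAlgCat.ofHom (Ideal.Quotient.mkₐ ℂ I'))
        (fun a ha => Ideal.Quotient.eq_zero_iff_mem.2 ha)
      exact fun a ha => Ideal.Quotient.eq_zero_iff_mem.1 (this ha)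
    exact le_antisymm (hq _ _ fun C ψ => (key C ψ).2) (hq _ _ fun C ψ => (key C ψ).1)
  -- Ideal sheaves are tested on points without a given `ℂ`-structure; the structure is induced by
  -- the point itself.
  obtain ⟨I, hI⟩ := exists_idealSheaf (X := X.left) (fun A x => J (algOf x) (overOf x))
    (fun A B x φ => hmap _ _ (algOfHom x φ) (overOf x))
  refine ⟨Over.mk (I.subschemeι ≫ X.hom), Over.homMk I.subschemeι, ?_, fun A x => ?_⟩
  · change IsClosedImmersion I.subschemeι
    infer_instance
  · have h1 : J A x = ⊥ ↔ cut I (pt x) = ⊥ := by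
      rw [hI]
      have := hmap _ _ (algOfId x) x
      rw [specOverMap_algOfId] at this
      have e : (J A x).map (algOfId x).hom.toRingHom = J A x := Ideal.map_id _
      rw [show J (algOf (pt x)) (overOf (pt x)) = J A x from
        this.symm.trans e]
    rw [hbot, h1]
    have h2 := exists_comp_eq_iff_cut I.subschemeι (pt x)
    rw [Scheme.IdealSheafData.ker_subschemeι] at h2
    rw [← h2]
    constructor
    · rintro ⟨y, hy⟩
      refine ⟨Over.homMk y ?_, ?_⟩
      · change y ≫ I.subschemeι ≫ X.hom = _
        rw [← Category.assoc, hy]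
        exact Over.w x
      · ext : 1
        exact hy
    · rintro ⟨y, rfl⟩
      exact ⟨y.left, rfl⟩

end

section

/-! ### Spreading out of morphisms -/

/-- The exponent and the numerator are chosen before `E`, so the same ones serve in the local ring,
where relations are known, and in a localization, where they are wanted. -/
theorem exists_clear_denominators {C R : Type} [CommRing C] [CommRing R] [Algebra C R] {n : ℕ}
    (b : R) (r : Fin n → R) (f : MvPolynomial (Fin n) C) :
    ∃ (m : ℕ) (u : R), ∀ (E : Type) [CommRing E] [Algebra C E] [Algebra R E] [IsScalarTower C R E]
      (y : Fin n → E), (∀ i, algebraMap R E b * y i = algebraMap R E (r i)) →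
      algebraMap R E b ^ m * MvPolynomial.aeval y f = algebraMap R E u := by
  induction f using MvPolynomial.induction_on with
  | C c =>
    refine ⟨0, algebraMap C R c, fun E _ _ _ _ y hy => ?_⟩
    simp [← IsScalarTower.algebraMap_apply]
  | add f g hf hg =>
    obtain ⟨m, u, hu⟩ := hf
    obtain ⟨m', u', hu'⟩ := hg
    refine ⟨m + m', b ^ m' * u + b ^ m * u', fun E _ _ _ _ y hy => ?_⟩
    rw [map_add, map_add, map_mul, map_mul, ← hu E y hy, ← hu' E y hy, map_pow, map_pow]
    ring
  | mul_X f i hf =>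
    obtain ⟨m, u, hu⟩ := hf
    refine ⟨m + 1, u * r i, fun E _ _ _ _ y hy => ?_⟩
    rw [map_mul, map_mul, ← hu E y hy, ← hy i, MvPolynomial.aeval_X]
    ring

/-- The images of the finitely many generators have a common denominator `b`. Each of the finitely
many relations `f` yields a numerator `u f` that dies in the local ring, hence is killed by some `c
f` outside `p`. Inverting `b` and all `c f` makes the map well defined. -/
theorem exists_algHom_away {C D R S : Type} [CommRing C] [CommRing D] [CommRing R] [CommRing S]
    [Algebra C D] [Algebra C R] [Algebra R S] [Algebra C S] [IsScalarTower C R S]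
    [Algebra.FinitePresentation C D] (p : Ideal R) [p.IsPrime] [IsLocalization.AtPrime S p]
    (ψ : D →ₐ[C] S) : ∃ a ∉ p, Nonempty (D →ₐ[C] Localization.Away a) := by
  obtain ⟨n, π, hπ, s, hs⟩ := Algebra.FinitePresentation.out (R := C) (A := D)
  obtain ⟨⟨b, hb⟩, hb'⟩ := IsLocalization.exist_integer_multiples_of_finite p.primeCompl
    (fun i => ψ (π (MvPolynomial.X i)))
  choose r hr using hb'
  have hy (i) : algebraMap R S b * ψ (π (MvPolynomial.X i)) = algebraMap R S (r i) := by
    rw [hr i, Algebra.smul_def]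
  choose m u hu using exists_clear_denominators (C := C) b r
  have hψ (f) : MvPolynomial.aeval (fun i => ψ (π (MvPolynomial.X i))) f = ψ (π f) := by
    have : MvPolynomial.aeval (fun i => ψ (π (MvPolynomial.X i))) = ψ.comp π := by
      ext i; simp
    rw [this]; rfl
  have hc (f) (hf : f ∈ s) : ∃ c ∉ p, c * u f = 0 := by
    have h1 := hu f S _ hy
    have h2 : π f = 0 := by
      have : f ∈ RingHom.ker π.toRingHom := hs ▸ Ideal.subset_span hf
      exact this
    rw [hψ, h2, map_zero, mul_zero] at h1
    obtain ⟨⟨c, hc⟩, h⟩ := (IsLocalization.map_eq_zero_iff p.primeCompl S (u f)).1 h1.symm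
    exact ⟨c, hc, h⟩
  choose! c hc hcu using hc
  let a := b * ∏ f ∈ s, c f
  have ha : a ∉ p := by
    refine fun h => (Ideal.IsPrime.mem_or_mem ‹_› h).elim hb fun h => ?_
    obtain ⟨f, hf, hfp⟩ := Ideal.IsPrime.prod_mem_iff.1 h
    exact hc f hf hfp
  refine ⟨a, ha, ?_⟩
  have hua : IsUnit (algebraMap R (Localization.Away a) a) := IsLocalization.Away.algebraMap_isUnit a
  have hub : IsUnit (algebraMap R (Localization.Away a) b) :=
    isUnit_of_dvd_unit (map_dvd _ (Dvd.intro _ rfl)) hua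
  obtain ⟨v, hv⟩ := hub.exists_right_inv
  let θ : MvPolynomial (Fin n) C →ₐ[C] Localization.Away a :=
    MvPolynomial.aeval (fun i => v * algebraMap R _ (r i))
  have hθ : RingHom.ker π ≤ RingHom.ker θ := by
    have : RingHom.ker π = Ideal.span s := hs.symm
    rw [this, Ideal.span_le]
    intro f hf
    have h1 := hu f (Localization.Away a) (fun i => v * algebraMap R _ (r i))
      (fun i => by rw [← mul_assoc, hv, one_mul])
    have huc : IsUnit (algebraMap R (Localization.Away a) (c f)) :=
      isUnit_of_dvd_unit (map_dvd _ (dvd_mul_of_dvd_right (Finset.dvd_prod_of_mem c hf) b)) hua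
    have h2 : algebraMap R (Localization.Away a) (u f) = 0 := by
      rw [← huc.mul_right_eq_zero, ← map_mul, hcu f hf, map_zero]
    rw [h2] at h1
    exact ((hub.pow _).mul_right_eq_zero).1 h1
  exact ⟨(Ideal.Quotient.liftₐ (RingHom.ker π) θ (fun f hf => hθ hf)).comp
    (Ideal.quotientKerAlgEquivOfSurjective hπ).symm.toAlgHom⟩

variable {B X T : Scheme.{0}}

/-- The closed points of the local spectra show that the maps agree on points; within a common
affine chart, sections are determined by their germs. -/
theorem hom_ext_of_fromSpecStalk {h h' : T ⟶ B}
    (H : ∀ t : T, T.fromSpecStalk t ≫ h = T.fromSpecStalk t ≫ h') : h = h' := by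
  refine Scheme.hom_ext_of_forall _ _ fun t => ?_
  have ht : h t = h' t := by
    have := congrArg (fun g : Spec (T.presheaf.stalk t) ⟶ B =>
      g (IsLocalRing.closedPoint (T.presheaf.stalk t))) (H t)
    exact (congrArg h Scheme.fromSpecStalk_closedPoint).symm.trans
      (this.trans (congrArg h' Scheme.fromSpecStalk_closedPoint))
  obtain ⟨U, hU, htU, -⟩ := exists_isAffineOpen_mem_and_subset (U := ⊤) (x := h t) trivial
  obtain ⟨V, hV, htV, hVU⟩ := exists_isAffineOpen_mem_and_subset (U := h ⁻¹ᵁ U ⊓ h' ⁻¹ᵁ U) (x := t)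
    ⟨htU, by change h' t ∈ U; rwa [← ht]⟩
  have hV1 : V ≤ h ⁻¹ᵁ U := fun x hx => (hVU hx).1
  have hV2 : V ≤ h' ⁻¹ᵁ U := fun x hx => (hVU hx).2
  refine ⟨V, htV, ?_⟩
  have key : h.appLE U V hV1 = h'.appLE U V hV2 := by
    ext s
    refine TopCat.Presheaf.section_ext T.sheaf _ _ _ fun v hv => ?_
    have e1 : Spec.map (h.appLE U V hV1 ≫ T.presheaf.germ V v hv) ≫ hU.fromSpec =
        T.fromSpecStalk v ≫ h := by
      rw [Spec.map_comp, Category.assoc, hU.SpecMap_appLE_fromSpec h hV hV1,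
        ← hV.fromSpecStalk_eq_fromSpecStalk hv, IsAffineOpen.fromSpecStalk, Category.assoc]
    have e2 : Spec.map (h'.appLE U V hV2 ≫ T.presheaf.germ V v hv) ≫ hU.fromSpec =
        T.fromSpecStalk v ≫ h' := by
      rw [Spec.map_comp, Category.assoc, hU.SpecMap_appLE_fromSpec h' hV hV2,
        ← hV.fromSpecStalk_eq_fromSpecStalk hv, IsAffineOpen.fromSpecStalk, Category.assoc]
    rw [H v, ← e2, cancel_mono] at e1
    exact congrArg (fun g => g.hom s) (Spec.map_injective e1)
  have : hV.fromSpec ≫ h = hV.fromSpec ≫ h' := by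
    rw [← hU.SpecMap_appLE_fromSpec h hV hV1, key, hU.SpecMap_appLE_fromSpec h' hV hV2]
  rw [IsAffineOpen.fromSpec, Category.assoc, Category.assoc] at this
  exact (cancel_epi _).1 this

theorem exists_specMap_of_mem {R : CommRingCat.{0}} [IsLocalRing R] (y : Spec R ⟶ B) {U : B.Opens}
    (hU : IsAffineOpen U) (h : y (IsLocalRing.closedPoint R) ∈ U) :
    ∃ ψ : Γ(B, U) ⟶ R, Spec.map ψ ≫ hU.fromSpec = y := by
  have htop := Scheme.preimage_eq_top_of_closedPoint_mem y h
  have hr : Set.range y ⊆ Set.range hU.fromSpec := by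
    rw [hU.range_fromSpec]
    rintro _ ⟨z, rfl⟩
    have : z ∈ y ⁻¹ᵁ U := by rw [htop]; trivial
    exact this
  refine ⟨Spec.preimage (IsOpenImmersion.lift hU.fromSpec y hr), ?_⟩
  rw [Spec.map_preimage, IsOpenImmersion.lift_fac]

/-- After passing to affine open sets this is `exists_algHom_away`. Agreement of the extension with
`y` is not recorded, since in the application lifts are unique anyway. -/
theorem exists_spread_out (p : B ⟶ X) [LocallyOfFinitePresentation p] (g : T ⟶ X) (t : T)
    (y : Spec (T.presheaf.stalk t) ⟶ B) (hy : y ≫ p = T.fromSpecStalk t ≫ g) :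
    ∃ (S : CommRingCat.{0}) (j : Spec S ⟶ T) (h : Spec S ⟶ B), IsOpenImmersion j ∧
      t ∈ Set.range j ∧ h ≫ p = j ≫ g := by
  obtain ⟨W, hW, htW, -⟩ := exists_isAffineOpen_mem_and_subset (U := ⊤) (x := g t) trivial
  obtain ⟨V, hV, htV, hVW⟩ := exists_isAffineOpen_mem_and_subset (U := g ⁻¹ᵁ W) (x := t) htW
  have hb : p (y (IsLocalRing.closedPoint _)) = g t := by
    have := congrArg (fun g : Spec (T.presheaf.stalk t) ⟶ X =>
      g (IsLocalRing.closedPoint (T.presheaf.stalk t))) hy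
    exact this.trans (congrArg g Scheme.fromSpecStalk_closedPoint)
  obtain ⟨U, hU, hbU, hUW⟩ := exists_isAffineOpen_mem_and_subset (U := p ⁻¹ᵁ W)
    (x := y (IsLocalRing.closedPoint _)) (by change p _ ∈ W; rwa [hb])
  obtain ⟨ψ, hψ⟩ := exists_specMap_of_mem y hU hbU
  have hcomp : p.appLE W U hUW ≫ ψ = g.appLE W V hVW ≫ T.presheaf.germ V t htV := by
    apply Spec.map_injective
    rw [← cancel_mono hW.fromSpec, Spec.map_comp, Spec.map_comp, Category.assoc, Category.assoc,
      hW.SpecMap_appLE_fromSpec p hU hUW, hW.SpecMap_appLE_fromSpec g hV hVW, reassoc_of% hψ, hy,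
      ← hV.fromSpecStalk_eq_fromSpecStalk htV, IsAffineOpen.fromSpecStalk, Category.assoc]
  let _ : Algebra Γ(X, W) Γ(B, U) := (p.appLE W U hUW).hom.toAlgebra
  let _ : Algebra Γ(X, W) Γ(T, V) := (g.appLE W V hVW).hom.toAlgebra
  let _ : Algebra Γ(T, V) (T.presheaf.stalk t) := (T.presheaf.germ V t htV).hom.toAlgebra
  let _ : Algebra Γ(X, W) (T.presheaf.stalk t) :=
    (g.appLE W V hVW ≫ T.presheaf.germ V t htV).hom.toAlgebra
  have : IsScalarTower Γ(X, W) Γ(T, V) (T.presheaf.stalk t) := IsScalarTower.of_algebraMap_eq'  rfl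
  have : Algebra.FinitePresentation Γ(X, W) Γ(B, U) :=
    Scheme.Hom.finitePresentation_appLE p hW hU hUW
  have : IsLocalization.AtPrime (T.presheaf.stalk t) (hV.primeIdealOf ⟨t, htV⟩).asIdeal :=
    hV.isLocalization_stalk ⟨t, htV⟩
  obtain ⟨a, ha, ⟨φ⟩⟩ := exists_algHom_away (C := Γ(X, W)) (D := Γ(B, U)) (R := Γ(T, V))
    (S := T.presheaf.stalk t) (hV.primeIdealOf ⟨t, htV⟩).asIdeal
    { ψ.hom with commutes' := fun c => congrArg (fun g => g.hom c) hcomp }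
  let ι : Γ(T, V) ⟶ .of (Localization.Away a) := CommRingCat.ofHom (algebraMap _ _)
  refine ⟨.of (Localization.Away a), Spec.map ι ≫ hV.fromSpec,
    Spec.map (CommRingCat.ofHom φ.toRingHom) ≫ hU.fromSpec, ?_, ?_, ?_⟩
  · have : IsOpenImmersion (Spec.map ι) :=
      Scheme.isOpenImmersion_SpecMap_localizationAway a
    infer_instance
  · have : hV.primeIdealOf ⟨t, htV⟩ ∈ Set.range (PrimeSpectrum.comap
        (algebraMap Γ(T, V) (Localization.Away a))) := by
      rw [PrimeSpectrum.localization_away_comap_range (Localization.Away a) a]; exact ha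
    obtain ⟨z, hz⟩ := this
    refine ⟨z, ?_⟩
    exact (congrArg hV.fromSpec hz).trans (hV.fromSpec_primeIdealOf ⟨t, htV⟩)
  · rw [Category.assoc, Category.assoc, ← hW.SpecMap_appLE_fromSpec p hU hUW,
      ← hW.SpecMap_appLE_fromSpec g hV hVW, ← Spec.map_comp_assoc, ← Spec.map_comp_assoc]
    congr 2
    ext c
    exact φ.commutes c

end

section

/-! ### A criterion for blow-ups in terms of local rings -/

variable {B X T : Scheme.{0}}

/-- The pullback of an ideal sheaf is generated by a nonzerodivisor at every stalk. -/
def StalkCartier (I : X.IdealSheafData) (g : T ⟶ X) : Prop :=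
  ∀ t : T, ∃ c ∈ nonZeroDivisors (T.presheaf.stalk t),
    cut I (T.fromSpecStalk t ≫ g) = Ideal.span {c}

theorem cut_fromSpecStalk (I : X.IdealSheafData) {U : X.Opens} (hU : IsAffineOpen U) (x : X)
    (hx : x ∈ U) :
    cut I (X.fromSpecStalk x) = (I.ideal ⟨U, hU⟩).map (X.presheaf.germ U x hx).hom := by
  rw [← hU.fromSpecStalk_eq_fromSpecStalk hx, IsAffineOpen.fromSpecStalk, ← cut_map, cut_fromSpec]

theorem stalkCartier_of_isEffectiveCartier {I : X.IdealSheafData} {g : T ⟶ X}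
    (h : IsEffectiveCartier (I.comap g)) : StalkCartier I g := by
  intro t
  obtain ⟨U, ht, f, hf, hI⟩ := h t
  refine ⟨T.presheaf.germ U.1 t ht f, ?_, ?_⟩
  · let _ : Algebra Γ(T, U.1) (T.presheaf.stalk t) := (T.presheaf.germ U.1 t ht).hom.toAlgebra
    have : IsLocalization.AtPrime (T.presheaf.stalk t)
      (IsAffineOpen.primeIdealOf U.2 ⟨t, ht⟩).asIdeal :=
      IsAffineOpen.isLocalization_stalk U.2 ⟨t, ht⟩
    exact IsLocalization.nonZeroDivisors_le_comap
      (IsAffineOpen.primeIdealOf U.2 ⟨t, ht⟩).asIdeal.primeCompl (T.presheaf.stalk t) hf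
  · rw [cut_comp, cut_fromSpecStalk _ U.2 t ht]
    have hI' : (I.comap g).ideal ⟨U.1, U.2⟩ = Ideal.span {f} := hI
    rw [hI', Ideal.map_span, Set.image_singleton]

theorem StalkCartier.comp {T' : Scheme.{0}} {I : X.IdealSheafData} {g : T ⟶ X}
    (h : StalkCartier I g) (j : T' ⟶ T) [IsOpenImmersion j] : StalkCartier I (j ≫ g) := by
  intro t
  obtain ⟨c, hc, hI⟩ := h (j t)
  refine ⟨j.stalkMap t c, ?_, ?_⟩
  · let e := (asIso (j.stalkMap t)).commRingCatIsoToRingEquiv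
    have : nonZeroDivisors (T.presheaf.stalk (j t)) ≤
        (nonZeroDivisors (T'.presheaf.stalk t)).comap e.toMonoidHom := by
      intro a ha
      rw [Submonoid.mem_comap, mem_nonZeroDivisors_iff_right]
      intro b hb
      have h1 : e.symm b * a = 0 := by
        apply e.injective
        rw [map_mul, RingEquiv.apply_symm_apply, map_zero]; exact hb
      have := (mem_nonZeroDivisors_iff_right.1 ha) _ h1
      rwa [map_eq_zero_iff _ e.symm.injective] at this
    exact this hc
  · rw [← Scheme.SpecMap_stalkMap_fromSpecStalk_assoc, ← cut_map, hI, Ideal.map_span,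
      Set.image_singleton]

/-- By noetherianity only finitely many facts have to be spread out: each generator of `J` is a
multiple of `f` after multiplication by some `a g`, and each generator of the annihilator of `f` is
killed by some `b g`. Inverting the product `A` of these elements keeps `f` a generator and a
nonzerodivisor. -/
theorem exists_away_principal {R S : Type} [CommRing R] [IsNoetherianRing R] [CommRing S]
    [Algebra R S] (p : Ideal R) [p.IsPrime] [IsLocalization.AtPrime S p] (J : Ideal R) {c : S}
    (hc : c ∈ nonZeroDivisors S) (hJ : J.map (algebraMap R S) = Ideal.span {c}) :
    ∃ a ∉ p, ∃ f : R, ∀ (R' : Type) [CommRing R'] [Algebra R R'] [IsLocalization.Away a R'],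
      algebraMap R R' f ∈ nonZeroDivisors R' ∧
      J.map (algebraMap R R') = Ideal.span {algebraMap R R' f} := by
  obtain ⟨⟨⟨f, hfJ⟩, ⟨s, hs⟩⟩, hfs⟩ := (IsLocalization.mem_map_algebraMap_iff p.primeCompl S).1
    (hJ ▸ Ideal.mem_span_singleton_self c : c ∈ J.map (algebraMap R S))
  dsimp only at hfs
  have hus : IsUnit (algebraMap R S s) := IsLocalization.map_units S (⟨s, hs⟩ : p.primeCompl)
  have hf : algebraMap R S f ∈ nonZeroDivisors S := by
    rw [← hfs]; exact mul_mem hc hus.mem_nonZeroDivisors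
  have hJf : J.map (algebraMap R S) = Ideal.span {algebraMap R S f} := by
    rw [hJ, ← hfs]
    exact (Ideal.span_singleton_mul_right_unit hus c).symm
  obtain ⟨G, hG⟩ := IsNoetherian.noetherian J
  have h1 (g : R) (hg : g ∈ G) : ∃ a ∉ p, ∃ r, a * g = r * f := by
    have : algebraMap R S g ∈ Ideal.span {algebraMap R S f} :=
      hJf ▸ Ideal.mem_map_of_mem _ (hG ▸ Ideal.subset_span hg)
    obtain ⟨z, hz⟩ := Ideal.mem_span_singleton'.1 this
    obtain ⟨⟨r, ⟨d, hd⟩⟩, hrd⟩ := IsLocalization.surj p.primeCompl z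
    dsimp only at hrd
    have : algebraMap R S (d * g) = algebraMap R S (r * f) := by
      rw [map_mul, map_mul, ← hrd, ← hz]; ring
    obtain ⟨⟨a, ha⟩, h⟩ := (IsLocalization.eq_iff_exists p.primeCompl S).1 this
    exact ⟨a * d, fun hh => (Ideal.IsPrime.mem_or_mem ‹_› hh).elim ha hd, a * r, by
      rw [mul_assoc, h, mul_assoc]⟩
  choose! a ha r har using h1
  obtain ⟨H, hH⟩ := IsNoetherian.noetherian (LinearMap.ker (LinearMap.mulLeft R f))
  have h2 (g : R) (hg : g ∈ H) : ∃ b ∉ p, b * g = 0 := by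
    have hg0 : f * g = 0 := by
      have : g ∈ LinearMap.ker (LinearMap.mulLeft R f) := hH ▸ Submodule.subset_span hg
      exact this
    have : algebraMap R S g = 0 := by
      refine (mem_nonZeroDivisors_iff_left.1 hf) _ ?_
      rw [← map_mul, hg0, map_zero]
    obtain ⟨⟨b, hb⟩, h⟩ := (IsLocalization.map_eq_zero_iff p.primeCompl S g).1 this
    exact ⟨b, hb, h⟩
  choose! b hb hbg using h2
  let A := (∏ g ∈ G, a g) * ∏ g ∈ H, b g
  have hA : A ∉ p := by
    intro h
    rcases Ideal.IsPrime.mem_or_mem ‹_› h with h | h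
    · obtain ⟨g, hg, h⟩ := Ideal.IsPrime.prod_mem_iff.1 h
      exact ha g hg h
    · obtain ⟨g, hg, h⟩ := Ideal.IsPrime.prod_mem_iff.1 h
      exact hb g hg h
  refine ⟨A, hA, f, fun R' _ _ _ => ⟨?_, ?_⟩⟩
  · have huA : IsUnit (algebraMap R R' A) := IsLocalization.Away.algebraMap_isUnit A
    rw [mem_nonZeroDivisors_iff_left]
    intro z hz
    obtain ⟨⟨y, ⟨d, m, hd⟩⟩, hyd⟩ := IsLocalization.surj (Submonoid.powers A) z
    dsimp only at hyd
    have : algebraMap R R' (f * y) = 0 := by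
      rw [map_mul, ← hyd, ← mul_assoc, hz, zero_mul]
    obtain ⟨⟨d', m', rfl⟩, h⟩ := (IsLocalization.map_eq_zero_iff (Submonoid.powers A) R' _).1 this
    dsimp only at h
    have hmem : A ^ m' * y ∈ LinearMap.ker (LinearMap.mulLeft R f) := by
      rw [LinearMap.mem_ker, LinearMap.mulLeft_apply, ← h]; ring
    have hall : ∀ w ∈ LinearMap.ker (LinearMap.mulLeft R f), algebraMap R R' w = 0 := by
      intro w hw
      rw [← hH] at hw
      induction hw using Submodule.span_induction with
      | mem g hg =>
        have hbu : IsUnit (algebraMap R R' (b g)) :=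
          isUnit_of_dvd_unit (map_dvd _ (dvd_mul_of_dvd_right (Finset.dvd_prod_of_mem b hg) _)) huA
        rw [← hbu.mul_right_eq_zero, ← map_mul, hbg g hg, map_zero]
      | zero => exact map_zero _
      | add x y _ _ hx hy => rw [map_add, hx, hy, add_zero]
      | smul c x _ hx => rw [smul_eq_mul, map_mul, hx, mul_zero]
    have h3 := hall _ hmem
    rw [map_mul, map_pow] at h3
    have h4 := ((huA.pow m').mul_right_eq_zero).1 h3
    rw [h4] at hyd
    have hud : IsUnit (algebraMap R R' d) := by
      rw [← hd, map_pow]; exact huA.pow m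
    exact (hud.mul_left_eq_zero).1 hyd
  · have huA : IsUnit (algebraMap R R' A) := IsLocalization.Away.algebraMap_isUnit A
    refine le_antisymm ?_ ?_
    · have : J = Ideal.span G := hG.symm
      rw [this, Ideal.map_span, Ideal.span_le]
      rintro _ ⟨g, hg, rfl⟩
      have hau : IsUnit (algebraMap R R' (a g)) :=
        isUnit_of_dvd_unit (map_dvd _ (dvd_mul_of_dvd_left (Finset.dvd_prod_of_mem a hg) _)) huA
      rw [SetLike.mem_coe, ← Ideal.unit_mul_mem_iff_mem _ hau, ← map_mul, har g hg, map_mul]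
      exact Ideal.mul_mem_left _ _ (Ideal.mem_span_singleton_self _)
    · rw [Ideal.span_singleton_le_iff_mem]
      exact Ideal.mem_map_of_mem _ hfJ

theorem isEffectiveCartier_of_stalkCartier [IsLocallyNoetherian T] {I : X.IdealSheafData}
    {g : T ⟶ X} (h : StalkCartier I g) : IsEffectiveCartier (I.comap g) := by
  intro t
  obtain ⟨c, hc, hI⟩ := h t
  obtain ⟨U, hU, ht, -⟩ := exists_isAffineOpen_mem_and_subset (U := ⊤) (x := t) trivial
  rw [cut_comp, cut_fromSpecStalk _ hU t ht] at hI
  let _ : Algebra Γ(T, U) (T.presheaf.stalk t) := (T.presheaf.germ U t ht).hom.toAlgebra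
  have : IsLocalization.AtPrime (T.presheaf.stalk t) (hU.primeIdealOf ⟨t, ht⟩).asIdeal :=
      hU.isLocalization_stalk ⟨t, ht⟩
  have : IsNoetherianRing Γ(T, U) := IsLocallyNoetherian.component_noetherian ⟨U, hU⟩
  obtain ⟨a, ha, f, hf⟩ := exists_away_principal (S := T.presheaf.stalk t)
    (hU.primeIdealOf ⟨t, ht⟩).asIdeal ((I.comap g).ideal ⟨U, hU⟩) hc hI
  have := hU.isLocalization_basicOpen a
  obtain ⟨h1, h2⟩ := hf Γ(T, T.basicOpen a)
  refine ⟨⟨T.basicOpen a, hU.basicOpen a⟩, ?_, _, h1, ?_⟩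
  · rw [T.mem_basicOpen a t ht]
    exact IsLocalization.map_units (T.presheaf.stalk t)
      (⟨a, ha⟩ : (hU.primeIdealOf ⟨t, ht⟩).asIdeal.primeCompl)
  · rw [← h2]
    exact ((I.comap g).map_ideal_basicOpen ⟨U, hU⟩ a).symm

/-- Uniqueness over local rings gives uniqueness of lifts over any scheme. Lifts over local rings
spread out to open neighbourhoods, and by uniqueness these local lifts glue. -/
theorem isBlowup_of_local {Z : Scheme.{0}} (p : B ⟶ X) (i : Z ⟶ X) [hi : IsClosedImmersion i]
    [LocallyOfFinitePresentation p] [IsLocallyNoetherian B] (hc : StalkCartier i.ker p)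
    (hl : ∀ (A : CommRingCat.{0}) [IsLocalRing A] (x : Spec A ⟶ X) (c : A), c ∈ nonZeroDivisors A →
      cut i.ker x = Ideal.span {c} → ∃! y : Spec A ⟶ B, y ≫ p = x) : IsBlowup p i where
  isClosedImmersion := hi
  isEffectiveCartier := isEffectiveCartier_of_stalkCartier hc
  existsUnique_lift T g hg := by
    have huniq {T' : Scheme.{0}} (g' : T' ⟶ X) (hg' : StalkCartier i.ker g') (h h' : T' ⟶ B)
        (e : h ≫ p = g') (e' : h' ≫ p = g') : h = h' := by
      refine hom_ext_of_fromSpecStalk fun t => ?_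
      obtain ⟨c, hc, hI⟩ := hg' t
      exact (hl _ _ c hc hI).unique (by rw [Category.assoc, e]) (by rw [Category.assoc, e'])
    have hs := stalkCartier_of_isEffectiveCartier hg
    have hex (t : T) : ∃ (S : CommRingCat.{0}) (j : Spec S ⟶ T) (h : Spec S ⟶ B),
        IsOpenImmersion j ∧ t ∈ Set.range j ∧ h ≫ p = j ≫ g := by
      obtain ⟨c, hc, hI⟩ := hs t
      obtain ⟨y, hy, -⟩ := hl _ _ c hc hI
      exact exists_spread_out p g t y hy
    choose S j h hj ht hh using hex
    let 𝓤 : T.OpenCover := Scheme.Cover.mkOfCovers (P := @IsOpenImmersion) T (fun t => Spec (S t)) j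
      (fun t => ⟨t, ht t⟩) hj
    have hglue : ∀ a b : T, Limits.pullback.fst (j a) (j b) ≫ h a =
        Limits.pullback.snd (j a) (j b) ≫ h b := by
      intro a b
      have := hj a
      have := hj b
      refine huniq (Limits.pullback.fst (j a) (j b) ≫ j a ≫ g) ?_ _ _ ?_ ?_
      · rw [← Category.assoc]
        exact hs.comp (Limits.pullback.fst (j a) (j b) ≫ j a)
      · rw [Category.assoc, hh]
      · rw [Category.assoc, hh, Limits.pullback.condition_assoc]
    refine ⟨Scheme.Cover.glueMorphisms 𝓤 h hglue, ?_, fun h' e' => ?_⟩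
    · refine Scheme.Cover.hom_ext 𝓤 _ _ fun t => ?_
      exact (Scheme.Cover.ι_glueMorphisms_assoc 𝓤 h hglue t p).trans (hh t)
    · refine huniq g hs _ _ e' ?_
      refine Scheme.Cover.hom_ext 𝓤 _ _ fun t => ?_
      exact (Scheme.Cover.ι_glueMorphisms_assoc 𝓤 h hglue t p).trans (hh t)

end

section

/-! ### Two blow-ups with the same total space -/

variable {B X Y Z W S T : Scheme.{0}}

theorem isEffectiveCartier_top : IsEffectiveCartier (⊤ : X.IdealSheafData) := by
  intro x
  obtain ⟨U, hU, hx, -⟩ := exists_isAffineOpen_mem_and_subset (U := ⊤) (x := x) trivial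
  refine ⟨⟨U, hU⟩, hx, 1, one_mem _, ?_⟩
  rw [Ideal.span_singleton_one]
  rfl

/-- If the divisor contained a nonempty basic open set of a function `a`, then `a * f` would be
nilpotent; as the local equation `f` is a nonzerodivisor, `a` would be nilpotent and its basic open
set empty. -/
theorem IsEffectiveCartier.dense_compl_support {I : X.IdealSheafData} (h : IsEffectiveCartier I) :
    Dense ((I.support : Set X)ᶜ) := by
  rw [dense_iff_inter_open]
  rintro O hO ⟨x, hx⟩
  obtain ⟨U, hxU, f, hf, hI⟩ := h x
  obtain ⟨a, ha, hxa⟩ := U.2.exists_basicOpen_le (V := ⟨O, hO⟩) ⟨x, hx⟩ hxU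
  by_contra hemp
  rw [Set.not_nonempty_iff_eq_empty] at hemp
  have hemp' : X.basicOpen (a * f) = ⊥ := by
    rw [eq_bot_iff, X.basicOpen_mul]
    rintro y ⟨hya, hyf⟩
    have hyU : y ∈ U.1 := X.basicOpen_le _ hya
    have : y ∈ O ∩ (I.support : Set X)ᶜ := by
      refine ⟨ha hya, fun hy => ?_⟩
      have := (Scheme.IdealSheafData.mem_support_iff_of_mem hyU).1 hy
      rw [hI, Scheme.zeroLocus_span, Scheme.zeroLocus_singleton] at this
      exact this hyf
    rw [hemp] at this
    exact this
  have h2 : IsNilpotent (a * f) :=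
    (Scheme.isNilpotent_iff_basicOpen_eq_bot_of_isCompact U.2.isCompact _).2 hemp'
  obtain ⟨n, hn⟩ := h2
  rw [mul_pow] at hn
  have h3 : a ^ n = 0 := (mem_nonZeroDivisors_iff_right.1 (pow_mem hf n)) _ hn
  have h4 : X.basicOpen a = ⊥ := (Scheme.isNilpotent_iff_basicOpen_eq_bot_of_isCompact U.2.isCompact _).1 ⟨n, h3⟩
  rw [h4] at hxa
  exact hxa

theorem support_comap_ker (i : Z ⟶ X) [IsClosedImmersion i] (g : T ⟶ X) :
    ((i.ker.comap g).support : Set T) = g ⁻¹' (Set.range i) := by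
  rw [Scheme.IdealSheafData.support_comap]
  rw [TopologicalSpace.Closeds.coe_preimage, Scheme.Hom.support_ker]
  exact congrArg _ (IsClosed.closure_eq i.isClosedEmbedding.isClosed_range)

theorem isEffectiveCartier_of_disjoint (i : Z ⟶ X) [IsClosedImmersion i] (g : T ⟶ X)
    (h : ∀ t : T, g t ∉ Set.range i) : IsEffectiveCartier (i.ker.comap g) := by
  have : i.ker.comap g = ⊤ := by
    rw [← Scheme.IdealSheafData.support_eq_bot_iff]
    ext t
    rw [support_comap_ker]
    simpa using h t
  rw [this]
  exact isEffectiveCartier_top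

variable {p : B ⟶ X} {i : Z ⟶ X}

/-- The empty subscheme is an effective Cartier divisor, so the universal property applies to every
morphism avoiding the center. -/
theorem IsBlowup.hom_ext (hp : IsBlowup p i) {g g' : T ⟶ B} (h : g ≫ p = g' ≫ p)
    (hd : ∀ t : T, p (g t) ∉ Set.range i) : g = g' := by
  have := hp.isClosedImmersion
  refine (hp.existsUnique_lift T (g ≫ p) (isEffectiveCartier_of_disjoint i _ ?_)).unique rfl h.symm
  intro t
  rw [Scheme.Hom.comp_apply]
  exact hd t

theorem IsBlowup.exists_section (hp : IsBlowup p i) (U : X.Opens)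
    (hU : (U : Set X) = (Set.range i)ᶜ) : ∃ σ : U.toScheme ⟶ B, σ ≫ p = U.ι := by
  have := hp.isClosedImmersion
  refine (hp.existsUnique_lift _ U.ι (isEffectiveCartier_of_disjoint i _ ?_)).exists
  intro t ht
  have : (U.ι t : X) ∈ (U : Set X) := t.2
  rw [hU] at this
  exact this ht

/-- The inclusion of the complement of the center lifts to a section of `p`, which is inverse to `p`
over that complement by uniqueness of lifts. -/
theorem IsBlowup.isOpenImmersion (hp : IsBlowup p i) (V : B.Opens)
    (hV : ∀ b ∈ V, p b ∉ Set.range i) : IsOpenImmersion (V.ι ≫ p) := by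
  have := hp.isClosedImmersion
  let U : X.Opens := ⟨(Set.range i)ᶜ, i.isClosedEmbedding.isClosed_range.isOpen_compl⟩
  obtain ⟨σ, hσ⟩ := hp.exists_section U rfl
  have hσU (x : U.toScheme) : p (σ x) ∉ Set.range i := by
    have : (p (σ x)) = U.ι x := by rw [← Scheme.Hom.comp_apply, hσ]
    rw [this]; exact x.2
  have h1 : (p ∣_ U) ≫ σ = (p ⁻¹ᵁ U).ι := by
    refine hp.hom_ext ?_ ?_
    · rw [Category.assoc, hσ, morphismRestrict_ι]
    · intro t
      rw [Scheme.Hom.comp_apply]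
      exact hσU _
  have hle : Set.range σ ⊆ Set.range (p ⁻¹ᵁ U).ι := by
    rintro _ ⟨x, rfl⟩
    rw [Scheme.Opens.range_ι]
    exact hσU x
  have : IsIso (p ∣_ U) := by
    refine ⟨IsOpenImmersion.lift (p ⁻¹ᵁ U).ι σ hle, ?_, ?_⟩
    · rw [← cancel_mono (p ⁻¹ᵁ U).ι, Category.assoc, IsOpenImmersion.lift_fac, h1, Category.id_comp]
    · rw [← cancel_mono U.ι, Category.assoc, morphismRestrict_ι, IsOpenImmersion.lift_fac_assoc, hσ,
        Category.id_comp]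
  have hVU : V ≤ p ⁻¹ᵁ U := fun b hb => hV b hb
  have : V.ι ≫ p = B.homOfLE hVU ≫ (p ∣_ U) ≫ U.ι := by
    rw [morphismRestrict_ι, Scheme.homOfLE_ι_assoc]
  rw [this]
  infer_instance

/-- The complement of both exceptional divisors is dense in `B` and is embedded as an open subscheme
in `X` by `p` and in `Y` by `q`; dominance makes the images dense. The partial isomorphism between
these images is represented by `σ ≫ q`. -/
theorem IsBlowup.exists_partialIso {q : B ⟶ Y} {j : W ⟶ Y} (hp : IsBlowup p i) (hq : IsBlowup q j)
    [IsDominant p] [IsDominant q] (sX : X ⟶ S) (sY : Y ⟶ S) (hs : p ≫ sX = q ≫ sY) (U : X.Opens)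
    (hU : (U : Set X) = (Set.range i)ᶜ) :
    ∃ (hd : Dense (U : Set X)) (σ : U.toScheme ⟶ B), σ ≫ p = U.ι ∧
      (p ∣_ U) ≫ σ ≫ q = (p ⁻¹ᵁ U).ι ≫ q ∧
      ∃ f : X.PartialIso Y, f.IsOver sX sY ∧
        f.toRationalMap = (Scheme.PartialMap.mk U hd (σ ≫ q)).toRationalMap := by
  have := hp.isClosedImmersion
  have := hq.isClosedImmersion
  have mem_U (x : X) : x ∈ U ↔ x ∉ Set.range i := by
    rw [← SetLike.mem_coe, hU]; rfl
  obtain ⟨σ, hσ⟩ := hp.exists_section U hU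
  let V₁ : B.Opens := ⟨((i.ker.comap p).support : Set B)ᶜ, (i.ker.comap p).support.2.isOpen_compl⟩
  let V₂ : B.Opens := ⟨((j.ker.comap q).support : Set B)ᶜ, (j.ker.comap q).support.2.isOpen_compl⟩
  let V := V₁ ⊓ V₂
  have hV : Dense (V : Set B) :=
    hp.isEffectiveCartier.dense_compl_support.inter_of_isOpen_left
      hq.isEffectiveCartier.dense_compl_support V₁.2
  have hV1 (b : B) (hb : b ∈ V) : p b ∉ Set.range i := by
    have := hb.1
    change b ∉ ((i.ker.comap p).support : Set B) at this
    rwa [support_comap_ker] at this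
  have hV2 (b : B) (hb : b ∈ V) : q b ∉ Set.range j := by
    have := hb.2
    change b ∉ ((j.ker.comap q).support : Set B) at this
    rwa [support_comap_ker] at this
  have o1 := hp.isOpenImmersion V hV1
  have o2 := hq.isOpenImmersion V hV2
  have dV := Opens.isDominant_ι hV
  have d1 : Dense ((V.ι ≫ p).opensRange : Set X) := (V.ι ≫ p).denseRange
  have d2 : Dense ((V.ι ≫ q).opensRange : Set Y) := (V.ι ≫ q).denseRange
  have hle : (V.ι ≫ p).opensRange ≤ U := by
    rintro _ ⟨b, rfl⟩
    rw [mem_U, Scheme.Hom.comp_apply]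
    exact hV1 _ b.2
  have hd : Dense (U : Set X) := d1.mono hle
  refine ⟨hd, σ, hσ, ?_, ⟨(V.ι ≫ p).opensRange, d1, (V.ι ≫ q).opensRange, d2,
    (V.ι ≫ p).isoOpensRange.symm ≪≫ (V.ι ≫ q).isoOpensRange⟩, ?_, ?_⟩
  · rw [← Category.assoc]
    congr 1
    refine hp.hom_ext ?_ ?_
    · rw [Category.assoc, hσ, morphismRestrict_ι]
    · intro t
      rw [← Scheme.Hom.comp_apply, Category.assoc, hσ, Scheme.Hom.comp_apply, ← mem_U]
      exact ((p ∣_ U) t).2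
  · rw [Scheme.PartialIso.IsOver, ← cancel_epi (V.ι ≫ p).isoOpensRange.hom]
    simp [hs]
  · rw [Scheme.PartialMap.toRationalMap_eq_iff]
    refine ⟨(V.ι ≫ p).opensRange, d1, le_rfl, hle, ?_⟩
    change X.homOfLE (le_refl (V.ι ≫ p).opensRange) ≫ ((V.ι ≫ p).isoOpensRange.inv ≫
      (V.ι ≫ q).isoOpensRange.hom) ≫ (V.ι ≫ q).opensRange.ι = X.homOfLE hle ≫ σ ≫ q
    rw [← cancel_epi (V.ι ≫ p).isoOpensRange.hom]
    have : (V.ι ≫ p).isoOpensRange.hom ≫ X.homOfLE hle ≫ σ = V.ι := by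
      symm
      refine hp.hom_ext ?_ ?_
      · rw [Category.assoc, Category.assoc, hσ, Scheme.homOfLE_ι, Scheme.Hom.isoOpensRange_hom_ι]
      · intro t
        exact hV1 _ t.2
    have h3 : (V.ι ≫ p).isoOpensRange.hom ≫ X.homOfLE hle ≫ σ ≫ q = V.ι ≫ q := by
      simpa only [Category.assoc] using congrArg (· ≫ q) this
    simp [h3]

end

section

/-! ### Nonzerodivisors from derivations, and a criterion for blow-ups by points -/

/-- Differentiating `g ^ (k + 1) * x = 0` lowers the exponent, and inductively shows that `g`
divides `x`; this needs `k + 1` and `D g` to be units. An element annihilated by `g` is then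
divisible by every power of `g`, hence zero by Krull's intersection theorem. -/
theorem mem_nonZeroDivisors_of_derivation {A : Type*} [CommRing A] [IsNoetherianRing A]
    [IsLocalRing A] [Algebra ℚ A] (D : Derivation ℤ A A) (g : A) (hg : ¬ IsUnit g)
    (hD : IsUnit (D g)) : g ∈ nonZeroDivisors A := by
  have key (k : ℕ) : ∀ x, g ^ k * x = 0 → g ∣ x := by
    induction k with
    | zero => intro x hx; simp at hx; simp [hx]
    | succ k ih =>
      intro x hx
      have h1 : g ^ k * ((k + 1 : ℕ) * D g * x + g * D x) = 0 := by
        have := congrArg D hx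
        rw [D.leibniz, D.leibniz_pow, map_zero] at this
        simp only [smul_eq_mul, nsmul_eq_mul, Nat.add_sub_cancel] at this
        rw [← this]; ring
      have h2 : g ∣ (k + 1 : ℕ) * D g * x :=
        (dvd_add_left (Dvd.intro _ rfl)).1 (ih _ h1)
      have hu : IsUnit (((k + 1 : ℕ) : A) * D g) := by
        refine IsUnit.mul ?_ hD
        have : ((k + 1 : ℕ) : A) = algebraMap ℚ A ((k + 1 : ℕ) : ℚ) := by simp
        rw [this]
        exact (isUnit_iff_ne_zero.2 (by positivity)).map (algebraMap ℚ A)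
      exact hu.dvd_mul_left.1 h2
  rw [mem_nonZeroDivisors_iff_left]
  intro h hh
  have h1 (n : ℕ) : ∃ y, h = g ^ n * y ∧ g ^ (n + 1) * y = 0 := by
    induction n with
    | zero => exact ⟨h, by simp, by simpa using hh⟩
    | succ n ih =>
      obtain ⟨y, hy, hy0⟩ := ih
      obtain ⟨z, rfl⟩ := key _ y hy0
      exact ⟨z, by rw [hy]; ring, by rw [← hy0]; ring⟩
  have h2 : h ∈ ⨅ n, Ideal.span {g} ^ n := by
    rw [Ideal.mem_iInf]
    intro n
    obtain ⟨y, hy, -⟩ := h1 n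
    rw [Ideal.span_singleton_pow, Ideal.mem_span_singleton]
    exact ⟨y, hy⟩
  rwa [Ideal.iInf_pow_eq_bot_of_isLocalRing _ (by rwa [Ne, Ideal.span_singleton_eq_top]),
    Ideal.mem_bot] at h2

instance dualNumber_isLocalRing (A : Type*) [CommRing A] [IsLocalRing A] :
    IsLocalRing (DualNumber A) := by
  have : IsLocalHom (TrivSqZeroExt.fstHom A A A).toRingHom :=
    ⟨fun a ha => TrivSqZeroExt.isUnit_iff_isUnit_fst.2 ha⟩
  exact RingHom.domain_isLocalRing (TrivSqZeroExt.fstHom A A A).toRingHom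

/-- A section of the projection of the dual numbers is the same as a derivation `D`. The equality of
ideals gives `u = z₀ * D t + z₁ * t` for some `z₀`, `z₁`; if `t` is not a unit and `u` is, then `D
t` must be a unit. -/
theorem mem_nonZeroDivisors_of_section {A : Type*} [CommRing A] [IsNoetherianRing A]
    [IsLocalRing A] [Algebra ℚ A] (φ : A →+* DualNumber A) (hφ : ∀ a, (φ a).fst = a) (t u : A)
    (hu : IsUnit t ∨ IsUnit u)
    (h : Ideal.span {φ t} = Ideal.span {(TrivSqZeroExt.inl t + TrivSqZeroExt.inr u : DualNumber A)}) :
    t ∈ nonZeroDivisors A := by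
  by_cases ht : IsUnit t
  · exact ht.mem_nonZeroDivisors
  replace hu := hu.resolve_left ht
  let D : Derivation ℤ A A :=
    { toFun := fun a => (φ a).snd
      map_add' := fun a b => by simp
      map_smul' := fun n a => by simp
      map_one_eq_zero' := by simp
      leibniz' := fun a b => by
        simp [hφ, mul_comm] }
  refine mem_nonZeroDivisors_of_derivation D t ht ?_
  obtain ⟨z, hz⟩ := Ideal.mem_span_singleton'.1
    (h ▸ Ideal.mem_span_singleton_self _ :
      (TrivSqZeroExt.inl t + TrivSqZeroExt.inr u : DualNumber A) ∈ Ideal.span {φ t})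
  have h2 := congrArg TrivSqZeroExt.snd hz
  have hD : D t = (φ t).snd := rfl
  simp [hφ, ← hD] at h2
  by_contra hDt
  have : u ∈ IsLocalRing.maximalIdeal A := by
    rw [← h2]
    exact Ideal.add_mem _ (Ideal.mul_mem_left _ _ ((IsLocalRing.mem_maximalIdeal _).2 hDt))
      (Ideal.mul_mem_left _ _ ((IsLocalRing.mem_maximalIdeal _).2 ht))
  exact (IsLocalRing.mem_maximalIdeal _).1 this hu

/-- A map from a local spectrum sending the closed point to `b` factors through the local ring at
`b`. Since its restriction along `ρ` is the canonical point, the resulting ring map is a section of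
`ρ`. -/
theorem exists_section_of_stalk {B : Scheme.{0}} (b : B) {R : CommRingCat.{0}} [IsLocalRing R]
    (ρ : R ⟶ B.presheaf.stalk b) (y : Spec R ⟶ B)
    (h : Spec.map ρ ≫ y = B.fromSpecStalk b) (hρ : IsLocalHom ρ.hom) :
    ∃ φ : B.presheaf.stalk b ⟶ R, φ ≫ ρ = 𝟙 _ ∧ Spec.map φ ≫ B.fromSpecStalk b = y := by
  have hb : y (IsLocalRing.closedPoint R) = b := by
    have h1 := congrArg (fun g : Spec (B.presheaf.stalk b) ⟶ B =>
      g (IsLocalRing.closedPoint (B.presheaf.stalk b))) h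
    simp only [Scheme.fromSpecStalk_closedPoint] at h1
    exact (congrArg y (IsLocalRing.comap_closedPoint ρ.hom).symm).trans h1
  obtain ⟨φ, hφ⟩ : ∃ φ : B.presheaf.stalk b ⟶ R, Spec.map φ ≫ B.fromSpecStalk b = y := by
    subst hb
    exact ⟨_, Scheme.Spec_stalkClosedPointTo_fromSpecStalk y⟩
  refine ⟨φ, ?_, hφ⟩
  apply Spec.map_injective
  rw [← cancel_mono (B.fromSpecStalk b), Spec.map_comp, Category.assoc, hφ, h, Spec.map_id,
    Category.id_comp]

variable {B X Z : Over (Spec (.of ℂ))}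

/-- The closed subscheme `Z` of `X` is pulled back by `x` to the zero locus of `c`. -/
def CutBy (i : Z ⟶ X) {A : CommAlgCat.{0} ℂ} (x : specOver A ⟶ X) (c : A) : Prop :=
  ∀ (C : CommAlgCat.{0} ℂ) (φ : A ⟶ C), (∃ y, y ≫ i = specOverMap φ ≫ x) ↔ φ.hom c = 0

theorem exists_over_factor (i : Z ⟶ X) [IsClosedImmersion i.left] {A : CommAlgCat.{0} ℂ}
    (x : specOver A ⟶ X) : (∃ y, y ≫ i = x) ↔ cut i.left.ker (pt x) = ⊥ := by
  rw [← exists_comp_eq_iff_cut i.left (pt x)]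
  constructor
  · rintro ⟨y, rfl⟩
    exact ⟨y.left, rfl⟩
  · rintro ⟨y, hy⟩
    refine ⟨Over.homMk y ?_, Over.OverMorphism.ext hy⟩
    exact (congrArg (y ≫ ·) (Over.w i).symm).trans ((Category.assoc _ _ _).symm.trans
      ((congrArg (· ≫ X.hom) hy).trans (Over.w x)))

theorem pt_specOverMap {A C : CommAlgCat.{0} ℂ} (φ : A ⟶ C) (x : specOver A ⟶ X) :
    pt (specOverMap φ ≫ x) = Spec.map (CommRingCat.ofHom φ.hom.toRingHom) ≫ pt x := rfl

theorem factor_iff_cut_le (i : Z ⟶ X) [IsClosedImmersion i.left] {A C : CommAlgCat.{0} ℂ}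
    (x : specOver A ⟶ X) (φ : A ⟶ C) : (∃ y, y ≫ i = specOverMap φ ≫ x) ↔
      cut i.left.ker (pt x) ≤ RingHom.ker φ.hom.toRingHom := by
  rw [exists_over_factor, pt_specOverMap, cut_comp_eq_bot_iff]
  rfl

theorem cutBy_iff (i : Z ⟶ X) [IsClosedImmersion i.left] {A : CommAlgCat.{0} ℂ}
    (x : specOver A ⟶ X) (c : A) : CutBy i x c ↔ cut i.left.ker (pt x) = Ideal.span {c} := by
  constructor
  · intro h
    have h' (C : CommAlgCat.{0} ℂ) (φ : A ⟶ C) :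
        cut i.left.ker (pt x) ≤ RingHom.ker φ.hom.toRingHom ↔ φ.hom c = 0 := by
      rw [← factor_iff_cut_le]; exact h C φ
    refine le_antisymm ?_ ?_
    · have := (h' (CommAlgCat.of ℂ (A ⧸ Ideal.span {c}))
        (CommAlgCat.ofHom (Ideal.Quotient.mkₐ ℂ (Ideal.span {c})))).2
        (Ideal.Quotient.eq_zero_iff_mem.2 (Ideal.mem_span_singleton_self c))
      exact fun a ha => Ideal.Quotient.eq_zero_iff_mem.1 (this ha)
    · rw [Ideal.span_singleton_le_iff_mem]
      let J : Ideal A := cut i.left.ker (pt x)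
      have := (h' (CommAlgCat.of ℂ (A ⧸ J)) (CommAlgCat.ofHom (Ideal.Quotient.mkₐ ℂ J))).1
        (fun a ha => Ideal.Quotient.eq_zero_iff_mem.2 ha)
      exact Ideal.Quotient.eq_zero_iff_mem.1 this
  · intro h C φ
    rw [factor_iff_cut_le, h]
    exact (Ideal.span_singleton_le_iff_mem _).trans RingHom.mem_ker

/-- The restriction of a first order deformation. -/
def dualFst (A : CommAlgCat.{0} ℂ) : CommAlgCat.of ℂ (DualNumber A) ⟶ A :=
  CommAlgCat.ofHom (X := DualNumber A) (Y := A) (TrivSqZeroExt.fstHom ℂ A A)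

/-- The hypothesis `hc` is applied to the canonical points of the local rings of `B`. There a
deformation along which the equation `t` moves to first order by a unit produces a derivation
showing that `t` is a nonzerodivisor; where `t` is a unit nothing is needed. -/
theorem isBlowup_of_points (p : B ⟶ X) (i : Z ⟶ X) [IsClosedImmersion i.left]
    [LocallyOfFiniteType B.hom] [LocallyOfFiniteType X.hom]
    (hl : ∀ (A : CommAlgCat.{0} ℂ) [IsLocalRing A] (x : specOver A ⟶ X) (c : A),
      c ∈ nonZeroDivisors A → CutBy i x c → ∃! y : specOver A ⟶ B, y ≫ p = x)
    (hc : ∀ (A : CommAlgCat.{0} ℂ) [IsLocalRing A] (x : specOver A ⟶ B), ∃ t : A,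
      CutBy i (x ≫ p) t ∧ (IsUnit t ∨ ∃ (y : specOver (.of ℂ (DualNumber A)) ⟶ B) (u : A),
        specOverMap (dualFst A) ≫ y = x ∧ IsUnit u ∧
        CutBy i (y ≫ p) (TrivSqZeroExt.inl t + TrivSqZeroExt.inr u : DualNumber A))) :
    IsBlowup p.left i.left := by
  have hX : IsLocallyNoetherian X.left := LocallyOfFiniteType.isLocallyNoetherian X.hom
  have hB : IsLocallyNoetherian B.left := LocallyOfFiniteType.isLocallyNoetherian B.hom
  have hp : LocallyOfFiniteType p.left := by
    have : LocallyOfFiniteType (p.left ≫ X.hom) := by rw [Over.w]; infer_instance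
    exact locallyOfFiniteType_of_comp p.left X.hom
  have hp' : LocallyOfFinitePresentation p.left :=
    LocallyOfFinitePresentation.iff_locallyOfFiniteType.2 hp
  refine isBlowup_of_local p.left i.left ?_ ?_
  · intro b
    let A := algOf (X := B) (B.left.fromSpecStalk b)
    let x : specOver A ⟶ B := overOf (B.left.fromSpecStalk b)
    have hA : IsLocalRing A := inferInstanceAs (IsLocalRing (B.left.presheaf.stalk b))
    have hN : IsNoetherianRing A := inferInstanceAs (IsNoetherianRing (B.left.presheaf.stalk b))
    obtain ⟨t, ht, h⟩ := hc A x
    have ht' := (cutBy_iff i _ t).1 ht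
    refine ⟨t, ?_, ht'⟩
    let _ : Algebra ℚ A := Algebra.compHom A (algebraMap ℚ ℂ)
    obtain h | ⟨y, u, hy, hu, hyc⟩ := h
    · exact IsUnit.mem_nonZeroDivisors (M₀ := A) h
    · let ρ : CommRingCat.of (DualNumber A) ⟶ B.left.presheaf.stalk b :=
        CommRingCat.ofHom (TrivSqZeroExt.fstHom ℂ A A).toRingHom
      have hρ : IsLocalHom ρ.hom := ⟨fun a ha => TrivSqZeroExt.isUnit_iff_isUnit_fst.2 ha⟩
      obtain ⟨φ, hφ, hφy⟩ := exists_section_of_stalk b (R := .of (DualNumber A)) ρ (pt y)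
        (congrArg CommaMorphism.left hy) hρ
      refine mem_nonZeroDivisors_of_section (A := A) φ.hom
        (fun a => congrArg (fun g => g.hom a) hφ) t u (Or.inr hu) ?_
      have h1 := (cutBy_iff i _ _).1 hyc
      rw [← h1]
      have h2 : pt (y ≫ p) = Spec.map φ ≫ B.left.fromSpecStalk b ≫ p.left := by
        rw [← Category.assoc, hφy]; rfl
      rw [h2, ← cut_map]
      refine Eq.trans ?_ (congrArg (Ideal.map φ.hom) ht').symm
      exact (Ideal.map_span φ.hom {t}).symm ▸ congrArg Ideal.span (Set.image_singleton).symm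
  · intro A _ x c hcA hx
    have hA : IsLocalRing (algOf (X := X) x) := ‹IsLocalRing A›
    obtain ⟨y, hy, huniq⟩ := hl (algOf (X := X) x) (overOf x) c hcA ((cutBy_iff i _ _).2 hx)
    refine ⟨y.left, congrArg CommaMorphism.left hy, fun y' hy' => ?_⟩
    have hw : y' ≫ B.hom = (specOver (algOf (X := X) x)).hom := by
      rw [← Over.w p, ← Category.assoc, hy']
      exact Over.w (overOf x)
    exact congrArg CommaMorphism.left (huniq (Over.homMk y' hw) (Over.OverMorphism.ext hy'))

end

section

/-! ### Closed conditions on families of subspaces -/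

section Algebra

variable {W W' : Type} [AddCommGroup W] [Module ℂ W] [AddCommGroup W'] [Module ℂ W'] {k : ℕ}
variable {A B : Type} [CommRing A] [Algebra ℂ A] [CommRing B] [Algebra ℂ B]

/-- Change of scalars of a linear functional. -/
def extDual (φ : A →ₐ[ℂ] B) (l : A ⊗[ℂ] W →ₗ[A] A) : B ⊗[ℂ] W →ₗ[B] B :=
  LinearMap.liftBaseChange B
    { toFun := fun w => φ (l (1 ⊗ₜ w))
      map_add' := fun w w' => by rw [TensorProduct.tmul_add, map_add, map_add]
      map_smul' := fun c w => by
        rw [TensorProduct.tmul_smul, ← algebraMap_smul A c, map_smul, smul_eq_mul, map_mul,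
          AlgHom.commutes, RingHom.id_apply, Algebra.smul_def] }

theorem extDual_bc (φ : A →ₐ[ℂ] B) (l : A ⊗[ℂ] W →ₗ[A] A) (v : A ⊗[ℂ] W) :
    extDual φ l (bc φ v) = φ (l v) := by
  induction v with
  | zero => simp
  | tmul a w =>
    have : (a ⊗ₜ[ℂ] w : A ⊗[ℂ] W) = a • (1 ⊗ₜ w) := by simp [TensorProduct.smul_tmul']
    rw [this, bc_smul, map_smul, map_smul, smul_eq_mul, smul_eq_mul, map_mul]
    simp [extDual]
  | add x y hx hy => simp only [map_add, hx, hy]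

theorem baseChange_bc (φ : A →ₐ[ℂ] B) (g : W →ₗ[ℂ] W') (v : A ⊗[ℂ] W) :
    g.baseChange B (bc φ v) = bc φ (g.baseChange A v) := by
  induction v with
  | zero => simp
  | tmul a w => simp
  | add x y hx hy => simp only [map_add, hx, hy]

theorem form_bc (φ : A →ₐ[ℂ] B) (a : LinearMap.BilinForm ℂ W) (x y : A ⊗[ℂ] W) :
    a.baseChange B (bc φ x) (bc φ y) = φ (a.baseChange A x y) := by
  induction x with
  | zero => simp
  | tmul r w =>
    induction y with
    | zero => simp
    | tmul s w' => simp [Algebra.smul_def, mul_comm]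
    | add x y hx hy => simp only [map_add, hx, hy]
  | add x y hx hy => simp only [map_add, LinearMap.add_apply, hx, hy]

theorem extend_bc (φ : A →ₐ[ℂ] B) (T : W →ₗ[ℂ] W →ₗ[ℂ] W →ₗ[ℂ] ℂ) (x y z : A ⊗[ℂ] W) :
    extend B T (bc φ x) (bc φ y) (bc φ z) = φ (extend A T x y z) := by
  induction x with
  | zero => simp
  | tmul r w =>
    induction y with
    | zero => simp
    | tmul s w' =>
      induction z with
      | zero => simp
      | tmul u w'' => simp [extend_tmul]
      | add x y hx hy => simp only [map_add, hx, hy]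
    | add x y hx hy => simp only [map_add, LinearMap.add_apply, hx, hy]
  | add x y hx hy => simp only [map_add, LinearMap.add_apply, hx, hy]

theorem map_le_of_bc_mem (φ : A →ₐ[ℂ] B) (N : Module.Grassmannian A (A ⊗[ℂ] W) k)
    {S : Submodule B (B ⊗[ℂ] W)} (h : ∀ v ∈ N.toSubmodule, bc φ v ∈ S) :
    (Module.Grassmannian.map φ N).toSubmodule ≤ S := by
  rw [map_toSubmodule_eq_span, Submodule.span_le]
  rintro _ ⟨v, hv, rfl⟩
  exact h v hv

theorem forall_mem_map_iff (φ : A →ₐ[ℂ] B) (N : Module.Grassmannian A (A ⊗[ℂ] W) k)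
    {M : Type*} [AddCommGroup M] [Module B M] (l : B ⊗[ℂ] W →ₗ[B] M) :
    (∀ v ∈ (Module.Grassmannian.map φ N).toSubmodule, l v = 0) ↔
      ∀ v ∈ N.toSubmodule, l (bc φ v) = 0 :=
  ⟨fun h _ hv => h _ (bc_mem_map φ N hv), fun h => map_le_of_bc_mem φ N (S := LinearMap.ker l) h⟩

/-- A family of subspaces is the common kernel of a system of functionals with a partial dual
system of vectors. -/
theorem exists_frame (N : Module.Grassmannian A (A ⊗[ℂ] W) k) :
    ∃ (n : ℕ) (l : Fin n → A ⊗[ℂ] W →ₗ[A] A) (m : Fin n → A ⊗[ℂ] W),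
      (∀ v ∈ N.toSubmodule, ∀ i, l i v = 0) ∧
      ∀ v, v - ∑ i, l i v • m i ∈ N.toSubmodule := by
  obtain ⟨n, f, g, hf, hg, hfg⟩ :=
    Module.Finite.exists_comp_eq_id_of_projective A ((A ⊗[ℂ] W) ⧸ N.toSubmodule)
  choose m hm using fun i => N.toSubmodule.mkQ_surjective (f (Pi.single i 1))
  refine ⟨n, fun i => LinearMap.proj i ∘ₗ g ∘ₗ N.toSubmodule.mkQ, m, ?_, ?_⟩
  · intro v hv i
    have : N.toSubmodule.mkQ v = 0 := by simpa using hv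
    simp only [LinearMap.comp_apply, this, map_zero]
  · intro v
    rw [← Submodule.Quotient.mk_eq_zero, ← Submodule.mkQ_apply, map_sub, map_sum, sub_eq_zero]
    simp only [map_smul, hm]
    rw [← LinearMap.id_apply (R := A) (N.toSubmodule.mkQ v), ← hfg, LinearMap.comp_apply]
    conv_lhs => rw [← LinearMap.sum_single_apply (fun _ => A) (g (N.toSubmodule.mkQ v))]
    rw [map_sum]
    refine Finset.sum_congr rfl fun i _ => ?_
    rw [← map_smul]
    congr 1
    ext j
    by_cases h : j = i
    · subst h; simp
    · simp [h]

/-- Subtracting from `v` its expansion in a frame of the quotient lands in `N`, and the coefficients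
of the expansion die in `B`. With the converse below, membership in a family is seen to be a closed
condition. -/
theorem bc_mem_map_of_functional (φ : A →ₐ[ℂ] B) (N : Module.Grassmannian A (A ⊗[ℂ] W) k)
    (v : A ⊗[ℂ] W)
    (h : ∀ l : A ⊗[ℂ] W →ₗ[A] A, (∀ x ∈ N.toSubmodule, l x = 0) → φ (l v) = 0) :
    bc φ v ∈ (Module.Grassmannian.map φ N).toSubmodule := by
  obtain ⟨n, l, m, hl, hm⟩ := exists_frame N
  have h1 := bc_mem_map φ N (hm v)
  rw [map_sub, map_sum] at h1
  simp only [bc_smul, h (l _) (fun x hx => hl x hx _), zero_smul, Finset.sum_const_zero,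
    sub_zero] at h1
  exact h1

theorem functional_of_bc_mem_map (φ : A →ₐ[ℂ] B) (N : Module.Grassmannian A (A ⊗[ℂ] W) k)
    (v : A ⊗[ℂ] W) (hv : bc φ v ∈ (Module.Grassmannian.map φ N).toSubmodule)
    (l : A ⊗[ℂ] W →ₗ[A] A) (hl : ∀ x ∈ N.toSubmodule, l x = 0) : φ (l v) = 0 := by
  rw [← extDual_bc]
  refine (forall_mem_map_iff φ N (extDual φ l)).2 (fun x hx => ?_) _ hv
  rw [extDual_bc, hl x hx, map_zero]

end Algebra

/-- A condition on the algebras over `A` that holds precisely over the quotients of `A ⧸ I`. -/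
def IsClosedCond {A : CommAlgCat.{0} ℂ} (Q : ∀ (B : CommAlgCat.{0} ℂ), (A ⟶ B) → Prop) : Prop :=
  ∃ I : Ideal A, ∀ (B : CommAlgCat.{0} ℂ) (φ : A ⟶ B), Q B φ ↔ I ≤ RingHom.ker φ.hom.toRingHom

section Closed

variable {A : CommAlgCat.{0} ℂ} {Q Q' : ∀ (B : CommAlgCat.{0} ℂ), (A ⟶ B) → Prop}

theorem IsClosedCond.congr (h : IsClosedCond Q) (hQ : ∀ B φ, Q' B φ ↔ Q B φ) :
    IsClosedCond Q' := by
  obtain ⟨I, hI⟩ := h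
  exact ⟨I, fun B φ => (hQ B φ).trans (hI B φ)⟩

theorem isClosedCond_eq_zero (a : A) : IsClosedCond (A := A) fun _ φ => φ.hom a = 0 :=
  ⟨Ideal.span {a}, fun _ _ => ((Ideal.span_singleton_le_iff_mem _).trans RingHom.mem_ker).symm⟩

theorem isClosedCond_forall {ι : Sort*} {Q : ι → ∀ (B : CommAlgCat.{0} ℂ), (A ⟶ B) → Prop}
    (h : ∀ i, IsClosedCond (Q i)) : IsClosedCond fun B φ => ∀ i, Q i B φ := by
  choose I hI using h
  exact ⟨⨆ i, I i, fun B φ => by simp only [hI, iSup_le_iff]⟩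

theorem IsClosedCond.and (h : IsClosedCond Q) (h' : IsClosedCond Q') :
    IsClosedCond fun B φ => Q B φ ∧ Q' B φ := by
  obtain ⟨I, hI⟩ := h
  obtain ⟨I', hI'⟩ := h'
  exact ⟨I ⊔ I', fun B φ => by simp only [hI, hI', sup_le_iff]⟩

variable {W : Type} [AddCommGroup W] [Module ℂ W] {k : ℕ}

theorem isClosedCond_mem (N : Module.Grassmannian A (A ⊗[ℂ] W) k) (v : A ⊗[ℂ] W) :
    IsClosedCond (A := A) fun _ φ =>
      bc φ.hom v ∈ (Module.Grassmannian.map φ.hom N).toSubmodule := by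
  refine (isClosedCond_forall fun l : A ⊗[ℂ] W →ₗ[A] A => isClosedCond_forall
    fun _ : ∀ x ∈ N.toSubmodule, l x = 0 => isClosedCond_eq_zero (l v)).congr fun B φ => ?_
  exact ⟨fun h l hl => functional_of_bc_mem_map φ.hom N v h l hl,
    fun h => bc_mem_map_of_functional φ.hom N v h⟩

/-- Membership in a family of subspaces can be checked over the localizations. -/
theorem mem_of_localizations (N : Module.Grassmannian A (A ⊗[ℂ] W) k) (v : A ⊗[ℂ] W)
    (h : ∀ (B : CommAlgCat.{0} ℂ) (φ : A ⟶ B), IsLocalRing B →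
      bc φ.hom v ∈ (Module.Grassmannian.map φ.hom N).toSubmodule) : v ∈ N.toSubmodule := by
  obtain ⟨n, l, m, hl, hm⟩ := exists_frame N
  have key (i : Fin n) : l i v = 0 := by
    refine eq_zero_of_localization _ fun J _ => ?_
    exact functional_of_bc_mem_map _ N v
      (h (.of ℂ (Localization.AtPrime J))
      (CommAlgCat.ofHom (Algebra.ofId A (Localization.AtPrime J) |>.restrictScalars ℂ))
      (inferInstanceAs (IsLocalRing (Localization.AtPrime J)))) (l i) (fun x hx => hl x hx i)
  have := hm v
  simpa [key] using this

end Closed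

end

section

/-! ### Closed subschemes of moduli schemes, incidence schemes -/

variable {W : Type} [AddCommGroup W] [Module ℂ W] {k : ℕ} {X Y : Over (Spec (.of ℂ))}

theorem Represents.sub_specOverMap {P : Condition W k} (r : Represents X P)
    {A B : CommAlgCat.{0} ℂ} (φ : A ⟶ B) (x : specOver A ⟶ X) :
    r.sub (specOverMap φ ≫ x) = (Module.Grassmannian.map φ.hom (r.points A x).1).toSubmodule :=
  congrArg _ (r.natural φ x)

theorem Represents.ext {P : Condition W k} (r : Represents X P) {A : CommAlgCat.{0} ℂ}
    {x y : specOver A ⟶ X} (h : r.sub x = r.sub y) : x = y :=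
  (r.points A).injective (Subtype.ext (Module.Grassmannian.ext h))

theorem Represents.ext_of_le {P : Condition W k} (r : Represents X P) {A : CommAlgCat.{0} ℂ}
    {x y : specOver A ⟶ X} (h : r.sub x ≤ r.sub y) : x = y :=
  (r.points A).injective (Subtype.ext (Grassmannian.eq_of_le h))

theorem locallyOfFiniteType_of_closed {Z : Over (Spec (.of ℂ))} (i : Z ⟶ X)
    [IsClosedImmersion i.left] [LocallyOfFiniteType X.hom] : LocallyOfFiniteType Z.hom := by
  rw [← Over.w i]; infer_instance

/-- A closed condition on the subspaces parametrized by `X` defines a closed subscheme. -/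
theorem Represents.exists_closed {P P' : Condition W k} (r : Represents X P)
    [LocallyOfFiniteType X.hom] (hP : ∀ A, P' A ⊆ P A)
    (h : ∀ (A : CommAlgCat.{0} ℂ) (N : Module.Grassmannian A (A ⊗[ℂ] W) k), N ∈ P A →
      IsClosedCond (A := A) fun B φ => Module.Grassmannian.map φ.hom N ∈ P' B) :
    ∃ (Z : Over (Spec (.of ℂ))) (i : Z ⟶ X) (r' : Represents Z P'), IsClosedImmersion i.left ∧
      LocallyOfFiniteType Z.hom ∧
      (∀ (A : CommAlgCat.{0} ℂ) (x : specOver A ⟶ Z), r.sub (x ≫ i) = r'.sub x) ∧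
      ∀ (A : CommAlgCat.{0} ℂ) (x : specOver A ⟶ X),
        (∃ y, y ≫ i = x) ↔ (r.points A x).1 ∈ P' A := by
  obtain ⟨Z, i, hi, hZ⟩ := CayleyGrassmannian.exists_closed (X := X)
    (fun A x => (r.points A x).1 ∈ P' A) (fun A x => by
      refine (h A (r.points A x).1 (r.points A x).2).congr fun B φ => ?_
      rw [r.natural])
  have hm : Mono i := by
    have := hi
    exact Over.mono_of_mono_left i
  let f (A : CommAlgCat.{0} ℂ) (x : specOver A ⟶ Z) : P' A :=
    ⟨(r.points A (x ≫ i)).1, (hZ A _).2 ⟨x, rfl⟩⟩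
  have hf (A) : Function.Bijective (f A) := by
    refine ⟨fun x y hxy => ?_, fun N => ?_⟩
    · have : x ≫ i = y ≫ i := (r.points A).injective (Subtype.ext
        (congrArg (fun N : P' A => N.1) hxy))
      exact (cancel_mono i).1 this
    · let x := (r.points A).symm ⟨N.1, hP A N.2⟩
      have hx : (r.points A x).1 = N.1 := by rw [Equiv.apply_symm_apply]
      obtain ⟨y, hy⟩ := (hZ A x).1 (hx ▸ N.2)
      exact ⟨y, Subtype.ext (by
        change (r.points A (y ≫ i)).1 = N.1
        rw [hy, hx])⟩
  refine ⟨Z, i, ⟨fun A => Equiv.ofBijective (f A) (hf A), fun {A B} φ x => ?_⟩, hi,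
    locallyOfFiniteType_of_closed i, fun A x => rfl, fun A x => (hZ A x).symm⟩
  change (r.points B ((specOverMap φ ≫ x) ≫ i)).1 = _
  rw [Category.assoc, r.natural]
  rfl

/-- A closed relation between the points of `X` and of `Y` defines an incidence scheme. -/
theorem exists_incidence [LocallyOfFiniteType X.hom] [LocallyOfFiniteType Y.hom]
    (𝒬 : ∀ A : CommAlgCat.{0} ℂ, (specOver A ⟶ X) → (specOver A ⟶ Y) → Prop)
    (h : ∀ (A : CommAlgCat.{0} ℂ) x y,
      IsClosedCond (A := A) fun B φ => 𝒬 B (specOverMap φ ≫ x) (specOverMap φ ≫ y)) :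
    ∃ (B : Over (Spec (.of ℂ))) (p : B ⟶ X) (q : B ⟶ Y), LocallyOfFiniteType B.hom ∧
      (∀ (A : CommAlgCat.{0} ℂ) (b : specOver A ⟶ B), 𝒬 A (b ≫ p) (b ≫ q)) ∧
      (∀ A x y, 𝒬 A x y → ∃ b : specOver A ⟶ B, b ≫ p = x ∧ b ≫ q = y) ∧
      ∀ (A : CommAlgCat.{0} ℂ) (b b' : specOver A ⟶ B), b ≫ p = b' ≫ p → b ≫ q = b' ≫ q →
        b = b' := by
  let P : Over (Spec (.of ℂ)) := Over.mk (Limits.pullback.fst X.hom Y.hom ≫ X.hom)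
  let p₀ : P ⟶ X := Over.homMk (Limits.pullback.fst X.hom Y.hom)
  let q₀ : P ⟶ Y := Over.homMk (Limits.pullback.snd X.hom Y.hom) Limits.pullback.condition.symm
  have hP : LocallyOfFiniteType P.hom := by
    dsimp [P]; infer_instance
  obtain ⟨Z, i, hi, hZ⟩ := CayleyGrassmannian.exists_closed (X := P)
    (fun A x => 𝒬 A (x ≫ p₀) (x ≫ q₀)) (fun A x => by
      refine (h A (x ≫ p₀) (x ≫ q₀)).congr fun B φ => ?_
      simp only [Category.assoc])
  have hm : Mono i := Over.mono_of_mono_left i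
  refine ⟨Z, i ≫ p₀, i ≫ q₀, locallyOfFiniteType_of_closed i, fun A b => ?_, fun A x y hxy => ?_,
    fun A b b' h1 h2 => ?_⟩
  · simpa only [Category.assoc] using (hZ A (b ≫ i)).2 ⟨b, rfl⟩
  · let z : specOver A ⟶ P := Over.homMk (Limits.pullback.lift x.left y.left
      ((Over.w x).trans (Over.w y).symm)) (by
        change Limits.pullback.lift _ _ _ ≫ Limits.pullback.fst _ _ ≫ X.hom = _
        rw [Limits.pullback.lift_fst_assoc]
        exact Over.w x)
    have hx : z ≫ p₀ = x := Over.OverMorphism.ext (Limits.pullback.lift_fst _ _ _)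
    have hy : z ≫ q₀ = y := Over.OverMorphism.ext (Limits.pullback.lift_snd _ _ _)
    obtain ⟨b, hb⟩ := (hZ A z).1 (by rwa [hx, hy])
    exact ⟨b, by rw [← Category.assoc, hb, hx], by rw [← Category.assoc, hb, hy]⟩
  · rw [← cancel_mono i]
    refine Over.OverMorphism.ext (Limits.pullback.hom_ext ?_ ?_)
    · exact congrArg CommaMorphism.left ((Category.assoc b i _).trans (h1.trans
        (Category.assoc b' i _).symm))
    · exact congrArg CommaMorphism.left ((Category.assoc b i _).trans (h2.trans
        (Category.assoc b' i _).symm))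

/-- A morphism for which all points with values in local rings lift uniquely is an isomorphism. -/
theorem isIso_of_local_points (p : X ⟶ Y) [LocallyOfFiniteType X.hom] [LocallyOfFiniteType Y.hom]
    (h : ∀ (A : CommAlgCat.{0} ℂ) [IsLocalRing A] (y : specOver A ⟶ Y),
      ∃! x : specOver A ⟶ X, x ≫ p = y) : IsIso p := by
  -- The empty subscheme. Every morphism pulls it back to an effective Cartier divisor, so its
  -- blow-up is an isomorphism and the pointwise criterion for blow-ups applies.
  let i : Over.mk ((⊤ : Y.left.IdealSheafData).subschemeι ≫ Y.hom) ⟶ Y :=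
    Over.homMk (⊤ : Y.left.IdealSheafData).subschemeι
  have hi : IsClosedImmersion i.left :=
    inferInstanceAs (IsClosedImmersion (⊤ : Y.left.IdealSheafData).subschemeι)
  have hker : i.left.ker = ⊤ := Scheme.IdealSheafData.ker_subschemeι _
  have hcut (A : CommAlgCat.{0} ℂ) (y : specOver A ⟶ Y) : CutBy i y 1 := by
    rw [cutBy_iff, hker, cut, Scheme.IdealSheafData.comap_top, Ideal.span_singleton_one]
    exact Ideal.comap_top
  have hb : IsBlowup p.left i.left := isBlowup_of_points p i (fun A _ x _ _ _ => h A x)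
    (fun A _ x => ⟨1, hcut A _, Or.inl isUnit_one⟩)
  have hd {T : Scheme.{0}} (g : T ⟶ Y.left) : IsEffectiveCartier (i.left.ker.comap g) := by
    rw [hker, Scheme.IdealSheafData.comap_top]
    exact isEffectiveCartier_top
  obtain ⟨s, hs, -⟩ := hb.existsUnique_lift _ (𝟙 Y.left) (hd _)
  have hl : IsIso p.left := ⟨s, (hb.existsUnique_lift _ p.left (hd _)).unique
    (by rw [Category.assoc, hs, Category.comp_id]) (Category.id_comp _), hs⟩
  have : IsIso ((Over.forget _).map p) := hl
  exact isIso_of_reflects_iso p (Over.forget _)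

/-- A morphism for which all points with values in fields lift is dominant. -/
theorem isDominant_of_field_points (p : X ⟶ Y)
    (h : ∀ (A : CommAlgCat.{0} ℂ), IsField A → ∀ y : specOver A ⟶ Y,
      ∃ x : specOver A ⟶ X, x ≫ p = y) : IsDominant p.left := by
  have : Surjective p.left := by
    refine ⟨fun y => ?_⟩
    let A := algOf (X := Y) (Y.left.fromSpecResidueField y)
    have hA : IsField A := (inferInstance : Field (Y.left.residueField y)).toIsField
    obtain ⟨x, hx⟩ := h A hA (overOf (Y.left.fromSpecResidueField y))
    refine ⟨x.left (IsLocalRing.closedPoint (Y.left.residueField y)), ?_⟩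
    have h1 := congrArg (fun g => g.left (IsLocalRing.closedPoint (Y.left.residueField y))) hx
    exact h1.trans (Scheme.fromSpecResidueField_apply y _)
  infer_instance

end

section

/-! ### Dual systems of vectors and functionals -/

section DualSystem

variable {R M : Type*} [CommRing R] [AddCommGroup M] [Module R M] {j k : ℕ}

theorem rankAtStalk_of_finrank (Q : Type*) [AddCommGroup Q] [Module R Q] [Module.Finite R Q]
    [Module.Free R Q] {n : ℕ} (h : Module.finrank R Q = n) (p : PrimeSpectrum R) :
    Module.rankAtStalk (R := R) Q p = n := by
  have := p.nontrivial
  rw [Module.rankAtStalk_eq_finrank_of_free, Pi.natCast_apply, Nat.cast_id, h]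

theorem rankAtStalk_of_basis (b : Module.Basis (Fin j) R M) (p : PrimeSpectrum R) :
    Module.rankAtStalk (R := R) M p = j := by
  have := p.nontrivial
  have := Module.Free.of_basis b
  have := Module.Finite.of_basis b
  exact rankAtStalk_of_finrank M (by simpa using Module.finrank_eq_card_basis b) p

theorem exists_grassmannian_of_surjective {Q : Type*} [AddCommGroup Q] [Module R Q]
    [Module.Finite R Q] [Module.Projective R Q]
    (hQ : ∀ p, Module.rankAtStalk (R := R) Q p = k) (g : M →ₗ[R] Q) (hg : Function.Surjective g) :
    ∃ N : Module.Grassmannian R M k, N.toSubmodule = LinearMap.ker g := by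
  let q := g.quotKerEquivOfSurjective hg
  exact ⟨{ toSubmodule := LinearMap.ker g
           finite_quotient := Module.Finite.equiv q.symm
           projective_quotient := Module.Projective.of_equiv q.symm
           rankAtStalk_eq := fun p => by rw [Module.rankAtStalk_eq_of_equiv q]; exact hQ p }, rfl⟩

theorem exists_grassmannian_pi (g : M →ₗ[R] (Fin k → R)) (hg : Function.Surjective g) :
    ∃ N : Module.Grassmannian R M k, N.toSubmodule = LinearMap.ker g :=
  exists_grassmannian_of_surjective (rankAtStalk_of_basis (Pi.basisFun R (Fin k))) g hg

/-- A system of vectors together with functionals dual to it. -/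
structure DualSystem (x : Fin j → M) (ξ : Fin j → M →ₗ[R] R) : Prop where
  apply_eq : ∀ a b, ξ a (x b) = if a = b then 1 else 0

namespace DualSystem

variable {x : Fin j → M} {ξ : Fin j → M →ₗ[R] R}

theorem apply_sum (h : DualSystem x ξ) (c : Fin j → R) (a : Fin j) :
    ξ a (∑ b, c b • x b) = c a := by
  simp [map_sum, h.apply_eq]

theorem mem_span_iff (h : DualSystem x ξ) (m : M) :
    m ∈ Submodule.span R (Set.range x) ↔ ∑ a, ξ a m • x a = m := by
  constructor
  · intro hm
    obtain ⟨c, rfl⟩ := (Submodule.mem_span_range_iff_exists_fun R).1 hm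
    simp [h.apply_sum]
  · intro hm
    rw [← hm]
    exact Submodule.sum_mem _ fun a _ => Submodule.smul_mem _ _ (Submodule.subset_span ⟨a, rfl⟩)

/-- Subtracting `∑ a, ξ a m • x a` projects onto the common kernel `K` of the functionals, with the
span of `x` as its kernel. So `K` is the quotient by the span; it is projective, and its rank is
found by additivity. -/
theorem exists_grassmannian (h : DualSystem x ξ) {n : ℕ} (b : Module.Basis (Fin n) R M)
    (hn : n = j + k) :
    ∃ N : Module.Grassmannian R M k, N.toSubmodule = Submodule.span R (Set.range x) := by
  have := Module.Free.of_basis b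
  have := Module.Finite.of_basis b
  let K := LinearMap.ker (LinearMap.pi ξ)
  let s : M →ₗ[R] M := ∑ a, (ξ a).smulRight (x a)
  have hs (m : M) : s m = ∑ a, ξ a m • x a := by simp [s]
  let g : M →ₗ[R] K := LinearMap.codRestrict K (LinearMap.id - s) (fun m => by
    refine LinearMap.mem_ker.2 (funext fun a => ?_)
    rw [LinearMap.pi_apply, LinearMap.sub_apply, LinearMap.id_apply, map_sub, hs, h.apply_sum]
    simp)
  have hgK (m : K) : g m.1 = m := by
    refine Subtype.ext ?_
    have : ∀ a, ξ a m.1 = 0 := fun a => congrFun (LinearMap.mem_ker.1 m.2) a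
    simp [g, hs, this]
  have hproj : Module.Projective R K := Module.Projective.of_split K.subtype g
    (LinearMap.ext fun m => hgK m)
  have hfin : Module.Finite R K := Module.Finite.of_surjective g fun m => ⟨m, hgK m⟩
  let e : M ≃ₗ[R] K × (Fin j → R) :=
    { (g.prod (LinearMap.pi ξ)) with
      invFun := fun c => c.1.1 + ∑ a, c.2 a • x a
      left_inv := fun m => by simp [g, hs]
      right_inv := fun c => by
        have h0 : ∀ a, ξ a c.1.1 = 0 := fun a => congrFun (LinearMap.mem_ker.1 c.1.2) a
        refine Prod.ext (Subtype.ext ?_) (funext fun a => ?_)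
        · simp [g, hs, h0, h.apply_eq]
        · simp [h.apply_eq] }
  have hr (p : PrimeSpectrum R) : Module.rankAtStalk (R := R) K p = k := by
    have h1 := congrFun (Module.rankAtStalk_eq_of_equiv e) p
    rw [rankAtStalk_of_basis b, Module.rankAtStalk_prod, Pi.add_apply,
      rankAtStalk_of_basis (Pi.basisFun R (Fin j))] at h1
    omega
  obtain ⟨N, hN⟩ := exists_grassmannian_of_surjective hr g fun m => ⟨m, hgK m⟩
  refine ⟨N, hN.trans ?_⟩
  ext m
  rw [h.mem_span_iff, LinearMap.mem_ker, Subtype.ext_iff]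
  simp only [g, LinearMap.codRestrict_apply, LinearMap.sub_apply, LinearMap.id_apply, hs,
    ZeroMemClass.coe_zero, sub_eq_zero]
  exact eq_comm

end DualSystem

/-- A system of vectors has dual functionals if its pairings with some functionals form an
invertible matrix. -/
theorem exists_dualSystem_of_isUnit_det {x : Fin j → M} {ξ : Fin j → M →ₗ[R] R}
    (h : IsUnit (Matrix.det (Matrix.of fun a b => ξ a (x b)))) :
    ∃ ξ' : Fin j → M →ₗ[R] R, DualSystem x ξ' := by
  let G : Matrix (Fin j) (Fin j) R := Matrix.of fun a b => ξ a (x b)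
  refine ⟨fun a => ∑ b, G⁻¹ a b • ξ b, ⟨fun a b => ?_⟩⟩
  have := congrFun (congrFun (Matrix.nonsing_inv_mul G h) a) b
  rw [Matrix.mul_apply, Matrix.one_apply] at this
  simpa [G] using this

/-- Over a local ring every family of subspaces is spanned by a system with dual functionals. -/
theorem exists_dualSystem [IsLocalRing R] {n : ℕ} (b : Module.Basis (Fin n) R M) (hn : n = j + k)
    (N : Module.Grassmannian R M k) :
    ∃ (x : Fin j → M) (ξ : Fin j → M →ₗ[R] R), DualSystem x ξ ∧
      Submodule.span R (Set.range x) = N.toSubmodule := by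
  have := Module.Free.of_basis b
  have := Module.Finite.of_basis b
  obtain ⟨s, hs⟩ := Module.projective_lifting_property N.toSubmodule.mkQ LinearMap.id
    N.toSubmodule.mkQ_surjective
  have hs' (q) : N.toSubmodule.mkQ (s q) = q := LinearMap.congr_fun hs q
  let ρ : M →ₗ[R] N.toSubmodule := LinearMap.codRestrict N.toSubmodule
    (LinearMap.id - s ∘ₗ N.toSubmodule.mkQ) (fun m => by
      rw [← Submodule.Quotient.mk_eq_zero, ← Submodule.mkQ_apply]
      simp only [LinearMap.sub_apply, LinearMap.id_apply, LinearMap.comp_apply, map_sub, hs',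
        sub_self])
  have hρ (m : N.toSubmodule) : ρ m = m := by
    refine Subtype.ext ?_
    have : N.toSubmodule.mkQ m.1 = 0 := by simp
    change m.1 - s (N.toSubmodule.mkQ m.1) = m.1
    rw [this, map_zero, sub_zero]
  have hproj : Module.Projective R N.toSubmodule :=
    Module.Projective.of_split N.toSubmodule.subtype ρ (LinearMap.ext hρ)
  have hfin : Module.Finite R N.toSubmodule := Module.Finite.of_surjective ρ fun m => ⟨m, hρ m⟩
  have hfree : Module.Free R N.toSubmodule := Module.free_of_flat_of_isLocalRing
  have hfreeQ : Module.Free R (M ⧸ N.toSubmodule) := Module.free_of_flat_of_isLocalRing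
  let e : M ≃ₗ[R] N.toSubmodule × (M ⧸ N.toSubmodule) :=
    { (ρ.prod N.toSubmodule.mkQ) with
      invFun := fun c => c.1.1 + s c.2
      left_inv := fun m => by simp [ρ]
      right_inv := fun c => by
        have h1 : N.toSubmodule.mkQ c.1.1 = 0 := by simp
        have h2 : N.toSubmodule.mkQ (c.1.1 + s c.2) = c.2 := by rw [map_add, h1, hs', zero_add]
        refine Prod.ext (Subtype.ext ?_) h2
        change (c.1.1 + s c.2) - s (N.toSubmodule.mkQ (c.1.1 + s c.2)) = c.1.1
        rw [h2, add_sub_cancel_right] }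
  have hk : Module.finrank R (M ⧸ N.toSubmodule) = k := by
    have := N.rankAtStalk_eq (IsLocalRing.closedPoint R)
    rwa [Module.rankAtStalk_eq_finrank_of_free, Pi.natCast_apply, Nat.cast_id] at this
  have hj : Module.finrank R N.toSubmodule = j := by
    have h1 := e.finrank_eq
    rw [Module.finrank_prod, hk, Module.finrank_eq_card_basis b, Fintype.card_fin] at h1
    omega
  let B := Module.finBasisOfFinrankEq R N.toSubmodule hj
  refine ⟨fun a => (B a).1, fun a => B.coord a ∘ₗ ρ, ⟨fun a c => ?_⟩, ?_⟩
  · rw [LinearMap.comp_apply, hρ]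
    simp [Finsupp.single_apply, eq_comm]
  · have h1 := congrArg (Submodule.map N.toSubmodule.subtype) B.span_eq
    rw [Submodule.map_span, Submodule.map_top, Submodule.range_subtype, ← Set.range_comp] at h1
    exact h1

end DualSystem

end

section

/-! ### The linear algebra of a three-form on `M₇ = M ⊕ R e` -/

/-- A module `M₇ = M ⊕ R e` with a three-form `Ω = ω + e* ∧ α`, where `α` is a perfect alternating
form on the free module `M` of rank six. -/
structure Geometry (R M M₇ : Type*) [CommRing R] [AddCommGroup M] [Module R M] [AddCommGroup M₇]
    [Module R M₇] where
  ι : M →ₗ[R] M₇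
  pr : M₇ →ₗ[R] M
  e : M₇
  lam : M₇ →ₗ[R] R
  pr_ι : ∀ m, pr (ι m) = m
  pr_e : pr e = 0
  lam_ι : ∀ m, lam (ι m) = 0
  lam_e : lam e = 1
  eq : ∀ m, ι (pr m) + lam m • e = m
  α : LinearMap.BilinForm R M
  ω : M →ₗ[R] M →ₗ[R] M →ₗ[R] R
  Ω : M₇ →ₗ[R] M₇ →ₗ[R] M₇ →ₗ[R] R
  α_self : ∀ x, α x x = 0
  ω_self_left : ∀ x y, ω x x y = 0
  ω_self_right : ∀ x y, ω x y y = 0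
  Ω_eq : ∀ x y z, Ω x y z = ω (pr x) (pr y) (pr z) + lam x * α (pr y) (pr z) -
    lam y * α (pr x) (pr z) + lam z * α (pr x) (pr y)
  exists_repr : ∀ f : M →ₗ[R] R, ∃ y, ∀ x, α y x = f x
  separating : ∀ y, (∀ x, α y x = 0) → y = 0
  basis : Module.Basis (Fin 6) R M
  basis₇ : Module.Basis (Fin 7) R M₇

namespace Geometry

variable {R M M₇ : Type*} [CommRing R] [AddCommGroup M] [Module R M] [AddCommGroup M₇]
  [Module R M₇] (G : Geometry R M M₇)

theorem α_swap (x y : M) : G.α y x = -G.α x y := by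
  have := G.α_self (x + y)
  simp only [map_add, LinearMap.add_apply, G.α_self] at this
  linear_combination this

theorem ω_swap_left (x y z : M) : G.ω y x z = -G.ω x y z := by
  have := G.ω_self_left (x + y) z
  simp only [map_add, LinearMap.add_apply, G.ω_self_left] at this
  linear_combination this

theorem ω_swap_right (x y z : M) : G.ω x z y = -G.ω x y z := by
  have := G.ω_self_right x (y + z)
  simp only [map_add, LinearMap.add_apply, G.ω_self_right] at this
  linear_combination this

theorem ω_self_outer (x y : M) : G.ω x y x = 0 := by
  rw [G.ω_swap_right, G.ω_self_left, neg_zero]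

theorem exists_repr_right (f : M →ₗ[R] R) : ∃ y, ∀ x, G.α x y = f x := by
  obtain ⟨y, hy⟩ := G.exists_repr (-f)
  exact ⟨y, fun x => by rw [G.α_swap, hy]; simp⟩

theorem separating_right (y : M) (h : ∀ x, G.α x y = 0) : y = 0 :=
  G.separating y fun x => by rw [G.α_swap, h, neg_zero]

theorem pr_surjective : Function.Surjective G.pr := fun m => ⟨G.ι m, G.pr_ι m⟩

theorem Ω_self_left (x y : M₇) : G.Ω x x y = 0 := by
  rw [G.Ω_eq, G.ω_self_left, G.α_self]; ring

theorem Ω_self_right (x y : M₇) : G.Ω x y y = 0 := by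
  rw [G.Ω_eq, G.ω_self_right, G.α_self]; ring

theorem Ω_swap_left (x y z : M₇) : G.Ω y x z = -G.Ω x y z := by
  have := G.Ω_self_left (x + y) z
  simp only [map_add, LinearMap.add_apply, G.Ω_self_left] at this
  linear_combination this

theorem Ω_swap_right (x y z : M₇) : G.Ω x z y = -G.Ω x y z := by
  have := G.Ω_self_right x (y + z)
  simp only [map_add, LinearMap.add_apply, G.Ω_self_right] at this
  linear_combination this

/-- If `Ω` vanishes on the kernel of `L` in `U` then `L ∧ Ω` vanishes on `U`. -/
theorem wedge_eq_zero {U : Submodule R M₇} (L : M₇ →ₗ[R] R) {v : M₇} (hv : v ∈ U) (hLv : L v = 1)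
    (h : ∀ x ∈ U, ∀ y ∈ U, ∀ z ∈ U, L x = 0 → L y = 0 → L z = 0 → G.Ω x y z = 0)
    {a b c d : M₇} (ha : a ∈ U) (hb : b ∈ U) (hc : c ∈ U) (hd : d ∈ U) :
    L a * G.Ω b c d - L b * G.Ω a c d + L c * G.Ω a b d - L d * G.Ω a b c = 0 := by
  -- `U` is the sum of the kernel of `L` and the multiples of `v`. On `U` this gives `Ω = L ∧ Ω(v,
  -- ·, ·)`, whence `L ∧ Ω = 0`.
  have key {x y z : M₇} (hx : x ∈ U) (hy : y ∈ U) (hz : z ∈ U) :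
      G.Ω x y z = L x * G.Ω v y z - L y * G.Ω v x z + L z * G.Ω v x y := by
    have hm {w : M₇} (hw : w ∈ U) : w - L w • v ∈ U := U.sub_mem hw (U.smul_mem _ hv)
    have hL (w : M₇) : L (w - L w • v) = 0 := by simp [hLv]
    have := h _ (hm hx) _ (hm hy) _ (hm hz) (hL x) (hL y) (hL z)
    simp only [map_sub, map_smul, LinearMap.sub_apply, LinearMap.smul_apply, smul_eq_mul,
      G.Ω_self_left, G.Ω_self_right] at this
    have e1 : G.Ω x v z = -G.Ω v x z := G.Ω_swap_left _ _ _
    have e2 : G.Ω x y v = G.Ω v x y := by rw [G.Ω_swap_right, G.Ω_swap_left]; ring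
    have e3 : G.Ω v y v = 0 := by rw [G.Ω_swap_right, G.Ω_self_left, neg_zero]
    rw [e1, e2, e3] at this
    linear_combination this
  rw [key ha hb hc, key ha hb hd, key ha hc hd, key hb hc hd]
  ring

/-- A system of four vectors adapted to the form `α`. -/
structure Adapted (x : Fin 4 → M) (ξ : Fin 4 → M →ₗ[R] R) : Prop extends DualSystem x ξ where
  h01 : G.α (x 0) (x 1) = 1
  h02 : G.α (x 0) (x 2) = 0
  h03 : G.α (x 0) (x 3) = 0
  h12 : G.α (x 1) (x 2) = 0
  h13 : G.α (x 1) (x 3) = 0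

variable {G}
variable {x : Fin 4 → M} {ξ : Fin 4 → M →ₗ[R] R}

theorem Adapted.α_sum (h : G.Adapted x ξ) (a b : Fin 4 → R) :
    G.α (∑ i, a i • x i) (∑ i, b i • x i) =
      (a 0 * b 1 - a 1 * b 0) + G.α (x 2) (x 3) * (a 2 * b 3 - a 3 * b 2) := by
  have e10 := G.α_swap (x 0) (x 1)
  have e20 := G.α_swap (x 0) (x 2)
  have e30 := G.α_swap (x 0) (x 3)
  have e21 := G.α_swap (x 1) (x 2)
  have e31 := G.α_swap (x 1) (x 3)
  have e32 := G.α_swap (x 2) (x 3)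
  simp only [Fin.sum_univ_four, map_add, map_smul, LinearMap.add_apply, LinearMap.smul_apply,
    smul_eq_mul, G.α_self, e10, e20, e30, e21, e31, e32, h.h01, h.h02, h.h03, h.h12, h.h13]
  ring

variable (G) in
theorem ω_sum (x : Fin 4 → M) (a b c : Fin 4 → R) :
    G.ω (∑ i, a i • x i) (∑ i, b i • x i) (∑ i, c i • x i) =
      G.ω (x 0) (x 1) (x 2) * Matrix.det !![a 0, a 1, a 2; b 0, b 1, b 2; c 0, c 1, c 2] +
      G.ω (x 0) (x 1) (x 3) * Matrix.det !![a 0, a 1, a 3; b 0, b 1, b 3; c 0, c 1, c 3] +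
      G.ω (x 0) (x 2) (x 3) * Matrix.det !![a 0, a 2, a 3; b 0, b 2, b 3; c 0, c 2, c 3] +
      G.ω (x 1) (x 2) (x 3) * Matrix.det !![a 1, a 2, a 3; b 1, b 2, b 3; c 1, c 2, c 3] := by
  have l10 := G.ω_swap_left (x 0) (x 1)
  have l20 := G.ω_swap_left (x 0) (x 2)
  have l30 := G.ω_swap_left (x 0) (x 3)
  have l21 := G.ω_swap_left (x 1) (x 2)
  have l31 := G.ω_swap_left (x 1) (x 3)
  have l32 := G.ω_swap_left (x 2) (x 3)
  have r20 := fun z => G.ω_swap_right z (x 0) (x 2)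
  have r30 := fun z => G.ω_swap_right z (x 0) (x 3)
  have r21 := fun z => G.ω_swap_right z (x 1) (x 2)
  have r31 := fun z => G.ω_swap_right z (x 1) (x 3)
  have r32 := fun z => G.ω_swap_right z (x 2) (x 3)
  simp only [Fin.sum_univ_four, map_add, map_smul, LinearMap.add_apply, LinearMap.smul_apply,
    smul_eq_mul, G.ω_self_left, G.ω_self_right, G.ω_self_outer, l10, l20, l30, l21, l31, l32,
    r20, r30, r21, r31, r32, Matrix.det_fin_three, Matrix.of_apply, Matrix.cons_val',
    Matrix.cons_val_zero, Matrix.cons_val_one, Matrix.cons_val, mul_zero, add_zero, zero_add,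
    neg_neg]
  ring

end Geometry

end

section

namespace Geometry

variable {R M M₇ : Type*} [CommRing R] [AddCommGroup M] [Module R M] [AddCommGroup M₇]
  [Module R M₇] {G : Geometry R M M₇}

/-! ### Orthogonal complements -/

theorem mem_orthogonal_span {j : ℕ} {x : Fin j → M} {y : M} :
    y ∈ G.α.orthogonal (Submodule.span R (Set.range x)) ↔ ∀ a, G.α (x a) y = 0 := by
  rw [LinearMap.BilinForm.mem_orthogonal_iff]
  constructor
  · exact fun h a => h _ (Submodule.subset_span ⟨a, rfl⟩)
  · intro h n hn
    induction hn using Submodule.span_induction with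
    | mem n hn => obtain ⟨a, rfl⟩ := hn; exact h a
    | zero => simp
    | add n n' _ _ h h' => simp [h, h']
    | smul c n _ h => simp [h]

/-- Vectors dual, with respect to `α`, to a system of vectors. -/
theorem exists_dual_vectors {j : ℕ} {x : Fin j → M} {ξ : Fin j → M →ₗ[R] R}
    (h : DualSystem x ξ) :
    ∃ y : Fin j → M, ∀ a b, G.α (x a) (y b) = if a = b then 1 else 0 := by
  choose y hy using fun b => G.exists_repr_right (ξ b)
  refine ⟨y, fun a b => ?_⟩
  rw [hy, h.apply_eq]
  simp only [eq_comm]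

/-- By perfectness of `α` the functionals dual to `x` are represented by vectors, on which the
pairings with `x` take all values; so the orthogonal is the kernel of a surjection to a free module.
-/
theorem exists_grassmannian_orthogonal {j : ℕ} {x : Fin j → M} {ξ : Fin j → M →ₗ[R] R}
    (h : DualSystem x ξ) : ∃ N : Module.Grassmannian R M j,
      N.toSubmodule = G.α.orthogonal (Submodule.span R (Set.range x)) := by
  obtain ⟨y, hy⟩ := exists_dual_vectors (G := G) h
  obtain ⟨N, hN⟩ := exists_grassmannian_pi (LinearMap.pi fun a => G.α (x a)) (fun c => by
    refine ⟨∑ b, c b • y b, funext fun a => ?_⟩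
    simp [map_sum, hy])
  refine ⟨N, hN.trans ?_⟩
  ext m
  rw [mem_orthogonal_span, LinearMap.mem_ker]
  exact funext_iff

/-- One inclusion is the hypothesis `ho`; both sides have corank `j`, so `Grassmannian.eq_of_le`
gives equality. -/
theorem orthogonal_orthogonal {j k : ℕ} {x : Fin j → M} {ξ : Fin j → M →ₗ[R] R}
    (h : DualSystem x ξ) (hjk : 6 = j + k) {x' : Fin k → M} {ξ' : Fin k → M →ₗ[R] R}
    (h' : DualSystem x' ξ') (ho : ∀ a b, G.α (x a) (x' b) = 0) :
    G.α.orthogonal (Submodule.span R (Set.range x)) = Submodule.span R (Set.range x') := by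
  obtain ⟨N, hN⟩ := exists_grassmannian_orthogonal (G := G) h
  obtain ⟨N', hN'⟩ := h'.exists_grassmannian (k := j) G.basis (by omega)
  have : N' = N := Grassmannian.eq_of_le (by
    rw [hN, hN', Submodule.span_le]
    rintro _ ⟨b, rfl⟩
    exact mem_orthogonal_span.2 fun a => ho a b)
  rw [← hN, ← hN', this]

variable {x : Fin 4 → M} {ξ : Fin 4 → M →ₗ[R] R}

theorem Adapted.dualSystem_pair (h : G.Adapted x ξ) :
    DualSystem ![x 2, x 3] ![ξ 2, ξ 3] := by
  refine ⟨fun a b => ?_⟩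
  fin_cases a <;> fin_cases b <;> simp [h.apply_eq]

theorem Adapted.orthogonal_eq (h : G.Adapted x ξ) (hf : G.α (x 2) (x 3) = 0) :
    G.α.orthogonal (Submodule.span R (Set.range x)) = Submodule.span R {x 2, x 3} := by
  have := orthogonal_orthogonal (G := G) (k := 2) h.toDualSystem rfl h.dualSystem_pair (by
    have e32 := G.α_swap (x 2) (x 3)
    intro a b
    fin_cases a <;> fin_cases b <;> simp [h.h02, h.h03, h.h12, h.h13, hf, G.α_self, e32])
  rw [this]
  congr 1
  simp [Matrix.range_cons, Set.pair_comm]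

/-- The equations of the variety `Y₄` in terms of an adapted system. -/
theorem Adapted.mem_iff (h : G.Adapted x ξ) (h2 : IsUnit (2 : R)) {U : Submodule R M}
    (hU : U = Submodule.span R (Set.range x)) :
    (G.α.orthogonal U ≤ U ∧ ∀ y ∈ G.α.orthogonal U, ∀ y' ∈ G.α.orthogonal U, ∀ z ∈ U,
      G.ω y y' z = 0) ↔
    (G.ω (x 0) (x 2) (x 3) = 0 ∧ G.ω (x 1) (x 2) (x 3) = 0 ∧ G.α (x 2) (x 3) = 0) := by
  subst hU
  have hx (i : Fin 4) : x i ∈ Submodule.span R (Set.range x) := Submodule.subset_span ⟨i, rfl⟩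
  constructor
  · rintro ⟨hle, hω⟩
    have hf : G.α (x 2) (x 3) = 0 := by
      set f := G.α (x 2) (x 3) with hf
      obtain ⟨y, hy⟩ := exists_dual_vectors (G := G) h.toDualSystem
      -- An element of the orthogonal lies in `U` by assumption. Pairing its expansion with the `x
      -- i` shows that the coefficients at `x 0`, `x 1` vanish and those at `x 2`, `x 3` are killed
      -- by `f`.
      have hann (m : M) (hm : m ∈ G.α.orthogonal (Submodule.span R (Set.range x))) : f • m = 0 := by
        have hs := (h.mem_span_iff m).1 (hle hm)
        rw [mem_orthogonal_span] at hm
        have key (i : Fin 4) : G.α (x i) m = G.α (∑ b, (Pi.single i 1 : Fin 4 → R) b • x b)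
            (∑ b, ξ b m • x b) := by
          rw [hs]; simp [Pi.single_apply]
        simp only [h.α_sum] at key
        have k0 := (key 0).symm.trans (hm 0)
        have k1 := (key 1).symm.trans (hm 1)
        have k2 := (key 2).symm.trans (hm 2)
        have k3 := (key 3).symm.trans (hm 3)
        simp [← hf] at k0 k1 k2 k3
        rw [← hs, Fin.sum_univ_four, k0, k1]
        simp [smul_smul, k2, k3]
      -- Since `f` kills the orthogonal, multiplication by `f` on the rank six module equals this
      -- sum of four rank one maps. Comparing traces gives `4 * f = 6 * f`, and `2` is invertible. A
      -- rank argument alone would not do over a ring with nilpotents.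
      let T : M →ₗ[R] M := ∑ a, (G.α (x a)).smulRight (f • y a)
      have hT : T = f • LinearMap.id := by
        ext m
        have h1 := hann (m - ∑ a, G.α (x a) m • y a) (mem_orthogonal_span.2 fun a => by
          simp [map_sum, hy])
        rw [smul_sub, sub_eq_zero] at h1
        simp only [T, LinearMap.sum_apply, LinearMap.smulRight_apply, LinearMap.smul_apply,
          LinearMap.id_apply, h1, Finset.smul_sum]
        exact Finset.sum_congr rfl fun a _ => smul_comm _ _ _
      have := Module.Free.of_basis G.basis
      have := Module.Finite.of_basis G.basis
      have htr := congrArg (LinearMap.trace R M) hT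
      rcases subsingleton_or_nontrivial R with hR | hR
      · exact Subsingleton.elim _ _
      rw [map_smul, LinearMap.trace_id, Module.finrank_eq_card_basis G.basis] at htr
      simp only [T, map_sum, LinearMap.trace_smulRight, map_smul, hy] at htr
      simp at htr
      have : (2 : R) * f = 0 := by linear_combination -htr
      exact h2.mul_right_eq_zero.1 this
    rw [h.orthogonal_eq hf] at hω
    have m2 : x 2 ∈ Submodule.span R {x 2, x 3} := Submodule.subset_span (by simp)
    have m3 : x 3 ∈ Submodule.span R {x 2, x 3} := Submodule.subset_span (by simp)
    refine ⟨?_, ?_, hf⟩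
    · rw [G.ω_swap_left, G.ω_swap_right, hω _ m2 _ m3 _ (hx 0)]; simp
    · rw [G.ω_swap_left, G.ω_swap_right, hω _ m2 _ m3 _ (hx 1)]; simp
  · rintro ⟨h0, h1, hf⟩
    rw [h.orthogonal_eq hf]
    refine ⟨Submodule.span_le.2 ?_, ?_⟩
    · rintro _ (rfl | rfl)
      · exact hx 2
      · exact hx 3
    · intro y hy y' hy' z hz
      obtain ⟨a, b, rfl⟩ := Submodule.mem_span_pair.1 hy
      obtain ⟨a', b', rfl⟩ := Submodule.mem_span_pair.1 hy'
      have ey (p q : R) : p • x 2 + q • x 3 = ∑ i, ![0, 0, p, q] i • x i := by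
        simp [Fin.sum_univ_four]
      rw [ey, ey, ← (h.mem_span_iff z).1 hz, G.ω_sum, h0, h1]
      simp [Matrix.det_fin_three]

/-! ### The local structure of the incidence variety -/

variable (G) in
/-- The functional whose kernel in `U₄ ⊕ R e` is the subspace with parameters `l`. -/
def functional (x : Fin 4 → M) (ξ : Fin 4 → M →ₗ[R] R) (l : Fin 3 → R) : M₇ →ₗ[R] R :=
  -- The values at `x 2` and `x 3` are forced: as `α(x₀, x₁) = 1`, the equations `(L ∧ Ω)(x₀, x₁,
  -- x₂, e) = 0` and `(L ∧ Ω)(x₀, x₁, x₃, e) = 0` solve for them in terms of `L(e) = l 2`.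
  l 0 • (ξ 0 ∘ₗ G.pr) + l 1 • (ξ 1 ∘ₗ G.pr) + l 2 • (G.ω (x 0) (x 1) (x 2) • (ξ 2 ∘ₗ G.pr) +
    G.ω (x 0) (x 1) (x 3) • (ξ 3 ∘ₗ G.pr) + G.lam)

theorem functional_apply (l : Fin 3 → R) (m : M₇) : G.functional x ξ l m =
    l 0 * ξ 0 (G.pr m) + l 1 * ξ 1 (G.pr m) + l 2 * (G.ω (x 0) (x 1) (x 2) * ξ 2 (G.pr m) +
    G.ω (x 0) (x 1) (x 3) * ξ 3 (G.pr m) + G.lam m) := rfl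

/-- The subspace is the kernel of the map to the quotient of `M` by `N` times `R`. The vector `v`,
which maps to `(0, 1)`, makes this map surjective, and the corank is `2 + 1`. -/
theorem exists_grassmannian_of_functional {N : Module.Grassmannian R M 2} (L : M₇ →ₗ[R] R) {v : M₇}
    (hv : G.pr v ∈ N.toSubmodule) (hL : L v = 1) : ∃ V : Module.Grassmannian R M₇ 3,
      ∀ m, m ∈ V.toSubmodule ↔ G.pr m ∈ N.toSubmodule ∧ L m = 0 := by
  let g : M₇ →ₗ[R] (M ⧸ N.toSubmodule) × R := (N.toSubmodule.mkQ ∘ₗ G.pr).prod L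
  have hg : Function.Surjective g := by
    rintro ⟨q, r⟩
    obtain ⟨m, rfl⟩ := N.toSubmodule.mkQ_surjective q
    refine ⟨G.ι m + (r - L (G.ι m)) • v, Prod.ext ?_ ?_⟩
    · have : N.toSubmodule.mkQ (G.pr v) = 0 := by simpa using hv
      change N.toSubmodule.mkQ (G.pr (G.ι m + (r - L (G.ι m)) • v)) = _
      rw [map_add, map_smul, map_add, map_smul, this, G.pr_ι, smul_zero, add_zero]
    · simp [g, hL]
  obtain ⟨V, hV⟩ := exists_grassmannian_of_surjective (k := 2 + 1) (fun p => by
    have := p.nontrivial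
    rw [Module.rankAtStalk_prod, Pi.add_apply, N.rankAtStalk_eq, Module.rankAtStalk_self,
      Pi.one_apply]) g hg
  refine ⟨V, fun m => ?_⟩
  rw [hV, LinearMap.mem_ker, Prod.ext_iff]
  simp [g]

theorem Adapted.exists_functional_eq_one (h : G.Adapted x ξ) (l : Fin 3 → R) {r : Fin 3 → R}
    (hr : ∑ i, r i * l i = 1) :
    ∃ v, G.pr v ∈ Submodule.span R (Set.range x) ∧ G.functional x ξ l v = 1 := by
  refine ⟨G.ι (r 0 • x 0 + r 1 • x 1) + r 2 • G.e, ?_, ?_⟩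
  · rw [map_add, G.pr_ι, map_smul, G.pr_e, smul_zero, add_zero]
    exact Submodule.add_mem _ (Submodule.smul_mem _ _ (Submodule.subset_span ⟨0, rfl⟩))
      (Submodule.smul_mem _ _ (Submodule.subset_span ⟨1, rfl⟩))
  · rw [functional_apply]
    simp [G.pr_ι, G.pr_e, G.lam_ι, G.lam_e, h.apply_eq]
    rw [Fin.sum_univ_three] at hr
    linear_combination hr

/-- The identity behind the vanishing of `Ω` on the kernel of the functional. -/
theorem polynomial_identity {w w' l₀ l₁ t c : R} {r : Fin 3 → R}
    (hr : r 0 * l₀ + r 1 * l₁ + r 2 * t = 1) {a b d : Fin 4 → R} {a' b' d' : R}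
    (ha : l₀ * a 0 + l₁ * a 1 + t * (w * a 2 + w' * a 3 + a') = 0)
    (hb : l₀ * b 0 + l₁ * b 1 + t * (w * b 2 + w' * b 3 + b') = 0)
    (hd : l₀ * d 0 + l₁ * d 1 + t * (w * d 2 + w' * d 3 + d') = 0) :
    w * Matrix.det !![a 0, a 1, a 2; b 0, b 1, b 2; d 0, d 1, d 2] +
      w' * Matrix.det !![a 0, a 1, a 3; b 0, b 1, b 3; d 0, d 1, d 3] +
      c * l₀ * Matrix.det !![a 0, a 2, a 3; b 0, b 2, b 3; d 0, d 2, d 3] +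
      c * l₁ * Matrix.det !![a 1, a 2, a 3; b 1, b 2, b 3; d 1, d 2, d 3] +
      a' * ((b 0 * d 1 - b 1 * d 0) + c * t * (b 2 * d 3 - b 3 * d 2)) -
      b' * ((a 0 * d 1 - a 1 * d 0) + c * t * (a 2 * d 3 - a 3 * d 2)) +
      d' * ((a 0 * b 1 - a 1 * b 0) + c * t * (a 2 * b 3 - a 3 * b 2)) = 0 := by
  simp only [Matrix.det_fin_three, Matrix.of_apply, Matrix.cons_val', Matrix.cons_val_zero,
    Matrix.cons_val_one, Matrix.cons_val]
  set Q := w * (a 0 * b 1 * d 2 - a 0 * b 2 * d 1 - a 1 * b 0 * d 2 + a 1 * b 2 * d 0 + a 2 * b 0 * d 1 - a 2 * b 1 * d 0) + w' * (a 0 * b 1 * d 3 - a 0 * b 3 * d 1 - a 1 * b 0 * d 3 + a 1 * b 3 * d 0 + a 3 * b 0 * d 1 - a 3 * b 1 * d 0) + c * l₀ * (a 0 * b 2 * d 3 - a 0 * b 3 * d 2 - a 2 * b 0 * d 3 + a 2 * b 3 * d 0 + a 3 * b 0 * d 2 - a 3 * b 2 * d 0) +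
    c * l₁ * (a 1 * b 2 * d 3 - a 1 * b 3 * d 2 - a 2 * b 1 * d 3 + a 2 * b 3 * d 1 + a 3 * b 1 * d 2 - a 3 * b 2 * d 1) +
    a' * ((b 0 * d 1 - b 1 * d 0) + c * t * (b 2 * d 3 - b 3 * d 2)) -
    b' * ((a 0 * d 1 - a 1 * d 0) + c * t * (a 2 * d 3 - a 3 * d 2)) +
    d' * ((a 0 * b 1 - a 1 * b 0) + c * t * (a 2 * b 3 - a 3 * b 2)) with hQ
  -- Multiplying `Q` by a coefficient of the functional allows one of the linear relations to be
  -- substituted into each term. So `Q` is killed by `l₀`, `l₁` and `t`, which generate the unit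
  -- ideal.
  have e0 : l₀ * Q = 0 := by
    rw [hQ]
    linear_combination (w * (b 1 * d 2 - b 2 * d 1) + w' * (b 1 * d 3 - b 3 * d 1) + c * l₀ * (b 2 * d 3 - b 3 * d 2) - b' * d 1 + d' * b 1) * ha -
      (w * (a 1 * d 2 - a 2 * d 1) + w' * (a 1 * d 3 - a 3 * d 1) + c * l₀ * (a 2 * d 3 - a 3 * d 2) - a' * d 1 + d' * a 1) * hb +
      (w * (a 1 * b 2 - a 2 * b 1) + w' * (a 1 * b 3 - a 3 * b 1) + c * l₀ * (a 2 * b 3 - a 3 * b 2) - a' * b 1 + b' * a 1) * hd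
  have e1 : l₁ * Q = 0 := by
    rw [hQ]
    linear_combination (-w * (b 0 * d 2 - b 2 * d 0) - w' * (b 0 * d 3 - b 3 * d 0) + c * l₁ * (b 2 * d 3 - b 3 * d 2) + b' * d 0 - d' * b 0) * ha -
      (-w * (a 0 * d 2 - a 2 * d 0) - w' * (a 0 * d 3 - a 3 * d 0) + c * l₁ * (a 2 * d 3 - a 3 * d 2) + a' * d 0 - d' * a 0) * hb +
      (-w * (a 0 * b 2 - a 2 * b 0) - w' * (a 0 * b 3 - a 3 * b 0) + c * l₁ * (a 2 * b 3 - a 3 * b 2) + a' * b 0 - b' * a 0) * hd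
  have e2 : t * Q = 0 := by
    rw [hQ]
    linear_combination ((b 0 * d 1 - b 1 * d 0) + c * t * (b 2 * d 3 - b 3 * d 2)) * ha -
      ((a 0 * d 1 - a 1 * d 0) + c * t * (a 2 * d 3 - a 3 * d 2)) * hb +
      ((a 0 * b 1 - a 1 * b 0) + c * t * (a 2 * b 3 - a 3 * b 2)) * hd
  linear_combination r 0 * e0 + r 1 * e1 + r 2 * e2 - Q * hr

theorem Adapted.Ω_eq_zero (h : G.Adapted x ξ) {l r : Fin 3 → R} {c : R}
    (hr : ∑ i, r i * l i = 1) (h0 : G.ω (x 0) (x 2) (x 3) = c * l 0)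
    (h1 : G.ω (x 1) (x 2) (x 3) = c * l 1) (hf : G.α (x 2) (x 3) = c * l 2) {m m' m'' : M₇}
    (hm : G.pr m ∈ Submodule.span R (Set.range x)) (hL : G.functional x ξ l m = 0)
    (hm' : G.pr m' ∈ Submodule.span R (Set.range x)) (hL' : G.functional x ξ l m' = 0)
    (hm'' : G.pr m'' ∈ Submodule.span R (Set.range x)) (hL'' : G.functional x ξ l m'' = 0) :
    G.Ω m m' m'' = 0 := by
  rw [functional_apply] at hL hL' hL''
  rw [G.Ω_eq, ← (h.mem_span_iff _).1 hm, ← (h.mem_span_iff _).1 hm', ← (h.mem_span_iff _).1 hm'',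
    G.ω_sum, h.α_sum, h.α_sum, h.α_sum, h0, h1, hf]
  generalize G.ω (x 0) (x 1) (x 2) = w at *
  generalize G.ω (x 0) (x 1) (x 3) = w' at *
  rw [Fin.sum_univ_three] at hr
  exact polynomial_identity (a := fun i => ξ i (G.pr m)) (b := fun i => ξ i (G.pr m'))
    (d := fun i => ξ i (G.pr m'')) (a' := G.lam m) (b' := G.lam m') (d' := G.lam m'') hr hL hL' hL''

end Geometry

end

section

namespace Geometry

variable {R M M₇ : Type*} [CommRing R] [AddCommGroup M] [Module R M] [AddCommGroup M₇]
  [Module R M₇] {G : Geometry R M M₇}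

/-! ### Adapted systems over local rings -/

theorem isUnit_det_one_add [IsLocalRing R] {n : ℕ} (P N : Matrix (Fin n) (Fin n) R)
    (hN : ∀ a b, ¬ IsUnit (N a b)) : IsUnit (1 + P * N).det := by
  refine isUnit_of_map_unit (IsLocalRing.residue R) _ ?_
  rw [RingHom.map_det]
  have : (IsLocalRing.residue R).mapMatrix (1 + P * N) = 1 := by
    have h0 : (IsLocalRing.residue R).mapMatrix N = 0 := by
      ext a b
      exact (IsLocalRing.residue_eq_zero_iff _).2 ((IsLocalRing.mem_maximalIdeal _).2 (hN a b))
    rw [map_add, map_mul, h0, mul_zero, add_zero, map_one]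
  rw [this, Matrix.det_one]
  exact isUnit_one

/-- A four-dimensional subspace of a six-dimensional symplectic space is not isotropic. -/
theorem exists_isUnit_α [IsLocalRing R] {x : Fin 4 → M} {ξ : Fin 4 → M →ₗ[R] R}
    (h : DualSystem x ξ) : ∃ a b, IsUnit (G.α (x a) (x b)) := by
  by_contra! hcon
  obtain ⟨y, hy⟩ := exists_dual_vectors (G := G) h
  let N : Matrix (Fin 4) (Fin 4) R := Matrix.of fun a b => G.α (x a) (x b)
  let P : Matrix (Fin 4) (Fin 4) R := Matrix.of fun a b => G.α (y a) (y b)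
  have hdet := isUnit_det_one_add P N fun a b => hcon a b
  -- If all pairings were nonunits, the four `x a` and their four dual vectors would be independent:
  -- pairing a relation with both systems gives `(1 + P * N) c = 0` for the coefficients at `x`, and
  -- this matrix is invertible. Eight independent vectors do not fit into rank six.
  have hli : LinearIndependent R (Sum.elim x y) := by
    rw [Fintype.linearIndependent_iff]
    intro c hc
    rw [Fintype.sum_sum_type] at hc
    simp only [Sum.elim_inl, Sum.elim_inr] at hc
    have h1 (k : Fin 4) : c (Sum.inr k) = -(N.mulVec fun i => c (Sum.inl i)) k := by
      have := congrArg (G.α (x k)) hc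
      simp only [map_add, map_sum, map_smul, hy, map_zero, smul_eq_mul, mul_ite, mul_one, mul_zero,
        Finset.sum_ite_eq, Finset.mem_univ, if_true] at this
      rw [Matrix.mulVec, dotProduct]
      simp only [N, Matrix.of_apply]
      rw [Finset.sum_congr rfl fun i _ => mul_comm (G.α (x k) (x i)) (c (Sum.inl i))]
      linear_combination this
    have h2 (k : Fin 4) : c (Sum.inl k) = (P.mulVec fun i => c (Sum.inr i)) k := by
      have := congrArg (G.α (y k)) hc
      simp only [map_add, map_sum, map_smul, G.α_swap (x _) (y k), hy, map_zero, smul_eq_mul,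
        mul_ite, mul_neg, mul_one, mul_zero, Finset.sum_neg_distrib, Finset.sum_ite_eq',
        Finset.mem_univ, if_true] at this
      rw [Matrix.mulVec, dotProduct]
      simp only [P, Matrix.of_apply]
      rw [Finset.sum_congr rfl fun i _ => mul_comm (G.α (y k) (y i)) (c (Sum.inr i))]
      linear_combination -this
    have h3 : (1 + P * N).mulVec (fun i => c (Sum.inl i)) = 0 := by
      have e1 : (fun i => c (Sum.inr i)) = -N.mulVec fun i => c (Sum.inl i) := funext h1
      have e2 : (fun i => c (Sum.inl i)) = P.mulVec fun i => c (Sum.inr i) := funext h2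
      rw [Matrix.add_mulVec, Matrix.one_mulVec, ← Matrix.mulVec_mulVec]
      nth_rewrite 1 [e2]
      rw [e1, Matrix.mulVec_neg]
      simp
    have h4 : (fun i => c (Sum.inl i)) = 0 := by
      have := congrArg ((1 + P * N)⁻¹.mulVec) h3
      rwa [Matrix.mulVec_mulVec, Matrix.nonsing_inv_mul _ hdet, Matrix.one_mulVec,
        Matrix.mulVec_zero] at this
    rintro (i | i)
    · exact congrFun h4 i
    · rw [h1, h4]; simp
  have := Module.Free.of_basis G.basis
  have := Module.Finite.of_basis G.basis
  have h6 := hli.fintype_card_le_finrank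
  rw [Module.finrank_eq_card_basis G.basis] at h6
  simp at h6

/-- Over a local ring, every family of four-dimensional subspaces has an adapted system. -/
theorem exists_adapted [IsLocalRing R] (N : Module.Grassmannian R M 2) :
    ∃ (x : Fin 4 → M) (ξ : Fin 4 → M →ₗ[R] R), G.Adapted x ξ ∧
      N.toSubmodule = Submodule.span R (Set.range x) := by
  obtain ⟨x, ξ, h, hN⟩ := exists_dualSystem (j := 4) G.basis rfl N
  obtain ⟨a, b, u, hu⟩ := exists_isUnit_α (G := G) h
  let y₀ := x a
  let y₁ := (↑u⁻¹ : R) • x b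
  have hy : G.α y₀ y₁ = 1 := by simp [y₀, y₁, ← hu]
  have hy' : G.α y₁ y₀ = -1 := by rw [G.α_swap, hy]
  have m₀ : y₀ ∈ N.toSubmodule := hN ▸ Submodule.subset_span ⟨a, rfl⟩
  have m₁ : y₁ ∈ N.toSubmodule := Submodule.smul_mem _ _ (hN ▸ Submodule.subset_span ⟨b, rfl⟩)
  let κ : (Fin 4 → R) →ₗ[R] M := Fintype.linearCombination R x
  let ξc : M →ₗ[R] (Fin 4 → R) := LinearMap.pi ξ
  have hκ (c) : κ c = ∑ i, c i • x i := Fintype.linearCombination_apply R x c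
  have hκξ (m : M) (hm : m ∈ N.toSubmodule) : κ (ξc m) = m := by
    rw [hκ]; exact (h.mem_span_iff m).1 (hN ▸ hm)
  have hξκ (c : Fin 4 → R) : ξc (κ c) = c := by
    rw [hκ]; exact funext fun i => h.apply_sum c i
  have hκN (c : Fin 4 → R) : κ c ∈ N.toSubmodule := by
    rw [hκ, ← hN]
    exact Submodule.sum_mem _ fun i _ => Submodule.smul_mem _ _ (Submodule.subset_span ⟨i, rfl⟩)
  -- Inside `N`, the orthogonal complement of the hyperbolic pair `y₀`, `y₁` is the kernel of a
  -- surjection, hence a direct summand of rank two; a basis of it supplies the last two vectors.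
  let g : (Fin 4 → R) →ₗ[R] (Fin 2 → R) :=
    LinearMap.pi ![G.α y₀ ∘ₗ κ, G.α y₁ ∘ₗ κ]
  have hg : Function.Surjective g := by
    intro c
    refine ⟨ξc (c 0 • y₁ - c 1 • y₀), funext fun i => ?_⟩
    have e : κ (ξc (c 0 • y₁ - c 1 • y₀)) = c 0 • y₁ - c 1 • y₀ :=
      hκξ _ (Submodule.sub_mem _ (Submodule.smul_mem _ _ m₁) (Submodule.smul_mem _ _ m₀))
    fin_cases i
    · change G.α y₀ (κ (ξc (c 0 • y₁ - c 1 • y₀))) = c 0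
      rw [e]; simp [hy, G.α_self]
    · change G.α y₁ (κ (ξc (c 0 • y₁ - c 1 • y₀))) = c 1
      rw [e]; simp [hy', G.α_self]
  obtain ⟨K, hK⟩ := exists_grassmannian_pi g hg
  obtain ⟨z, η, hz, hzK⟩ := exists_dualSystem (j := 2) (Pi.basisFun R (Fin 4)) rfl K
  have hgz (i : Fin 2) : g (z i) = 0 := by
    have : z i ∈ K.toSubmodule := hzK ▸ Submodule.subset_span ⟨i, rfl⟩
    rwa [hK, LinearMap.mem_ker] at this
  have hz₀ (i : Fin 2) : G.α y₀ (κ (z i)) = 0 := congrFun (hgz i) 0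
  have hz₁ (i : Fin 2) : G.α y₁ (κ (z i)) = 0 := congrFun (hgz i) 1
  -- The projection of `M` along `y₀`, `y₁` onto their orthogonal complement; composing with it
  -- makes the last two dual functionals vanish on the first two vectors.
  let P : M →ₗ[R] M := LinearMap.id - (G.α y₀).smulRight y₁ + (G.α y₁).smulRight y₀
  have hP (m) : P m = m - G.α y₀ m • y₁ + G.α y₁ m • y₀ := by simp [P]
  have hP₀ : P y₀ = 0 := by rw [hP, G.α_self, hy']; simp
  have hP₁ : P y₁ = 0 := by rw [hP, G.α_self, hy]; simp
  have hPz (i : Fin 2) : P (κ (z i)) = κ (z i) := by rw [hP, hz₀, hz₁]; simp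
  let x' : Fin 4 → M := ![y₀, y₁, κ (z 0), κ (z 1)]
  let ξ' : Fin 4 → M →ₗ[R] R := ![-G.α y₁, G.α y₀, η 0 ∘ₗ ξc ∘ₗ P, η 1 ∘ₗ ξc ∘ₗ P]
  have hA : G.Adapted x' ξ' :=
    { apply_eq := fun i j => by
        fin_cases i <;> fin_cases j <;>
          simp [x', ξ', hy, hy', G.α_self, hz₀, hz₁, hP₀, hP₁, hPz, hξκ, hz.apply_eq]
      h01 := hy
      h02 := hz₀ 0
      h03 := hz₀ 1
      h12 := hz₁ 0
      h13 := hz₁ 1 }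
  refine ⟨x', ξ', hA, ?_⟩
  obtain ⟨N', hN'⟩ := hA.exists_grassmannian (k := 2) G.basis rfl
  have : N' = N := Grassmannian.eq_of_le (by
    rw [hN', Submodule.span_le]
    rintro _ ⟨i, rfl⟩
    fin_cases i
    · exact m₀
    · exact m₁
    · exact hκN _
    · exact hκN _)
  rw [← this, hN']

/-- A hyperplane over a local ring has a free quotient of rank one, so it is the kernel of a single
functional that takes the value one. -/
theorem exists_functional_of_dualSystem [IsLocalRing R] {n : ℕ} (b : Module.Basis (Fin (n + 1)) R M)
    {x : Fin n → M} {ξ : Fin n → M →ₗ[R] R} (h : DualSystem x ξ) :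
    ∃ (l : M →ₗ[R] R) (v : M), l v = 1 ∧
      ∀ m, m ∈ Submodule.span R (Set.range x) ↔ l m = 0 := by
  obtain ⟨N, hN⟩ := h.exists_grassmannian (k := 1) b rfl
  have hfree : Module.Free R (M ⧸ N.toSubmodule) := Module.free_of_flat_of_isLocalRing
  have hk : Module.finrank R (M ⧸ N.toSubmodule) = 1 := by
    have := N.rankAtStalk_eq (IsLocalRing.closedPoint R)
    rwa [Module.rankAtStalk_eq_finrank_of_free, Pi.natCast_apply, Nat.cast_id] at this
  let B := Module.finBasisOfFinrankEq R (M ⧸ N.toSubmodule) hk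
  obtain ⟨v, hv⟩ := N.toSubmodule.mkQ_surjective (B 0)
  refine ⟨B.coord 0 ∘ₗ N.toSubmodule.mkQ, v, by simp [hv], fun m => ?_⟩
  rw [← hN, ← Submodule.Quotient.mk_eq_zero, ← Submodule.mkQ_apply, LinearMap.comp_apply,
    ← B.repr.map_eq_zero_iff]
  constructor
  · intro h
    exact congrArg (fun f => f 0) h
  · intro h
    refine Finsupp.ext fun i => ?_
    rw [Fin.fin_one_eq_zero i]
    exact h

variable {x : Fin 4 → M} {ξ : Fin 4 → M →ₗ[R] R}

/-- The local structure of the four-dimensional subspaces on which `Ω` vanishes. -/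
theorem Adapted.exists_parameters [IsLocalRing R] (h : G.Adapted x ξ)
    (V : Module.Grassmannian R M₇ 3)
    (hV : ∀ m ∈ V.toSubmodule, G.pr m ∈ Submodule.span R (Set.range x))
    (hΩ : ∀ m ∈ V.toSubmodule, ∀ m' ∈ V.toSubmodule, ∀ m'' ∈ V.toSubmodule, G.Ω m m' m'' = 0) :
    ∃ (l r : Fin 3 → R) (c : R), ∑ i, r i * l i = 1 ∧ G.ω (x 0) (x 2) (x 3) = c * l 0 ∧
      G.ω (x 1) (x 2) (x 3) = c * l 1 ∧ G.α (x 2) (x 3) = c * l 2 ∧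
      ∀ m, m ∈ V.toSubmodule ↔
        G.pr m ∈ Submodule.span R (Set.range x) ∧ G.functional x ξ l m = 0 := by
  obtain ⟨y, η, hy, hyV⟩ := exists_dualSystem (j := 4) G.basis₇ rfl V
  -- The coordinates `κ` and `ζ` identify `U₄ ⊕ R e` with `R ^ 5`, where `V` becomes a hyperplane
  -- and so has an equation `ℓ`.
  let κ : (Fin 5 → R) →ₗ[R] M₇ :=
    G.ι ∘ₗ Fintype.linearCombination R x ∘ₗ LinearMap.funLeft R R Fin.castSucc +
      (LinearMap.proj 4).smulRight G.e
  let ζ : M₇ →ₗ[R] (Fin 5 → R) :=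
    LinearMap.pi ![ξ 0 ∘ₗ G.pr, ξ 1 ∘ₗ G.pr, ξ 2 ∘ₗ G.pr, ξ 3 ∘ₗ G.pr, G.lam]
  have hκ (c) : κ c = G.ι (c 0 • x 0 + c 1 • x 1 + c 2 • x 2 + c 3 • x 3) + c 4 • G.e := by
    simp [κ, Fintype.linearCombination_apply, Fin.sum_univ_four, LinearMap.funLeft_apply]
  have hκζ (m : M₇) (hm : G.pr m ∈ Submodule.span R (Set.range x)) : κ (ζ m) = m := by
    rw [hκ]
    have := (h.mem_span_iff _).1 hm
    rw [Fin.sum_univ_four] at this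
    conv_rhs => rw [← G.eq m, ← this]
    rfl
  have hy' (i : Fin 4) : κ (ζ (y i)) = y i :=
    hκζ _ (hV _ (hyV ▸ Submodule.subset_span ⟨i, rfl⟩))
  have hd : DualSystem (fun i => ζ (y i)) (fun i => η i ∘ₗ κ) := ⟨fun a b => by
    rw [LinearMap.comp_apply, hy', hy.apply_eq]⟩
  obtain ⟨ℓ, v, hv, hℓ⟩ := exists_functional_of_dualSystem (Pi.basisFun R (Fin 5)) hd
  let L : M₇ →ₗ[R] R := ℓ ∘ₗ ζ
  have hζκ (c : Fin 5 → R) : ζ (κ c) = c := by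
    ext i
    fin_cases i <;>
    simp [ζ, hκ, G.pr_ι, G.pr_e, G.lam_ι, G.lam_e, h.apply_eq]
  have hVL (m : M₇) : m ∈ V.toSubmodule ↔
      G.pr m ∈ Submodule.span R (Set.range x) ∧ L m = 0 := by
    constructor
    · intro hm
      refine ⟨hV m hm, (hℓ _).1 ?_⟩
      rw [← hyV] at hm
      have := Submodule.mem_map_of_mem (f := ζ) hm
      rw [Submodule.map_span, ← Set.range_comp] at this
      exact this
    · rintro ⟨hm, hL⟩
      have := Submodule.mem_map_of_mem (f := κ) ((hℓ _).2 hL)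
      rw [Submodule.map_span, ← Set.range_comp, hκζ m hm] at this
      rw [← hyV]
      convert! this using 3
      exact funext fun i => (hy' i).symm
  let U : Submodule R M₇ := (Submodule.span R (Set.range x)).comap G.pr
  have hκU (c) : κ c ∈ U := by
    change G.pr (κ c) ∈ Submodule.span R (Set.range x)
    rw [hκ, map_add, G.pr_ι, map_smul, G.pr_e, smul_zero, add_zero]
    refine Submodule.add_mem _ (Submodule.add_mem _ (Submodule.add_mem _ ?_ ?_) ?_) ?_ <;>
      exact Submodule.smul_mem _ _ (Submodule.subset_span ⟨_, rfl⟩)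
  have hLκ : L (κ v) = 1 := by rw [LinearMap.comp_apply, hζκ, hv]
  have hrel {a b c d : M₇} (ha : a ∈ U) (hb : b ∈ U) (hc : c ∈ U) (hd : d ∈ U) :=
    G.wedge_eq_zero L (hκU v) hLκ (fun x hx y hy z hz hLx hLy hLz =>
      hΩ _ ((hVL x).2 ⟨hx, hLx⟩) _ ((hVL y).2 ⟨hy, hLy⟩) _ ((hVL z).2 ⟨hz, hLz⟩)) ha hb hc hd
  have mx (i : Fin 4) : G.ι (x i) ∈ U := by
    change G.pr (G.ι (x i)) ∈ Submodule.span R (Set.range x)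
    rw [G.pr_ι]
    exact Submodule.subset_span ⟨i, rfl⟩
  have me : G.e ∈ U := by
    change G.pr G.e ∈ Submodule.span R (Set.range x)
    rw [G.pr_e]; exact Submodule.zero_mem _
  -- The five values of `L ∧ Ω` on the basis of `U₄ ⊕ R e`. The first two express `L(x₂)` and
  -- `L(x₃)` through `L(e)`; the other three then say that all two by two minors of the equations of
  -- `Y₄` against `l` vanish.
  have r1 := hrel (mx 0) (mx 1) (mx 2) me
  have r2 := hrel (mx 0) (mx 1) (mx 3) me
  have r3 := hrel (mx 0) (mx 2) (mx 3) me
  have r4 := hrel (mx 1) (mx 2) (mx 3) me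
  have r5 := hrel (mx 0) (mx 1) (mx 2) (mx 3)
  simp only [G.Ω_eq, G.pr_ι, G.pr_e, G.lam_ι, G.lam_e, map_zero, zero_mul,
    one_mul, mul_zero, add_zero, sub_zero, zero_add, h.h01, h.h02, h.h03, h.h12, h.h13, mul_one]
    at r1 r2 r3 r4 r5
  have hℓc (c : Fin 5 → R) : ℓ c = c 0 * L (G.ι (x 0)) + c 1 * L (G.ι (x 1)) +
      c 2 * L (G.ι (x 2)) + c 3 * L (G.ι (x 3)) + c 4 * L G.e := by
    conv_lhs => rw [← hζκ c]
    change L (κ c) = _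
    rw [hκ]
    simp only [map_add, map_smul, smul_eq_mul]
  let l : Fin 3 → R := ![L (G.ι (x 0)), L (G.ι (x 1)), L G.e]
  let r : Fin 3 → R := ![v 0, v 1, v 2 * G.ω (x 0) (x 1) (x 2) + v 3 * G.ω (x 0) (x 1) (x 3) + v 4]
  have hr : ∑ i, r i * l i = 1 := by
    rw [hℓc] at hv
    rw [Fin.sum_univ_three]
    simp only [r, l, Matrix.cons_val_zero, Matrix.cons_val_one, Matrix.cons_val]
    linear_combination hv - v 2 * r1 - v 3 * r2
  have hr' := hr
  rw [Fin.sum_univ_three] at hr'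
  simp only [l, Matrix.cons_val_zero, Matrix.cons_val_one, Matrix.cons_val] at hr'
  -- A vector `s` parallel to `l` with `r · l = 1` equals `(r · s) l`, so the scalar is `r · s`.
  refine ⟨l, r, r 0 * G.ω (x 0) (x 2) (x 3) + r 1 * G.ω (x 1) (x 2) (x 3) + r 2 * G.α (x 2) (x 3),
    hr, ?_, ?_, ?_, fun m => ?_⟩
  · simp only [l, Matrix.cons_val_zero]
    generalize r 0 = a at *
    generalize r 1 = b at *
    generalize r 2 = d at *
    linear_combination -G.ω (x 0) (x 2) (x 3) * hr' - b * (r5 - G.ω (x 0) (x 1) (x 3) * r1 + G.ω (x 0) (x 1) (x 2) * r2) - d * r3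
  · simp only [l, Matrix.cons_val_one, Matrix.cons_val_zero]
    generalize r 0 = a at *
    generalize r 1 = b at *
    generalize r 2 = d at *
    linear_combination -G.ω (x 1) (x 2) (x 3) * hr' + a * (r5 - G.ω (x 0) (x 1) (x 3) * r1 + G.ω (x 0) (x 1) (x 2) * r2) - d * r4
  · simp only [l, Matrix.cons_val]
    generalize r 0 = a at *
    generalize r 1 = b at *
    generalize r 2 = d at *
    linear_combination -G.α (x 2) (x 3) * hr' + a * r3 + b * r4
  · rw [hVL]
    refine and_congr_right fun hm => ?_
    have : L m = G.functional x ξ l m := by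
      change ℓ (ζ m) = _
      rw [hℓc, functional_apply]
      simp only [l, ζ, LinearMap.pi_apply, Matrix.cons_val_zero, Matrix.cons_val_one,
        Matrix.cons_val, LinearMap.comp_apply]
      linear_combination ξ 2 (G.pr m) * r1 + ξ 3 (G.pr m) * r2
    rw [this]

end Geometry

end

section

/-! ### The standard three-form in seven variables -/

section Standard

variable {R : Type*} [CommRing R]

/-- The standard general three-form in coordinates. -/
def stdForm (x y z : Fin 7 → R) : R :=
  Matrix.det !![x 0, y 0, z 0; x 1, y 1, z 1; x 4, y 4, z 4] +
  Matrix.det !![x 0, y 0, z 0; x 2, y 2, z 2; x 5, y 5, z 5] +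
  Matrix.det !![x 0, y 0, z 0; x 3, y 3, z 3; x 6, y 6, z 6] +
  Matrix.det !![x 1, y 1, z 1; x 2, y 2, z 2; x 3, y 3, z 3] +
  Matrix.det !![x 4, y 4, z 4; x 5, y 5, z 5; x 6, y 6, z 6]

/-- The equations expressing that the contraction of the three-form with two vectors vanishes. -/
theorem stdForm_equations {x y : Fin 7 → R} (h : ∀ z, stdForm x y z = 0) :
    x 1 * y 4 - x 4 * y 1 + (x 2 * y 5 - x 5 * y 2) + (x 3 * y 6 - x 6 * y 3) = 0 ∧
    x 2 * y 3 - x 3 * y 2 = x 0 * y 4 - x 4 * y 0 ∧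
    x 3 * y 1 - x 1 * y 3 = x 0 * y 5 - x 5 * y 0 ∧
    x 1 * y 2 - x 2 * y 1 = x 0 * y 6 - x 6 * y 0 ∧
    x 5 * y 6 - x 6 * y 5 = -(x 0 * y 1 - x 1 * y 0) ∧
    x 6 * y 4 - x 4 * y 6 = -(x 0 * y 2 - x 2 * y 0) ∧
    x 4 * y 5 - x 5 * y 4 = -(x 0 * y 3 - x 3 * y 0) := by
  have h0 := h (Pi.single 0 1)
  have h1 := h (Pi.single 1 1)
  have h2 := h (Pi.single 2 1)
  have h3 := h (Pi.single 3 1)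
  have h4 := h (Pi.single 4 1)
  have h5 := h (Pi.single 5 1)
  have h6 := h (Pi.single 6 1)
  simp [stdForm, Matrix.det_fin_three] at h0 h1 h2 h3 h4 h5 h6
  refine ⟨?_, ?_, ?_, ?_, ?_, ?_, ?_⟩
  · linear_combination h0
  · linear_combination h1
  · linear_combination h2
  · linear_combination h3
  · linear_combination h4
  · linear_combination h5
  · linear_combination h6

/-- Away from a quadric, the contraction with `x` has only the multiples of `x` in its kernel. -/
theorem stdForm_kernel {x y : Fin 7 → R} (h : ∀ z, stdForm x y z = 0) :
    (x 0 ^ 2 - (x 1 * x 4 + x 2 * x 5 + x 3 * x 6)) • y =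
      (x 0 * y 0 - (x 1 * y 4 + x 2 * y 5 + x 3 * y 6)) • x := by
  obtain ⟨h0, h1, h2, h3, h4, h5, h6⟩ := stdForm_equations h
  ext i
  fin_cases i
  · simp
    linear_combination -x 1 * h1 - x 2 * h2 - x 3 * h3
  · simp
    linear_combination x 0 * h4 + x 5 * h3 - x 6 * h2 + x 1 * h0
  · simp
    linear_combination x 0 * h5 + x 6 * h1 - x 4 * h3 + x 2 * h0
  · simp
    linear_combination x 0 * h6 + x 4 * h2 - x 5 * h1 + x 3 * h0
  · simp
    linear_combination -x 0 * h1 + x 2 * h6 - x 3 * h5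
  · simp
    linear_combination -x 0 * h2 + x 3 * h4 - x 1 * h6
  · simp
    linear_combination -x 0 * h3 + x 1 * h5 - x 2 * h4

end Standard

section NoThreeSpace

variable {K : Type*} [Field K]

theorem finrank_le_one_of_parallel {S : Type*} [AddCommGroup S] [Module K S] {n : ℕ}
    (f : S →ₗ[K] (Fin n → K)) (hf : Function.Injective f)
    (h : ∀ x y i j, f x i * f y j = f x j * f y i) : Module.finrank K S ≤ 1 := by
  by_cases hz : ∀ x : S, x = 0
  · have : Subsingleton S := ⟨fun a b => by rw [hz a, hz b]⟩
    rw [Module.finrank_zero_of_subsingleton]; exact Nat.zero_le _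
  push Not at hz
  obtain ⟨v, hv⟩ := hz
  obtain ⟨i, hi⟩ : ∃ i, f v i ≠ 0 := by
    by_contra! hcon
    exact hv (hf (by rw [map_zero]; exact funext hcon))
  refine finrank_le_one v fun w => ⟨f w i / f v i, hf (funext fun j => ?_)⟩
  rw [map_smul, Pi.smul_apply, smul_eq_mul, div_mul_eq_mul_div, div_eq_iff hi]
  have := h w v i j
  linear_combination this

section Coordinates

variable {S : Type*} [AddCommGroup S] [Module K S] {f : S →ₗ[K] (Fin 7 → K)}

/-- When the zeroth coordinates vanish, three of the seven equations are precisely the minors in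
coordinates 1, 2, 3; three others are those in coordinates 4, 5, 6. -/
theorem stdForm_parallel_left (h : ∀ x y z, stdForm (f x) (f y) z = 0) (h0 : ∀ x, f x 0 = 0)
    (x y : S) (i j : Fin 3) :
    f x (![1, 2, 3] i) * f y (![1, 2, 3] j) = f x (![1, 2, 3] j) * f y (![1, 2, 3] i) := by
  obtain ⟨-, e1, e2, e3, -⟩ := stdForm_equations (h x y)
  rw [h0 x, h0 y] at e1 e2 e3
  fin_cases i <;> fin_cases j <;> simp <;>
    first
    | linear_combination e1
    | linear_combination e2
    | linear_combination e3
    | linear_combination -e1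
    | linear_combination -e2
    | linear_combination -e3

theorem stdForm_parallel_right (h : ∀ x y z, stdForm (f x) (f y) z = 0) (h0 : ∀ x, f x 0 = 0)
    (x y : S) (i j : Fin 3) :
    f x (![4, 5, 6] i) * f y (![4, 5, 6] j) = f x (![4, 5, 6] j) * f y (![4, 5, 6] i) := by
  obtain ⟨-, -, -, -, e1, e2, e3⟩ := stdForm_equations (h x y)
  rw [h0 x, h0 y] at e1 e2 e3
  fin_cases i <;> fin_cases j <;> simp <;>
    first
    | linear_combination e1
    | linear_combination e2
    | linear_combination e3
    | linear_combination -e1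
    | linear_combination -e2
    | linear_combination -e3

theorem finrank_le_one_of_stdForm (hf : Function.Injective f)
    (h : ∀ x y z, stdForm (f x) (f y) z = 0) (h0 : ∀ x, f x 0 = 0)
    (ha : ∀ x, (∀ i, f x (![4, 5, 6] i) = 0) → ∀ i, f x (![1, 2, 3] i) = 0) :
    Module.finrank K S ≤ 1 := by
  refine finrank_le_one_of_parallel (LinearMap.funLeft K K ![4, 5, 6] ∘ₗ f)
    ((injective_iff_map_eq_zero _).2 fun u hu => ?_) (stdForm_parallel_right h h0)
  have hb (i) : f u (![4, 5, 6] i) = 0 := congrFun hu i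
  have ha' := ha u hb
  refine hf ?_
  rw [map_zero]
  ext i
  fin_cases i
  exacts [h0 u, ha' 0, ha' 1, ha' 2, hb 0, hb 1, hb 2]

/-- There is no three-dimensional space on which the contractions of the standard three-form with
pairs of vectors vanish. -/
theorem finrank_le_two_of_stdForm [Module.Finite K S] (hf : Function.Injective f)
    (h : ∀ x y z, stdForm (f x) (f y) z = 0) : Module.finrank K S ≤ 2 := by
  have hker {T : Submodule K S} : Function.Injective (f ∘ₗ T.subtype) :=
    hf.comp Subtype.val_injective
  -- If all zeroth coordinates vanish, the projection to coordinates 1, 2, 3 has parallel image,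
  -- hence rank at most one, and its kernel has parallel coordinates 4, 5, 6, hence dimension at
  -- most one.
  by_cases hp : ∀ w, f w 0 = 0
  · have h2 := LinearMap.finrank_range_add_finrank_ker (LinearMap.funLeft K K ![1, 2, 3] ∘ₗ f)
    have h3 : Module.finrank K (LinearMap.range (LinearMap.funLeft K K ![1, 2, 3] ∘ₗ f)) ≤ 1 :=
      finrank_le_one_of_parallel (Submodule.subtype _) Subtype.val_injective (by
        rintro ⟨_, u, rfl⟩ ⟨_, v, rfl⟩ i j
        exact stdForm_parallel_left h hp u v i j)
    have h4 : Module.finrank K (LinearMap.ker (LinearMap.funLeft K K ![1, 2, 3] ∘ₗ f)) ≤ 1 :=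
      finrank_le_one_of_stdForm (f := f ∘ₗ Submodule.subtype _) hker (fun x y => h x y)
        (fun x => hp x) fun x _ i => congrFun (LinearMap.mem_ker.1 x.2) i
    omega
  · push Not at hp
    -- Otherwise the zeroth coordinate has rank one, and its kernel has dimension at most one: a
    -- kernel vector without coordinates 4, 5, 6 loses coordinates 1, 2, 3 by the equations against
    -- `w`.
    obtain ⟨w, hw⟩ := hp
    have h2 := LinearMap.finrank_range_add_finrank_ker (LinearMap.proj 0 ∘ₗ f)
    have h1 : Module.finrank K (LinearMap.range (LinearMap.proj 0 ∘ₗ f)) ≤ 1 :=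
      (Submodule.finrank_le _).trans (by simp)
    have h4 : Module.finrank K (LinearMap.ker (LinearMap.proj 0 ∘ₗ f)) ≤ 1 := by
      have h0 (x : LinearMap.ker (LinearMap.proj 0 ∘ₗ f)) : f x 0 = 0 := LinearMap.mem_ker.1 x.2
      refine finrank_le_one_of_stdForm (f := f ∘ₗ Submodule.subtype _) hker (fun x y => h x y)
        h0 fun x hx i => ?_
      have b1 : f x 4 = 0 := hx 0
      have b2 : f x 5 = 0 := hx 1
      have b3 : f x 6 = 0 := hx 2
      obtain ⟨-, -, -, -, e1, e2, e3⟩ := stdForm_equations (h x w)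
      rw [h0 x, b1, b2] at e3
      rw [h0 x, b1, b3] at e2
      rw [h0 x, b2, b3] at e1
      have k1 : f x 1 * f w 0 = 0 := by linear_combination -e1
      have k2 : f x 2 * f w 0 = 0 := by linear_combination -e2
      have k3 : f x 3 * f w 0 = 0 := by linear_combination -e3
      fin_cases i
      · exact (mul_eq_zero.1 k1).resolve_right hw
      · exact (mul_eq_zero.1 k2).resolve_right hw
      · exact (mul_eq_zero.1 k3).resolve_right hw
    omega

end Coordinates

end NoThreeSpace

end

section

namespace Geometry

/-! ### Infinitesimal deformations of adapted systems -/

section Deformation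

variable {R M M₇ : Type*} [CommRing R] [AddCommGroup M] [Module R M] [AddCommGroup M₇]
  [Module R M₇] (G : Geometry R M M₇)

/-- The equations of the variety `Y₄` in terms of an adapted system. -/
def equations (x : Fin 4 → M) : Fin 3 → R :=
  ![G.ω (x 0) (x 2) (x 3), G.ω (x 1) (x 2) (x 3), G.α (x 2) (x 3)]

/-- The derivative of the equations of the variety `Y₄`. -/
def equationsDeriv (x y : Fin 4 → M) : Fin 3 → R :=
  ![G.ω (y 0) (x 2) (x 3) + G.ω (x 0) (y 2) (x 3) + G.ω (x 0) (x 2) (y 3),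
    G.ω (y 1) (x 2) (x 3) + G.ω (x 1) (y 2) (x 3) + G.ω (x 1) (x 2) (y 3),
    G.α (y 2) (x 3) + G.α (x 2) (y 3)]

/-- The infinitesimal condition for a deformation of an adapted system to be adapted. -/
structure IsTangent (x y : Fin 4 → M) : Prop where
  h01 : G.α (y 0) (x 1) + G.α (x 0) (y 1) = 0
  h02 : G.α (y 0) (x 2) + G.α (x 0) (y 2) = 0
  h03 : G.α (y 0) (x 3) + G.α (x 0) (y 3) = 0
  h12 : G.α (y 1) (x 2) + G.α (x 1) (y 2) = 0
  h13 : G.α (y 1) (x 3) + G.α (x 1) (y 3) = 0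

/-- The projection to the orthogonal complement of the first two vectors of an adapted system. -/
def proj (x : Fin 4 → M) : M →ₗ[R] M :=
  LinearMap.id - (G.α (x 0)).smulRight (x 1) + (G.α (x 1)).smulRight (x 0)

theorem proj_apply (x : Fin 4 → M) (m : M) :
    G.proj x m = m - G.α (x 0) m • x 1 + G.α (x 1) m • x 0 := rfl

/-- The contraction of `Ω` with the lifts of the last two vectors of an adapted system. -/
def contraction (x : Fin 4 → M) (m : M) : R :=
  G.ω m (x 2) (x 3) - G.α m (x 2) * G.ω (x 0) (x 1) (x 3) + G.α m (x 3) * G.ω (x 0) (x 1) (x 2)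

/-- The derivative of the equations along a parametrized family of tangent vectors. -/
def derivParam (x z : Fin 4 → M) : Fin 3 → R :=
  ![G.contraction x (G.proj x (z 0)) + G.ω (x 0) (G.proj x (z 2)) (x 3) +
      G.ω (x 0) (x 2) (G.proj x (z 3)),
    G.contraction x (G.proj x (z 1)) + G.ω (x 1) (G.proj x (z 2)) (x 3) +
      G.ω (x 1) (x 2) (G.proj x (z 3)),
    G.α (G.proj x (z 2)) (x 3) + G.α (x 2) (G.proj x (z 3))]

theorem derivParam_add (x z z' : Fin 4 → M) :
    G.derivParam x (z + z') = G.derivParam x z + G.derivParam x z' := by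
  ext i
  fin_cases i <;>
    simp only [derivParam, contraction, Pi.add_apply, map_add, LinearMap.add_apply,
      Fin.zero_eta, Fin.mk_one, Fin.reduceFinMk, Matrix.cons_val_zero, Matrix.cons_val_one,
      Matrix.cons_val] <;> ring

theorem derivParam_smul (x z : Fin 4 → M) (c : R) :
    G.derivParam x (c • z) = c • G.derivParam x z := by
  ext i
  fin_cases i <;>
    simp only [derivParam, contraction, Pi.smul_apply, map_smul, LinearMap.smul_apply, smul_eq_mul,
      Fin.zero_eta, Fin.mk_one, Fin.reduceFinMk, Matrix.cons_val_zero, Matrix.cons_val_one,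
      Matrix.cons_val] <;> ring

variable {G}
variable {x : Fin 4 → M} {ξ : Fin 4 → M →ₗ[R] R}

theorem Adapted.α_proj (h : G.Adapted x ξ) (m : M) :
    G.α (x 0) (G.proj x m) = 0 ∧ G.α (x 1) (G.proj x m) = 0 := by
  have e10 := G.α_swap (x 0) (x 1)
  simp [proj_apply, e10, h.h01, G.α_self]

/-- All four vectors move freely inside the orthogonal complement of `x 0`, `x 1`. The multiples of
`x 0`, `x 1` added to the last two restore their orthogonality to first order, and are the source of
the `α`–`ω` terms in `contraction`. -/
theorem Adapted.exists_isTangent (h : G.Adapted x ξ) (z : Fin 4 → M) :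
    ∃ y, G.IsTangent x y ∧ G.equationsDeriv x y = G.derivParam x z := by
  have p0 (i) := (h.α_proj (z i)).1
  have p1 (i) := (h.α_proj (z i)).2
  have q1 (i) : G.α (G.proj x (z i)) (x 1) = 0 := by rw [G.α_swap, p1, neg_zero]
  have e10 := G.α_swap (x 0) (x 1)
  have e20 : G.α (x 2) (x 0) = 0 := by rw [G.α_swap, h.h02, neg_zero]
  have e21 : G.α (x 2) (x 1) = 0 := by rw [G.α_swap, h.h12, neg_zero]
  have r21 := G.ω_swap_right (x 0) (x 1) (x 2)
  have l01 := G.ω_swap_left (x 0) (x 1)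
  have r20 := G.ω_swap_right (x 1) (x 0) (x 2)
  refine ⟨![G.proj x (z 0), G.proj x (z 1),
    G.proj x (z 2) - G.α (G.proj x (z 0)) (x 2) • x 1 + G.α (G.proj x (z 1)) (x 2) • x 0,
    G.proj x (z 3) - G.α (G.proj x (z 0)) (x 3) • x 1 + G.α (G.proj x (z 1)) (x 3) • x 0], ?_, ?_⟩
  · constructor <;> simp [p0, p1, q1, e10, h.h01, G.α_self]
  · ext i
    fin_cases i <;>
    simp only [equationsDeriv, derivParam, contraction, map_add, map_sub, map_smul,
      LinearMap.add_apply, LinearMap.sub_apply, LinearMap.smul_apply, smul_eq_mul,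
      Fin.zero_eta, Fin.mk_one, Fin.reduceFinMk, Matrix.cons_val_zero, Matrix.cons_val_one,
      Matrix.cons_val, G.ω_self_left, G.ω_self_outer, e20, e21, h.h03, h.h13, r21, l01, r20] <;>
    ring

end Deformation

section Field

variable {K M M₇ : Type*} [Field K] [AddCommGroup M] [Module K M] [AddCommGroup M₇]
  [Module K M₇] {G : Geometry K M M₇} {x : Fin 4 → M} {ξ : Fin 4 → M →ₗ[K] K}

/-- Over a field, the equations of `Y₄` are independent at each point of `Y₄`. -/
theorem Adapted.eq_zero_of_derivParam (h : G.Adapted x ξ) (φ : M₇ ≃ₗ[K] (Fin 7 → K))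
    (hφ : ∀ x y z, G.Ω x y z = stdForm (φ x) (φ y) (φ z)) (hs : G.equations x = 0)
    (c : Fin 3 → K) (hc : ∀ z, ∑ i, c i * G.derivParam x z i = 0) : c = 0 := by
  have s0 : G.ω (x 0) (x 2) (x 3) = 0 := congrFun hs 0
  have s1 : G.ω (x 1) (x 2) (x 3) = 0 := congrFun hs 1
  have s2 : G.α (x 2) (x 3) = 0 := congrFun hs 2
  have c0 (m : M) : c 0 * G.contraction x (G.proj x m) = 0 := by
    simpa [Fin.sum_univ_three, derivParam, contraction] using hc (Pi.single 0 m)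
  have c1 (m : M) : c 1 * G.contraction x (G.proj x m) = 0 := by
    simpa [Fin.sum_univ_three, derivParam, contraction] using hc (Pi.single 1 m)
  have c2 (m : M) : c 0 * G.ω (x 0) (G.proj x m) (x 3) + c 1 * G.ω (x 1) (G.proj x m) (x 3) +
      c 2 * G.α (G.proj x m) (x 3) = 0 := by
    simpa [Fin.sum_univ_three, derivParam, contraction] using hc (Pi.single 2 m)
  have c3 (m : M) : c 0 * G.ω (x 0) (x 2) (G.proj x m) + c 1 * G.ω (x 1) (x 2) (G.proj x m) +
      c 2 * G.α (x 2) (G.proj x m) = 0 := by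
    simpa [Fin.sum_univ_three, derivParam, contraction] using hc (Pi.single 3 m)
  have e20 : G.α (x 2) (x 0) = 0 := by rw [G.α_swap, h.h02, neg_zero]
  have e21 : G.α (x 2) (x 1) = 0 := by rw [G.α_swap, h.h12, neg_zero]
  have e30 : G.α (x 3) (x 0) = 0 := by rw [G.α_swap, h.h03, neg_zero]
  have e31 : G.α (x 3) (x 1) = 0 := by rw [G.α_swap, h.h13, neg_zero]
  have e10 := G.α_swap (x 0) (x 1)
  rw [h.h01] at e10
  -- If only the third coefficient is left, perfectness of `α` kills it: the dual vector to `x 2`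
  -- pairs with `x 2` to one.
  by_cases h01 : c 0 = 0 ∧ c 1 = 0
  · obtain ⟨y, hy⟩ := exists_dual_vectors (G := G) h.toDualSystem
    have := c3 (y 2)
    rw [h01.1, h01.2, G.proj_apply] at this
    simp [hy] at this
    ext i
    fin_cases i
    exacts [h01.1, h01.2, this]
  exfalso
  have hE (m : M) : G.contraction x (G.proj x m) = 0 := by
    by_contra hm
    exact h01 ⟨(mul_eq_zero.1 (c0 m)).resolve_right hm, (mul_eq_zero.1 (c1 m)).resolve_right hm⟩
  -- A nontrivial dependence makes the contractions of `Ω` with any two of `X₂`, `X₃`, `Z` vanish: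
  -- for `X₂`, `X₃` because `contraction` vanishes on the orthogonal complement and the equations of
  -- `Y₄` hold, for pairs with `Z` by the conditions `c3` and `c2`. These vectors span a
  -- three-space, which the standard form forbids.
  let X₂ := G.ι (x 2) - G.ω (x 0) (x 1) (x 2) • G.e
  let X₃ := G.ι (x 3) - G.ω (x 0) (x 1) (x 3) • G.e
  let Z := G.ι (c 0 • x 0 + c 1 • x 1) + c 2 • G.e
  have pX₂ : G.pr X₂ = x 2 := by simp [X₂, G.pr_ι, G.pr_e]
  have pX₃ : G.pr X₃ = x 3 := by simp [X₃, G.pr_ι, G.pr_e]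
  have pZ : G.pr Z = c 0 • x 0 + c 1 • x 1 := by simp [Z, G.pr_ι, G.pr_e]
  have lX₂ : G.lam X₂ = -G.ω (x 0) (x 1) (x 2) := by simp [X₂, G.lam_ι, G.lam_e]
  have lX₃ : G.lam X₃ = -G.ω (x 0) (x 1) (x 3) := by simp [X₃, G.lam_ι, G.lam_e]
  have lZ : G.lam Z = c 2 := by simp [Z, G.lam_ι, G.lam_e]
  have hdec (m : M₇) : m = G.ι (G.proj x (G.pr m)) + G.α (x 0) (G.pr m) • G.ι (x 1) -
      G.α (x 1) (G.pr m) • G.ι (x 0) + G.lam m • G.e := by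
    conv_lhs => rw [← G.eq m]
    rw [proj_apply]
    simp only [map_add, map_sub, map_smul]
    abel
  have hall {a b : M₇} (hp : ∀ m, G.Ω a b (G.ι (G.proj x m)) = 0) (h0 : G.Ω a b (G.ι (x 0)) = 0)
      (h1 : G.Ω a b (G.ι (x 1)) = 0) (he : G.Ω a b G.e = 0) (m : M₇) : G.Ω a b m = 0 := by
    rw [hdec m]
    simp [hp, h0, h1, he]
  have hX₂₃ : ∀ m, G.Ω X₂ X₃ m = 0 := by
    refine hall (fun m => ?_) ?_ ?_ ?_
    · have := hE m
      rw [contraction] at this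
      simp only [G.Ω_eq, pX₂, pX₃, lX₂, lX₃, G.pr_ι, G.lam_ι]
      rw [G.α_swap (G.proj x m) (x 3), G.α_swap (G.proj x m) (x 2),
        G.ω_swap_right (x 2) (G.proj x m) (x 3), G.ω_swap_left (G.proj x m) (x 2)]
      linear_combination this
    · simp only [G.Ω_eq, pX₂, pX₃, lX₂, lX₃, G.pr_ι, G.lam_ι, e20, e30, G.ω_swap_right (x 2) (x 0) (x 3),
        G.ω_swap_left (x 0) (x 2), s0]
      ring
    · simp only [G.Ω_eq, pX₂, pX₃, lX₂, lX₃, G.pr_ι, G.lam_ι, e21, e31, G.ω_swap_right (x 2) (x 1) (x 3),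
        G.ω_swap_left (x 1) (x 2), s1]
      ring
    · simp only [G.Ω_eq, pX₂, pX₃, lX₂, lX₃, G.pr_e, G.lam_e, map_zero, s2]
      ring
  have hX₂Z : ∀ m, G.Ω X₂ Z m = 0 := by
    refine hall (fun m => ?_) ?_ ?_ ?_ <;>
      simp only [G.Ω_eq, pX₂, pZ, lX₂, lZ, map_smul, map_add, G.pr_ι, G.pr_e, G.lam_ι, G.lam_e,
        LinearMap.add_apply, LinearMap.smul_apply, smul_eq_mul,
        map_zero, e20, e21, e10, h.h01, G.α_self]
    · have := c3 m
      rw [(h.α_proj m).1, (h.α_proj m).2, G.ω_swap_left (x 0) (x 2), G.ω_swap_left (x 1) (x 2)]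
      linear_combination -this
    · rw [G.ω_self_right, G.ω_swap_left (x 1) (x 2), G.ω_swap_right (x 1) (x 0) (x 2),
        G.ω_swap_left (x 0) (x 1)]
      ring
    · rw [G.ω_self_right, G.ω_swap_left (x 0) (x 2), G.ω_swap_right (x 0) (x 1) (x 2)]
      ring
    · ring
  have hX₃Z : ∀ m, G.Ω X₃ Z m = 0 := by
    refine hall (fun m => ?_) ?_ ?_ ?_ <;>
      simp only [G.Ω_eq, pX₃, pZ, lX₃, lZ, map_smul, map_add, G.pr_ι, G.pr_e, G.lam_ι, G.lam_e,
        LinearMap.add_apply, LinearMap.smul_apply, smul_eq_mul,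
        map_zero, e30, e31, e10, h.h01, G.α_self]
    · have := c2 m
      rw [(h.α_proj m).1, (h.α_proj m).2, G.ω_swap_left (x 0) (x 3), G.ω_swap_left (x 1) (x 3),
        G.ω_swap_right (x 0) (G.proj x m) (x 3), G.ω_swap_right (x 1) (G.proj x m) (x 3),
        G.α_swap (G.proj x m) (x 3)]
      linear_combination this
    · rw [G.ω_self_right, G.ω_swap_left (x 1) (x 3), G.ω_swap_right (x 1) (x 0) (x 3),
        G.ω_swap_left (x 0) (x 1)]
      ring
    · rw [G.ω_self_right, G.ω_swap_left (x 0) (x 3), G.ω_swap_right (x 0) (x 1) (x 3)]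
      ring
    · ring
  let f : (Fin 3 → K) →ₗ[K] M₇ := Fintype.linearCombination K ![X₂, X₃, Z]
  have hf (a) : f a = a 0 • X₂ + a 1 • X₃ + a 2 • Z := by
    simp [f, Fintype.linearCombination_apply, Fin.sum_univ_three]
  have hinj : Function.Injective f := by
    refine (injective_iff_map_eq_zero _).2 fun a ha => ?_
    rw [hf] at ha
    have hpr : a 0 • x 2 + a 1 • x 3 + a 2 • (c 0 • x 0 + c 1 • x 1) = 0 := by
      have := congrArg G.pr ha
      simpa [X₂, X₃, Z, G.pr_ι, G.pr_e] using this
    have k0 := congrArg (ξ 0) hpr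
    have k1 := congrArg (ξ 1) hpr
    have k2 := congrArg (ξ 2) hpr
    have k3 := congrArg (ξ 3) hpr
    simp [h.apply_eq] at k0 k1 k2 k3
    have : a 2 = 0 := by
      by_contra ha2
      exact h01 ⟨k0.resolve_left ha2, k1.resolve_left ha2⟩
    ext i
    fin_cases i
    exacts [k2, k3, this]
  have := finrank_le_two_of_stdForm (K := K) (f := φ.toLinearMap ∘ₗ f) (φ.injective.comp hinj)
    (fun a b z => by
      have := hφ (f a) (f b) (φ.symm z)
      rw [φ.apply_symm_apply] at this
      change stdForm (φ (f a)) (φ (f b)) z = 0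
      rw [← this, hf, hf]
      simp only [map_add, map_smul, LinearMap.add_apply, LinearMap.smul_apply, smul_eq_mul,
        hX₂₃, hX₂Z, hX₃Z, G.Ω_self_left, G.Ω_swap_left X₂ X₃, G.Ω_swap_left X₂ Z,
        G.Ω_swap_left X₃ Z]
      ring)
  simp at this

end Field

end Geometry

end

section

namespace Geometry

/-! ### Base change -/

section Hom

variable {R M M₇ R' M' M₇' : Type*} [CommRing R] [AddCommGroup M] [Module R M] [AddCommGroup M₇]
  [Module R M₇] [CommRing R'] [AddCommGroup M'] [Module R' M'] [AddCommGroup M₇'] [Module R' M₇']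

/-- A base change of geometries along a ring homomorphism. -/
structure Hom (G : Geometry R M M₇) (G' : Geometry R' M' M₇') (φ : R →+* R') where
  f : M →ₛₗ[φ] M'
  f₇ : M₇ →ₛₗ[φ] M₇'
  pr_f₇ : ∀ m, G'.pr (f₇ m) = f (G.pr m)
  f₇_e : f₇ G.e = G'.e
  lam_f₇ : ∀ m, G'.lam (f₇ m) = φ (G.lam m)
  α_f : ∀ x y, G'.α (f x) (f y) = φ (G.α x y)
  ω_f : ∀ x y z, G'.ω (f x) (f y) (f z) = φ (G.ω x y z)
  f_basis : ∀ i, f (G.basis i) = G'.basis i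

variable {G : Geometry R M M₇} {G' : Geometry R' M' M₇'} {φ : R →+* R'}
  {x : Fin 4 → M} {ξ : Fin 4 → M →ₗ[R] R}

theorem Hom.exists_functional (T : Hom G G' φ) (l : M →ₗ[R] R) :
    ∃ l' : M' →ₗ[R'] R', ∀ m, l' (T.f m) = φ (l m) := by
  refine ⟨G'.basis.constr R' fun i => φ (l (G.basis i)), fun m => ?_⟩
  conv_lhs => rw [← G.basis.sum_repr m]
  conv_rhs => rw [← G.basis.sum_repr m]
  simp only [map_sum, LinearMap.map_smulₛₗ, map_smul, T.f_basis, Module.Basis.constr_basis,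
    smul_eq_mul, map_mul]

theorem Hom.adapted (T : Hom G G' φ) (h : G.Adapted x ξ) :
    ∃ ξ', G'.Adapted (fun i => T.f (x i)) ξ' ∧ ∀ i m, ξ' i (T.f m) = φ (ξ i m) := by
  choose ξ' hξ' using fun i => T.exists_functional (ξ i)
  refine ⟨ξ', ?_, hξ'⟩
  exact
    { apply_eq := fun a b => by rw [hξ', h.apply_eq]; split_ifs <;> simp
      h01 := by rw [T.α_f, h.h01, map_one]
      h02 := by rw [T.α_f, h.h02, map_zero]
      h03 := by rw [T.α_f, h.h03, map_zero]
      h12 := by rw [T.α_f, h.h12, map_zero]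
      h13 := by rw [T.α_f, h.h13, map_zero] }

theorem Hom.f_mem_span (T : Hom G G' φ) {j : ℕ} {x : Fin j → M} {m : M}
    (hm : m ∈ Submodule.span R (Set.range x)) :
    T.f m ∈ Submodule.span R' (Set.range fun i => T.f (x i)) := by
  induction hm using Submodule.span_induction with
  | mem m hm => obtain ⟨a, rfl⟩ := hm; exact Submodule.subset_span ⟨a, rfl⟩
  | zero => simp
  | add m m' _ _ h h' => rw [map_add]; exact Submodule.add_mem _ h h'
  | smul c m _ h => rw [LinearMap.map_smulₛₗ]; exact Submodule.smul_mem _ _ h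

theorem Hom.equations_f (T : Hom G G' φ) :
    G'.equations (fun i => T.f (x i)) = fun i => φ (G.equations x i) := by
  ext i
  fin_cases i <;> simp [equations, T.ω_f, T.α_f]

theorem Hom.proj_f (T : Hom G G' φ) (m : M) :
    G'.proj (fun i => T.f (x i)) (T.f m) = T.f (G.proj x m) := by
  simp only [proj_apply, map_add, map_sub, LinearMap.map_smulₛₗ, T.α_f]

theorem Hom.derivParam_f (T : Hom G G' φ) (z : Fin 4 → M) :
    G'.derivParam (fun i => T.f (x i)) (fun i => T.f (z i)) = fun i => φ (G.derivParam x z i) := by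
  ext i
  fin_cases i <;> simp [derivParam, contraction, T.proj_f, T.ω_f, T.α_f]

end Hom

section Residue

variable {R M M₇ K M' M₇' : Type*} [CommRing R] [AddCommGroup M] [Module R M]
  [AddCommGroup M₇] [Module R M₇] [Field K] [AddCommGroup M'] [Module K M'] [AddCommGroup M₇']
  [Module K M₇'] {G : Geometry R M M₇} {G' : Geometry K M' M₇'} {φ : R →+* K}
  {x : Fin 4 → M} {ξ : Fin 4 → M →ₗ[R] R}

/-- The equations of `Y₄` are independent at each point of `Y₄`. -/
theorem Hom.exists_equationsDeriv (T : Hom G G' φ) [IsLocalHom φ] (hf : Function.Surjective T.f)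
    (ψ : M₇' ≃ₗ[K] (Fin 7 → K))
    (hψ : ∀ x y z, G'.Ω x y z = stdForm (ψ x) (ψ y) (ψ z)) (h : G.Adapted x ξ)
    (hs : ∀ i, φ (G.equations x i) = 0) (l : Fin 3 → R) :
    ∃ y, G.IsTangent x y ∧ G.equationsDeriv x y = l := by
  obtain ⟨ξ', h', -⟩ := T.adapted h
  let D : (Fin 4 → M) →ₗ[R] (Fin 3 → R) :=
    { toFun := G.derivParam x
      map_add' := G.derivParam_add x
      map_smul' := fun c z => G.derivParam_smul x z c }
  let D' : (Fin 4 → M') →ₗ[K] (Fin 3 → K) :=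
    { toFun := G'.derivParam fun i => T.f (x i)
      map_add' := G'.derivParam_add _
      map_smul' := fun c z => G'.derivParam_smul _ z c }
  have hD' : Function.Surjective D' := by
    rw [← LinearMap.range_eq_top]
    by_contra hne
    -- A proper image over the field is killed by a nonzero functional, whose coefficients are the
    -- dependence excluded by `Adapted.eq_zero_of_derivParam`.
    obtain ⟨c, hc0, hc⟩ := Submodule.exists_dual_map_eq_bot_of_lt_top (lt_top_iff_ne_top.2 hne)
      inferInstance
    refine hc0 ?_
    have hcs (v : Fin 3 → K) : c v = ∑ i, c (Pi.single i 1) * v i := by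
      rw [LinearMap.pi_apply_eq_sum_univ c v]
      refine Finset.sum_congr rfl fun i _ => ?_
      rw [smul_eq_mul, mul_comm]
      congr 2
      ext a
      rw [Pi.single_apply]
      simp only [eq_comm]
    have := h'.eq_zero_of_derivParam ψ hψ (by rw [T.equations_f]; exact funext hs)
      (fun i => c (Pi.single i 1)) (fun z => by
        rw [← hcs]
        have : c (D' z) ∈ Submodule.map c (LinearMap.range D') := ⟨_, ⟨z, rfl⟩, rfl⟩
        rw [hc] at this
        exact (Submodule.mem_bot K).1 this)
    ext i
    simpa using congrFun this i
  -- Nakayama by hand: lifts of preimages of the standard basis give a matrix whose determinant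
  -- becomes one in the field, hence is a unit.
  have hD : Function.Surjective D := by
    choose z hz using fun i => hD' (Pi.single i 1)
    choose w hw using fun i a => hf (z i a)
    let P : Matrix (Fin 3) (Fin 3) R := Matrix.of fun a i => D (w i) a
    have hP : IsUnit P.det := by
      refine isUnit_of_map_unit φ _ ?_
      rw [RingHom.map_det]
      have : φ.mapMatrix P = 1 := by
        ext a i
        have h1 := congrFun (T.derivParam_f (x := x) (w i)) a
        have h2 : (fun a => T.f (w i a)) = z i := funext fun a => hw i a
        rw [h2] at h1
        have h3 := congrFun (hz i) a
        change φ (G.derivParam x (w i) a) = _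
        rw [← h1]
        refine h3.trans ?_
        rw [Matrix.one_apply, Pi.single_apply]
      rw [this, Matrix.det_one]
      exact isUnit_one
    intro v
    refine ⟨∑ i, (P⁻¹.mulVec v) i • w i, ?_⟩
    have := congrArg (fun Q : Matrix (Fin 3) (Fin 3) R => Q.mulVec v) (Matrix.mul_nonsing_inv P hP)
    simp only [← Matrix.mulVec_mulVec, Matrix.one_mulVec] at this
    rw [map_sum]
    conv_rhs => rw [← this]
    ext a
    simp [Matrix.mulVec, dotProduct, P, mul_comm]
  obtain ⟨z, hz⟩ := hD l
  obtain ⟨y, hy, hyz⟩ := h.exists_isTangent z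
  exact ⟨y, hy, hyz.trans hz⟩

end Residue

end Geometry

end

/-! ### Parametrized pairs of subspaces and their first order deformations -/

section

namespace Geometry

section Parametrized

variable {R M M₇ R' M' M₇' : Type*} [CommRing R] [AddCommGroup M] [Module R M] [AddCommGroup M₇]
  [Module R M₇] [CommRing R'] [AddCommGroup M'] [Module R' M'] [AddCommGroup M₇'] [Module R' M₇']
  {G : Geometry R M M₇} {G' : Geometry R' M' M₇'}

variable (G) in
/-- A parametrization of a pair of a four-dimensional subspace `U` of `M` and a four-dimensional
subspace `V` of `U ⊕ R e` on which `Ω` vanishes. -/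
structure Parametrized (x : Fin 4 → M) (ξ : Fin 4 → M →ₗ[R] R) (l : Fin 3 → R) (c : R)
    (U : Submodule R M) (V : Submodule R M₇) : Prop where
  adapted : G.Adapted x ξ
  eq_span : U = Submodule.span R (Set.range x)
  unimodular : ∃ r : Fin 3 → R, ∑ i, r i * l i = 1
  equations : ∀ i, G.equations x i = c * l i
  mem_iff : ∀ m, m ∈ V ↔ G.pr m ∈ U ∧ G.functional x ξ l m = 0

variable {x : Fin 4 → M} {ξ : Fin 4 → M →ₗ[R] R} {l : Fin 3 → R} {c : R} {U : Submodule R M}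
  {V : Submodule R M₇}

theorem Parametrized.Ω_eq_zero (h : G.Parametrized x ξ l c U V) :
    ∀ m ∈ V, ∀ m' ∈ V, ∀ m'' ∈ V, G.Ω m m' m'' = 0 := by
  intro m hm m' hm' m'' hm''
  obtain ⟨r, hr⟩ := h.unimodular
  rw [h.mem_iff, h.eq_span] at hm hm' hm''
  exact h.adapted.Ω_eq_zero hr (h.equations 0) (h.equations 1) (h.equations 2) hm.1 hm.2 hm'.1 hm'.2
    hm''.1 hm''.2

theorem Parametrized.pr_mem (h : G.Parametrized x ξ l c U V) {m : M₇} (hm : m ∈ V) : G.pr m ∈ U :=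
  ((h.mem_iff m).1 hm).1

/-- The functional takes the value `l 2` at `e`. So `l 2` is the local equation of the exceptional
divisor over `Z₃`. -/
theorem Parametrized.e_mem_iff (h : G.Parametrized x ξ l c U V) : G.e ∈ V ↔ l 2 = 0 := by
  rw [h.mem_iff, functional_apply, G.pr_e, G.lam_e]
  simp

/-- The equations of `Y₄` are `c • l` with `l` unimodular, so they vanish together iff `c` does: `c`
is the local equation of the exceptional divisor over `Y₄`. -/
theorem Parametrized.orthogonal_iff (h : G.Parametrized x ξ l c U V) (h2 : IsUnit (2 : R)) :
    (G.α.orthogonal U ≤ U ∧ ∀ y ∈ G.α.orthogonal U, ∀ y' ∈ G.α.orthogonal U, ∀ z ∈ U,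
      G.ω y y' z = 0) ↔ c = 0 := by
  rw [h.adapted.mem_iff h2 h.eq_span]
  obtain ⟨r, hr⟩ := h.unimodular
  have e0 : G.ω (x 0) (x 2) (x 3) = c * l 0 := h.equations 0
  have e1 : G.ω (x 1) (x 2) (x 3) = c * l 1 := h.equations 1
  have e2 : G.α (x 2) (x 3) = c * l 2 := h.equations 2
  rw [e0, e1, e2]
  constructor
  · rintro ⟨h0, h1, h2⟩
    rw [Fin.sum_univ_three] at hr
    linear_combination -c * hr + r 0 * h0 + r 1 * h1 + r 2 * h2
  · rintro rfl
    simp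

theorem Adapted.exists_parametrized (h : G.Adapted x ξ)
    (hl : ∃ r : Fin 3 → R, ∑ i, r i * l i = 1) (hs : ∀ i, G.equations x i = c * l i)
    (U : Module.Grassmannian R M 2) (hU : U.toSubmodule = Submodule.span R (Set.range x)) :
    ∃ V : Module.Grassmannian R M₇ 3, G.Parametrized x ξ l c U.toSubmodule V.toSubmodule := by
  obtain ⟨r, hr⟩ := hl
  obtain ⟨v, hv, hv1⟩ := h.exists_functional_eq_one l hr
  obtain ⟨V, hV⟩ := exists_grassmannian_of_functional (G := G) (N := U) (G.functional x ξ l)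
    (hU ▸ hv) hv1
  exact ⟨V, h, hU, ⟨r, hr⟩, hs, hV⟩

theorem Adapted.parametrized [IsLocalRing R] (h : G.Adapted x ξ)
    (hU : U = Submodule.span R (Set.range x)) (V : Module.Grassmannian R M₇ 3)
    (hV : ∀ m ∈ V.toSubmodule, G.pr m ∈ U)
    (hΩ : ∀ m ∈ V.toSubmodule, ∀ m' ∈ V.toSubmodule, ∀ m'' ∈ V.toSubmodule, G.Ω m m' m'' = 0) :
    ∃ l c, G.Parametrized x ξ l c U V.toSubmodule := by
  subst hU
  obtain ⟨l, r, c, hr, h0, h1, h2, hm⟩ := h.exists_parameters V hV hΩ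
  refine ⟨l, c, h, rfl, ⟨r, hr⟩, fun i => ?_, hm⟩
  fin_cases i
  exacts [h0, h1, h2]

/-- The subspace `V` is determined by `U` if the equations generate an invertible ideal. -/
theorem Parametrized.unique {l' : Fin 3 → R} {c' : R} {V' : Submodule R M₇}
    (h : G.Parametrized x ξ l c U V) (h' : G.Parametrized x ξ l' c' U V')
    (hc : c ∈ nonZeroDivisors R) : V ≤ V' := by
  obtain ⟨r, hr⟩ := h.unimodular
  obtain ⟨r', hr'⟩ := h'.unimodular
  have e (i) : c * l i = c' * l' i := (h.equations i).symm.trans (h'.equations i)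
  -- From `c • l = c' • l'` the scalars `c` and `c'` divide each other with quotients `a` and `b`;
  -- cancelling `c` makes these inverse units and `l = b • l'`, so the two functionals have the same
  -- kernel.
  let a := ∑ i, r i * l' i
  let b := ∑ i, r' i * l i
  have ha : c = c' * a := by
    simp only [a, Fin.sum_univ_three] at hr ⊢
    linear_combination -c * hr + r 0 * e 0 + r 1 * e 1 + r 2 * e 2
  have hb : c' = c * b := by
    simp only [b, Fin.sum_univ_three] at hr' ⊢
    linear_combination -c' * hr' - r' 0 * e 0 - r' 1 * e 1 - r' 2 * e 2
  have hl (i) : l i = b * l' i := by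
    have : c * (l i - b * l' i) = 0 := by linear_combination e i + l' i * hb
    exact sub_eq_zero.1 (mem_nonZeroDivisors_iff_left.1 hc _ this)
  have hab : b * a = 1 := by
    have : c * (b * a - 1) = 0 := by linear_combination -ha - a * hb
    exact sub_eq_zero.1 (mem_nonZeroDivisors_iff_left.1 hc _ this)
  intro m hm
  rw [h.mem_iff] at hm
  rw [h'.mem_iff]
  refine ⟨hm.1, ?_⟩
  have h0 := hm.2
  rw [functional_apply, hl 0, hl 1, hl 2] at h0
  rw [functional_apply]
  linear_combination a * h0 - (l' 0 * ξ 0 (G.pr m) + l' 1 * ξ 1 (G.pr m) +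
    l' 2 * (G.ω (x 0) (x 1) (x 2) * ξ 2 (G.pr m) + G.ω (x 0) (x 1) (x 3) * ξ 3 (G.pr m) +
      G.lam m)) * hab

/-- Base change of parametrizations. -/
theorem Hom.parametrized {φ : R →+* R'} (T : Hom G G' φ) (h : G.Parametrized x ξ l c U V)
    (U' : Module.Grassmannian R' M' 2) (hU' : U'.toSubmodule = Submodule.span R' (T.f '' U))
    (V' : Module.Grassmannian R' M₇' 3) (hV' : V'.toSubmodule = Submodule.span R' (T.f₇ '' V)) :
    ∃ ξ', G'.Parametrized (fun i => T.f (x i)) ξ' (fun i => φ (l i)) (φ c) U'.toSubmodule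
      V'.toSubmodule := by
  obtain ⟨ξ', h', hξ⟩ := T.adapted h.adapted
  have hspan : U'.toSubmodule = Submodule.span R' (Set.range fun i => T.f (x i)) := by
    rw [hU']
    refine le_antisymm (Submodule.span_le.2 ?_) (Submodule.span_le.2 ?_)
    · rintro _ ⟨m, hm, rfl⟩
      rw [h.eq_span] at hm
      exact T.f_mem_span hm
    · rintro _ ⟨i, rfl⟩
      refine Submodule.subset_span ⟨x i, ?_, rfl⟩
      rw [h.eq_span]
      exact Submodule.subset_span ⟨i, rfl⟩
  obtain ⟨r, hr⟩ := h.unimodular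
  obtain ⟨V'', hV''⟩ := h'.exists_parametrized (l := fun i => φ (l i)) (c := φ c)
    ⟨fun i => φ (r i), by rw [← map_one φ, ← hr, map_sum]; simp only [map_mul]⟩
    (fun i => by
      rw [T.equations_f, ← map_mul, ← h.equations]) U' hspan
  have : V' = V'' := Grassmannian.eq_of_le (by
    rw [hV', Submodule.span_le]
    rintro _ ⟨m, hm, rfl⟩
    obtain ⟨h1, h2⟩ := (h.mem_iff m).1 hm
    refine (hV''.mem_iff _).2 ⟨?_, ?_⟩
    · rw [T.pr_f₇, hU']
      exact Submodule.subset_span ⟨_, h1, rfl⟩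
    · rw [functional_apply, T.pr_f₇, T.lam_f₇, hξ, hξ, hξ, hξ, T.ω_f, T.ω_f, ← map_zero φ, ← h2,
        functional_apply]
      simp only [map_add, map_mul])
  exact ⟨ξ', this ▸ hV''⟩

end Parametrized

section FirstOrder

variable {R M M₇ M' M₇' : Type*} [CommRing R] [AddCommGroup M] [Module R M] [AddCommGroup M₇]
  [Module R M₇] [AddCommGroup M'] [Module (DualNumber R) M'] [AddCommGroup M₇']
  [Module (DualNumber R) M₇'] {G : Geometry R M M₇} {G' : Geometry (DualNumber R) M' M₇'}
  {x y : Fin 4 → M} {ξ : Fin 4 → M →ₗ[R] R} {l : Fin 3 → R} {c : R} {U : Submodule R M}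
  {V : Submodule R M₇}

open TrivSqZeroExt in
/-- First order deformations of parametrized pairs of subspaces. -/
theorem Parametrized.exists_deformation (h : G.Parametrized x ξ l c U V) (hy : G.IsTangent x y)
    (T : Hom G G' (inlHom R R)) (F : Hom G' G (fstHom R R R).toRingHom)
    (hFT : ∀ m, F.f (T.f m) = m) (l' : Fin 3 → DualNumber R) (c' : DualNumber R)
    (hl' : ∀ i, (l' i).fst = l i)
    (hc' : ∀ i, inl (G.equations x i) + inr (G.equationsDeriv x y i) = c' * l' i) :
    ∃ (x' : Fin 4 → M') (ξ' : Fin 4 → M' →ₗ[DualNumber R] DualNumber R)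
      (U' : Module.Grassmannian (DualNumber R) M' 2)
      (V' : Module.Grassmannian (DualNumber R) M₇' 3),
      G'.Parametrized x' ξ' l' c' U'.toSubmodule V'.toSubmodule ∧
      (∀ m ∈ U'.toSubmodule, F.f m ∈ U) ∧ ∀ m ∈ V'.toSubmodule, F.f₇ m ∈ V := by
  -- The deformation `x + ε y`; the tangency conditions say that it is adapted over the dual
  -- numbers.
  let x' : Fin 4 → M' := fun i => T.f (x i) + (inr 1 : DualNumber R) • T.f (y i)
  have hFx (i) : F.f (x' i) = x i := by
    change F.f (T.f (x i) + (inr 1 : DualNumber R) • T.f (y i)) = x i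
    rw [map_add, LinearMap.map_smulₛₗ, hFT, hFT]
    change x i + (0 : R) • y i = x i
    rw [zero_smul, add_zero]
  have hα (i j : Fin 4) : G'.α (x' i) (x' j) =
      inl (G.α (x i) (x j)) + inr (G.α (y i) (x j) + G.α (x i) (y j)) := by
    simp only [x', map_add, map_smul, LinearMap.add_apply, LinearMap.smul_apply, T.α_f, smul_eq_mul]
    ext <;> simp [add_comm]
  have hω (i j k : Fin 4) : G'.ω (x' i) (x' j) (x' k) = inl (G.ω (x i) (x j) (x k)) +
      inr (G.ω (y i) (x j) (x k) + G.ω (x i) (y j) (x k) + G.ω (x i) (x j) (y k)) := by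
    simp only [x', map_add, map_smul, LinearMap.add_apply, LinearMap.smul_apply, T.ω_f, smul_eq_mul]
    ext
    · simp
    · simp
  choose η hη using fun i => T.exists_functional (ξ i)
  -- Modulo `ε` the pairings of `x'` with the extended functionals form the identity matrix, so
  -- their determinant is a unit.
  obtain ⟨ξ', hξ'⟩ := exists_dualSystem_of_isUnit_det (x := x') (ξ := η) (by
    rw [TrivSqZeroExt.isUnit_iff_isUnit_fst]
    have : ((fstHom R R R).toRingHom.mapMatrix (Matrix.of fun a b => η a (x' b))) = 1 := by
      ext a b
      by_cases hab : a = b <;> simp [x', hη, h.adapted.apply_eq, Matrix.one_apply, hab]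
    have h1 := (fstHom R R R).toRingHom.map_det (Matrix.of fun a b => η a (x' b))
    rw [this, Matrix.det_one] at h1
    exact (congrArg IsUnit h1).mpr isUnit_one)
  have hA : G'.Adapted x' ξ' :=
    { toDualSystem := hξ'
      h01 := by rw [hα, hy.h01, h.adapted.h01]; simp
      h02 := by rw [hα, hy.h02, h.adapted.h02]; simp
      h03 := by rw [hα, hy.h03, h.adapted.h03]; simp
      h12 := by rw [hα, hy.h12, h.adapted.h12]; simp
      h13 := by rw [hα, hy.h13, h.adapted.h13]; simp }
  obtain ⟨r, hr⟩ := h.unimodular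
  have hl : ∃ r' : Fin 3 → DualNumber R, ∑ i, r' i * l' i = 1 := by
    have hu : IsUnit (∑ i, inl (r i) * l' i) := by
      rw [TrivSqZeroExt.isUnit_iff_isUnit_fst, TrivSqZeroExt.fst_sum]
      simp [hl', hr]
    obtain ⟨u, hu⟩ := hu
    refine ⟨fun i => (↑u⁻¹ : DualNumber R) * inl (r i), ?_⟩
    simp only [mul_assoc, ← Finset.mul_sum, ← hu, Units.inv_mul]
  obtain ⟨U', hU'⟩ := hξ'.exists_grassmannian (k := 2) G'.basis rfl
  obtain ⟨V', hV'⟩ := hA.exists_parametrized hl (c := c') (fun i => by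
    rw [← hc']
    fin_cases i
    · exact hω 0 2 3
    · exact hω 1 2 3
    · exact hα 2 3) U' hU'
  have hmem (m : M') (hm : m ∈ U'.toSubmodule) : F.f m = ∑ i, (ξ' i m).fst • x i := by
    rw [hU'] at hm
    conv_lhs => rw [← (hξ'.mem_span_iff m).1 hm]
    simp only [map_sum, LinearMap.map_smulₛₗ, hFx]
    rfl
  have hξ (m : M') (hm : m ∈ U'.toSubmodule) (i) : ξ i (F.f m) = (ξ' i m).fst := by
    rw [hmem m hm, h.adapted.apply_sum]
  refine ⟨x', ξ', U', V', hV', fun m hm => ?_, fun m hm => ?_⟩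
  · rw [hmem m hm, h.eq_span]
    exact Submodule.sum_mem _ fun i _ => Submodule.smul_mem _ _ (Submodule.subset_span ⟨i, rfl⟩)
  · obtain ⟨h1, h2⟩ := (hV'.mem_iff m).1 hm
    refine (h.mem_iff _).2 ⟨?_, ?_⟩
    · rw [F.pr_f₇, hmem _ h1, h.eq_span]
      exact Submodule.sum_mem _ fun i _ => Submodule.smul_mem _ _ (Submodule.subset_span ⟨i, rfl⟩)
    · have h3 := congrArg TrivSqZeroExt.fst h2
      rw [functional_apply] at h3
      rw [functional_apply, F.pr_f₇, hξ _ h1, hξ _ h1, hξ _ h1, hξ _ h1, F.lam_f₇]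
      simp only [hω, TrivSqZeroExt.fst_add, TrivSqZeroExt.fst_mul, hl', TrivSqZeroExt.fst_inl,
        TrivSqZeroExt.fst_inr, add_zero, TrivSqZeroExt.fst_zero] at h3
      exact h3

end FirstOrder

end Geometry

end

section

theorem exists_surjection_of_grassmannian {R M : Type*} [CommRing R] [IsLocalRing R]
    [AddCommGroup M] [Module R M] {k : ℕ} (N : Module.Grassmannian R M k) :
    ∃ g : M →ₗ[R] (Fin k → R), Function.Surjective g ∧ N.toSubmodule = LinearMap.ker g := by
  have hfree : Module.Free R (M ⧸ N.toSubmodule) := Module.free_of_flat_of_isLocalRing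
  have hk : Module.finrank R (M ⧸ N.toSubmodule) = k := by
    have := N.rankAtStalk_eq (IsLocalRing.closedPoint R)
    rwa [Module.rankAtStalk_eq_finrank_of_free, Pi.natCast_apply, Nat.cast_id] at this
  let b := Module.finBasisOfFinrankEq R (M ⧸ N.toSubmodule) hk
  refine ⟨b.equivFun.toLinearMap ∘ₗ N.toSubmodule.mkQ,
    b.equivFun.surjective.comp N.toSubmodule.mkQ_surjective, ?_⟩
  rw [LinearEquiv.ker_comp, Submodule.ker_mkQ]

namespace Geometry

variable {R M M₇ : Type*} [CommRing R] [AddCommGroup M] [Module R M] [AddCommGroup M₇]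
  [Module R M₇] {G : Geometry R M M₇}

/-! ### Subspaces containing a projection -/

/-- `U` is the preimage of the line `R l` under `g ∘ ι`. For `m` in `U` some `c • ι m - a • e` lies
in `V`, so `c • m` lies in every competitor `U'`; the quotient by `U'` is flat, so a nonzerodivisor
`c` may be cancelled. -/
theorem exists_grassmannian_pr {V : Module.Grassmannian R M₇ 3} {g : M₇ →ₗ[R] (Fin 3 → R)}
    (hg : Function.Surjective g) (hV : V.toSubmodule = LinearMap.ker g) {l : Fin 3 → R} {c : R}
    (hl : ∃ r : Fin 3 → R, ∑ i, r i * l i = 1) (he : g G.e = c • l) :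
    ∃ U : Module.Grassmannian R M 2, (∀ m ∈ V.toSubmodule, G.pr m ∈ U.toSubmodule) ∧
      ∀ U' : Module.Grassmannian R M 2, (∀ m ∈ V.toSubmodule, G.pr m ∈ U'.toSubmodule) →
        c ∈ nonZeroDivisors R → U = U' := by
  obtain ⟨r, hr⟩ := hl
  have hd : DualSystem (fun _ : Fin 1 => l) (fun _ => Fintype.linearCombination R r) :=
    ⟨fun a b => by
      rw [if_pos (Subsingleton.elim a b), Fintype.linearCombination_apply, ← hr]
      exact Finset.sum_congr rfl fun i _ => mul_comm _ _⟩
  obtain ⟨Q, hQ⟩ := hd.exists_grassmannian (k := 2) (Pi.basisFun R (Fin 3)) rfl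
  have hlQ : l ∈ Q.toSubmodule := by rw [hQ]; exact Submodule.subset_span ⟨0, rfl⟩
  have he0 : Q.toSubmodule.mkQ (g G.e) = 0 := by
    rw [he, Submodule.mkQ_apply, Submodule.Quotient.mk_eq_zero]
    exact Submodule.smul_mem _ _ hlQ
  have hpr (m : M₇) : Q.toSubmodule.mkQ (g (G.ι (G.pr m))) = Q.toSubmodule.mkQ (g m) := by
    conv_rhs => rw [← G.eq m]
    rw [map_add, map_add, map_smul, map_smul, he0, smul_zero, add_zero]
  obtain ⟨U, hU⟩ := exists_grassmannian_of_surjective Q.rankAtStalk_eq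
    (Q.toSubmodule.mkQ ∘ₗ g ∘ₗ G.ι) (fun q => by
      obtain ⟨v, rfl⟩ := Q.toSubmodule.mkQ_surjective q
      obtain ⟨m, rfl⟩ := hg v
      exact ⟨G.pr m, hpr m⟩)
  refine ⟨U, fun m hm => ?_, fun U' hU' hc => ?_⟩
  · rw [hV, LinearMap.mem_ker] at hm
    rw [hU, LinearMap.mem_ker]
    exact (hpr m).trans (by rw [hm, map_zero])
  · refine Grassmannian.eq_of_le fun m hm => ?_
    have h1 : g (G.ι m) ∈ Q.toSubmodule := by
      rw [hU, LinearMap.mem_ker] at hm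
      exact (Submodule.Quotient.mk_eq_zero _).1 hm
    rw [hQ, Set.range_const, Submodule.mem_span_singleton] at h1
    obtain ⟨a, ha⟩ := h1
    have h2 : c • G.ι m - a • G.e ∈ V.toSubmodule := by
      rw [hV, LinearMap.mem_ker, map_sub, map_smul, map_smul, ← ha, he, smul_comm, sub_self]
    have h3 := hU' _ h2
    rw [map_sub, map_smul, map_smul, G.pr_ι, G.pr_e, smul_zero, sub_zero,
      ← Submodule.Quotient.mk_eq_zero, Submodule.Quotient.mk_smul] at h3
    rw [← Submodule.Quotient.mk_eq_zero]
    exact (Module.Flat.isSMulRegular_of_nonZeroDivisors hc) (h3.trans (smul_zero c).symm)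

/-! ### The adjoint variety and the variety `Y₄` -/

variable (G) in
/-- The condition defining the adjoint variety. -/
def IsAdjoint (V : Submodule R M₇) : Prop := ∀ v ∈ V, ∀ v' ∈ V, ∀ z, G.Ω v v' z = 0

variable (G) in
/-- The condition defining the variety `Y₄`. -/
def IsCenter (U : Submodule R M) : Prop :=
  G.α.orthogonal U ≤ U ∧ ∀ y ∈ G.α.orthogonal U, ∀ y' ∈ G.α.orthogonal U, ∀ z ∈ U, G.ω y y' z = 0

theorem isAdjoint_span {v : Fin 2 → M₇} (h : ∀ z, G.Ω (v 0) (v 1) z = 0) :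
    G.IsAdjoint (Submodule.span R (Set.range v)) := by
  intro w hw w' hw' z
  obtain ⟨a, rfl⟩ := (Submodule.mem_span_range_iff_exists_fun R).1 hw
  obtain ⟨b, rfl⟩ := (Submodule.mem_span_range_iff_exists_fun R).1 hw'
  simp [Fin.sum_univ_two, G.Ω_self_left, G.Ω_swap_left (v 0) (v 1), h]

/-- Planes of the adjoint variety project to rank two summands. The vector `k` represents the
contraction of `θ₀ ∧ θ₁` with `e` up to sign, and `Ω(v₀, v₁, ι k) = 0` then says that a certain
alternating form on `M` takes the value one at the two projections. Contracting that form with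
either projection gives the dual functionals. -/
theorem exists_dualSystem_pr {v : Fin 2 → M₇} {θ : Fin 2 → M₇ →ₗ[R] R} (h : DualSystem v θ)
    (hv : ∀ z, G.Ω (v 0) (v 1) z = 0) :
    ∃ ζ : Fin 2 → M →ₗ[R] R, DualSystem (fun i => G.pr (v i)) ζ := by
  obtain ⟨k, hk⟩ := G.exists_repr_right
    (θ 1 G.e • (θ 0 ∘ₗ G.ι) - θ 0 G.e • (θ 1 ∘ₗ G.ι))
  have hθ (i j) : θ i (G.ι (G.pr (v j))) = (if i = j then 1 else 0) - G.lam (v j) * θ i G.e := by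
    have := congrArg (θ i) (G.eq (v j))
    rw [h.apply_eq, map_add, map_smul, smul_eq_mul] at this
    linear_combination this
  have h1 := hv (G.ι k)
  have k0 := hk (G.pr (v 0))
  have k1 := hk (G.pr (v 1))
  simp only [LinearMap.sub_apply, LinearMap.smul_apply, LinearMap.comp_apply, smul_eq_mul, hθ]
    at k0 k1
  rw [G.Ω_eq, G.pr_ι, G.lam_ι, k0, k1] at h1
  simp at h1
  have key : θ 0 (G.ι (G.pr (v 0))) * θ 1 (G.ι (G.pr (v 1))) -
      θ 1 (G.ι (G.pr (v 0))) * θ 0 (G.ι (G.pr (v 1))) + G.ω (G.pr (v 0)) (G.pr (v 1)) k = 1 := by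
    simp only [hθ]
    simp
    linear_combination h1
  have s01 := G.ω_swap_left (G.pr (v 0)) (G.pr (v 1)) k
  refine ⟨![θ 1 (G.ι (G.pr (v 1))) • (θ 0 ∘ₗ G.ι) - θ 0 (G.ι (G.pr (v 1))) • (θ 1 ∘ₗ G.ι) -
      (G.ω (G.pr (v 1))).flip k,
    θ 0 (G.ι (G.pr (v 0))) • (θ 1 ∘ₗ G.ι) - θ 1 (G.ι (G.pr (v 0))) • (θ 0 ∘ₗ G.ι) +
      (G.ω (G.pr (v 0))).flip k], ⟨fun a b => ?_⟩⟩
  fin_cases a <;> fin_cases b <;>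
    simp only [Fin.zero_eta, Fin.mk_one, Matrix.cons_val_zero, Matrix.cons_val_one,
      LinearMap.sub_apply, LinearMap.add_apply, LinearMap.smul_apply, LinearMap.comp_apply,
      LinearMap.flip_apply, smul_eq_mul, G.ω_self_left, s01, if_true, zero_ne_one, one_ne_zero,
      if_false]
  · linear_combination key
  · ring
  · ring
  · linear_combination key

/-- Let `U` be the orthogonal of the projected plane. Then `α(pr v₀, pr v₁) = Ω(v₀, v₁, e) = 0` puts
`U^⊥ = pr V` inside `U`, and for `z` in `U` the `α`-terms of `Ω(v₀, v₁, ι z)` drop out, which leaves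
`ω(pr v₀, pr v₁, z) = 0`. -/
theorem exists_isCenter [IsLocalRing R] (V : Module.Grassmannian R M₇ 5)
    (hV : G.IsAdjoint V.toSubmodule) :
    ∃ U : Module.Grassmannian R M 2, G.IsCenter U.toSubmodule ∧
      U.toSubmodule = G.α.orthogonal (V.toSubmodule.map G.pr) ∧
      ∀ m ∈ V.toSubmodule, ∀ u ∈ U.toSubmodule, G.α u (G.pr m) = 0 := by
  obtain ⟨v, θ, h, hvV⟩ := exists_dualSystem (j := 2) G.basis₇ rfl V
  have hΩ (z) : G.Ω (v 0) (v 1) z = 0 :=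
    hV _ (hvV ▸ Submodule.subset_span ⟨0, rfl⟩) _ (hvV ▸ Submodule.subset_span ⟨1, rfl⟩) z
  obtain ⟨ζ, hζ⟩ := exists_dualSystem_pr h hΩ
  have hmap : V.toSubmodule.map G.pr = Submodule.span R (Set.range fun i => G.pr (v i)) := by
    rw [← hvV, Submodule.map_span, ← Set.range_comp]; rfl
  obtain ⟨U, hU⟩ := exists_grassmannian_orthogonal (G := G) hζ
  obtain ⟨x, ξ, hx, hxU⟩ := exists_dualSystem (j := 4) G.basis rfl U
  have hUm (u : M) : u ∈ U.toSubmodule ↔ ∀ a, G.α (G.pr (v a)) u = 0 := by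
    rw [hU, mem_orthogonal_span]
  have horth : G.α.orthogonal U.toSubmodule = Submodule.span R (Set.range fun i => G.pr (v i)) := by
    rw [← hxU]
    refine orthogonal_orthogonal hx rfl hζ fun a b => ?_
    rw [G.α_swap, (hUm _).1 (hxU ▸ Submodule.subset_span ⟨a, rfl⟩) b, neg_zero]
  have h01 : G.α (G.pr (v 0)) (G.pr (v 1)) = 0 := by
    have := hΩ G.e
    simpa [G.Ω_eq, G.pr_e, G.lam_e] using this
  refine ⟨U, ⟨?_, ?_⟩, hmap ▸ hU, ?_⟩
  · rw [horth, Submodule.span_le]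
    rintro _ ⟨b, rfl⟩
    refine (hUm _).2 fun a => ?_
    have h10 := G.α_swap (G.pr (v 0)) (G.pr (v 1))
    fin_cases a <;> fin_cases b <;> simp [G.α_self, h01, h10]
  · rw [horth]
    intro y hy y' hy' z hz
    obtain ⟨a, rfl⟩ := (Submodule.mem_span_range_iff_exists_fun R).1 hy
    obtain ⟨b, rfl⟩ := (Submodule.mem_span_range_iff_exists_fun R).1 hy'
    have hz' := (hUm z).1 hz
    have := hΩ (G.ι z)
    rw [G.Ω_eq, G.pr_ι, G.lam_ι, hz', hz'] at this
    simp at this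
    simp [Fin.sum_univ_two, G.ω_self_left, G.ω_swap_left (G.pr (v 0)) (G.pr (v 1)), this]
  · intro m hm u hu
    have hm' : G.pr m ∈ G.α.orthogonal U.toSubmodule := by
      rw [horth, ← hmap]; exact ⟨m, hm, rfl⟩
    exact hm' u hu

theorem eq_orthogonal_of_incident [IsLocalRing R] (V : Module.Grassmannian R M₇ 5)
    (hV : G.IsAdjoint V.toSubmodule) (U : Module.Grassmannian R M 2)
    (h : ∀ m ∈ V.toSubmodule, ∀ u ∈ U.toSubmodule, G.α u (G.pr m) = 0) :
    U.toSubmodule = G.α.orthogonal (V.toSubmodule.map G.pr) := by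
  obtain ⟨U', -, hU', -⟩ := exists_isCenter V hV
  have : U = U' := Grassmannian.eq_of_le (by
    rw [hU']
    rintro u hu _ ⟨m, hm, rfl⟩
    change G.α (G.pr m) u = 0
    rw [G.α_swap, h m hm u hu, neg_zero])
  rw [this, hU']

/-- The functional `ω(x₂, x₃, ·)` vanishes on `U`, so it equals `α(w, ·)` with `w = p x₂ + q x₃` in
`U^⊥`. Its coefficients are exactly the corrections along `e` that turn `x₂`, `x₃` into vectors `x₂
- q e`, `x₃ + p e` killed by `Ω`. -/
theorem existsUnique_isAdjoint [IsLocalRing R] (h2 : IsUnit (2 : R))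
    (U : Module.Grassmannian R M 2) (hU : G.IsCenter U.toSubmodule) :
    ∃! V : Module.Grassmannian R M₇ 5, G.IsAdjoint V.toSubmodule ∧
      ∀ m ∈ V.toSubmodule, ∀ u ∈ U.toSubmodule, G.α u (G.pr m) = 0 := by
  obtain ⟨x, ξ, h, hUx⟩ := exists_adapted (G := G) U
  obtain ⟨s0, s1, hf⟩ := (h.mem_iff h2 hUx).1 hU
  have horth := h.orthogonal_eq hf
  rw [← hUx] at horth
  obtain ⟨w, hw⟩ := G.exists_repr (G.ω (x 2) (x 3))
  have hx2 : x 2 ∈ G.α.orthogonal U.toSubmodule := by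
    rw [horth]; exact Submodule.subset_span (by simp)
  have hx3 : x 3 ∈ G.α.orthogonal U.toSubmodule := by
    rw [horth]; exact Submodule.subset_span (by simp)
  have hwU : w ∈ G.α.orthogonal U.toSubmodule := fun u hu => by
    change G.α u w = 0
    rw [G.α_swap, hw, hU.2 _ hx2 _ hx3 _ hu, neg_zero]
  rw [horth, Submodule.mem_span_pair] at hwU
  obtain ⟨p, q, rfl⟩ := hwU
  let X : Fin 2 → M₇ := ![G.ι (x 2) - q • G.e, G.ι (x 3) + p • G.e]
  have pX0 : G.pr (X 0) = x 2 := by simp [X, G.pr_ι, G.pr_e]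
  have pX1 : G.pr (X 1) = x 3 := by simp [X, G.pr_ι, G.pr_e]
  have lX0 : G.lam (X 0) = -q := by simp [X, G.lam_ι, G.lam_e]
  have lX1 : G.lam (X 1) = p := by simp [X, G.lam_ι, G.lam_e]
  have hX (z) : G.Ω (X 0) (X 1) z = 0 := by
    rw [G.Ω_eq, pX0, pX1, lX0, lX1, ← hw, hf, map_add, map_smul, map_smul, LinearMap.add_apply,
      LinearMap.smul_apply, LinearMap.smul_apply, smul_eq_mul, smul_eq_mul]
    ring
  have hd : DualSystem X ![ξ 2 ∘ₗ G.pr, ξ 3 ∘ₗ G.pr] := ⟨fun a b => by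
    fin_cases a <;> fin_cases b <;> simp [pX0, pX1, h.apply_eq]⟩
  obtain ⟨V, hV⟩ := hd.exists_grassmannian (k := 5) G.basis₇ rfl
  refine ⟨V, ⟨hV ▸ isAdjoint_span hX, fun m hm u hu => ?_⟩, fun V' ⟨hV', hinc⟩ => ?_⟩
  · rw [hV] at hm
    obtain ⟨a, rfl⟩ := (Submodule.mem_span_range_iff_exists_fun R).1 hm
    have e2 : G.α u (x 2) = 0 := hx2 u hu
    have e3 : G.α u (x 3) = 0 := hx3 u hu
    simp [Fin.sum_univ_two, pX0, pX1, e2, e3]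
  · obtain ⟨v, θ, hθ, hvV⟩ := exists_dualSystem (j := 2) G.basis₇ rfl V'
    have hvm (i) : v i ∈ V'.toSubmodule := hvV ▸ Submodule.subset_span ⟨i, rfl⟩
    have hΩ := hV' _ (hvm 0) _ (hvm 1)
    obtain ⟨ζ, hζ⟩ := exists_dualSystem_pr hθ hΩ
    have hpr (i) : ∃ a b : R, a • x 2 + b • x 3 = G.pr (v i) := by
      rw [← Submodule.mem_span_pair, ← horth]
      exact fun u hu => hinc _ (hvm i) u hu
    choose a b hab using hpr
    -- The deviation of another solution from the plane found above. The relations against the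
    -- vectors dual to `x 2` and `x 3` say that `ρ` is annihilated by the matrix of the coefficients
    -- `a`, `b`, which is invertible because the projections of the `v i` have dual functionals.
    let ρ : Fin 2 → R := fun i => G.lam (v i) + a i * q - b i * p
    have hv (i) : v i = a i • X 0 + b i • X 1 + ρ i • G.e := by
      conv_lhs => rw [← G.eq (v i), ← hab]
      simp only [X, ρ, Matrix.cons_val_zero, Matrix.cons_val_one, map_add, map_smul]
      module
    obtain ⟨y, hy⟩ := exists_dual_vectors (G := G) h.toDualSystem
    have hexp (j : Fin 4) := hΩ (G.ι (y j))
    simp only [G.Ω_eq, G.pr_ι, G.lam_ι, ← hab] at hexp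
    simp only [map_add, map_smul, LinearMap.add_apply, LinearMap.smul_apply, smul_eq_mul,
      G.ω_self_left, G.ω_swap_left (x 2) (x 3), ← hw, hy] at hexp
    have r2 := hexp 2
    have r3 := hexp 3
    simp at r2 r3
    have hd1 : IsUnit (a 0 * b 1 - a 1 * b 0) := by
      have e00 := hζ.apply_eq 0 0
      have e01 := hζ.apply_eq 0 1
      have e10 := hζ.apply_eq 1 0
      have e11 := hζ.apply_eq 1 1
      simp [← hab] at e00 e01 e10 e11
      refine IsUnit.of_mul_eq_one (ζ 0 (x 2) * ζ 1 (x 3) - ζ 0 (x 3) * ζ 1 (x 2)) ?_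
      linear_combination (a 1 * ζ 1 (x 2) + b 1 * ζ 1 (x 3)) * e00 + e11 -
        (a 0 * ζ 1 (x 2) + b 0 * ζ 1 (x 3)) * e01
    have k2 : a 0 * ρ 1 - a 1 * ρ 0 = 0 := by
      simp only [ρ]; linear_combination -r2
    have k3 : b 0 * ρ 1 - b 1 * ρ 0 = 0 := by
      simp only [ρ]; linear_combination -r3
    have hρ0 : ρ 0 = 0 := hd1.mul_right_eq_zero.1 (by linear_combination b 0 * k2 - a 0 * k3)
    have hρ1 : ρ 1 = 0 := hd1.mul_right_eq_zero.1 (by linear_combination b 1 * k2 - a 1 * k3)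
    refine Grassmannian.eq_of_le ?_
    rw [← hvV, Submodule.span_le, hV]
    rintro _ ⟨i, rfl⟩
    have hρ : ρ i = 0 := by fin_cases i; exacts [hρ0, hρ1]
    rw [hv, hρ, zero_smul, add_zero]
    exact Submodule.add_mem _ (Submodule.smul_mem _ _ (Submodule.subset_span ⟨0, rfl⟩))
      (Submodule.smul_mem _ _ (Submodule.subset_span ⟨1, rfl⟩))

end Geometry

end

section

/-! ### Extension of scalars of a geometry over the complex numbers -/

section Extension

variable {W : Type} [AddCommGroup W] [Module ℂ W] (A : Type) [CommRing A] [Algebra ℂ A]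

theorem baseChange_form_tmul (a : LinearMap.BilinForm ℂ W) (r s : A) (x y : W) :
    a.baseChange A (r ⊗ₜ x) (s ⊗ₜ y) = r * s * algebraMap ℂ A (a x y) := by
  simp [Algebra.smul_def, mul_comm]

theorem baseChange_swap {a : LinearMap.BilinForm ℂ W} (ha : ∀ x, a x x = 0) (x y : A ⊗[ℂ] W) :
    a.baseChange A x y + a.baseChange A y x = 0 := by
  induction x with
  | zero => simp
  | tmul r w =>
    induction y with
    | zero => simp
    | tmul s w' =>
      have := ha (w + w')
      simp only [map_add, LinearMap.add_apply, ha, zero_add, add_zero] at this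
      rw [baseChange_form_tmul, baseChange_form_tmul, mul_comm s r, ← mul_add, ← map_add,
        add_comm (a w w'), this, map_zero, mul_zero]
    | add x y hx hy => simp only [map_add, LinearMap.add_apply]; linear_combination hx + hy
  | add x y hx hy => simp only [map_add, LinearMap.add_apply]; linear_combination hx + hy

theorem baseChange_self {a : LinearMap.BilinForm ℂ W} (ha : ∀ x, a x x = 0) (x : A ⊗[ℂ] W) :
    a.baseChange A x x = 0 := by
  induction x with
  | zero => simp
  | tmul r w => rw [baseChange_form_tmul, ha]; simp
  | add x y hx hy =>
    have := baseChange_swap A ha x y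
    simp only [map_add, LinearMap.add_apply]
    linear_combination hx + hy + this

variable {T : W →ₗ[ℂ] W →ₗ[ℂ] W →ₗ[ℂ] ℂ}

/-- Vanishing on the diagonal is not additive, so antisymmetry is established first, to cancel the
cross terms of a sum of tensors. -/
theorem extend_self_left (hT : ∀ x y, T x x y = 0) (x y : A ⊗[ℂ] W) : extend A T x x y = 0 := by
  have swap (x z y : A ⊗[ℂ] W) : extend A T x z y + extend A T z x y = 0 := by
    induction x with
    | zero => simp
    | tmul r w =>
      induction z with
      | zero => simp
      | tmul s w' =>
        induction y with
        | zero => simp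
        | tmul t w'' =>
          have := hT (w + w') w''
          simp only [map_add, LinearMap.add_apply, hT, zero_add, add_zero] at this
          rw [extend_tmul, extend_tmul, mul_comm s r, ← mul_add, ← map_add,
            add_comm (T w w' w''), this, map_zero, mul_zero]
        | add x y hx hy => simp only [map_add]; linear_combination hx + hy
      | add x y hx hy => simp only [map_add, LinearMap.add_apply]; linear_combination hx + hy
    | add x y hx hy => simp only [map_add, LinearMap.add_apply]; linear_combination hx + hy
  induction x with
  | zero => simp
  | tmul r w =>
    induction y with
    | zero => simp
    | tmul s w' => rw [extend_tmul, hT]; simp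
    | add x y hx hy => simp only [map_add]; linear_combination hx + hy
  | add x z hx hz =>
    have := swap x z y
    simp only [map_add, LinearMap.add_apply]
    linear_combination hx + hz + this

theorem extend_self_right (hT : ∀ x y, T x y y = 0) (x y : A ⊗[ℂ] W) : extend A T x y y = 0 := by
  have swap (x y z : A ⊗[ℂ] W) : extend A T x y z + extend A T x z y = 0 := by
    induction x with
    | zero => simp
    | tmul r w =>
      induction y with
      | zero => simp
      | tmul s w' =>
        induction z with
        | zero => simp
        | tmul t w'' =>
          have := hT w (w' + w'')
          simp only [map_add, LinearMap.add_apply, hT, zero_add, add_zero] at this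
          rw [extend_tmul, extend_tmul, mul_right_comm r s t, ← mul_add, ← map_add,
            add_comm (T w w' w''), this, map_zero, mul_zero]
        | add x y hx hy => simp only [map_add, LinearMap.add_apply]; linear_combination hx + hy
      | add x y hx hy => simp only [map_add, LinearMap.add_apply]; linear_combination hx + hy
    | add x y hx hy => simp only [map_add, LinearMap.add_apply]; linear_combination hx + hy
  induction y with
  | zero => simp
  | tmul s w' =>
    induction x with
    | zero => simp
    | tmul r w => rw [extend_tmul, hT]; simp
    | add x y hx hy => simp only [map_add, LinearMap.add_apply]; linear_combination hx + hy
  | add y z hy hz =>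
    have := swap x y z
    simp only [map_add, LinearMap.add_apply]
    linear_combination hy + hz + this

end Extension

namespace Geometry

variable {W W₇ : Type} [AddCommGroup W] [Module ℂ W] [AddCommGroup W₇] [Module ℂ W₇]
  (G : Geometry ℂ W W₇) (A : Type) [CommRing A] [Algebra ℂ A]

/-- The functional on `A ⊗ W₇` defined by `lam`. -/
def lamExt : A ⊗[ℂ] W₇ →ₗ[A] A := LinearMap.liftBaseChange A (Algebra.linearMap ℂ A ∘ₗ G.lam)

theorem lamExt_tmul (a : A) (w : W₇) : G.lamExt A (a ⊗ₜ w) = a * algebraMap ℂ A (G.lam w) := by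
  simp [lamExt]

theorem extend_Ω_eq (x y z : A ⊗[ℂ] W₇) : extend A G.Ω x y z =
    extend A G.ω (G.pr.baseChange A x) (G.pr.baseChange A y) (G.pr.baseChange A z) +
    G.lamExt A x * G.α.baseChange A (G.pr.baseChange A y) (G.pr.baseChange A z) -
    G.lamExt A y * G.α.baseChange A (G.pr.baseChange A x) (G.pr.baseChange A z) +
    G.lamExt A z * G.α.baseChange A (G.pr.baseChange A x) (G.pr.baseChange A y) := by
  induction x with
  | zero => simp
  | tmul r w =>
    induction y with
    | zero => simp
    | tmul s w' =>
      induction z with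
      | zero => simp
      | tmul t w'' =>
        simp only [LinearMap.baseChange_tmul, extend_tmul, lamExt_tmul, baseChange_form_tmul,
          G.Ω_eq, map_add, map_sub, map_mul]
        ring
      | add x y hx hy => simp only [map_add, hx, hy]; ring
    | add x y hx hy => simp only [map_add, LinearMap.add_apply, hx, hy]; ring
  | add x y hx hy => simp only [map_add, LinearMap.add_apply, hx, hy]; ring

theorem baseChange_separating (y : A ⊗[ℂ] W) (hy : ∀ x, G.α.baseChange A y x = 0) : y = 0 := by
  choose z hz using fun i => G.exists_repr_right (G.basis.coord i)
  have h (i) : (G.basis.baseChange A).repr y i = 0 := by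
    have h1 := hy (1 ⊗ₜ z i)
    rw [← (G.basis.baseChange A).sum_repr y, map_sum, LinearMap.sum_apply,
      Finset.sum_eq_single i] at h1
    · simpa [baseChange_form_tmul, hz] using h1
    · intro j _ hij
      simp [hz, hij]
    · simp
  rw [← (G.basis.baseChange A).sum_repr y]
  simp [h]

/-- Extension of scalars of a geometry. -/
def baseChange : Geometry A (A ⊗[ℂ] W) (A ⊗[ℂ] W₇) where
  ι := G.ι.baseChange A
  pr := G.pr.baseChange A
  e := 1 ⊗ₜ G.e
  lam := G.lamExt A
  pr_ι m := by
    induction m with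
    | zero => simp
    | tmul a w => simp [G.pr_ι]
    | add x y hx hy => simp only [map_add, hx, hy]
  pr_e := by simp [G.pr_e]
  lam_ι m := by
    induction m with
    | zero => simp
    | tmul a w => simp [lamExt_tmul, G.lam_ι]
    | add x y hx hy => simp only [map_add, hx, hy, add_zero]
  lam_e := by simp [lamExt_tmul, G.lam_e]
  eq m := by
    induction m with
    | zero => simp
    | tmul a w =>
      conv_rhs => rw [← G.eq w]
      rw [LinearMap.baseChange_tmul, LinearMap.baseChange_tmul, lamExt_tmul,
        TensorProduct.smul_tmul', smul_eq_mul, mul_one, TensorProduct.tmul_add,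
        TensorProduct.tmul_smul, TensorProduct.smul_tmul', Algebra.smul_def, mul_comm a]
    | add x y hx hy =>
      conv_rhs => rw [← hx, ← hy]
      simp only [map_add, add_smul]
      abel
  α := G.α.baseChange A
  ω := extend A G.ω
  Ω := extend A G.Ω
  α_self := baseChange_self A G.α_self
  ω_self_left := extend_self_left A G.ω_self_left
  ω_self_right := extend_self_right A G.ω_self_right
  Ω_eq := G.extend_Ω_eq A
  exists_repr f := by
    choose y hy using fun i => G.exists_repr (G.basis.coord i)
    refine ⟨∑ i, f (1 ⊗ₜ G.basis i) ⊗ₜ y i, fun x => ?_⟩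
    refine LinearMap.congr_fun (f := G.α.baseChange A (∑ i, f (1 ⊗ₜ G.basis i) ⊗ₜ y i))
      ((G.basis.baseChange A).ext fun j => ?_) x
    rw [Module.Basis.baseChange_apply, map_sum, LinearMap.sum_apply]
    simp only [baseChange_form_tmul, hy]
    rw [Finset.sum_eq_single j]
    · simp
    · intro i _ hij
      simp [Ne.symm hij]
    · simp
  separating := G.baseChange_separating A
  basis := G.basis.baseChange A
  basis₇ := G.basis₇.baseChange A

variable {A} {B : Type} [CommRing B] [Algebra ℂ B]

/-- Change of scalars, as a semilinear map. -/
def bcₛₗ {W : Type} [AddCommGroup W] [Module ℂ W] (φ : A →ₐ[ℂ] B) :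
    A ⊗[ℂ] W →ₛₗ[φ.toRingHom] B ⊗[ℂ] W where
  toFun := bc φ
  map_add' := map_add _
  map_smul' := bc_smul φ

/-- Extension of scalars of a geometry along a homomorphism of algebras. -/
def bcHom (φ : A →ₐ[ℂ] B) : Hom (G.baseChange A) (G.baseChange B) φ.toRingHom where
  f := bcₛₗ φ
  f₇ := bcₛₗ φ
  pr_f₇ := baseChange_bc φ G.pr
  f₇_e := (bc_tmul φ 1 G.e).trans (by rw [map_one]; rfl)
  lam_f₇ m := by
    change G.lamExt B (bc φ m) = φ (G.lamExt A m)
    induction m with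
    | zero => simp
    | tmul a w => rw [bc_tmul, lamExt_tmul, lamExt_tmul, map_mul, AlgHom.commutes]
    | add x y hx hy => simp only [map_add, hx, hy]
  α_f := form_bc φ G.α
  ω_f := extend_bc φ G.ω
  f_basis i := by
    change bc φ ((G.basis.baseChange A) i) = (G.basis.baseChange B) i
    rw [Module.Basis.baseChange_apply, Module.Basis.baseChange_apply, bc_tmul, map_one]

end Geometry

section Std

variable {W : Type} [AddCommGroup W] [Module ℂ W]

theorem stdForm_add_left {R : Type*} [CommRing R] (x x' y z : Fin 7 → R) :
    stdForm (x + x') y z = stdForm x y z + stdForm x' y z := by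
  simp [stdForm, Matrix.det_fin_three]; ring

theorem stdForm_add_middle {R : Type*} [CommRing R] (x y y' z : Fin 7 → R) :
    stdForm x (y + y') z = stdForm x y z + stdForm x y' z := by
  simp [stdForm, Matrix.det_fin_three]; ring

theorem stdForm_add_right {R : Type*} [CommRing R] (x y z z' : Fin 7 → R) :
    stdForm x y (z + z') = stdForm x y z + stdForm x y z' := by
  simp [stdForm, Matrix.det_fin_three]; ring

/-- The extension of scalars of a three-form given by the standard formula is given by it too. -/
theorem extend_eq_stdForm {T : W →ₗ[ℂ] W →ₗ[ℂ] W →ₗ[ℂ] ℂ} (b : Module.Basis (Fin 7) ℂ W)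
    (hT : ∀ x y z, T x y z = stdForm (b.repr x) (b.repr y) (b.repr z))
    (A : Type) [CommRing A] [Algebra ℂ A] (x y z : A ⊗[ℂ] W) :
    extend A T x y z = stdForm (coords b A x) (coords b A y) (coords b A z) := by
  have h0 (x y : Fin 7 → A) : stdForm x y 0 = 0 ∧ stdForm x 0 y = 0 ∧ stdForm 0 x y = 0 := by
    simp [stdForm, Matrix.det_fin_three]
  have hc (a : A) (w : W) (i) : coords b A (a ⊗ₜ w) i = a * algebraMap ℂ A (b.repr w i) := by
    simp [coords, Algebra.smul_def, mul_comm]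
  induction x with
  | zero => rw [map_zero, map_zero, (h0 _ _).2.2]; rfl
  | tmul r w =>
    induction y with
    | zero => rw [map_zero, map_zero, (h0 _ _).2.1]; rfl
    | tmul s w' =>
      induction z with
      | zero => rw [map_zero, map_zero, (h0 _ _).1]
      | tmul t w'' =>
        rw [extend_tmul, hT]
        simp only [stdForm, Matrix.det_fin_three, Matrix.of_apply, Matrix.cons_val', hc,
          Matrix.cons_val_zero, Matrix.cons_val_one, Matrix.cons_val, map_add, map_sub, map_mul]
        ring
      | add x y hx hy => rw [map_add, map_add, stdForm_add_right, hx, hy]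
    | add x y hx hy =>
      rw [map_add, map_add, LinearMap.add_apply, stdForm_add_middle, hx, hy]
  | add x y hx hy =>
    rw [map_add, map_add, LinearMap.add_apply, LinearMap.add_apply, stdForm_add_left, hx, hy]

end Std

end

section

/-! ### The geometry of a general three-form and a general line -/

section Concrete

variable {V : Type} [AddCommGroup V] [Module ℂ V] (Ω : V [⋀^Fin 3]→ₗ[ℂ] ℂ)

theorem trilinear_self_left (x y : V) : trilinear Ω x x y = 0 :=
  Ω.map_eq_zero_of_eq ![x, x, y] (i := 0) (j := 1) rfl (by decide)

theorem trilinear_self_right (x y : V) : trilinear Ω x y y = 0 :=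
  Ω.map_eq_zero_of_eq ![x, y, y] (i := 1) (j := 2) rfl (by decide)

theorem trilinear_self_outer (x y : V) : trilinear Ω x y x = 0 :=
  Ω.map_eq_zero_of_eq ![x, y, x] (i := 0) (j := 2) rfl (by decide)

theorem trilinear_swap_left (x y z : V) : trilinear Ω y x z = -trilinear Ω x y z := by
  have := trilinear_self_left Ω (x + y) z
  simp only [map_add, LinearMap.add_apply, trilinear_self_left] at this
  linear_combination this

theorem trilinear_swap_right (x y z : V) : trilinear Ω x z y = -trilinear Ω x y z := by
  have := trilinear_self_right Ω x (y + z)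
  simp only [map_add, LinearMap.add_apply, trilinear_self_right] at this
  linear_combination this

variable {Ω}

theorem IsGeneralThreeForm.exists_basis (h : IsGeneralThreeForm Ω) :
    ∃ b : Module.Basis (Fin 7) ℂ V, ∀ x y z : V,
      trilinear Ω x y z = stdForm (b.repr x) (b.repr y) (b.repr z) := by
  obtain ⟨b, hb⟩ := h
  exact ⟨b, fun x y z => hb x y z⟩

/-- For a general line the form `α` is nondegenerate. -/
theorem alpha_nondegenerate {b : Module.Basis (Fin 7) ℂ V} (hb : ∀ x y z : V,
      trilinear Ω x y z = stdForm (b.repr x) (b.repr y) (b.repr z)) {e : V}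
    (he : b.repr e 0 ^ 2 - (b.repr e 1 * b.repr e 4 + b.repr e 2 * b.repr e 5 +
      b.repr e 3 * b.repr e 6) ≠ 0)
    {V₆ : Submodule ℂ V} (hV : IsCompl V₆ (ℂ ∙ e)) : (alpha Ω e V₆).Nondegenerate := by
  have key (m : V₆) (hm : ∀ n : V₆, trilinear Ω e m n = 0) : m = 0 := by
    have hall (z : V) : trilinear Ω e m z = 0 := by
      obtain ⟨n, hn, w, hw, rfl⟩ := Submodule.mem_sup.1 (hV.sup_eq_top ▸ Submodule.mem_top : z ∈ _)
      obtain ⟨c, rfl⟩ := Submodule.mem_span_singleton.1 hw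
      rw [map_add, map_smul, trilinear_self_outer, smul_zero, add_zero]
      exact hm ⟨n, hn⟩
    have h1 := stdForm_kernel (x := b.repr e) (y := b.repr m.1) (fun z => by
      rw [← hall (b.equivFun.symm z), hb]
      congr 1
      exact (b.equivFun.apply_symm_apply z).symm)
    set P := b.repr e 0 ^ 2 - (b.repr e 1 * b.repr e 4 + b.repr e 2 * b.repr e 5 +
      b.repr e 3 * b.repr e 6)
    -- A vector of `V₆` in the kernel of `Ω(e, ·, ·)` has, up to the nonzero value `P` of the
    -- quadric, to be a multiple of `e` by `stdForm_kernel`; but `V₆` meets the line in zero.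
    have h2 : P • m.1 ∈ (ℂ ∙ e) := by
      refine Submodule.mem_span_singleton.2 ⟨b.repr e 0 * b.repr m.1 0 - (b.repr e 1 * b.repr m.1 4 +
        b.repr e 2 * b.repr m.1 5 + b.repr e 3 * b.repr m.1 6), b.equivFun.injective ?_⟩
      rw [map_smul, map_smul]
      exact h1.symm
    have h3 : P • m.1 = 0 := by
      have := hV.disjoint.le_bot ⟨V₆.smul_mem P m.2, h2⟩
      simpa using this
    exact Subtype.ext ((smul_eq_zero.1 h3).resolve_left he)
  refine ⟨fun m hm => key m hm, fun m hm => key m fun n => ?_⟩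
  rw [trilinear_swap_right]
  exact neg_eq_zero.2 (hm n)

variable {e : V} {V₆ : Submodule ℂ V}

theorem ne_zero_of_nondegenerate [Nontrivial V] (hV : IsCompl V₆ (ℂ ∙ e))
    (h : (alpha Ω e V₆).Nondegenerate) : e ≠ 0 := by
  rintro rfl
  obtain ⟨v, hv⟩ := exists_ne (0 : V)
  have hv6 : v ∈ V₆ := by
    have : V₆ = ⊤ := by simpa using hV.sup_eq_top
    rw [this]; trivial
  have := h.1 ⟨v, hv6⟩ (fun n => by
    change trilinear Ω 0 v n = 0
    simp)
  exact hv (congrArg Subtype.val this)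

theorem finrank_complement (b : Module.Basis (Fin 7) ℂ V) (hV : IsCompl V₆ (ℂ ∙ e)) (he : e ≠ 0) :
    Module.finrank ℂ V₆ = 6 := by
  have := Module.Finite.of_basis b
  have h := Submodule.finrank_add_eq_of_isCompl hV
  rw [finrank_span_singleton he, Module.finrank_eq_card_basis b, Fintype.card_fin] at h
  omega

/-- The coordinate along the line `ℂ e`. -/
def lineCoord (hV : IsCompl V₆ (ℂ ∙ e)) (he : e ≠ 0) : V →ₗ[ℂ] ℂ :=
  (LinearEquiv.toSpanNonzeroSingleton ℂ V e he).symm.toLinearMap ∘ₗ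
    (ℂ ∙ e).projectionOnto V₆ hV.symm

theorem lineCoord_smul (hV : IsCompl V₆ (ℂ ∙ e)) (he : e ≠ 0) (v : V) :
    lineCoord hV he v • e = ((ℂ ∙ e).projectionOnto V₆ hV.symm v : V) :=
  congrArg Subtype.val
    ((LinearEquiv.toSpanNonzeroSingleton ℂ V e he).apply_symm_apply
      ((ℂ ∙ e).projectionOnto V₆ hV.symm v))

theorem projectionOnto_add_lineCoord (hV : IsCompl V₆ (ℂ ∙ e)) (he : e ≠ 0) (v : V) :
    (V₆.projectionOnto (ℂ ∙ e) hV v : V) + lineCoord hV he v • e = v := by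
  rw [lineCoord_smul]
  exact Submodule.projection_add_projection_eq_self hV v

theorem lineCoord_of_mem (hV : IsCompl V₆ (ℂ ∙ e)) (he : e ≠ 0) (v : V₆) :
    lineCoord hV he v = 0 := by
  rw [lineCoord, LinearMap.comp_apply, Submodule.projectionOnto_apply_right, map_zero]

theorem lineCoord_self (hV : IsCompl V₆ (ℂ ∙ e)) (he : e ≠ 0) : lineCoord hV he e = 1 := by
  have h := lineCoord_smul hV he e
  have h1 := Submodule.projectionOnto_apply_left hV.symm ⟨e, Submodule.mem_span_singleton_self e⟩
  rw [h1] at h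
  have h2 : (lineCoord hV he e - 1) • e = 0 := by rw [sub_smul, h, one_smul, sub_self]
  exact sub_eq_zero.1 ((smul_eq_zero.1 h2).resolve_right he)

variable (Ω) in
/-- The geometry defined by a three-form, a line and a complement of the line. -/
def geometry (hV : IsCompl V₆ (ℂ ∙ e)) (he : e ≠ 0) (hα : (alpha Ω e V₆).Nondegenerate)
    (b₇ : Module.Basis (Fin 7) ℂ V) (b₆ : Module.Basis (Fin 6) ℂ V₆) : Geometry ℂ V₆ V where
  ι := V₆.subtype
  pr := V₆.projectionOnto (ℂ ∙ e) hV
  e := e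
  lam := lineCoord hV he
  pr_ι := Submodule.projectionOnto_apply_left hV
  pr_e := Submodule.projectionOnto_apply_right hV ⟨e, Submodule.mem_span_singleton_self e⟩
  lam_ι := lineCoord_of_mem hV he
  lam_e := lineCoord_self hV he
  eq := projectionOnto_add_lineCoord hV he
  α := alpha Ω e V₆
  ω := trilinear (omega Ω V₆)
  Ω := trilinear Ω
  α_self x := trilinear_self_right Ω e x
  ω_self_left := trilinear_self_left _
  ω_self_right := trilinear_self_right _
  Ω_eq x y z := by
    have hω (x y z : V₆) : trilinear (omega Ω V₆) x y z = trilinear Ω x y z := by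
      change Ω (V₆.subtype ∘ ![x, y, z]) = Ω ![x.1, y.1, z.1]
      congr 1
      ext i
      fin_cases i <;> rfl
    have hα (x y : V₆) : alpha Ω e V₆ x y = trilinear Ω e x y := rfl
    rw [hω, hα, hα, hα]
    conv_lhs => rw [← projectionOnto_add_lineCoord hV he x, ← projectionOnto_add_lineCoord hV he y,
      ← projectionOnto_add_lineCoord hV he z]
    generalize V₆.projectionOnto (ℂ ∙ e) hV x = x'
    generalize V₆.projectionOnto (ℂ ∙ e) hV y = y'
    generalize V₆.projectionOnto (ℂ ∙ e) hV z = z'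
    have h1 := trilinear_swap_left Ω e x'.1
    have h2 := trilinear_swap_right Ω x'.1 e y'.1
    simp only [map_add, map_smul, LinearMap.add_apply, LinearMap.smul_apply, smul_eq_mul,
      trilinear_self_left, trilinear_self_outer, h1, h2]
    ring
  exists_repr f := by
    have := Module.Finite.of_basis b₆
    refine ⟨((alpha Ω e V₆).toDual hα).symm f, fun x => ?_⟩
    exact LinearMap.BilinForm.apply_toDual_symm_apply ..
  separating := hα.1
  basis := b₆
  basis₇ := b₇

end Concrete

end

section

/-! ### The varieties attached to a geometry -/

theorem exists_grassmannian_comap {R M M' : Type*} [CommRing R] [AddCommGroup M] [Module R M]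
    [AddCommGroup M'] [Module R M'] {k : ℕ} (N : Module.Grassmannian R M k) (g : M' →ₗ[R] M)
    (hg : ∀ m, ∃ m', m - g m' ∈ N.toSubmodule) :
    ∃ N' : Module.Grassmannian R M' k, N'.toSubmodule = N.toSubmodule.comap g := by
  obtain ⟨N', hN'⟩ := exists_grassmannian_of_surjective N.rankAtStalk_eq
    (N.toSubmodule.mkQ ∘ₗ g) (fun q => by
      obtain ⟨m, rfl⟩ := N.toSubmodule.mkQ_surjective q
      obtain ⟨m', hm'⟩ := hg m
      refine ⟨m', ?_⟩
      exact ((Submodule.Quotient.eq _).2 hm').symm)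
  refine ⟨N', hN'.trans ?_⟩
  rw [LinearMap.ker_comp, Submodule.ker_mkQ]

theorem Represents.exists_sub_eq {W : Type} [AddCommGroup W] [Module ℂ W] {k : ℕ}
    {X : Over (Spec (.of ℂ))} {P : Condition W k} (r : Represents X P) {A : CommAlgCat.{0} ℂ}
    {N : Module.Grassmannian A (A ⊗[ℂ] W) k} (hN : N ∈ P A) :
    ∃ x : specOver A ⟶ X, (r.points A x).1 = N :=
  ⟨(r.points A).symm ⟨N, hN⟩, by rw [Equiv.apply_symm_apply]⟩

theorem bc_forall_iff {W : Type} [AddCommGroup W] [Module ℂ W] {A B : Type} [CommRing A]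
    [Algebra ℂ A] [CommRing B] [Algebra ℂ B] (φ : A →ₐ[ℂ] B) (l : B ⊗[ℂ] W →ₗ[B] B) :
    (∀ z, l z = 0) ↔ ∀ z, l (bc φ z) = 0 := by
  refine ⟨fun h z => h _, fun h z => ?_⟩
  induction z with
  | zero => simp
  | tmul b w =>
    have h1 := h (1 ⊗ₜ w)
    rw [bc_tmul, map_one] at h1
    have h2 : (b ⊗ₜ[ℂ] w : B ⊗[ℂ] W) = b • (1 ⊗ₜ w) := by simp [TensorProduct.smul_tmul']
    rw [h2, map_smul, h1, smul_zero]
  | add x y hx hy => rw [map_add, hx, hy, add_zero]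

namespace Geometry

/-- The orthogonal complement of a common kernel. -/
theorem orthogonal_eq_span {R M M₇ : Type*} [CommRing R] [AddCommGroup M] [Module R M]
    [AddCommGroup M₇] [Module R M₇] (G : Geometry R M M₇) {N : Submodule R M} {n : ℕ}
    {a m : Fin n → M} (ha : ∀ v ∈ N, ∀ i, G.α v (a i) = 0)
    (hm : ∀ v, v - ∑ i, G.α v (a i) • m i ∈ N) :
    G.α.orthogonal N = Submodule.span R (Set.range a) := by
  refine le_antisymm (fun y hy => ?_) (Submodule.span_le.2 ?_)
  · have : y = ∑ i, G.α (m i) y • a i := by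
      rw [← sub_eq_zero]
      refine G.separating_right _ fun v => ?_
      have h1 : G.α (v - ∑ i, G.α v (a i) • m i) y = 0 := hy _ (hm v)
      rw [map_sub, map_sum, LinearMap.sub_apply, LinearMap.sum_apply] at h1
      rw [map_sub, map_sum]
      simp only [map_smul, LinearMap.smul_apply, smul_eq_mul] at h1 ⊢
      rw [← h1]
      exact congrArg _ (Finset.sum_congr rfl fun i _ => mul_comm _ _)
    rw [this]
    exact Submodule.sum_mem _ fun i _ => Submodule.smul_mem _ _ (Submodule.subset_span ⟨i, rfl⟩)
  · rintro _ ⟨i, rfl⟩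
    exact fun v hv => ha v hv i

variable {W W₇ : Type} [AddCommGroup W] [Module ℂ W] [AddCommGroup W₇] [Module ℂ W₇]
  (G : Geometry ℂ W W₇)

/-- The condition defining the Cayley Grassmannian. -/
def cayleyCond : Condition W₇ 3 := fun A => {N | ∀ x ∈ N.toSubmodule, ∀ y ∈ N.toSubmodule,
  ∀ z ∈ N.toSubmodule, extend A G.Ω x y z = 0}

/-- The condition defining the adjoint variety. -/
def adjointCond : Condition W₇ 5 := fun A => {N | (G.baseChange A).IsAdjoint N.toSubmodule}

/-- The condition defining the variety `Y₄`. -/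
def centerCond : Condition W 2 := fun A => {N | (G.baseChange A).IsCenter N.toSubmodule}

/-- The condition defining the variety `Z₃`. -/
def lagrangianCond : Condition W 3 := fun A =>
  {N | (∀ x ∈ N.toSubmodule, ∀ y ∈ N.toSubmodule, G.α.baseChange A x y = 0) ∧
    ∀ x ∈ N.toSubmodule, ∀ y ∈ N.toSubmodule, ∀ z ∈ N.toSubmodule, extend A G.ω x y z = 0}

/-- The condition on elements of the Cayley Grassmannian to contain the given line. -/
def containingCond : Condition W₇ 3 := fun A =>
  {N | N ∈ G.cayleyCond A ∧ 1 ⊗ₜ[ℂ] G.e ∈ N.toSubmodule}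

variable {A : CommAlgCat.{0} ℂ}

/-- The equations are the values of `Ω` on triples from `N`. After base change the family is
generated by the images of vectors of `N`, and vanishing spreads one argument at a time. -/
theorem isClosedCond_cayley (N : Module.Grassmannian A (A ⊗[ℂ] W₇) 3) :
    IsClosedCond (A := A) fun B φ => Module.Grassmannian.map φ.hom N ∈ G.cayleyCond B := by
  refine (isClosedCond_forall fun x : N.toSubmodule => isClosedCond_forall
    fun y : N.toSubmodule => isClosedCond_forall fun z : N.toSubmodule =>
      isClosedCond_eq_zero (extend A G.Ω x.1 y.1 z.1)).congr fun B φ => ?_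
  constructor
  · intro h x y z
    rw [← extend_bc]
    exact h _ (bc_mem_map _ _ x.2) _ (bc_mem_map _ _ y.2) _ (bc_mem_map _ _ z.2)
  · intro h
    have h1 (x : N.toSubmodule) (y : N.toSubmodule) :=
      (forall_mem_map_iff φ.hom N (extend B G.Ω (bc φ.hom x.1) (bc φ.hom y.1))).2 fun z hz => by
        rw [extend_bc]; exact h x y ⟨z, hz⟩
    have h2 (x : N.toSubmodule) (z) (hz : z ∈ (Module.Grassmannian.map φ.hom N).toSubmodule) :=
      (forall_mem_map_iff φ.hom N ((extend B G.Ω (bc φ.hom x.1)).flip z)).2 fun y hy =>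
        h1 x ⟨y, hy⟩ z hz
    have h3 (y) (hy : y ∈ (Module.Grassmannian.map φ.hom N).toSubmodule) (z)
        (hz : z ∈ (Module.Grassmannian.map φ.hom N).toSubmodule) :=
      (forall_mem_map_iff φ.hom N (((extend B G.Ω).flip y).flip z)).2 fun x hx =>
        h2 ⟨x, hx⟩ z hz y hy
    exact fun x hx y hy z hz => h3 y hy z hz x hx

theorem isClosedCond_adjoint (N : Module.Grassmannian A (A ⊗[ℂ] W₇) 5) :
    IsClosedCond (A := A) fun B φ => Module.Grassmannian.map φ.hom N ∈ G.adjointCond B := by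
  refine (isClosedCond_forall fun x : N.toSubmodule => isClosedCond_forall
    fun y : N.toSubmodule => isClosedCond_forall fun z : A ⊗[ℂ] W₇ =>
      isClosedCond_eq_zero (extend A G.Ω x.1 y.1 z)).congr fun B φ => ?_
  constructor
  · intro h x y z
    rw [← extend_bc]
    exact h _ (bc_mem_map _ _ x.2) _ (bc_mem_map _ _ y.2) _
  · intro h
    have h1 (x : N.toSubmodule) (y : N.toSubmodule) :=
      (bc_forall_iff φ.hom (extend B G.Ω (bc φ.hom x.1) (bc φ.hom y.1))).2 fun z => by
        rw [extend_bc]; exact h x y z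
    have h2 (x : N.toSubmodule) (z) :=
      (forall_mem_map_iff φ.hom N ((extend B G.Ω (bc φ.hom x.1)).flip z)).2 fun y hy =>
        h1 x ⟨y, hy⟩ z
    have h3 (y) (hy : y ∈ (Module.Grassmannian.map φ.hom N).toSubmodule) (z) :=
      (forall_mem_map_iff φ.hom N (((extend B G.Ω).flip y).flip z)).2 fun x hx =>
        h2 ⟨x, hx⟩ z y hy
    exact fun x hx y hy z => h3 y hy z x hx

/-- The orthogonal complement of `N` is spanned by the vectors `a i` that represent the frame
functionals, and the same images span it after every base change (`horth`). So the condition becomes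
membership of the `a i` in the family and vanishing of `ω` on them. -/
theorem isClosedCond_center (N : Module.Grassmannian A (A ⊗[ℂ] W) 2) :
    IsClosedCond (A := A) fun B φ => Module.Grassmannian.map φ.hom N ∈ G.centerCond B := by
  obtain ⟨n, l, m, hl, hm⟩ := exists_frame N
  choose a ha using fun i => (G.baseChange A).exists_repr_right (l i)
  change ∀ i (x : A ⊗[ℂ] W), G.α.baseChange A x (a i) = l i x at ha
  have horth (B : CommAlgCat.{0} ℂ) (φ : A ⟶ B) :
      (G.baseChange B).α.orthogonal (Module.Grassmannian.map φ.hom N).toSubmodule =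
        Submodule.span B (Set.range fun i => bc φ.hom (a i)) := by
    have hα (i) (v : A ⊗[ℂ] W) :
        (G.baseChange B).α (bc φ.hom v) (bc φ.hom (a i)) = φ.hom (l i v) := by
      rw [← ha]; exact form_bc φ.hom G.α v (a i)
    refine (G.baseChange B).orthogonal_eq_span (m := fun i => bc φ.hom (m i)) ?_ ?_
    · intro v hv i
      exact (forall_mem_map_iff φ.hom N ((G.baseChange B).α.flip (bc φ.hom (a i)))).2
        (fun v hv => (hα i v).trans (by rw [hl v hv, map_zero])) v hv
    · intro v
      induction v with
      | zero => simp
      | tmul b w =>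
        have h1 := bc_mem_map φ.hom N (hm (1 ⊗ₜ w))
        rw [map_sub, map_sum] at h1
        simp only [bc_smul, ← hα] at h1
        rw [bc_tmul, map_one] at h1
        have h2 : (b ⊗ₜ[ℂ] w : B ⊗[ℂ] W) = b • (1 ⊗ₜ w) := by simp [TensorProduct.smul_tmul']
        have h3 := Submodule.smul_mem _ b h1
        rw [smul_sub, Finset.smul_sum] at h3
        rw [h2]
        simpa only [map_smul, LinearMap.smul_apply, smul_assoc] using h3
      | add x y hx hy =>
        have h3 := Submodule.add_mem _ hx hy
        simp only [map_add, LinearMap.add_apply, add_smul, Finset.sum_add_distrib]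
        convert! h3 using 1
        abel
  refine ((isClosedCond_forall fun i => isClosedCond_mem N (a i)).and
    (isClosedCond_forall fun i => isClosedCond_forall fun j => isClosedCond_forall
      fun z : N.toSubmodule => isClosedCond_eq_zero (extend A G.ω (a i) (a j) z.1))).congr
      fun B φ => ?_
  change (_ ≤ _ ∧ _) ↔ _
  rw [horth]
  refine and_congr ?_ ?_
  · rw [Submodule.span_le]
    exact ⟨fun h i => h ⟨i, rfl⟩, by rintro h _ ⟨i, rfl⟩; exact h i⟩
  · constructor
    · intro h i j z
      rw [← extend_bc]
      exact h _ (Submodule.subset_span ⟨i, rfl⟩) _ (Submodule.subset_span ⟨j, rfl⟩) _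
        (bc_mem_map _ _ z.2)
    · intro h y hy y' hy' z hz
      obtain ⟨c, rfl⟩ := (Submodule.mem_span_range_iff_exists_fun B).1 hy
      obtain ⟨c', rfl⟩ := (Submodule.mem_span_range_iff_exists_fun B).1 hy'
      have key (i j) := (forall_mem_map_iff φ.hom N
        (extend B G.ω (bc φ.hom (a i)) (bc φ.hom (a j)))).2 (fun z hz => by
          rw [extend_bc]; exact h i j ⟨z, hz⟩) z hz
      change extend B G.ω _ _ z = 0
      simp only [map_sum, map_smul, LinearMap.sum_apply, LinearMap.smul_apply, key, smul_zero,
        Finset.sum_const_zero]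

theorem isClosedCond_containing (N : Module.Grassmannian A (A ⊗[ℂ] W₇) 3) :
    IsClosedCond (A := A) fun B φ => Module.Grassmannian.map φ.hom N ∈ G.containingCond B := by
  refine ((G.isClosedCond_cayley N).and (isClosedCond_mem N (1 ⊗ₜ G.e))).congr fun B φ => ?_
  refine and_congr_right fun _ => ?_
  rw [bc_tmul, map_one]

end Geometry

end

section

namespace Geometry

variable {W W₇ : Type} [AddCommGroup W] [Module ℂ W] [AddCommGroup W₇] [Module ℂ W₇]
  (G : Geometry ℂ W W₇)

/-! ### The variety `Z₃` -/

theorem exists_comap_pr {A : CommAlgCat.{0} ℂ} (N : Module.Grassmannian A (A ⊗[ℂ] W) 3) :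
    ∃ N' : Module.Grassmannian A (A ⊗[ℂ] W₇) 3,
      N'.toSubmodule = N.toSubmodule.comap (G.baseChange A).pr :=
  exists_grassmannian_comap N _ fun m => ⟨(G.baseChange A).ι m, by
    rw [(G.baseChange A).pr_ι, sub_self]; exact N.toSubmodule.zero_mem⟩

theorem comap_pr_eq {R M M₇ : Type*} [CommRing R] [AddCommGroup M] [Module R M]
    [AddCommGroup M₇] [Module R M₇] (G : Geometry R M M₇) (N : Submodule R M) :
    N.comap G.pr = N.map G.ι ⊔ Submodule.span R {G.e} := by
  refine le_antisymm (fun m hm => ?_) (sup_le ?_ ?_)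
  · rw [← G.eq m]
    exact Submodule.add_mem_sup ⟨_, hm, rfl⟩
      (Submodule.smul_mem _ _ (Submodule.mem_span_singleton_self _))
  · rintro _ ⟨m, hm, rfl⟩
    rw [Submodule.mem_comap, G.pr_ι]
    exact hm
  · rw [Submodule.span_singleton_le_iff_mem, Submodule.mem_comap, G.pr_e]
    exact N.zero_mem

/-- On a subspace of the form `U₃ ⊕ A e` the form `Ω` splits into `ω` on `U₃` and `α = Ω(e, ·, ·)`
on `U₃`. -/
theorem comap_pr_mem_iff {A : CommAlgCat.{0} ℂ} {N : Module.Grassmannian A (A ⊗[ℂ] W) 3}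
    {N' : Module.Grassmannian A (A ⊗[ℂ] W₇) 3}
    (h : N'.toSubmodule = N.toSubmodule.comap (G.baseChange A).pr) :
    N' ∈ G.containingCond A ↔ N ∈ G.lagrangianCond A := by
  have he : (G.baseChange A).e ∈ N'.toSubmodule := by
    rw [h, Submodule.mem_comap, (G.baseChange A).pr_e]; exact N.toSubmodule.zero_mem
  have hι (m) (hm : m ∈ N.toSubmodule) : (G.baseChange A).ι m ∈ N'.toSubmodule := by
    rw [h, Submodule.mem_comap, (G.baseChange A).pr_ι]; exact hm
  constructor
  · rintro ⟨hN, -⟩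
    refine ⟨fun x hx y hy => ?_, fun x hx y hy z hz => ?_⟩
    · have h1 : (G.baseChange A).Ω _ _ _ = 0 := hN _ he _ (hι x hx) _ (hι y hy)
      rw [Geometry.Ω_eq] at h1
      simp only [Geometry.pr_e, Geometry.lam_e, Geometry.pr_ι, Geometry.lam_ι, map_zero,
        LinearMap.zero_apply] at h1
      have h2 : (G.baseChange A).α x y = 0 := by linear_combination h1
      exact h2
    · have h1 : (G.baseChange A).Ω _ _ _ = 0 := hN _ (hι x hx) _ (hι y hy) _ (hι z hz)
      rw [Geometry.Ω_eq] at h1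
      simp only [Geometry.pr_ι, Geometry.lam_ι] at h1
      have h2 : (G.baseChange A).ω x y z = 0 := by linear_combination h1
      exact h2
  · rintro ⟨hα, hω⟩
    refine ⟨fun x hx y hy z hz => ?_, he⟩
    rw [h, Submodule.mem_comap] at hx hy hz
    change (G.baseChange A).Ω x y z = 0
    have h1 : (G.baseChange A).ω _ _ _ = 0 := hω _ hx _ hy _ hz
    have h2 : (G.baseChange A).α _ _ = 0 := hα _ hy _ hz
    have h3 : (G.baseChange A).α _ _ = 0 := hα _ hx _ hz
    have h4 : (G.baseChange A).α _ _ = 0 := hα _ hx _ hy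
    rw [Geometry.Ω_eq, h1, h2, h3, h4]
    ring

/-- The identification of `Z₃` with the subspaces containing the given line. -/
def lineEquiv (A : CommAlgCat.{0} ℂ) : G.lagrangianCond A ≃ G.containingCond A :=
  Equiv.ofBijective (fun N => ⟨(G.exists_comap_pr N.1).choose,
    (G.comap_pr_mem_iff (G.exists_comap_pr N.1).choose_spec).2 N.2⟩) (by
  constructor
  · intro N N' h
    have h1 := congrArg (fun N : G.containingCond A => N.1.toSubmodule) h
    change (G.exists_comap_pr N.1).choose.toSubmodule =
      (G.exists_comap_pr N'.1).choose.toSubmodule at h1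
    rw [(G.exists_comap_pr N.1).choose_spec, (G.exists_comap_pr N'.1).choose_spec] at h1
    exact Subtype.ext (Module.Grassmannian.ext
      (Submodule.comap_injective_of_surjective (G.baseChange A).pr_surjective h1))
  · rintro ⟨N', hN'⟩
    have he : (G.baseChange A).e ∈ N'.toSubmodule := hN'.2
    obtain ⟨N, hN⟩ := exists_grassmannian_comap N' (G.baseChange A).ι fun m => by
      refine ⟨(G.baseChange A).pr m, ?_⟩
      have := (G.baseChange A).eq m
      rw [← eq_sub_iff_add_eq'] at this
      rw [← this]
      exact Submodule.smul_mem _ _ he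
    have h : N'.toSubmodule = N.toSubmodule.comap (G.baseChange A).pr := by
      ext m
      rw [hN, Submodule.mem_comap, Submodule.mem_comap]
      conv_lhs => rw [← (G.baseChange A).eq m]
      exact Submodule.add_mem_iff_left _ (Submodule.smul_mem _ _ he)
    refine ⟨⟨N, (G.comap_pr_mem_iff h).1 hN'⟩, Subtype.ext (Module.Grassmannian.ext ?_)⟩
    rw [h]
    exact (G.exists_comap_pr N).choose_spec)

theorem lineEquiv_toSubmodule {A : CommAlgCat.{0} ℂ} (N : G.lagrangianCond A) :
    (G.lineEquiv A N).1.toSubmodule = N.1.toSubmodule.comap (G.baseChange A).pr :=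
  (G.exists_comap_pr N.1).choose_spec

/-- The moduli scheme of the elements of the Cayley Grassmannian containing the given line is the
variety `Z₃`. -/
def representsLagrangian {Z : Over (Spec (.of ℂ))} (r : Represents Z G.containingCond) :
    Represents Z G.lagrangianCond where
  points A := (r.points A).trans (G.lineEquiv A).symm
  natural {A B} φ x := by
    let N := (G.lineEquiv A).symm (r.points A x)
    have hN : G.lineEquiv A N = r.points A x := Equiv.apply_symm_apply _ _
    let N' := (G.lineEquiv B).symm (r.points B (specOverMap φ ≫ x))
    have hN' : (G.lineEquiv B N').1 = Module.Grassmannian.map φ.hom (G.lineEquiv A N).1 := by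
      rw [hN, ← r.natural]; exact congrArg Subtype.val (Equiv.apply_symm_apply _ _)
    change N'.1 = Module.Grassmannian.map φ.hom N.1
    obtain ⟨P, hP⟩ := G.exists_comap_pr (Module.Grassmannian.map φ.hom N.1)
    have h1 : (G.lineEquiv B N').1 = P := by
      rw [hN']
      refine Grassmannian.eq_of_le (map_le_of_bc_mem _ _ fun v hv => ?_)
      rw [lineEquiv_toSubmodule, Submodule.mem_comap] at hv
      rw [hP, Submodule.mem_comap]
      have : (G.baseChange B).pr (bc φ.hom v) = bc φ.hom ((G.baseChange A).pr v) :=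
        baseChange_bc φ.hom G.pr v
      rw [this]
      exact bc_mem_map _ _ hv
    have h2 := congrArg Module.Grassmannian.toSubmodule h1
    rw [lineEquiv_toSubmodule, hP] at h2
    exact Module.Grassmannian.ext
      (Submodule.comap_injective_of_surjective (G.baseChange B).pr_surjective h2)

theorem representsLagrangian_sub {Z : Over (Spec (.of ℂ))} (r : Represents Z G.containingCond)
    {A : CommAlgCat.{0} ℂ} (x : specOver A ⟶ Z) :
    r.sub x = ((G.representsLagrangian r).sub x).comap (G.baseChange A).pr := by
  have h := G.lineEquiv_toSubmodule ((G.lineEquiv A).symm (r.points A x))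
  rw [Equiv.apply_symm_apply] at h
  exact h

/-! ### Deformations over local rings -/

variable {G}

theorem bcₛₗ_surjective {A B : Type} [CommRing A] [Algebra ℂ A] [CommRing B] [Algebra ℂ B]
    {φ : A →ₐ[ℂ] B} (h : Function.Surjective φ) : Function.Surjective (bcₛₗ (W := W) φ) :=
  LinearMap.rTensor_surjective W (g := φ.toLinearMap) h

/-- Since the equations are nonunits, the closed point lies on `Y₄`. Over the residue field the form
is still standard, so the derivative of the equations is surjective there, and hence over `A`. -/
theorem Adapted.exists_equationsDeriv {b : Module.Basis (Fin 7) ℂ W₇}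
    (hb : ∀ x y z, G.Ω x y z = stdForm (b.repr x) (b.repr y) (b.repr z)) {A : Type} [CommRing A]
    [Algebra ℂ A] [IsLocalRing A] {x : Fin 4 → A ⊗[ℂ] W} {ξ : Fin 4 → A ⊗[ℂ] W →ₗ[A] A}
    (h : (G.baseChange A).Adapted x ξ) (hs : ∀ i, ¬ IsUnit ((G.baseChange A).equations x i))
    (l : Fin 3 → A) : ∃ y, (G.baseChange A).IsTangent x y ∧
      (G.baseChange A).equationsDeriv x y = l := by
  let φ : A →ₐ[ℂ] IsLocalRing.ResidueField A := IsScalarTower.toAlgHom ℂ A _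
  have hφ (a : A) : φ a = IsLocalRing.residue A a := rfl
  have hloc : IsLocalHom φ.toRingHom :=
    inferInstanceAs (IsLocalHom (IsLocalRing.residue A))
  refine (G.bcHom φ).exists_equationsDeriv (bcₛₗ_surjective IsLocalRing.residue_surjective)
    (coords b _) (extend_eq_stdForm b hb _) h (fun i => ?_) l
  exact (IsLocalRing.residue_eq_zero_iff _).2 ((IsLocalRing.mem_maximalIdeal _).2 (hs i))

end Geometry

end

/-! ### Multiples of unimodular vectors, and points of the incidence scheme -/

section

/-- Testing on the quotients by `(c)` and by the ideal of `s` shows that the two ideals agree. So `s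
= c • l` and `c` is a combination of the entries of `s`; cancelling `c` shows that `l` is
unimodular. -/
theorem exists_unimodular {A : CommAlgCat.{0} ℂ} {s : Fin 3 → A} {c : A}
    (hc : c ∈ nonZeroDivisors A)
    (h : ∀ (C : CommAlgCat.{0} ℂ) (φ : A ⟶ C), (∀ i, φ.hom (s i) = 0) ↔ φ.hom c = 0) :
    ∃ l : Fin 3 → A, (∀ i, s i = c * l i) ∧ ∃ r : Fin 3 → A, ∑ i, r i * l i = 1 := by
  have h1 (i) : s i ∈ Ideal.span {c} := by
    have := (h (CommAlgCat.of ℂ (A ⧸ Ideal.span {c}))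
      (CommAlgCat.ofHom (Ideal.Quotient.mkₐ ℂ (Ideal.span {c})))).2
      (Ideal.Quotient.eq_zero_iff_mem.2 (Ideal.mem_span_singleton_self c)) i
    exact Ideal.Quotient.eq_zero_iff_mem.1 this
  choose l hl using fun i => Ideal.mem_span_singleton.1 (h1 i)
  refine ⟨l, hl, ?_⟩
  have h2 : c ∈ Ideal.span (Set.range s) := by
    have := (h (CommAlgCat.of ℂ (A ⧸ Ideal.span (Set.range s)))
      (CommAlgCat.ofHom (Ideal.Quotient.mkₐ ℂ (Ideal.span (Set.range s))))).1
      (fun i => Ideal.Quotient.eq_zero_iff_mem.2 (Ideal.subset_span ⟨i, rfl⟩))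
    exact Ideal.Quotient.eq_zero_iff_mem.1 this
  obtain ⟨r, hr⟩ := (Submodule.mem_span_range_iff_exists_fun A).1 h2
  refine ⟨r, ?_⟩
  have : c * (∑ i, r i * l i - 1) = 0 := by
    simp only [smul_eq_mul, hl, Fin.sum_univ_three] at hr ⊢
    linear_combination hr
  exact sub_eq_zero.1 (mem_nonZeroDivisors_iff_left.1 hc _ this)

theorem IsField.exists_unimodular {A : Type*} [CommRing A] (hA : IsField A) (s : Fin 3 → A) :
    ∃ (l : Fin 3 → A) (c : A), (∀ i, s i = c * l i) ∧ ∃ r : Fin 3 → A, ∑ i, r i * l i = 1 := by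
  by_cases h : ∀ i, s i = 0
  -- At a point of the center every direction is allowed; any unimodular vector will do.
  · refine ⟨fun _ => 1, 0, fun i => by simp [h], Pi.single 0 1, by simp⟩
  · push Not at h
    obtain ⟨i, hi⟩ := h
    obtain ⟨b, hb⟩ := hA.mul_inv_cancel hi
    refine ⟨s, 1, fun i => by simp, Pi.single i b, ?_⟩
    rw [Finset.sum_eq_single i]
    · rw [Pi.single_eq_same, mul_comm, hb]
    · intro j _ hj
      rw [Pi.single_eq_of_ne hj, zero_mul]
    · simp

theorem IsField.isLocalRing {A : Type*} [CommRing A] (hA : IsField A) : IsLocalRing A := by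
  have : Nontrivial A := ⟨hA.exists_pair_ne⟩
  refine IsLocalRing.of_isUnit_or_isUnit_one_sub_self fun a => ?_
  by_cases ha : a = 0
  · right; simp [ha]
  · left
    obtain ⟨b, hb⟩ := hA.mul_inv_cancel ha
    exact IsUnit.of_mul_eq_one b hb

theorem isUnit_two (A : Type) [CommRing A] [Algebra ℂ A] : IsUnit (2 : A) := by
  have : (2 : A) = algebraMap ℂ A 2  := (map_ofNat (algebraMap ℂ A) 2).symm
  rw [this]
  exact (isUnit_iff_ne_zero.2 two_ne_zero).map (algebraMap ℂ A)

namespace Geometry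

variable {W W₇ : Type} [AddCommGroup W] [Module ℂ W] [AddCommGroup W₇] [Module ℂ W₇]
  {G : Geometry ℂ W W₇}

theorem _root_.CayleyGrassmannian.Represents.sub_specOverMap_eq_span {W : Type} [AddCommGroup W]
    [Module ℂ W] {k : ℕ} {X : Over (Spec (.of ℂ))} {P : Condition W k} (r : Represents X P)
    {A B : CommAlgCat.{0} ℂ} (φ : A ⟶ B) (x : specOver A ⟶ X) :
    r.sub (specOverMap φ ≫ x) = Submodule.span B (bcₛₗ φ.hom '' (r.sub x : Set (A ⊗[ℂ] W))) :=
  (r.sub_specOverMap φ x).trans (map_toSubmodule_eq_span φ.hom _)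

/-! ### The incidence variety and the two blow-ups -/

variable {CG G₄ B Z Y : Over (Spec (.of ℂ))} {rCG : Represents CG G.cayleyCond}
  {rG₄ : Represents G₄ (grassmannian W 2)}

variable (rCG rG₄) in
/-- The incidence relation between elements of the Cayley Grassmannian and four-dimensional
subspaces of `W`. -/
def Incident (A : CommAlgCat.{0} ℂ) (x : specOver A ⟶ CG) (y : specOver A ⟶ G₄) : Prop :=
  ∀ m ∈ rCG.sub x, (G.baseChange A).pr m ∈ rG₄.sub y

variable (rCG rG₄) in
theorem isClosedCond_incident (A : CommAlgCat.{0} ℂ) (x : specOver A ⟶ CG)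
    (y : specOver A ⟶ G₄) : IsClosedCond (A := A) fun C φ =>
      Incident rCG rG₄ C (specOverMap φ ≫ x) (specOverMap φ ≫ y) := by
  refine (isClosedCond_forall fun m : rCG.sub x => isClosedCond_mem (rG₄.points A y).1
    ((G.baseChange A).pr m.1)).congr fun C φ => ?_
  have hpr (m) : (G.baseChange C).pr (bc φ.hom m) = bc φ.hom ((G.baseChange A).pr m) :=
    baseChange_bc φ.hom G.pr m
  rw [Incident, rCG.sub_specOverMap, rG₄.sub_specOverMap]
  constructor
  · intro h m
    rw [← hpr]
    exact h _ (bc_mem_map φ.hom _ m.2)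
  · intro h
    refine fun m hm => map_le_of_bc_mem φ.hom _ (S := Submodule.comap (G.baseChange C).pr
      (Module.Grassmannian.map φ.hom (rG₄.points A y).1).toSubmodule) (fun m hm => ?_) hm
    rw [Submodule.mem_comap, hpr]
    exact h ⟨m, hm⟩

variable (rCG rG₄) in
/-- `B` is the incidence variety. -/
structure IsIncidence (p : B ⟶ CG) (q : B ⟶ G₄) : Prop where
  incident : ∀ (A : CommAlgCat.{0} ℂ) (b : specOver A ⟶ B), Incident rCG rG₄ A (b ≫ p) (b ≫ q)
  exists_point : ∀ A x y, Incident rCG rG₄ A x y → ∃ b : specOver A ⟶ B, b ≫ p = x ∧ b ≫ q = y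
  ext : ∀ (A : CommAlgCat.{0} ℂ) (b b' : specOver A ⟶ B), b ≫ p = b' ≫ p → b ≫ q = b' ≫ q → b = b'

variable (rCG) in
/-- `i` is the inclusion of the subvariety of the subspaces containing the given line. -/
def IsLineLocus (i : Z ⟶ CG) : Prop :=
  ∀ (A : CommAlgCat.{0} ℂ) (x : specOver A ⟶ CG),
    (∃ y, y ≫ i = x) ↔ (G.baseChange A).e ∈ rCG.sub x

variable (G rG₄) in
/-- `j` is the inclusion of the variety `Y₄`. -/
def IsCenterLocus (j : Y ⟶ G₄) : Prop :=
  ∀ (A : CommAlgCat.{0} ℂ) (y : specOver A ⟶ G₄),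
    (∃ z, z ≫ j = y) ↔ (G.baseChange A).IsCenter (rG₄.sub y)

variable {A : CommAlgCat.{0} ℂ} {x : specOver A ⟶ CG} {y : specOver A ⟶ G₄}
  {v : Fin 4 → A ⊗[ℂ] W} {ξ : Fin 4 → A ⊗[ℂ] W →ₗ[A] A} {l : Fin 3 → A} {c : A}

theorem exists_parametrized [IsLocalRing A] (h : Incident rCG rG₄ A x y) :
    ∃ v ξ l c, (G.baseChange A).Parametrized v ξ l c (rG₄.sub y) (rCG.sub x) := by
  obtain ⟨v, ξ, hv, hU⟩ := exists_adapted (G := G.baseChange A) (rG₄.points A y).1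
  obtain ⟨l, c, hp⟩ := hv.parametrized (U := rG₄.sub y) hU (rCG.points A x).1 h
    (rCG.points A x).2
  exact ⟨v, ξ, l, c, hp⟩

theorem Parametrized.comp_specOverMap
    (h : (G.baseChange A).Parametrized v ξ l c (rG₄.sub y) (rCG.sub x))
    {C : CommAlgCat.{0} ℂ} (φ : A ⟶ C) :
    ∃ v' ξ', (G.baseChange C).Parametrized v' ξ' (fun i => φ.hom (l i)) (φ.hom c)
      (rG₄.sub (specOverMap φ ≫ y)) (rCG.sub (specOverMap φ ≫ x)) := by
  obtain ⟨ξ', h'⟩ := (G.bcHom φ.hom).parametrized h (rG₄.points C (specOverMap φ ≫ y)).1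
    (rG₄.sub_specOverMap_eq_span φ y) (rCG.points C (specOverMap φ ≫ x)).1
    (rCG.sub_specOverMap_eq_span φ x)
  exact ⟨_, ξ', h'⟩

theorem Parametrized.cutBy_line {i : Z ⟶ CG} (hi : IsLineLocus rCG i)
    (h : (G.baseChange A).Parametrized v ξ l c (rG₄.sub y) (rCG.sub x)) : CutBy i x (l 2) := by
  intro C φ
  obtain ⟨v', ξ', h'⟩ := h.comp_specOverMap φ
  exact (hi C _).trans h'.e_mem_iff

theorem Parametrized.cutBy_center {j : Y ⟶ G₄} (hj : IsCenterLocus G rG₄ j)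
    (h : (G.baseChange A).Parametrized v ξ l c (rG₄.sub y) (rCG.sub x)) : CutBy j y c := by
  intro C φ
  obtain ⟨v', ξ', h'⟩ := h.comp_specOverMap φ
  exact (hj C _).trans (h'.orthogonal_iff (isUnit_two C))

-- The deformed pair of subspaces is incident, so it is a point of the incidence scheme over the
-- dual numbers. That it restricts to `b` follows from containments of subspaces of equal rank.
open TrivSqZeroExt in
theorem Parametrized.exists_deformation_point {p : B ⟶ CG} {q : B ⟶ G₄}
    (hB : IsIncidence rCG rG₄ p q) {b : specOver A ⟶ B} {w : Fin 4 → A ⊗[ℂ] W}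
    (h : (G.baseChange A).Parametrized v ξ l c (rG₄.sub (b ≫ q)) (rCG.sub (b ≫ p)))
    (hw : (G.baseChange A).IsTangent v w) (l' : Fin 3 → DualNumber A) (c' : DualNumber A)
    (hl' : ∀ i, (l' i).fst = l i)
    (hc' : ∀ i, inl ((G.baseChange A).equations v i) +
      inr ((G.baseChange A).equationsDeriv v w i) = c' * l' i) :
    ∃ (b' : specOver (.of ℂ (DualNumber A)) ⟶ B) (v' : Fin 4 → DualNumber A ⊗[ℂ] W)
      (ξ' : Fin 4 → DualNumber A ⊗[ℂ] W →ₗ[DualNumber A] DualNumber A),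
      specOverMap (dualFst A) ≫ b' = b ∧
      (G.baseChange (DualNumber A)).Parametrized v' ξ' l' c' (rG₄.sub (b' ≫ q))
        (rCG.sub (b' ≫ p)) := by
  obtain ⟨v', ξ', U', V', h', hU, hV⟩ := h.exists_deformation hw
    (G.bcHom (inlAlgHom ℂ A A)) (G.bcHom (dualFst A).hom) (fun m => by
      refine (bc_bc (inlAlgHom ℂ A A) (dualFst A).hom m).trans ?_
      exact LinearMap.congr_fun (LinearMap.rTensor_id W A) m) l' c' hl' hc'
  obtain ⟨x', hx'⟩ := rCG.exists_sub_eq (A := .of ℂ (DualNumber A)) (N := V') h'.Ω_eq_zero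
  obtain ⟨y', hy'⟩ := rG₄.exists_sub_eq (A := .of ℂ (DualNumber A)) (N := U') trivial
  have hx'' : rCG.sub x' = V'.toSubmodule := congrArg _ hx'
  have hy'' : rG₄.sub y' = U'.toSubmodule := congrArg _ hy'
  obtain ⟨b', hb'p, hb'q⟩ := hB.exists_point _ x' y' (fun m hm => by
    rw [hx''] at hm
    rw [hy'']
    exact h'.pr_mem hm)
  refine ⟨b', v', ξ', hB.ext _ _ _ ?_ ?_, ?_⟩
  · rw [Category.assoc, hb'p]
    refine rCG.ext_of_le ?_
    rw [rCG.sub_specOverMap_eq_span, Submodule.span_le, hx'']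
    rintro _ ⟨m, hm, rfl⟩
    exact hV m hm
  · rw [Category.assoc, hb'q]
    refine rG₄.ext_of_le ?_
    rw [rG₄.sub_specOverMap_eq_span, Submodule.span_le, hy'']
    rintro _ ⟨m, hm, rfl⟩
    exact hU m hm
  · rw [hb'p, hb'q, hx'', hy'']
    exact h'

end Geometry

end

/-! ### The two projections of the incidence scheme are blow-ups -/

section

namespace Geometry

variable {W W₇ : Type} [AddCommGroup W] [Module ℂ W] [AddCommGroup W₇] [Module ℂ W₇]
  {G : Geometry ℂ W W₇} {CG G₄ B Z Y : Over (Spec (.of ℂ))} {rCG : Represents CG G.cayleyCond}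
  {rG₄ : Represents G₄ (grassmannian W 2)} {p : B ⟶ CG} {q : B ⟶ G₄} {i : Z ⟶ CG} {j : Y ⟶ G₄}

/-- The line spanned by `l` in the quotient determines the four-dimensional subspace by
`exists_grassmannian_pr`. Existence is kept separate from uniqueness because over fields it is also
needed at points of the center, where `c = 0`. -/
theorem IsIncidence.exists_lift_left (hB : IsIncidence rCG rG₄ p q) {A : CommAlgCat.{0} ℂ}
    {x : specOver A ⟶ CG} {g : A ⊗[ℂ] W₇ →ₗ[A] (Fin 3 → A)} (hg : Function.Surjective g)
    (hV : rCG.sub x = LinearMap.ker g) {l : Fin 3 → A} {c : A}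
    (hl : ∃ r : Fin 3 → A, ∑ i, r i * l i = 1) (he : ∀ i, g (G.baseChange A).e i = c * l i) :
    ∃ b : specOver A ⟶ B, b ≫ p = x ∧ (c ∈ nonZeroDivisors A → ∀ b', b' ≫ p = x → b' = b) := by
  obtain ⟨U, hU, huniq⟩ := exists_grassmannian_pr (G := G.baseChange A) (V := (rCG.points A x).1)
    hg hV hl (funext he)
  obtain ⟨y, hy⟩ := rG₄.exists_sub_eq (A := A) (N := U) trivial
  have hy' : rG₄.sub y = U.toSubmodule := congrArg _ hy
  obtain ⟨b, hbp, hbq⟩ := hB.exists_point A x y (fun m hm => by rw [hy']; exact hU m hm)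
  refine ⟨b, hbp, fun hc b' hb' => hB.ext A _ _ (hb'.trans hbp.symm) ?_⟩
  have h1 := hB.incident A b'
  rw [hb'] at h1
  have h2 := huniq (rG₄.points A (b' ≫ q)).1 h1 hc
  rw [hbq]
  refine rG₄.ext ?_
  rw [hy', h2]
  rfl

theorem IsIncidence.exists_lift_right (hB : IsIncidence rCG rG₄ p q) {A : CommAlgCat.{0} ℂ}
    {y : specOver A ⟶ G₄} {v : Fin 4 → A ⊗[ℂ] W} {ξ : Fin 4 → A ⊗[ℂ] W →ₗ[A] A}
    (hv : (G.baseChange A).Adapted v ξ) (hU : rG₄.sub y = Submodule.span A (Set.range v))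
    {l : Fin 3 → A} {c : A} (hl : ∃ r : Fin 3 → A, ∑ i, r i * l i = 1)
    (hs : ∀ i, (G.baseChange A).equations v i = c * l i) :
    ∃ b : specOver A ⟶ B, b ≫ q = y ∧ (IsLocalRing A → c ∈ nonZeroDivisors A →
      ∀ b', b' ≫ q = y → b' = b) := by
  obtain ⟨V, hV⟩ := hv.exists_parametrized hl hs (rG₄.points A y).1 hU
  obtain ⟨x, hx⟩ := rCG.exists_sub_eq (A := A) (N := V) hV.Ω_eq_zero
  have hx' : rCG.sub x = V.toSubmodule := congrArg _ hx
  obtain ⟨b, hbp, hbq⟩ := hB.exists_point A x y (fun m hm => by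
    rw [hx'] at hm; exact hV.pr_mem hm)
  refine ⟨b, hbq, fun _ hc b' hb' => hB.ext A _ _ ?_ (hb'.trans hbq.symm)⟩
  have h1 := hB.incident A b'
  rw [hb'] at h1
  obtain ⟨l', c', h'⟩ := hv.parametrized (U := rG₄.sub y) hU (rCG.points A (b' ≫ p)).1 h1
    (rCG.points A (b' ≫ p)).2
  rw [hbp]
  refine (rCG.ext_of_le ?_).symm
  rw [hx']
  exact Parametrized.unique (U := rG₄.sub y) hV h' hc

open TrivSqZeroExt in
/-- The projection of the incidence variety to the Cayley Grassmannian is the blow-up of the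
subvariety of the subspaces containing the given line. -/
theorem IsIncidence.isBlowup_left [LocallyOfFiniteType B.hom] [LocallyOfFiniteType CG.hom]
    (hB : IsIncidence rCG rG₄ p q) {b₇ : Module.Basis (Fin 7) ℂ W₇}
    (hb : ∀ x y z, G.Ω x y z = stdForm (b₇.repr x) (b₇.repr y) (b₇.repr z))
    [IsClosedImmersion i.left] (hi : IsLineLocus rCG i) : IsBlowup p.left i.left := by
  refine isBlowup_of_points p i (fun A _ x c hc hcut => ?_) (fun A _ b => ?_)
  · obtain ⟨g, hg, hV⟩ := exists_surjection_of_grassmannian (rCG.points A x).1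
    -- The class of `e` modulo the subspace is a vector in `A ^ 3` that vanishes over `C` iff the
    -- line is contained in the subspace over `C`; its entries therefore generate the ideal of `Z₃`,
    -- which is `(c)`.
    obtain ⟨l, hl, hr⟩ := exists_unimodular (s := g (G.baseChange A).e) hc (fun C φ => by
      rw [← hcut C φ, hi, rCG.sub_specOverMap]
      have he : (G.baseChange C).e = bc φ.hom (G.baseChange A).e :=
        ((G.bcHom φ.hom).f₇_e).symm
      rw [he]
      constructor
      · intro h
        refine bc_mem_map_of_functional φ.hom _ _ fun f hf => ?_
        obtain ⟨f', rfl⟩ : ∃ f' : (Fin 3 → A) →ₗ[A] A, f = f' ∘ₗ g := by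
          obtain ⟨s, hs⟩ := Module.projective_lifting_property g LinearMap.id hg
          refine ⟨f ∘ₗ s, LinearMap.ext fun m => ?_⟩
          have hm : m - s (g m) ∈ (rCG.points A x).1.toSubmodule := by
            rw [hV, LinearMap.mem_ker, map_sub, sub_eq_zero]
            exact (LinearMap.congr_fun hs (g m)).symm
          have := hf _ hm
          rw [map_sub, sub_eq_zero] at this
          exact this
        rw [LinearMap.comp_apply, LinearMap.pi_apply_eq_sum_univ f', map_sum]
        refine Finset.sum_eq_zero fun i _ => ?_
        rw [smul_eq_mul, map_mul, h i, zero_mul]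
      · intro h i
        refine functional_of_bc_mem_map φ.hom _ _ h (LinearMap.proj i ∘ₗ g) fun m hm => ?_
        rw [hV, LinearMap.mem_ker] at hm
        rw [LinearMap.comp_apply, hm, map_zero])
    obtain ⟨b, hbp, huniq⟩ := hB.exists_lift_left (x := x) hg hV hr hl
    exact ⟨b, hbp, fun b' hb' => huniq hc b' hb'⟩
  · obtain ⟨v, ξ, l, c, h⟩ := exists_parametrized (hB.incident A b)
    refine ⟨l 2, h.cutBy_line hi, or_iff_not_imp_left.2 fun ht => ?_⟩
    -- The scalar `c` is kept and `l` is moved to `l + ε r`, so the equations must have derivative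
    -- `c • r`; the equation `l 2` of `Z₃` then moves by the unit `r 2`.
    obtain ⟨w, hw, r, hr, hr2⟩ : ∃ w, (G.baseChange A).IsTangent v w ∧ ∃ r : Fin 3 → A,
        (∀ i, (G.baseChange A).equationsDeriv v w i = c * r i) ∧ IsUnit (r 2) := by
      by_cases hc : IsUnit c
      · obtain ⟨u, rfl⟩ := hc
        -- Where `c` is a unit, every derivative has the form `c • r`; moving only the last vector
        -- by the dual of `x 2` gives `α(x₂, x₃)` the derivative one.
        obtain ⟨d, hd⟩ := exists_dual_vectors (G := G.baseChange A) h.adapted.toDualSystem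
        refine ⟨![0, 0, 0, d 2], ⟨by simp, by simp, by simp [hd], by simp, by simp [hd]⟩,
          fun i => (↑u⁻¹ : A) * (G.baseChange A).equationsDeriv v ![0, 0, 0, d 2] i,
          fun i => by simp, ?_⟩
        have : (G.baseChange A).equationsDeriv v ![0, 0, 0, d 2] 2 = 1 := by
          simp [equationsDeriv, hd]
        change IsUnit ((↑u⁻¹ : A) * (G.baseChange A).equationsDeriv v ![0, 0, 0, d 2] 2)
        rw [this, mul_one]
        exact u⁻¹.isUnit
      -- Where `c` is not a unit, the closed point lies over `Y₄` and every derivative is attained,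
      -- in particular `c • (0, 0, 1)`.
      · obtain ⟨w, hw, hwd⟩ := h.adapted.exists_equationsDeriv hb (fun i => by
          rw [h.equations]
          exact fun hu => hc (isUnit_of_mul_isUnit_left hu)) (c • ![0, 0, 1])
        exact ⟨w, hw, ![0, 0, 1], fun i => by rw [hwd]; rfl, isUnit_one⟩
    obtain ⟨b', v', ξ', hbb', h'⟩ := h.exists_deformation_point hB hw
      (fun i => inl (l i) + inr (r i)) (inl c) (fun i => by simp) (fun i => by
        rw [h.equations, hr]
        ext <;> simp)
    have hcut := h'.cutBy_line (A := .of ℂ (DualNumber A)) hi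
    exact ⟨b', r 2, hbb', hr2, hcut⟩

open TrivSqZeroExt in
/-- The projection of the incidence variety to the Grassmannian is the blow-up of `Y₄`. -/
theorem IsIncidence.isBlowup_right [LocallyOfFiniteType B.hom] [LocallyOfFiniteType G₄.hom]
    (hB : IsIncidence rCG rG₄ p q) {b₇ : Module.Basis (Fin 7) ℂ W₇}
    (hb : ∀ x y z, G.Ω x y z = stdForm (b₇.repr x) (b₇.repr y) (b₇.repr z))
    [IsClosedImmersion j.left] (hj : IsCenterLocus G rG₄ j) : IsBlowup q.left j.left := by
  refine isBlowup_of_points q j (fun A _ y c hc hcut => ?_) (fun A _ b => ?_)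
  · obtain ⟨v, ξ, hv, hU⟩ := exists_adapted (G := G.baseChange A) (rG₄.points A y).1
    obtain ⟨l, hl, hr⟩ := exists_unimodular (s := (G.baseChange A).equations v) hc (fun C φ => by
      rw [← hcut C φ, hj]
      obtain ⟨ξ', h', -⟩ := (G.bcHom φ.hom).adapted hv
      have hspan : rG₄.sub (specOverMap φ ≫ y) =
          Submodule.span C (Set.range fun i => (G.bcHom φ.hom).f (v i)) := by
        rw [rG₄.sub_specOverMap_eq_span]
        refine le_antisymm (Submodule.span_le.2 ?_) (Submodule.span_le.2 ?_)
        · rintro _ ⟨m, hm, rfl⟩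
          exact (G.bcHom φ.hom).f_mem_span (hU.le hm)
        · rintro _ ⟨i, rfl⟩
          exact Submodule.subset_span ⟨v i, hU.ge (Submodule.subset_span ⟨i, rfl⟩), rfl⟩
      refine Iff.trans ?_ (h'.mem_iff (isUnit_two C) hspan).symm
      have he := (G.bcHom φ.hom).equations_f (x := v)
      have e0 := congrFun he 0
      have e1 := congrFun he 1
      have e2 := congrFun he 2
      simp only [equations, Matrix.cons_val_zero, Matrix.cons_val_one, Matrix.cons_val]
        at e0 e1 e2
      rw [e0, e1, e2]
      exact ⟨fun h => ⟨h 0, h 1, h 2⟩, fun ⟨h0, h1, h2⟩ i => by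
        fin_cases i
        exacts [h0, h1, h2]⟩)
    obtain ⟨b, hbq, huniq⟩ := hB.exists_lift_right (y := y) hv hU hr hl
    exact ⟨b, hbq, fun b' hb' => huniq inferInstance hc b' hb'⟩
  · obtain ⟨v, ξ, l, c, h⟩ := exists_parametrized (hB.incident A b)
    refine ⟨c, h.cutBy_center hj, or_iff_not_imp_left.2 fun hc => ?_⟩
    -- Here `l` is kept and `c` is moved to `c + ε`, so the equations must have derivative `l`.
    obtain ⟨w, hw, hwd⟩ := h.adapted.exists_equationsDeriv hb (fun i => by
      rw [h.equations]
      exact fun hu => hc (isUnit_of_mul_isUnit_left hu)) l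
    obtain ⟨b', v', ξ', hbb', h'⟩ := h.exists_deformation_point hB hw
      (fun i => inl (l i)) (inl c + inr 1) (fun i => by simp) (fun i => by
        rw [h.equations, hwd]
        ext <;> simp)
    exact ⟨b', 1, hbb', isUnit_one, h'.cutBy_center hj⟩

/-- Over a field the class of `e` is a multiple of a unimodular vector even when it is zero, so
every field-valued point lifts. -/
theorem IsIncidence.isDominant_left (hB : IsIncidence rCG rG₄ p q) : IsDominant p.left := by
  refine isDominant_of_field_points p fun A hA x => ?_
  have := IsField.isLocalRing hA
  obtain ⟨g, hg, hV⟩ := exists_surjection_of_grassmannian (rCG.points A x).1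
  obtain ⟨l, c, hs, hl⟩ := IsField.exists_unimodular hA (g (G.baseChange A).e)
  obtain ⟨b, hb, -⟩ := hB.exists_lift_left (x := x) hg hV hl hs
  exact ⟨b, hb⟩

theorem IsIncidence.isDominant_right (hB : IsIncidence rCG rG₄ p q) : IsDominant q.left := by
  refine isDominant_of_field_points q fun A hA y => ?_
  have := IsField.isLocalRing hA
  obtain ⟨v, ξ, hv, hU⟩ := exists_adapted (G := G.baseChange A) (rG₄.points A y).1
  obtain ⟨l, c, hs, hl⟩ := IsField.exists_unimodular hA ((G.baseChange A).equations v)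
  obtain ⟨b, hb, -⟩ := hB.exists_lift_right (y := y) hv hU hl hs
  exact ⟨b, hb⟩

end Geometry

end

section

namespace Geometry

variable {W W₇ : Type} [AddCommGroup W] [Module ℂ W] [AddCommGroup W₇] [Module ℂ W₇]
  {G : Geometry ℂ W W₇}

/-! ### The adjoint variety and the center of the second blow-up -/

section Adjoint

variable {X Y : Over (Spec (.of ℂ))} (rX : Represents X G.adjointCond)
  (rY : Represents Y G.centerCond)

/-- The orthogonality relation between planes and elements of the variety `Y₄`. -/
def Orthogonal (A : CommAlgCat.{0} ℂ) (x : specOver A ⟶ X) (y : specOver A ⟶ Y) : Prop :=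
  ∀ m ∈ rX.sub x, ∀ u ∈ rY.sub y, (G.baseChange A).α u ((G.baseChange A).pr m) = 0

theorem isClosedCond_orthogonal (A : CommAlgCat.{0} ℂ) (x : specOver A ⟶ X)
    (y : specOver A ⟶ Y) : IsClosedCond (A := A) fun C φ =>
      Orthogonal rX rY C (specOverMap φ ≫ x) (specOverMap φ ≫ y) := by
  refine (isClosedCond_forall fun m : rX.sub x => isClosedCond_forall fun u : rY.sub y =>
    isClosedCond_eq_zero ((G.baseChange A).α u.1 ((G.baseChange A).pr m.1))).congr fun C φ => ?_
  have hα (u m) : (G.baseChange C).α (bc φ.hom u) ((G.baseChange C).pr (bc φ.hom m)) =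
      φ.hom ((G.baseChange A).α u ((G.baseChange A).pr m)) :=
    (congrArg _ (baseChange_bc φ.hom G.pr m)).trans (form_bc φ.hom G.α u _)
  rw [Orthogonal, rX.sub_specOverMap, rY.sub_specOverMap]
  constructor
  · intro h m u
    rw [← hα]
    exact h _ (bc_mem_map φ.hom _ m.2) _ (bc_mem_map φ.hom _ u.2)
  · intro h
    have h1 (u : rY.sub y) := (forall_mem_map_iff φ.hom (rX.points A x).1
      ((G.baseChange C).α (bc φ.hom u.1) ∘ₗ (G.baseChange C).pr)).2
      (fun m hm => (hα u.1 m).trans (h ⟨m, hm⟩ u))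
    exact fun m hm => (forall_mem_map_iff φ.hom (rY.points A y).1
      ((G.baseChange C).α.flip ((G.baseChange C).pr m))).2 fun u hu => h1 ⟨u, hu⟩ m hm

/-- The adjoint variety is isomorphic to `Y₄`. -/
theorem exists_iso [LocallyOfFiniteType X.hom] [LocallyOfFiniteType Y.hom] :
    ∃ ε : X ≅ Y, ∀ (A : CommAlgCat.{0} ℂ) (x : specOver A ⟶ X),
      rY.sub (x ≫ ε.hom) =
        (G.baseChange A).α.orthogonal ((rX.sub x).map (G.baseChange A).pr) := by
  obtain ⟨I, s, t, hI, hinc, hex, hext⟩ := exists_incidence (Orthogonal rX rY)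
    (isClosedCond_orthogonal rX rY)
  have hs : IsIso s := isIso_of_local_points s fun A _ x => by
    obtain ⟨U, hU, hUV, hUinc⟩ := exists_isCenter (G := G.baseChange A) (rX.points A x).1
      (rX.points A x).2
    obtain ⟨y, hy⟩ := rY.exists_sub_eq (A := A) (N := U) hU
    have hy' : rY.sub y = U.toSubmodule := congrArg _ hy
    obtain ⟨b, hbs, hbt⟩ := hex A x y (fun m hm u hu => hUinc m hm u (hy' ▸ hu))
    refine ⟨b, hbs, fun b' hb' => hext A _ _ (hb'.trans hbs.symm) ?_⟩
    rw [hbt]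
    refine rY.ext ?_
    have h1 := hinc A b'
    rw [hb'] at h1
    rw [hy', hUV]
    exact eq_orthogonal_of_incident (G := G.baseChange A) (rX.points A x).1 (rX.points A x).2
      (rY.points A (b' ≫ t)).1 h1
  have ht : IsIso t := isIso_of_local_points t fun A _ y => by
    obtain ⟨V, ⟨hV, hVinc⟩, huniq⟩ := existsUnique_isAdjoint (G := G.baseChange A) (isUnit_two A)
      (rY.points A y).1 (rY.points A y).2
    obtain ⟨x, hx⟩ := rX.exists_sub_eq (A := A) (N := V) hV
    have hx' : rX.sub x = V.toSubmodule := congrArg _ hx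
    obtain ⟨b, hbs, hbt⟩ := hex A x y (fun m hm u hu => hVinc m (hx' ▸ hm) u hu)
    refine ⟨b, hbt, fun b' hb' => hext A _ _ ?_ (hb'.trans hbt.symm)⟩
    rw [hbs]
    refine rX.ext ?_
    have h1 := hinc A b'
    rw [hb'] at h1
    rw [hx', ← huniq (rX.points A (b' ≫ s)).1 ⟨(rX.points A (b' ≫ s)).2, h1⟩]
    rfl
  refine ⟨(asIso s).symm ≪≫ asIso t, fun A x => ?_⟩
  let ε : X ⟶ Y := inv s ≫ t
  change rY.sub (x ≫ ε) = _
  have horth {C : CommAlgCat.{0} ℂ} (x : specOver C ⟶ X) : Orthogonal rX rY C x (x ≫ ε) := by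
    have := hinc C (x ≫ inv s)
    simpa [ε] using this
  refine le_antisymm ?_ fun u hu => ?_
  · rintro u hu _ ⟨m, hm, rfl⟩
    change (G.baseChange A).α _ _ = 0
    rw [Geometry.α_swap, horth x m hm u hu, neg_zero]
  -- The orthogonal has been identified with the subspace only over local rings; this inclusion is
  -- therefore checked after localization.
  · refine mem_of_localizations (rY.points A (x ≫ ε)).1 u fun C φ hC => ?_
    rw [← rY.natural]
    have h1 := eq_orthogonal_of_incident (G := G.baseChange C) (rX.points C (specOverMap φ ≫ x)).1
      (rX.points C (specOverMap φ ≫ x)).2 (rY.points C ((specOverMap φ ≫ x) ≫ ε)).1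
      (horth (specOverMap φ ≫ x))
    rw [Category.assoc] at h1
    rw [h1]
    rintro _ ⟨m, hm, rfl⟩
    change (G.baseChange C).α _ _ = 0
    rw [rX.natural] at hm
    refine (forall_mem_map_iff φ.hom (rX.points A x).1
      ((G.baseChange C).α.flip (bc φ.hom u) ∘ₗ (G.baseChange C).pr)).2 (fun m hm => ?_) m hm
    have h2 : (G.baseChange A).α ((G.baseChange A).pr m) u = 0 := hu _ ⟨m, hm, rfl⟩
    have h3 : (G.baseChange C).pr (bc φ.hom m) = bc φ.hom ((G.baseChange A).pr m) :=
      baseChange_bc φ.hom G.pr m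
    change (G.baseChange C).α ((G.baseChange C).pr (bc φ.hom m)) (bc φ.hom u) = 0
    rw [h3]
    exact (form_bc φ.hom G.α _ u).trans (by
      rw [← map_zero φ.hom]; exact congrArg φ.hom h2)

end Adjoint

/-! ### The projection of the Cayley Grassmannian -/

/-- By ranks `V` is the whole kernel of `L` in the preimage of `U`. Since `L e = 1`, subtracting a
multiple of `e` lifts each element of `U` into this kernel. -/
theorem eq_map_pr {R M M₇ : Type*} [CommRing R] [AddCommGroup M] [Module R M]
    [AddCommGroup M₇] [Module R M₇] {G : Geometry R M M₇} (V : Module.Grassmannian R M₇ 3)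
    (U : Module.Grassmannian R M 2) (h : ∀ m ∈ V.toSubmodule, G.pr m ∈ U.toSubmodule)
    (L : M₇ →ₗ[R] R) (hL : ∀ m ∈ V.toSubmodule, L m = 0) (he : L G.e = 1) :
    U.toSubmodule = V.toSubmodule.map G.pr := by
  refine le_antisymm (fun u hu => ?_) ?_
  · obtain ⟨V', hV'⟩ := exists_grassmannian_of_functional (G := G) (N := U) L (v := G.e)
      (by rw [G.pr_e]; exact Submodule.zero_mem _) he
    have hVV' : V = V' := Grassmannian.eq_of_le fun m hm => (hV' m).2 ⟨h m hm, hL m hm⟩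
    have hpr : G.pr (G.ι u - L (G.ι u) • G.e) = u := by
      rw [map_sub, map_smul, G.pr_ι, G.pr_e, smul_zero, sub_zero]
    refine ⟨G.ι u - L (G.ι u) • G.e, ?_, hpr⟩
    rw [hVV']
    refine (hV' _).2 ⟨hpr.symm ▸ hu, ?_⟩
    rw [map_sub, map_smul, he, smul_eq_mul, mul_one, sub_self]
  · rintro _ ⟨m, hm, rfl⟩
    exact h m hm

variable {CG G₄ B Z : Over (Spec (.of ℂ))} {rCG : Represents CG G.cayleyCond}
  {rG₄ : Represents G₄ (grassmannian W 2)} {p : B ⟶ CG} {q : B ⟶ G₄} {i : Z ⟶ CG}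

/-- The values at `e` of the functionals vanishing on the subspace form an ideal `J`, and modulo `J`
the subspace contains `e`. A point avoiding `Z₃` has no such nonempty locus, so `J` is the unit
ideal. -/
theorem IsLineLocus.exists_functional (hi : IsLineLocus rCG i) {U : CG.left.Opens}
    (hU : (U : Set CG.left) = (Set.range i.left)ᶜ) {A : CommAlgCat.{0} ℂ}
    (x : specOver A ⟶ Over.mk (U.ι ≫ CG.hom)) :
    ∃ L : A ⊗[ℂ] W₇ →ₗ[A] A,
      (∀ m ∈ rCG.sub (x ≫ (Over.homMk U.ι : Over.mk (U.ι ≫ CG.hom) ⟶ CG)), L m = 0) ∧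
      L (G.baseChange A).e = 1 := by
  set x' := x ≫ (Over.homMk U.ι : Over.mk (U.ι ≫ CG.hom) ⟶ CG) with hx'
  let J : Ideal A := Submodule.map (LinearMap.applyₗ (G.baseChange A).e)
    (rCG.sub x').dualAnnihilator
  suffices h : (1 : A) ∈ J by
    obtain ⟨L, hL, hLe⟩ := h
    exact ⟨L, (Submodule.mem_dualAnnihilator L).1 hL, hLe⟩
  rw [← Ideal.eq_top_iff_one]
  by_contra hJ
  let φ : A ⟶ CommAlgCat.of ℂ (A ⧸ J) := CommAlgCat.ofHom (Ideal.Quotient.mkₐ ℂ J)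
  obtain ⟨z, hz⟩ : ∃ z, z ≫ i = specOverMap φ ≫ x' := by
    rw [hi, rCG.sub_specOverMap]
    have he : (G.baseChange (A ⧸ J)).e = bc φ.hom (G.baseChange A).e :=
      ((G.bcHom φ.hom).f₇_e).symm
    change (G.baseChange (A ⧸ J)).e ∈ _
    rw [he]
    refine bc_mem_map_of_functional φ.hom _ _ fun L hL => ?_
    exact Ideal.Quotient.eq_zero_iff_mem.2 ⟨L, (Submodule.mem_dualAnnihilator L).2 hL, rfl⟩
  have : Nontrivial (A ⧸ J) := Ideal.Quotient.nontrivial_iff.2 hJ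
  obtain ⟨P⟩ : Nonempty (PrimeSpectrum (A ⧸ J)) := inferInstance
  have h1 := congrArg (fun g : specOver (.of ℂ (A ⧸ J)) ⟶ CG => g.left P) hz
  have h2 : (specOverMap φ ≫ x').left P ∈ U := by
    have : (specOverMap φ ≫ x').left = ((specOverMap φ ≫ x).left ≫ U.ι) := rfl
    rw [this]
    have h3 : U.ι ((specOverMap φ ≫ x).left P) ∈ Set.range U.ι := ⟨_, rfl⟩
    rw [Scheme.Opens.range_ι] at h3
    exact h3
  have h3 : (specOverMap φ ≫ x').left P ∈ (Set.range i.left)ᶜ := hU ▸ h2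
  exact h3 ⟨z.left P, h1⟩

end Geometry

end

end CayleyGrassmannian

end

/-! ### Assembly of the theorem -/

open CayleyGrassmannian in
theorem mainTheorem6 (V : Type) [AddCommGroup V] [Module ℂ V]
    (Ω : V [⋀^Fin 3]→ₗ[ℂ] ℂ) (hΩ : IsGeneralThreeForm Ω) :
    -- for a general line `V₁ = ℂ e` and every complement `V₆`, the form `α` is nondegenerate
    (∃ (b : Module.Basis (Fin 7) ℂ V) (P : MvPolynomial (Fin 7) ℂ), P ≠ 0 ∧
      ∀ e : V, MvPolynomial.eval (b.repr e) P ≠ 0 →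
        ∀ V₆ : Submodule ℂ V, IsCompl V₆ (ℂ ∙ e) → (alpha Ω e V₆).Nondegenerate) ∧
    ∀ (e : V) (V₆ : Submodule ℂ V) (hV : IsCompl V₆ (ℂ ∙ e)), (alpha Ω e V₆).Nondegenerate →
      ∃ (CG G₄ Z₃ Y₄ G₂ad : Over (Spec (.of ℂ)))
        (rCG : Represents CG (cayley Ω))
        (rG₄ : Represents G₄ (grassmannian V₆ 2))
        (rZ₃ : Represents Z₃ (varietyZ₃ (alpha Ω e V₆) (omega Ω V₆)))
        (rY₄ : Represents Y₄ (varietyY₄ (alpha Ω e V₆) (omega Ω V₆)))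
        (rG₂ad : Represents G₂ad (adjointVariety Ω))
        -- the embedding `U₃ ↦ U₃ ⊕ V₁` of `Z₃` in `CG`, and the inclusion of `Y₄` in `G(4, V₆)`
        (i : Z₃ ⟶ CG) (j : Y₄ ⟶ G₄)
        -- the rational map `π₄` from `CG` to `G(4, V₆)`, defined on the open subset `U`
        (U : CG.left.Opens) (hU : Dense (U : Set CG.left))
        (π₄ : Over.mk (U.ι ≫ CG.hom) ⟶ G₄)
        -- the common blow-up
        (B : Over (Spec (.of ℂ))) (p : B ⟶ CG) (q : B ⟶ G₄),
        (∀ (A : CommAlgCat.{0} ℂ) (x : specOver A ⟶ Z₃),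
          rCG.sub (x ≫ i) =
            (rZ₃.sub x).map (V₆.subtype.baseChange A) ⊔ Submodule.span A {1 ⊗ₜ[ℂ] e}) ∧
        (∀ (A : CommAlgCat.{0} ℂ) (x : specOver A ⟶ Y₄), rG₄.sub (x ≫ j) = rY₄.sub x) ∧
        -- `π₄` is the projection of 4-planes along `V₁`, defined away from `Z₃`
        (U : Set CG.left) = (Set.range i.left)ᶜ ∧
        (∀ (A : CommAlgCat.{0} ℂ) (x : specOver A ⟶ Over.mk (U.ι ≫ CG.hom)),
          rG₄.sub (x ≫ π₄) =
            (rCG.sub (x ≫ (Over.homMk U.ι : Over.mk (U.ι ≫ CG.hom) ⟶ CG))).map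
              ((V₆.projectionOnto (ℂ ∙ e) hV).baseChange A)) ∧
        -- `π₄` is birational
        (∃ f : CG.left.PartialIso G₄.left, f.IsOver CG.hom G₄.hom ∧
          f.toRationalMap = (Scheme.PartialMap.mk U hU π₄.left).toRationalMap) ∧
        -- `B` is the blow-up of `CG` along `Z₃` and resolves `π₄` to the morphism `q`
        IsBlowup p.left i.left ∧
        (p.left ∣_ U) ≫ π₄.left = (p.left ⁻¹ᵁ U).ι ≫ q.left ∧
        -- `q` is the blow-up of `G(4, V₆)` along `Y₄`
        IsBlowup q.left j.left ∧
        -- `Y₄` is isomorphic to the adjoint variety by `V₂ ↦ π₂(V₂)^⊥`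
        ∃ ε : G₂ad ≅ Y₄, ∀ (A : CommAlgCat.{0} ℂ) (x : specOver A ⟶ G₂ad),
          rY₄.sub (x ≫ ε.hom) = ((alpha Ω e V₆).baseChange A).orthogonal
            ((rG₂ad.sub x).map ((V₆.projectionOnto (ℂ ∙ e) hV).baseChange A)) := by
  obtain ⟨b, hb⟩ := hΩ.exists_basis
  -- The quadric of `stdForm_kernel`; it takes the value one at the first basis vector.
  refine ⟨⟨b, .X 0 ^ 2 - (.X 1 * .X 4 + .X 2 * .X 5 + .X 3 * .X 6), fun h => ?_,
    fun e he V₆ hV => alpha_nondegenerate hb (by simpa using he) hV⟩, fun e V₆ hV hα => ?_⟩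
  · simpa using congrArg (MvPolynomial.eval (Pi.single 0 1 : Fin 7 → ℂ)) h
  have : Nontrivial V := b.repr.toEquiv.nontrivial
  have he := ne_zero_of_nondegenerate hV hα
  have hfin := Module.Finite.of_basis b
  let b₆ := Module.finBasisOfFinrankEq ℂ V₆ (finrank_complement b hV he)
  let G : Geometry ℂ V₆ V := geometry Ω hV he hα b b₆
  obtain ⟨CG, -, rCG, -, hCG, -, -⟩ := (grCRepresents (k := 3) b).exists_closed
    (P' := G.cayleyCond) (fun _ _ _ => trivial) (fun _ N _ => G.isClosedCond_cayley N)
  obtain ⟨G₂ad, -, rG₂ad, -, hG₂ad, -, -⟩ := (grCRepresents (k := 5) b).exists_closed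
    (P' := G.adjointCond) (fun _ _ _ => trivial) (fun _ N _ => G.isClosedCond_adjoint N)
  let rG₄ : Represents (grC 6 2) (grassmannian V₆ 2) := grCRepresents b₆
  obtain ⟨Y₄, j, rY₄, hj, hY₄, hjsub, hjmem⟩ := rG₄.exists_closed
    (P' := G.centerCond) (fun _ _ _ => trivial) (fun _ N _ => G.isClosedCond_center N)
  obtain ⟨Z₃, i, rZ, hi, -, hisub, himem⟩ := rCG.exists_closed
    (P' := G.containingCond) (fun _ _ h => h.1) (fun _ N _ => G.isClosedCond_containing N)
  obtain ⟨B, p, q, hBft, hB₁, hB₂, hB₃⟩ := exists_incidence (Geometry.Incident rCG rG₄)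
    (Geometry.isClosedCond_incident rCG rG₄)
  have hB : Geometry.IsIncidence rCG rG₄ p q := ⟨hB₁, hB₂, hB₃⟩
  have hline : Geometry.IsLineLocus rCG i := fun A x =>
    (himem A x).trans ⟨fun h => h.2, fun h => ⟨(rCG.points A x).2, h⟩⟩
  have hp := hB.isBlowup_left hb hline
  have hq := hB.isBlowup_right hb (j := j) hjmem
  have hpd := hB.isDominant_left
  have hqd := hB.isDominant_right
  let U : CG.left.Opens := ⟨(Set.range i.left)ᶜ,
    i.left.isClosedEmbedding.isClosed_range.isOpen_compl⟩
  obtain ⟨hU, σ, hσ, hσq, f, hf, hfU⟩ := hp.exists_partialIso hq CG.hom (grC 6 2).hom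
    ((Over.w p).trans (Over.w q).symm) U rfl
  -- The section of the blow-up over the complement of `Z₃`; followed by `q` it is the projection
  -- `π₄`.
  let σ' : Over.mk (U.ι ≫ CG.hom) ⟶ B := Over.homMk σ (by
    rw [← Over.w p, ← Category.assoc, hσ]; rfl)
  have hσ' : σ' ≫ p = (Over.homMk U.ι : Over.mk (U.ι ≫ CG.hom) ⟶ CG) :=
    Over.OverMorphism.ext hσ
  obtain ⟨ε, hε⟩ := Geometry.exists_iso rG₂ad rY₄
  refine ⟨CG, grC 6 2, Z₃, Y₄, G₂ad, rCG, rG₄, G.representsLagrangian rZ, rY₄, rG₂ad, i, j, U, hU,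
    σ' ≫ q, B, p, q, fun A x => ?_, hjsub, rfl, fun A x => ?_, ⟨f, hf, hfU⟩, hp, hσq, hq, ε, hε⟩
  · exact (hisub A x).trans ((G.representsLagrangian_sub rZ x).trans
      (Geometry.comap_pr_eq (G.baseChange A) _))
  -- Incidence gives only that the projection of the subspace is contained in the value of `π₄`;
  -- away from `Z₃` the functional `L` turns this into an equality, over any algebra.
  · obtain ⟨L, hL, hLe⟩ := hline.exists_functional (U := U) rfl x
    have hinc := hB.incident A (x ≫ σ')
    rw [Category.assoc, hσ', Category.assoc] at hinc
    exact Geometry.eq_map_pr (G := G.baseChange A) (rCG.points A _).1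
      (rG₄.points A (x ≫ σ' ≫ q)).1 hinc L hL hLe
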